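/- Let $k$ be a field of arbitrary characteristic; all gradings are $\mathbb Z$-gradings, or all are $\mathbb Z/2$-gradings. A (small) \emph{$A_\infty$-pre-category} $\mathcal C$ consists of a set of objects; for each $n\ge 1$ a set $\mathcal C^n_{tr}$ of transversal sequences of $n$ objects, with $\mathcal C^1_{tr}=Ob(\mathcal C)$ and closed under passing to subsequences; a graded vector space $\mathrm{Hom}(X,Y)$ for each transversal pair; and, for each transversal sequence $(X_0,\dots,X_n)$, $n\ge 1$, a multilinear map $m_n:\mathrm{Hom}(X_0,X_1)\otimes\dots\otimes \mathrm{Hom}(X_{n-1},X_n)\to \mathrm{Hom}(X_0,X_n)$ of degree $2-n$, such that $\bigoplus_{i<j}\mathrm{Hom}(X_i,X_j)$ is a non-unital $A_\infty$-algebra for each transversal $(X_0,\dots,X_N)$, i.e. for $n\ge 0$ and homogeneous $a_0,\dots,a_n$, $$\sum_{i+j=n+2}\ \sum_{0\le l\le i-1}(-1)^{\epsilon}m_i(a_0,\dots,a_{l-1},m_j(a_l,\dots,a_{l+j-1}),a_{l+j},\dots,a_n)=0\quad (i,j\ge 1),$$ $\epsilon=j\sum_{s<l}\deg a_s+l(j-1)+j(i-1)$.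 Moreover the following extension property is required: for every finite collection of transversal sequences $S_i$ and every object $X$ there are quasi-isomorphisms $X_-\to X\to X_+$ such that all sequences $(X_-,S_i,X_+)$ are transversal. Here an $m_1$-closed $f\in\mathrm{Hom}^0(X,Y)$, with $(X,Y)$ transversal, is a \emph{quasi-isomorphism} if composition ($m_2$) with $f$ induces isomorphisms on $m_1$-cohomology $\mathrm{Hom}(W,X)\to\mathrm{Hom}(W,Y)$ whenever $(W,X,Y)$ is transversal, and $\mathrm{Hom}(Y,Z)\to\mathrm{Hom}(X,Z)$ whenever $(X,Y,Z)$ is transversal. Two objects are quasi-isomorphic if they are related by the equivalence relation generated by the existence of a quasi-isomorphism. An \emph{$A_\infty$-functor} $F:\mathcal C\to\mathcal D$ is a map on objects that preserves transversality of sequences, with multilinear maps $f_n:\mathrm{Hom}(X_0,X_1)\otimes\dots\otimes\mathrm{Hom}(X_{n-1},X_n)\to\mathrm{Hom}(FX_0,FX_n)$ of degree $1-n$ for all transversal $(X_0,\dots,X_n)$, $n\ge1$, that form an $A_\infty$-morphism $\bigoplus_{i<j}\mathrm{Hom}(X_i,X_j)\to\bigoplus_{i<j}\mathrm{Hom}(FX_i,FX_j)$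 for each transversal $(X_0,\dots,X_N)$ (that is, $\sum(-1)^{\gamma}m_i(f_{l_1}(a_1,\dots,a_{l_1}),\dots,f_{n-l_{i-1}}(a_{l_{i-1}+1},\dots,a_n))=\sum(-1)^{\epsilon_j}f_s(a_1,\dots,a_{j-1},m_r(a_j,\dots,a_{j+r-1}),a_{j+r},\dots,a_n)$ for $n\ge1$ and homogeneous $a_1,\dots,a_n$, summed over $0=l_0<l_1<\dots<l_i=n$ and over $s+r=n+1$, $1\le j\le s$, $r\ge 1$, respectively, where $\epsilon_j=r\sum_{p<j}\deg a_p+j-1+r(s-j)$ and $\gamma=\sum_{p=1}^{i}(l_p-l_{p-1}-1)\bigl(i-p+\sum_{q\le l_{p-1}}\deg a_q\bigr)$), and such that $f_1$ takes quasi-isomorphisms to quasi-isomorphisms. It is a \emph{quasi-equivalence} if each $f_1:\mathrm{Hom}(X,Y)\to\mathrm{Hom}(FX,FY)$, $(X,Y)$ transversal, is a quasi-isomorphism of complexes and each object of $\mathcal D$ is quasi-isomorphic to some $F(X)$. A \emph{graded pre-category} is an $A_\infty$-pre-category with $m_n=0$ for $n\ne 2$; a functor of graded pre-categories is an $A_\infty$-functor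 with $f_n=0$ for $n\neq 1$, and it is an \emph{equivalence} if it is a quasi-equivalence. A (minimal) \emph{$A_\infty$-structure} on a graded pre-category $\mathcal C$ is a collection of maps $m_n$, $n\ge 3$, of degree $2-n$, for all transversal sequences, which together with the given $m_2$ and $m_1=0$ make $\mathcal C$ an $A_\infty$-pre-category; $A_\infty(\mathcal C)$ is the set of these. Two such structures $m,m'$ are \emph{strongly homotopic} if there are maps $f_n:\mathrm{Hom}(X_0,X_1)\otimes\dots\otimes\mathrm{Hom}(X_{n-1},X_n)\to\mathrm{Hom}(X_0,X_n)$ of degree $1-n$, for all transversal sequences, $n\ge1$, with $f_1=\mathrm{id}$, which form an $A_\infty$-morphism $(\mathcal C,m)\to(\mathcal C,m')$; that is, if some element $f$ of the group $G_{\mathcal C}$ of all such collections takes $m$ to $m'$. \textbf{Invariance Theorem.} Strong homotopy is an equivalence relation on the $A_\infty$-structures of a graded pre-category; write $A_\infty(\mathcal C)/G_{\mathcal C}$ for the set of its classes. Let $\varphi:\mathcal C\to\mathcal D$ be an equivalence of graded pre-categories. Then pullback $\varphi^*m$, given by $(\varphi^*m)_n(a_1,\dots,a_n)=\varphi^{-1}\bigl(m_n(\varphi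 a_1,\dots,\varphi a_n)\bigr)$, induces a well-defined map $$\varphi^*:A_\infty(\mathcal D)/G_{\mathcal D}\longrightarrow A_\infty(\mathcal C)/G_{\mathcal C},$$ and this map is a bijection. -/

import Mathlib

universe w u u' v v'

namespace AInf

noncomputable section

/-! ### Signs and `A∞`-algebras -/

/-- The parity of a degree; degrees live in `ZMod N`, with `N = 0` (that is, `ℤ`) or `N = 2`. -/
def parity {N : ℕ} (d : ZMod N) : ZMod 2 := ZMod.cast d

/-- A family of multilinear maps `A^{⊗ (n+1)} → B`, `n ≥ 0`: the member with index `n` is the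
operation of arity `n + 1`. -/
abbrev OpFamily (k : Type w) [Field k] (A : Type v) (B : Type v') [AddCommGroup A] [Module k A]
    [AddCommGroup B] [Module k B] :=
  ∀ n : ℕ, MultilinearMap k (fun _ : Fin (n + 1) => A) B

section Algebra

variable {k : Type w} [Field k] {N : ℕ}
variable {A : Type v} {B : Type v'} [AddCommGroup A] [Module k A] [AddCommGroup B] [Module k B]

/-- The sequence `a_0, …, a_{l-1}, g(a_l, …, a_{l+j}), a_{l+j+1}, …` for `g` of arity `j + 1`. -/
def insertOp {j : ℕ} (g : MultilinearMap k (fun _ : Fin (j + 1) => A) A) (l : ℕ) (a : ℕ → A) :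
    ℕ → A := fun q =>
  if q < l then a q else if q = l then g (fun r => a (l + r)) else a (q + j)

/-- The expression
`∑ (-1)^ε f_{i+1}(a_0, …, a_{l-1}, m_{j+1}(a_l, …, a_{l+j}), a_{l+j+1}, …, a_n)`
over `i + j = n` and `0 ≤ l ≤ i`, where
`ε = (j+1) (deg a_0 + ⋯ + deg a_{l-1}) + l j + (j+1) i` and `d s` is the degree of `a_s`. -/
def insertionSum (f : OpFamily k A B) (m : OpFamily k A A) (n : ℕ) (d : ℕ → ZMod N) (a : ℕ → A) :
    B :=
  ∑ ij ∈ Finset.HasAntidiagonal.antidiagonal n, ∑ l ∈ Finset.range (ij.1 + 1),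
    ((-1 : ℤˣ) ^ (((ij.2 + 1 : ℕ) : ZMod 2) * (∑ s ∈ Finset.range l, parity (d s))
        + ((l * ij.2 + (ij.2 + 1) * ij.1 : ℕ) : ZMod 2))) •
      f ij.1 (fun q => insertOp (m ij.2) l a q)

/-- The position of the first entry of block `q`, if the block `p` has `s p + 1` entries. -/
def blockStart {i : ℕ} (s : Fin (i + 1) → ℕ) (q : Fin (i + 1)) : ℕ :=
  ∑ p ∈ Finset.univ.filter (fun p => p < q), (s p + 1)

/-- The expression `∑ (-1)^γ m_{i+1}(f_{s_0+1}(a_0, …), …, f_{s_i+1}(…, a_n))` over all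
decompositions of `a_0, …, a_n` into `i + 1` consecutive non-empty blocks of lengths
`s_0 + 1, …, s_i + 1`, where
`γ = ∑_q (i - q) s_q + ∑_q s_q · (sum of the degrees of the entries before block q)`. -/
def blockSum (m : OpFamily k B B) (f : OpFamily k A B) (n : ℕ) (d : ℕ → ZMod N) (a : ℕ → A) : B :=
  ∑ i ∈ Finset.range (n + 1), ∑ s ∈ Finset.Nat.antidiagonalTuple (i + 1) (n - i),
    ((-1 : ℤˣ) ^ (∑ q : Fin (i + 1), (((i - (q : ℕ)) * s q : ℕ) : ZMod 2)
        + ∑ q : Fin (i + 1), (s q : ZMod 2) *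
            ∑ r ∈ Finset.range (blockStart s q), parity (d r))) •
      m i (fun q => f (s q) (fun r => a (blockStart s q + r)))

/-- The (non-unital) `A∞`-algebra relations, for operations on a space with homogeneous
components `gr`. -/
def IsAInfAlgebra (gr : ZMod N → Submodule k A) (m : OpFamily k A A) : Prop :=
  ∀ (n : ℕ) (d : ℕ → ZMod N) (a : ℕ → A), (∀ s, a s ∈ gr (d s)) → insertionSum m m n d a = 0

/-- The equations of an `A∞`-morphism `f : (A, mA) → (B, mB)`. -/
def IsAInfMorphism (gr : ZMod N → Submodule k A) (mA : OpFamily k A A) (mB : OpFamily k B B)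
    (f : OpFamily k A B) : Prop :=
  ∀ (n : ℕ) (d : ℕ → ZMod N) (a : ℕ → A), (∀ s, a s ∈ gr (d s)) →
    blockSum mB f n d a = insertionSum f mA n d a

end Algebra

/-! ### Transversal sequences and graded morphism spaces -/

/-- A class of transversal sequences `(X_0, …, X_n)`, `n ≥ 0`, of objects, closed under passing to
subsequences, and graded vector spaces `Hom X Y`. The space `Hom X Y` only plays a role if
`(X, Y)` is transversal. -/
structure TransversalQuiver (k : Type w) [Field k] (N : ℕ) (Ob : Type u) where
  Hom : Ob → Ob → Type v
  [addCommGroup : ∀ X Y, AddCommGroup (Hom X Y)]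
  [module : ∀ X Y, Module k (Hom X Y)]
  /-- the homogeneous components of the morphism spaces -/
  gr : ∀ X Y, ZMod N → Submodule k (Hom X Y)
  isInternal : ∀ X Y, DirectSum.IsInternal (gr X Y)
  /-- transversality of a sequence `(X_0, …, X_n)` -/
  Tr : ∀ {n : ℕ}, (Fin (n + 1) → Ob) → Prop
  tr_single : ∀ X : Fin 1 → Ob, Tr X
  tr_sub : ∀ {m n : ℕ} {X : Fin (n + 1) → Ob}, Tr X →
    ∀ i : Fin (m + 1) ↪o Fin (n + 1), Tr (X ∘ i)

attribute [instance] TransversalQuiver.addCommGroup TransversalQuiver.module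

section Quiver

variable {k : Type w} [Field k] {N : ℕ} {Ob : Type u} {Ob' : Type u'}

namespace TransversalQuiver

/-- The quiver with objects `Ob` and morphisms `Hom (o X) (o Y)`. -/
def comap (Q : TransversalQuiver.{w, u', v} k N Ob') (o : Ob → Ob') :
    TransversalQuiver.{w, u, v} k N Ob where
  Hom X Y := Q.Hom (o X) (o Y)
  gr X Y := Q.gr (o X) (o Y)
  isInternal X Y := Q.isInternal (o X) (o Y)
  Tr X := Q.Tr (o ∘ X)
  tr_single X := Q.tr_single (o ∘ X)
  tr_sub h i := Q.tr_sub h i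

/-- The graded vector space `⨁_{i < j} Hom (X i) (X j)` of a sequence of objects. -/
abbrev SeqHom (Q : TransversalQuiver.{w, u, v} k N Ob) {M : ℕ} (X : Fin (M + 1) → Ob) : Type v :=
  ∀ q : {q : Fin (M + 1) × Fin (M + 1) // q.1 < q.2}, Q.Hom (X q.1.1) (X q.1.2)

/-- The homogeneous components of `⨁_{i < j} Hom (X i) (X j)`. -/
def seqGr (Q : TransversalQuiver.{w, u, v} k N Ob) {M : ℕ} (X : Fin (M + 1) → Ob) (d : ZMod N) :
    Submodule k (Q.SeqHom X) :=
  Submodule.pi Set.univ (fun q => Q.gr (X q.1.1) (X q.1.2) d)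

theorem tr_pair (Q : TransversalQuiver.{w, u, v} k N Ob) {n : ℕ} {X : Fin (n + 1) → Ob}
    (h : Q.Tr X) {i j : Fin (n + 1)} (hij : i < j) : Q.Tr ![X i, X j] := by
  have hm : StrictMono ![i, j] := by
    intro a b hab
    fin_cases a <;> fin_cases b <;> simp_all
  have h2 := Q.tr_sub h (OrderEmbedding.ofStrictMono ![i, j] hm)
  have h3 : X ∘ (OrderEmbedding.ofStrictMono ![i, j] hm) = ![X i, X j] := by
    funext a
    fin_cases a <;> rfl
  rwa [h3] at h2

theorem tr_left (Q : TransversalQuiver.{w, u, v} k N Ob) {X Y Z : Ob} (h : Q.Tr ![X, Y, Z]) :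
    Q.Tr ![X, Y] :=
  Q.tr_pair h (i := 0) (j := 1) (by decide)

theorem tr_outer (Q : TransversalQuiver.{w, u, v} k N Ob) {X Y Z : Ob} (h : Q.Tr ![X, Y, Z]) :
    Q.Tr ![X, Z] :=
  Q.tr_pair h (i := 0) (j := 2) (by decide)

theorem tr_right (Q : TransversalQuiver.{w, u, v} k N Ob) {X Y Z : Ob} (h : Q.Tr ![X, Y, Z]) :
    Q.Tr ![Y, Z] :=
  Q.tr_pair h (i := 1) (j := 2) (by decide)

theorem tr_of_comap (Q : TransversalQuiver.{w, u', v} k N Ob') {o : Ob → Ob'} {X Y : Ob}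
    (h : (Q.comap o).Tr ![X, Y]) : Q.Tr ![o X, o Y] :=
  Q.tr_pair (X := o ∘ ![X, Y]) h (i := 0) (j := 1) (by decide)

end TransversalQuiver

/-- A collection of multilinear maps
`Hom(X_0, X_1) ⊗ ⋯ ⊗ Hom(X_n, X_{n+1}) → Hom'(X_0, X_{n+1})`, `n ≥ 0`, of degree `e - (n + 1)`, for
all transversal sequences `(X_0, …, X_{n+1})`. The member with index `n` has arity `n + 1`. -/
@[ext]
structure MultiMaps (Q : TransversalQuiver.{w, u, v} k N Ob)
    (Q' : TransversalQuiver.{w, u, v'} k N Ob) (e : ℤ) where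
  map : ∀ (n : ℕ) (X : Fin (n + 2) → Ob), Q.Tr X →
    MultilinearMap k (fun p : Fin (n + 1) => Q.Hom (X p.castSucc) (X p.succ))
      (Q'.Hom (X 0) (X (Fin.last (n + 1))))
  map_mem : ∀ (n : ℕ) (X : Fin (n + 2) → Ob) (hX : Q.Tr X) (d : Fin (n + 1) → ZMod N)
    (a : ∀ p : Fin (n + 1), Q.Hom (X p.castSucc) (X p.succ)),
    (∀ p, a p ∈ Q.gr (X p.castSucc) (X p.succ) (d p)) →
      map n X hX a ∈ Q'.gr (X 0) (X (Fin.last (n + 1)))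
        ((∑ p, d p) + ((e - (n + 1) : ℤ) : ZMod N))

namespace MultiMaps

variable {Q : TransversalQuiver.{w, u, v} k N Ob} {Q' : TransversalQuiver.{w, u, v'} k N Ob} {e : ℤ}

/-- The maps of a collection on the sequences `(o X_0, …, o X_{n+1})`. -/
def comap {Q : TransversalQuiver.{w, u', v} k N Ob'} {Q' : TransversalQuiver.{w, u', v'} k N Ob'}
    (F : MultiMaps Q Q' e) (o : Ob → Ob') : MultiMaps (Q.comap o) (Q'.comap o) e where
  map n X hX := F.map n (o ∘ X) hX
  map_mem n X hX d a ha := F.map_mem n (o ∘ X) hX d a ha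

/-- The maps induced on `⨁_{i < j} Hom (X i) (X j)` for a transversal sequence `X`: the sum, over all
`i_0 < ⋯ < i_{n+1}`, of the map of the subsequence `(X_{i_0}, …, X_{i_{n+1}})`. -/
def total (F : MultiMaps Q Q' e) {M : ℕ} (X : Fin (M + 1) → Ob) (hX : Q.Tr X) :
    OpFamily k (Q.SeqHom X) (Q'.SeqHom X) := fun n =>
  ∑ i : Fin (n + 2) ↪o Fin (M + 1),
    (LinearMap.single k
        (fun q : {q : Fin (M + 1) × Fin (M + 1) // q.1 < q.2} => Q'.Hom (X q.1.1) (X q.1.2))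
        ⟨(i 0, i (Fin.last (n + 1))), i.strictMono (Fin.last_pos)⟩).compMultilinearMap
      ((F.map n (X ∘ i) (Q.tr_sub hX i)).compLinearMap
        (fun p : Fin (n + 1) => LinearMap.proj
          (R := k) (φ := fun q : {q : Fin (M + 1) × Fin (M + 1) // q.1 < q.2} =>
            Q.Hom (X q.1.1) (X q.1.2))
          ⟨(i p.castSucc, i p.succ), i.strictMono p.castSucc_lt_succ⟩))

/-- The linear map `Hom(X, Y) → Hom'(X, Y)` of arity one. -/
def lin (F : MultiMaps Q Q' e) (X Y : Ob) (h : Q.Tr ![X, Y]) : Q.Hom X Y →ₗ[k] Q'.Hom X Y where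
  toFun a := F.map 0 ![X, Y] h (Fin.cons a finZeroElim)
  map_add' a b := by
    have h1 := (F.map 0 ![X, Y] h).cons_add finZeroElim a b
    exact h1
  map_smul' c a := by
    have h1 := (F.map 0 ![X, Y] h).cons_smul finZeroElim c a
    exact h1

/-- The operation `Hom(X, Y) × Hom(Y, Z) → Hom'(X, Z)` of arity two. -/
def bin (F : MultiMaps Q Q' e) (X Y Z : Ob) (h : Q.Tr ![X, Y, Z]) (a : Q.Hom X Y) (b : Q.Hom Y Z) :
    Q'.Hom X Z :=
  F.map 1 ![X, Y, Z] h (Fin.cons a (Fin.cons b finZeroElim))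

end MultiMaps

/-! ### `A∞`-pre-categories -/

/-- The operations `μ` make `⨁_{i < j} Hom (X i) (X j)` a non-unital `A∞`-algebra for every
transversal sequence `X`. -/
def IsAInf {Q : TransversalQuiver.{w, u, v} k N Ob} (μ : MultiMaps Q Q 2) : Prop :=
  ∀ (M : ℕ) (X : Fin (M + 1) → Ob) (hX : Q.Tr X), IsAInfAlgebra (Q.seqGr X) (μ.total X hX)

/-- The maps `F` give an `A∞`-morphism
`⨁_{i < j} Hom (X i) (X j) → ⨁_{i < j} Hom' (X i) (X j)` for every transversal sequence `X`. -/
def IsAInfMor {Q : TransversalQuiver.{w, u, v} k N Ob} {Q' : TransversalQuiver.{w, u, v'} k N Ob}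
    (μ : MultiMaps Q Q 2) (μ' : MultiMaps Q' Q' 2)
    (hQ : ∀ {n : ℕ} {X : Fin (n + 1) → Ob}, Q.Tr X → Q'.Tr X) (F : MultiMaps Q Q' 1) : Prop :=
  ∀ (M : ℕ) (X : Fin (M + 1) → Ob) (hX : Q.Tr X),
    IsAInfMorphism (Q.seqGr X) (μ.total X hX) (μ'.total X (hQ hX)) (F.total X hX)

/-- `g : (V, δ) → (V', δ')` induces a bijection `ker δ / im δ → ker δ' / im δ'`. -/
def InducesCohomologyIso {V : Type*} {V' : Type*} [AddCommGroup V] [AddCommGroup V']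
    (δ : V → V) (δ' : V' → V') (g : V → V') : Prop :=
  (∀ a, δ a = 0 → δ' (g a) = 0) ∧
  (∀ a, δ a = 0 → (∃ b, g a = δ' b) → ∃ c, a = δ c) ∧
  (∀ b, δ' b = 0 → ∃ a, δ a = 0 ∧ ∃ c, b = g a + δ' c)

/-- A closed degree `0` morphism `f ∈ Hom(X, Y)` is a quasi-isomorphism if composition with `f`
gives quasi-isomorphisms `Hom(W, X) → Hom(W, Y)` for `(W, X, Y)` transversal and
`Hom(Y, Z) → Hom(X, Z)` for `(X, Y, Z)` transversal. -/
def IsQuasiIso {Q : TransversalQuiver.{w, u, v} k N Ob} (μ : MultiMaps Q Q 2) {X Y : Ob}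
    (h : Q.Tr ![X, Y]) (f : Q.Hom X Y) : Prop :=
  f ∈ Q.gr X Y 0 ∧ μ.lin X Y h f = 0 ∧
  (∀ (W : Ob) (hW : Q.Tr ![W, X, Y]),
    InducesCohomologyIso
      (μ.lin W X (Q.tr_left hW))
      (μ.lin W Y (Q.tr_outer hW))
      (fun a => μ.bin W X Y hW a f)) ∧
  (∀ (Z : Ob) (hZ : Q.Tr ![X, Y, Z]),
    InducesCohomologyIso
      (μ.lin Y Z (Q.tr_right hZ))
      (μ.lin X Z (Q.tr_outer hZ))
      (fun b => μ.bin X Y Z hZ f b))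

/-- There is a quasi-isomorphism from `X` to `Y`. -/
def HasQuasiIso {Q : TransversalQuiver.{w, u, v} k N Ob} (μ : MultiMaps Q Q 2) (X Y : Ob) : Prop :=
  ∃ (h : Q.Tr ![X, Y]) (f : Q.Hom X Y), IsQuasiIso μ h f

/-- The extension property: for finitely many transversal sequences `S` and an object `X` there are
quasi-isomorphisms `X₋ → X → X₊` such that all the sequences `(X₋, S, X₊)` are transversal. -/
def HasExtension {Q : TransversalQuiver.{w, u, v} k N Ob} (μ : MultiMaps Q Q 2) : Prop :=
  ∀ T : Set (Σ n : ℕ, Fin (n + 1) → Ob), T.Finite → (∀ S ∈ T, Q.Tr S.2) → ∀ X : Ob,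
    ∃ Xm Xp : Ob, HasQuasiIso μ Xm X ∧ HasQuasiIso μ X Xp ∧
      ∀ S ∈ T, Q.Tr (Fin.cons Xm (Fin.snoc S.2 Xp : Fin (S.1 + 2) → Ob) : Fin (S.1 + 3) → Ob)

end Quiver

set_option linter.checkUnivs false in
/-- A small `A∞`-pre-category over `k`, graded by `ZMod N`. -/
structure AInfPreCategory (k : Type w) [Field k] (N : ℕ) where
  Ob : Type u
  Q : TransversalQuiver.{w, u, v} k N Ob
  /-- the operations; `μ.map n` is the operation of arity `n + 1` -/
  μ : MultiMaps Q Q 2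
  isAInf : IsAInf μ
  hasExtension : HasExtension μ

/-- An `A∞`-functor between `A∞`-pre-categories. -/
structure AInfFunctor {k : Type w} [Field k] {N : ℕ} (C : AInfPreCategory.{w, u, v} k N)
    (D : AInfPreCategory.{w, u', v'} k N) where
  obj : C.Ob → D.Ob
  tr : ∀ {n : ℕ} {X : Fin (n + 1) → C.Ob}, C.Q.Tr X → (D.Q.comap obj).Tr X
  /-- the maps `Hom(X_0, X_1) ⊗ ⋯ → Hom(obj X_0, obj X_{n+1})` -/
  maps : MultiMaps C.Q (D.Q.comap obj) 1
  isAInfMor : IsAInfMor C.μ (D.μ.comap obj) tr maps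
  map_quasiIso : ∀ {X Y : C.Ob} (h : C.Q.Tr ![X, Y]) (f : C.Q.Hom X Y), IsQuasiIso C.μ h f →
    IsQuasiIso D.μ (X := obj X) (Y := obj Y)
      (D.Q.tr_of_comap (tr h)) (maps.lin X Y h f)

/-- Objects are quasi-isomorphic if they are related by the equivalence relation generated by the
existence of a quasi-isomorphism. -/
def AInfPreCategory.QuasiIsomorphic {k : Type w} [Field k] {N : ℕ}
    (C : AInfPreCategory.{w, u, v} k N) (X Y : C.Ob) : Prop :=
  Relation.EqvGen (HasQuasiIso C.μ) X Y

/-- Quasi-equivalences of `A∞`-pre-categories. -/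
def AInfFunctor.IsQuasiEquivalence {k : Type w} [Field k] {N : ℕ}
    {C : AInfPreCategory.{w, u, v} k N} {D : AInfPreCategory.{w, u', v'} k N}
    (F : AInfFunctor C D) : Prop :=
  (∀ (X Y : C.Ob) (h : C.Q.Tr ![X, Y]),
    InducesCohomologyIso (C.μ.lin X Y h)
      ((D.μ.comap F.obj).lin X Y (F.tr h)) (F.maps.lin X Y h)) ∧
  (∀ Y : D.Ob, ∃ X : C.Ob, D.QuasiIsomorphic Y (F.obj X))

/-! ### Graded pre-categories -/

set_option linter.checkUnivs false in
/-- A graded pre-category: an `A∞`-pre-category whose only non-zero operation is the one of arity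
two. -/
structure GradedPreCategory (k : Type w) [Field k] (N : ℕ) extends
    AInfPreCategory.{w, u, v} k N where
  map_eq_zero : ∀ (n : ℕ), n ≠ 1 → ∀ (X : Fin (n + 2) → Ob) (hX : Q.Tr X), μ.map n X hX = 0

/-- A functor of graded pre-categories: an `A∞`-functor whose only non-zero component is the one of
arity one. -/
structure GradedFunctor {k : Type w} [Field k] {N : ℕ} (C : GradedPreCategory.{w, u, v} k N)
    (D : GradedPreCategory.{w, u', v'} k N) extends
    AInfFunctor C.toAInfPreCategory D.toAInfPreCategory where
  maps_eq_zero : ∀ (n : ℕ), n ≠ 0 → ∀ (X : Fin (n + 2) → C.Ob) (hX : C.Q.Tr X),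
    maps.map n X hX = 0

/-- An equivalence of graded pre-categories. -/
def GradedFunctor.IsEquivalence {k : Type w} [Field k] {N : ℕ}
    {C : GradedPreCategory.{w, u, v} k N} {D : GradedPreCategory.{w, u', v'} k N}
    (φ : GradedFunctor C D) : Prop :=
  φ.toAInfFunctor.IsQuasiEquivalence

/-- An `A∞`-structure on a graded pre-category `C`: operations which, together with `m_1 = 0` and
the given `m_2`, form an `A∞`-pre-category with the same objects, transversal sequences and
morphism spaces. -/
@[ext]
structure AInfStructure {k : Type w} [Field k] {N : ℕ} (C : GradedPreCategory.{w, u, v} k N) where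
  ops : MultiMaps C.Q C.Q 2
  ops_one : ∀ (X : Fin 2 → C.Ob) (hX : C.Q.Tr X), ops.map 0 X hX = 0
  ops_two : ∀ (X : Fin 3 → C.Ob) (hX : C.Q.Tr X), ops.map 1 X hX = C.μ.map 1 X hX
  isAInf : IsAInf ops
  hasExtension : HasExtension ops

/-- The underlying set of the group `G_C`: collections of maps
`f_n : Hom(X_0, X_1) ⊗ ⋯ ⊗ Hom(X_{n-1}, X_n) → Hom(X_0, X_n)` of degree `1 - n`, `n ≥ 1`, for all
transversal sequences, with `f_1 = id`. -/
structure GaugeMaps {k : Type w} [Field k] {N : ℕ} (C : GradedPreCategory.{w, u, v} k N) where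
  maps : MultiMaps C.Q C.Q 1
  maps_one : ∀ (X : Fin 2 → C.Ob) (hX : C.Q.Tr X)
    (a : ∀ p : Fin 1, C.Q.Hom (X p.castSucc) (X p.succ)), maps.map 0 X hX a = a 0

/-- The `A∞`-structures `m` and `m'` are strongly homotopic: some `f` in `G_C` is an `A∞`-morphism
`(C, m) → (C, m')`, that is, `f(m) = m'`. -/
def StronglyHomotopic {k : Type w} [Field k] {N : ℕ} {C : GradedPreCategory.{w, u, v} k N}
    (m m' : AInfStructure C) : Prop :=
  ∃ f : GaugeMaps C, IsAInfMor m.ops m'.ops (fun h => h) f.maps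

/-! ### Transport along an isomorphism of graded morphism spaces -/

section Transport

variable {k : Type w} [Field k] {N : ℕ}

theorem insertionSum_transport {A : Type v} {B : Type v'} {A' : Type u} {B' : Type u'}
    [AddCommGroup A] [Module k A] [AddCommGroup B] [Module k B]
    [AddCommGroup A'] [Module k A'] [AddCommGroup B'] [Module k B']
    (Φ : A →ₗ[k] A') (Ψ : B →ₗ[k] B')
    (f : OpFamily k A B) (m : OpFamily k A A) (f' : OpFamily k A' B') (m' : OpFamily k A' A')
    (hf : ∀ n a, Ψ (f n a) = f' n (fun p => Φ (a p)))
    (hm : ∀ n a, Φ (m n a) = m' n (fun p => Φ (a p)))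
    (n : ℕ) (d : ℕ → ZMod N) (a : ℕ → A) :
    Ψ (insertionSum f m n d a) = insertionSum f' m' n d (fun s => Φ (a s)) := by
  have key : ∀ (j l : ℕ) (q : ℕ), Φ (insertOp (m j) l a q) =
      insertOp (m' j) l (fun s => Φ (a s)) q := by
    intro j l q
    unfold insertOp
    split_ifs
    · rfl
    · exact hm _ _
    · rfl
  simp only [insertionSum, map_sum, Units.smul_def, map_zsmul, hf, key]

theorem blockSum_transport {A : Type v} {B : Type v'} {A' : Type u} {B' : Type u'}
    [AddCommGroup A] [Module k A] [AddCommGroup B] [Module k B]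
    [AddCommGroup A'] [Module k A'] [AddCommGroup B'] [Module k B']
    (Φ : A →ₗ[k] A') (Ψ : B →ₗ[k] B')
    (f : OpFamily k A B) (m : OpFamily k B B) (f' : OpFamily k A' B') (m' : OpFamily k B' B')
    (hf : ∀ n a, Ψ (f n a) = f' n (fun p => Φ (a p)))
    (hm : ∀ n a, Ψ (m n a) = m' n (fun p => Ψ (a p)))
    (n : ℕ) (d : ℕ → ZMod N) (a : ℕ → A) :
    Ψ (blockSum m f n d a) = blockSum m' f' n d (fun s => Φ (a s)) := by
  simp only [blockSum, map_sum, Units.smul_def, map_zsmul, hf, hm]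

/-- A bijective linear map preserving internal gradings reflects degrees. -/
theorem mem_of_map_mem {A : Type v} {B : Type v'}
    [AddCommGroup A] [Module k A] [AddCommGroup B] [Module k B]
    (gA : ZMod N → Submodule k A) (gB : ZMod N → Submodule k B)
    (hA : DirectSum.IsInternal gA) (hB : DirectSum.IsInternal gB)
    (L : A →ₗ[k] B) (hinj : Function.Injective L) (hL : ∀ d a, a ∈ gA d → L a ∈ gB d)
    (d : ZMod N) (a : A) (ha : L a ∈ gB d) : a ∈ gA d := by
  let _ := hA.chooseDecomposition
  let _ := hB.chooseDecomposition
  have key : ∀ (x : A) (j : ZMod N),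
      (DirectSum.decompose gB (L x) j : B) = L (DirectSum.decompose gA x j : A) := by
    intro x j
    induction x using DirectSum.Decomposition.inductionOn gA with
    | zero => simp
    | @homogeneous i m =>
      by_cases h : i = j
      · subst h
        rw [DirectSum.decompose_of_mem_same gB (hL _ _ m.2),
          DirectSum.decompose_of_mem_same gA m.2]
      · rw [DirectSum.decompose_of_mem_ne gB (hL _ _ m.2) h,
          DirectSum.decompose_of_mem_ne gA m.2 h, map_zero]
    | add x y hx hy => simp [hx, hy]
  have h1 := key a d
  rw [DirectSum.decompose_of_mem_same gB ha] at h1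
  rw [hinj h1]
  exact SetLike.coe_mem _

/-- Multilinear maps that agree on homogeneous elements are equal. -/
theorem multilinear_ext_homogeneous {n : ℕ} {A : Fin n → Type v} {B : Type v'}
    [∀ p, AddCommGroup (A p)] [∀ p, Module k (A p)] [AddCommGroup B] [Module k B]
    (gA : ∀ p, ZMod N → Submodule k (A p)) (hA : ∀ p, DirectSum.IsInternal (gA p))
    (f g : MultilinearMap k A B)
    (h : ∀ (d : Fin n → ZMod N) (a : ∀ p, A p), (∀ p, a p ∈ gA p (d p)) → f a = g a) : f = g := by
  have key : ∀ (S : Finset (Fin n)) (a : ∀ p, A p), (∀ p, p ∉ S → ∃ d, a p ∈ gA p d) →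
      f a = g a := by
    intro S
    induction S using Finset.induction_on with
    | empty =>
      intro a ha
      choose d hd using fun p => ha p (by simp)
      exact h d a hd
    | insert p S hp ih =>
      intro a ha
      have h1 : ∀ x : A p, f (Function.update a p x) = g (Function.update a p x) := by
        intro x
        have hx : x ∈ ⨆ i, gA p i := by
          rw [(hA p).submodule_iSup_eq_top]
          trivial
        induction hx using Submodule.iSup_induction' with
        | mem i x hx =>
          refine ih _ fun q hq => ?_
          by_cases hqp : q = p
          · subst hqp
            exact ⟨i, by simpa using hx⟩
          · rw [Function.update_of_ne hqp]
            exact ha q (by simp [hqp, hq])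
        | zero => rw [f.map_update_zero, g.map_update_zero]
        | add x y _ _ hx hy => rw [f.map_update_add, g.map_update_add, hx, hy]
      simpa using h1 (a p)
  ext a
  exact key Finset.univ a (by simp)

variable {Ob : Type u} {Q : TransversalQuiver.{w, u, v} k N Ob}
  {R : TransversalQuiver.{w, u, v'} k N Ob}

theorem MultiMaps.lin_mem (E : MultiMaps Q R 1) {X Y : Ob} (h : Q.Tr ![X, Y]) (d : ZMod N)
    (a : Q.Hom X Y) (ha : a ∈ Q.gr X Y d) : E.lin X Y h a ∈ R.gr X Y d := by
  have h1 := E.map_mem 0 ![X, Y] h (fun _ => d) (Fin.cons a finZeroElim)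
    (fun p => by
      obtain rfl : p = 0 := by omega
      exact ha)
  have h2 : (∑ _p : Fin (0 + 1), d) + (((1 : ℤ) - ((0 : ℕ) + 1) : ℤ) : ZMod N) = d := by simp
  rw [h2] at h1
  exact h1

/-- Transport of a collection of maps along isomorphisms `E : Hom(X, Y) → Hom'(X, Y)`:
`(a_0, …, a_n) ↦ E⁻¹ (F (E a_0, …, E a_n))`. -/
def MultiMaps.transport (E : MultiMaps Q R 1)
    (hQR : ∀ {n : ℕ} {X : Fin (n + 1) → Ob}, Q.Tr X → R.Tr X)
    (hE : ∀ (X Y : Ob) (h : Q.Tr ![X, Y]), Function.Bijective (E.lin X Y h))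
    {e : ℤ} (F : MultiMaps R R e) : MultiMaps Q Q e where
  map n X hX :=
    ((LinearEquiv.ofBijective (E.lin (X 0) (X (Fin.last (n + 1)))
        (Q.tr_pair hX Fin.last_pos)) (hE _ _ _)).symm : _ →ₗ[k] _).compMultilinearMap
      ((F.map n X (hQR hX)).compLinearMap
        (fun p => E.lin (X p.castSucc) (X p.succ) (Q.tr_pair hX p.castSucc_lt_succ)))
  map_mem n X hX d a ha := by
    refine mem_of_map_mem _ _ (Q.isInternal _ _) (R.isInternal _ _)
      (E.lin (X 0) (X (Fin.last (n + 1))) (Q.tr_pair hX Fin.last_pos)) (hE _ _ _).1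
      (fun d a ha => E.lin_mem _ d a ha) _ _ ?_
    have h1 := F.map_mem n X (hQR hX) d
      (fun p => E.lin (X p.castSucc) (X p.succ) (Q.tr_pair hX p.castSucc_lt_succ) (a p))
      (fun p => E.lin_mem _ _ _ (ha p))
    convert h1 using 1
    exact (LinearEquiv.ofBijective (E.lin (X 0) (X (Fin.last (n + 1)))
        (Q.tr_pair hX Fin.last_pos)) (hE _ _ _)).apply_symm_apply _

variable (E : MultiMaps Q R 1) (hQR : ∀ {n : ℕ} {X : Fin (n + 1) → Ob}, Q.Tr X → R.Tr X)
  (hE : ∀ (X Y : Ob) (h : Q.Tr ![X, Y]), Function.Bijective (E.lin X Y h))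

theorem MultiMaps.lin_transport {e : ℤ} (F : MultiMaps R R e) (n : ℕ) (X : Fin (n + 2) → Ob)
    (hX : Q.Tr X) (a : ∀ p : Fin (n + 1), Q.Hom (X p.castSucc) (X p.succ)) :
    E.lin (X 0) (X (Fin.last (n + 1))) (Q.tr_pair hX Fin.last_pos)
      ((E.transport hQR hE F).map n X hX a) =
    F.map n X (hQR hX)
      (fun p => E.lin (X p.castSucc) (X p.succ) (Q.tr_pair hX p.castSucc_lt_succ) (a p)) :=
  (LinearEquiv.ofBijective (E.lin (X 0) (X (Fin.last (n + 1)))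
        (Q.tr_pair hX Fin.last_pos)) (hE _ _ _)).apply_symm_apply _

/-- The map induced by the arity one components on `⨁_{i < j} Hom (X i) (X j)`. -/
def MultiMaps.seqLin {e : ℤ} (E : MultiMaps Q R e) {M : ℕ} (X : Fin (M + 1) → Ob) (hX : Q.Tr X) :
    Q.SeqHom X →ₗ[k] R.SeqHom X :=
  LinearMap.pi (fun q => (E.lin (X q.1.1) (X q.1.2) (Q.tr_pair hX q.2)).comp (LinearMap.proj q))

theorem MultiMaps.seqLin_mem {M : ℕ} (X : Fin (M + 1) → Ob) (hX : Q.Tr X) (d : ZMod N)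
    (a : Q.SeqHom X) (ha : a ∈ Q.seqGr X d) : E.seqLin X hX a ∈ R.seqGr X d :=
  fun q hq => E.lin_mem _ d _ (ha q hq)

theorem MultiMaps.seqLin_single {M : ℕ} (X : Fin (M + 1) → Ob) (hX : Q.Tr X)
    (q : {q : Fin (M + 1) × Fin (M + 1) // q.1 < q.2}) (x : Q.Hom (X q.1.1) (X q.1.2)) :
    E.seqLin X hX (LinearMap.single k
        (fun q : {q : Fin (M + 1) × Fin (M + 1) // q.1 < q.2} => Q.Hom (X q.1.1) (X q.1.2)) q x) =
      LinearMap.single k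
        (fun q : {q : Fin (M + 1) × Fin (M + 1) // q.1 < q.2} => R.Hom (X q.1.1) (X q.1.2)) q
        (E.lin (X q.1.1) (X q.1.2) (Q.tr_pair hX q.2) x) := by
  funext r
  by_cases h : r = q
  · subst h
    simp [MultiMaps.seqLin]
  · simp [MultiMaps.seqLin, h]

theorem MultiMaps.seqLin_total {e : ℤ} (F : MultiMaps R R e) {M : ℕ} (X : Fin (M + 1) → Ob)
    (hX : Q.Tr X) (n : ℕ) (a : Fin (n + 1) → Q.SeqHom X) :
    E.seqLin X hX ((E.transport hQR hE F).total X hX n a) =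
      F.total X (hQR hX) n (fun p => E.seqLin X hX (a p)) := by
  unfold MultiMaps.total
  rw [sum_apply, sum_apply, map_sum]
  refine Finset.sum_congr rfl fun i _ => ?_
  rw [LinearMap.compMultilinearMap_apply, LinearMap.compMultilinearMap_apply,
    E.seqLin_single]
  congr 1
  exact E.lin_transport hQR hE F n (X ∘ i) (Q.tr_sub hX i)
    (fun p => a p ⟨(i p.castSucc, i p.succ), i.strictMono p.castSucc_lt_succ⟩)

theorem MultiMaps.seqLin_injective (hE : ∀ (X Y : Ob) (h : Q.Tr ![X, Y]),
    Function.Bijective (E.lin X Y h)) {M : ℕ} (X : Fin (M + 1) → Ob) (hX : Q.Tr X) :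
    Function.Injective (E.seqLin X hX) := by
  intro a b hab
  funext q
  exact (hE _ _ (Q.tr_pair hX q.2)).1 (congrFun hab q)

theorem MultiMaps.map_arity_one {e : ℤ} (F : MultiMaps Q R e) (X : Fin 2 → Ob) (hX : Q.Tr X)
    (a : ∀ p : Fin 1, Q.Hom (X p.castSucc) (X p.succ)) :
    F.map 0 X hX a = F.lin (X 0) (X 1) (Q.tr_pair hX (by decide)) (a 0) := by
  obtain ⟨x, y, rfl⟩ : ∃ x y, X = ![x, y] :=
    ⟨X 0, X 1, by funext p; fin_cases p <;> rfl⟩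
  refine congrArg (F.map 0 ![x, y] hX) ?_
  funext p
  obtain rfl : p = 0 := by omega
  rfl

theorem MultiMaps.total_arity_one {e : ℤ} (F : MultiMaps Q R e) {M : ℕ} (X : Fin (M + 1) → Ob)
    (hX : Q.Tr X) (a : Fin 1 → Q.SeqHom X) :
    F.total X hX 0 a = F.seqLin X hX (a 0) := by
  funext q
  unfold MultiMaps.total
  have hq : StrictMono ![q.1.1, q.1.2] := by
    intro a b hab
    have h3 := q.2
    fin_cases a <;> fin_cases b <;> simp_all
  rw [sum_apply, Finset.sum_apply, Finset.sum_eq_single (OrderEmbedding.ofStrictMono _ hq)]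
  · rw [LinearMap.compMultilinearMap_apply]
    refine (Pi.single_eq_same (M := fun q : {q : Fin (M + 1) × Fin (M + 1) // q.1 < q.2} =>
      R.Hom (X q.1.1) (X q.1.2)) q _).trans ?_
    exact F.map_arity_one _ _ _
  · intro i _ hi
    rw [LinearMap.compMultilinearMap_apply]
    refine Pi.single_eq_of_ne (fun h => hi ?_) _
    ext p
    fin_cases p
    · exact congrArg (fun q => (q.1.1 : ℕ)) h.symm
    · exact congrArg (fun q => (q.1.2 : ℕ)) h.symm
  · simp

theorem MultiMaps.total_top {e : ℤ} (F : MultiMaps Q R e) {n : ℕ} (X : Fin (n + 2) → Ob)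
    (hX : Q.Tr X) (a : Fin (n + 1) → Q.SeqHom X) :
    F.total X hX n a ⟨(0, Fin.last (n + 1)), Fin.last_pos⟩ =
      F.map n X hX (fun p => a p ⟨(p.castSucc, p.succ), p.castSucc_lt_succ⟩) := by
  unfold MultiMaps.total
  have hu : ∀ i : Fin (n + 2) ↪o Fin (n + 1 + 1), i = (OrderIso.refl _).toOrderEmbedding := by
    intro i
    have hs : Function.Surjective i := Finite.injective_iff_surjective.1 i.injective
    have h2 : RelIso.ofSurjective i hs = OrderIso.refl _ := Subsingleton.elim _ _
    ext p
    exact congrArg (fun g : Fin (n + 2) ≃o Fin (n + 2) => ((g p : Fin (n + 2)) : ℕ)) h2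
  rw [sum_apply, Finset.sum_eq_single (OrderIso.refl _).toOrderEmbedding
    (fun i _ hi => absurd (hu i) hi) (by simp), LinearMap.compMultilinearMap_apply]
  exact Pi.single_eq_same _ _

theorem MultiMaps.total_eq_zero {e : ℤ} (F : MultiMaps Q R e) {n : ℕ}
    (hF : ∀ X hX, F.map n X hX = 0) {M : ℕ} (X : Fin (M + 1) → Ob) (hX : Q.Tr X) :
    F.total X hX n = 0 := by
  unfold MultiMaps.total
  refine Finset.sum_eq_zero fun i _ => ?_
  refine MultilinearMap.ext fun a => ?_
  rw [LinearMap.compMultilinearMap_apply, MultilinearMap.compLinearMap_apply, hF, zero_apply,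
    map_zero, zero_apply]

theorem IsAInf.transport {F : MultiMaps R R 2} (hF : IsAInf F) :
    IsAInf (E.transport hQR hE F) := by
  intro M X hX n d a ha
  apply E.seqLin_injective hE X hX
  rw [insertionSum_transport (E.seqLin X hX) (E.seqLin X hX) _ _ (F.total X (hQR hX))
    (F.total X (hQR hX)) (E.seqLin_total hQR hE F X hX) (E.seqLin_total hQR hE F X hX), map_zero]
  exact hF M X (hQR hX) n d _ (fun s => E.seqLin_mem X hX _ _ (ha s))

theorem IsAInfMor.transport {μ μ' : MultiMaps R R 2} {F : MultiMaps R R 1}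
    (hF : IsAInfMor μ μ' (fun h => h) F) :
    IsAInfMor (E.transport hQR hE μ) (E.transport hQR hE μ') (fun h => h)
      (E.transport hQR hE F) := by
  intro M X hX n d a ha
  apply E.seqLin_injective hE X hX
  rw [insertionSum_transport (E.seqLin X hX) (E.seqLin X hX) _ _ (F.total X (hQR hX))
      (μ.total X (hQR hX)) (E.seqLin_total hQR hE F X hX) (E.seqLin_total hQR hE μ X hX),
    blockSum_transport (E.seqLin X hX) (E.seqLin X hX) _ _ (F.total X (hQR hX))
      (μ'.total X (hQR hX)) (E.seqLin_total hQR hE F X hX) (E.seqLin_total hQR hE μ' X hX)]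
  exact hF M X (hQR hX) n d _ (fun s => E.seqLin_mem X hX _ _ (ha s))

theorem IsAInf.comap {Ob' : Type u'} {Q' : TransversalQuiver.{w, u', v} k N Ob'}
    {μ : MultiMaps Q' Q' 2} (h : IsAInf μ) (o : Ob → Ob') : IsAInf (μ.comap o) :=
  fun M X hX => h M (o ∘ X) hX

theorem IsAInfMor.comap {Ob' : Type u'} {Q' : TransversalQuiver.{w, u', v} k N Ob'}
    {μ μ' : MultiMaps Q' Q' 2} {F : MultiMaps Q' Q' 1} (h : IsAInfMor μ μ' (fun h => h) F)
    (o : Ob → Ob') : IsAInfMor (μ.comap o) (μ'.comap o) (fun h => h) (F.comap o) :=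
  fun M X hX => h M (o ∘ X) hX

/-- Quasi-isomorphisms, hence the extension property, only depend on `m_1` and `m_2`. -/
theorem HasExtension.congr {μ μ' : MultiMaps Q Q 2} (h : HasExtension μ)
    (h1 : ∀ X hX, μ'.map 0 X hX = μ.map 0 X hX) (h2 : ∀ X hX, μ'.map 1 X hX = μ.map 1 X hX) :
    HasExtension μ' := by
  have hl : ∀ X Y hXY, μ'.lin X Y hXY = μ.lin X Y hXY := by
    intro X Y hXY
    ext a
    exact DFunLike.congr_fun (h1 ![X, Y] hXY) _
  have hb : ∀ X Y Z hX a b, μ'.bin X Y Z hX a b = μ.bin X Y Z hX a b := by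
    intro X Y Z hX a b
    exact DFunLike.congr_fun (h2 ![X, Y, Z] hX) _
  have hq : ∀ X Y, HasQuasiIso μ X Y → HasQuasiIso μ' X Y := by
    rintro X Y ⟨hXY, f, hf⟩
    refine ⟨hXY, f, ?_⟩
    obtain ⟨hf0, hf1, hf2, hf3⟩ := hf
    refine ⟨hf0, ?_, fun W hW => ?_, fun Z hZ => ?_⟩
    · rw [hl, hf1]
    · have h3 := hf2 W hW
      rw [← hl W X, ← hl W Y] at h3
      simpa only [hb] using h3
    · have h3 := hf3 Z hZ
      rw [← hl Y Z, ← hl X Z] at h3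
      simpa only [hb] using h3
  intro T hT hTr X
  obtain ⟨Xm, Xp, hm, hp, hS⟩ := h T hT hTr X
  exact ⟨Xm, Xp, hq _ _ hm, hq _ _ hp, hS⟩

end Transport

/-! ### Pullback of `A∞`-structures along an equivalence -/

section Pullback

variable {k : Type w} [Field k] {N : ℕ}
  {C : GradedPreCategory.{w, u, v} k N} {D : GradedPreCategory.{w, u', v'} k N}

/-- An equivalence is bijective on morphism spaces of transversal pairs. -/
theorem GradedFunctor.IsEquivalence.bijective {φ : GradedFunctor C D} (hφ : φ.IsEquivalence)
    (X Y : C.Ob) (h : C.Q.Tr ![X, Y]) : Function.Bijective (φ.maps.lin X Y h) := by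
  have hC : ∀ a, C.μ.lin X Y h a = 0 := fun a =>
    DFunLike.congr_fun (C.map_eq_zero 0 (by decide) ![X, Y] h) _
  have hD : ∀ a, (D.μ.comap φ.obj).lin X Y (φ.tr h) a = 0 := fun a =>
    DFunLike.congr_fun (D.map_eq_zero 0 (by decide) (φ.obj ∘ ![X, Y]) (φ.tr h)) _
  obtain ⟨-, h1, h2⟩ := hφ.1 X Y h
  refine ⟨(injective_iff_map_eq_zero _).2 fun a ha => ?_, fun b => ?_⟩
  · obtain ⟨c, hc⟩ := h1 a (hC a) ⟨0, by rw [ha, hD]⟩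
    rw [hc, hC]
  · obtain ⟨a, -, c, hc⟩ := h2 b (hD b)
    exact ⟨a, by rw [hc, hD, add_zero]⟩

/-- A functor of graded pre-categories is compatible with the operation of arity two. -/
theorem GradedFunctor.map_two (φ : GradedFunctor C D) (X : Fin 3 → C.Ob) (hX : C.Q.Tr X)
    (a : ∀ p : Fin 2, C.Q.Hom (X p.castSucc) (X p.succ)) :
    φ.maps.lin (X 0) (X (Fin.last 2)) (C.Q.tr_pair hX Fin.last_pos) (C.μ.map 1 X hX a) =
      (D.μ.comap φ.obj).map 1 X (φ.tr hX)
        (fun p => φ.maps.lin (X p.castSucc) (X p.succ) (C.Q.tr_pair hX p.castSucc_lt_succ) (a p)) := by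
  suffices H : (φ.maps.lin (X 0) (X (Fin.last 2)) (C.Q.tr_pair hX Fin.last_pos)).compMultilinearMap
      (C.μ.map 1 X hX) = ((D.μ.comap φ.obj).map 1 X (φ.tr hX)).compLinearMap
        (fun p : Fin 2 => φ.maps.lin (X p.castSucc) (X p.succ)
          (C.Q.tr_pair hX p.castSucc_lt_succ)) from DFunLike.congr_fun H a
  refine multilinear_ext_homogeneous _ (fun p => C.Q.isInternal _ _) _ _ fun d a ha => ?_
  let b : ℕ → C.Q.SeqHom X
    | 0 => LinearMap.single k (fun q : {q : Fin 3 × Fin 3 // q.1 < q.2} =>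
        C.Q.Hom (X q.1.1) (X q.1.2)) ⟨(0, 1), by decide⟩ (a 0)
    | 1 => LinearMap.single k (fun q : {q : Fin 3 × Fin 3 // q.1 < q.2} =>
        C.Q.Hom (X q.1.1) (X q.1.2)) ⟨(1, 2), by decide⟩ (a 1)
    | _ + 2 => 0
  let d' : ℕ → ZMod N
    | 0 => d 0
    | 1 => d 1
    | _ + 2 => 0
  have hb : ∀ s, b s ∈ C.Q.seqGr X (d' s)
    | 0 => by
      intro q _
      by_cases h : q = ⟨(0, 1), by decide⟩
      · subst h
        simpa [b, d'] using ha 0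
      · simp [b, h]
    | 1 => by
      intro q _
      by_cases h : q = ⟨(1, 2), by decide⟩
      · subst h
        simpa [b, d'] using ha 1
      · simp [b, h]
    | _ + 2 => Submodule.zero_mem _
  have key := φ.isAInfMor 2 X hX 1 d' b hb
  have hD0 : (D.μ.comap φ.obj).total X (φ.tr hX) 0 = 0 :=
    MultiMaps.total_eq_zero _ (fun X hX => D.map_eq_zero 0 (by decide) (φ.obj ∘ X) hX) _ _
  have hC0 : C.μ.total X hX 0 = 0 :=
    MultiMaps.total_eq_zero _ (fun X hX => C.map_eq_zero 0 (by decide) X hX) _ _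
  have hφ1 : φ.maps.total X hX 1 = 0 :=
    MultiMaps.total_eq_zero _ (fun X hX => φ.maps_eq_zero 1 (by decide) X hX) _ _
  simp [blockSum, insertionSum, Finset.sum_range_succ, hD0, hC0, hφ1,
    Finset.Nat.antidiagonal_succ, Finset.Nat.antidiagonalTuple_zero_right] at key
  have h3 := congrFun key ⟨(0, Fin.last 2), Fin.last_pos⟩
  rw [MultiMaps.total_top, MultiMaps.total_arity_one] at h3
  have hin : insertOp (C.μ.total X hX 1) 0 b 0 = C.μ.total X hX 1 (fun r => b r) := by
    simp [insertOp]
  have hb0 : b 0 ⟨(0, 1), by decide⟩ = a 0 := by simp [b]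
  have hb1 : b 1 ⟨(1, 2), by decide⟩ = a 1 := by simp [b]
  have hs0 : blockStart (0 : Fin 2 → ℕ) 0 = 0 := by decide
  have hs1 : blockStart (0 : Fin 2 → ℕ) 1 = 1 := by decide
  have hL : φ.maps.seqLin X hX (insertOp (C.μ.total X hX 1) 0 b 0)
      ⟨(0, Fin.last 2), Fin.last_pos⟩ =
      φ.maps.lin (X 0) (X (Fin.last 2)) (C.Q.tr_pair hX Fin.last_pos) (C.μ.map 1 X hX a) := by
    rw [hin]
    change φ.maps.lin (X 0) (X (Fin.last 2)) _
      (C.μ.total X hX 1 (fun r => b r) ⟨(0, Fin.last 2), Fin.last_pos⟩) = _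
    rw [MultiMaps.total_top]
    congr 2
    funext p
    fin_cases p
    · exact hb0
    · exact hb1
  refine hL.symm.trans (h3.symm.trans ?_)
  refine congrArg ((D.μ.comap φ.obj).map 1 X (φ.tr hX)) ?_
  funext p
  rw [MultiMaps.total_arity_one]
  refine congrArg (φ.maps.lin (X p.castSucc) (X p.succ) _) ?_
  fin_cases p
  · refine Eq.trans ?_ hb0
    exact congrArg (fun s => b s ⟨(0, 1), by decide⟩) hs0
  · refine Eq.trans ?_ hb1
    exact congrArg (fun s => b s ⟨(1, 2), by decide⟩) hs1

theorem AInfStructure.pullback_one (φ : GradedFunctor C D) (hφ : φ.IsEquivalence)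
    (m : AInfStructure D) (X : Fin 2 → C.Ob) (hX : C.Q.Tr X) :
    (φ.maps.transport φ.tr hφ.bijective (m.ops.comap φ.obj)).map 0 X hX = 0 := by
  refine MultilinearMap.ext fun a => ?_
  apply (hφ.bijective _ _ (C.Q.tr_pair hX Fin.last_pos)).1
  refine (φ.maps.lin_transport φ.tr hφ.bijective (m.ops.comap φ.obj) 0 X hX a).trans ?_
  rw [zero_apply, map_zero]
  exact DFunLike.congr_fun (m.ops_one (φ.obj ∘ X) (φ.tr hX)) _

theorem AInfStructure.pullback_two (φ : GradedFunctor C D) (hφ : φ.IsEquivalence)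
    (m : AInfStructure D) (X : Fin 3 → C.Ob) (hX : C.Q.Tr X) :
    (φ.maps.transport φ.tr hφ.bijective (m.ops.comap φ.obj)).map 1 X hX = C.μ.map 1 X hX := by
  refine MultilinearMap.ext fun a => ?_
  apply (hφ.bijective _ _ (C.Q.tr_pair hX Fin.last_pos)).1
  refine (φ.maps.lin_transport φ.tr hφ.bijective (m.ops.comap φ.obj) 1 X hX a).trans ?_
  refine Eq.trans ?_ (φ.map_two X hX a).symm
  exact DFunLike.congr_fun (m.ops_two (φ.obj ∘ X) (φ.tr hX)) _

/-- The pullback `φ^* m` of an `A∞`-structure along an equivalence `φ`: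
`(φ^* m)_n (a_1, …, a_n) = φ⁻¹ (m_n (φ a_1, …, φ a_n))`. -/
def AInfStructure.pullback (φ : GradedFunctor C D) (hφ : φ.IsEquivalence) (m : AInfStructure D) :
    AInfStructure C where
  ops := φ.maps.transport φ.tr hφ.bijective (m.ops.comap φ.obj)
  ops_one := AInfStructure.pullback_one φ hφ m
  ops_two := AInfStructure.pullback_two φ hφ m
  isAInf := (m.isAInf.comap φ.obj).transport φ.maps φ.tr hφ.bijective
  hasExtension := by
    refine C.hasExtension.congr (fun X hX => ?_) (fun X hX => ?_)
    · refine Eq.trans ?_ (C.map_eq_zero 0 (by decide) X hX).symm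
      exact AInfStructure.pullback_one φ hφ m X hX
    · exact AInfStructure.pullback_two φ hφ m X hX

/-- Pullback along an equivalence preserves strong homotopy. -/
theorem StronglyHomotopic.pullback (φ : GradedFunctor C D) (hφ : φ.IsEquivalence)
    (m m' : AInfStructure D) (h : StronglyHomotopic m m') :
    StronglyHomotopic (m.pullback φ hφ) (m'.pullback φ hφ) := by
  obtain ⟨f, hf⟩ := h
  refine ⟨⟨φ.maps.transport φ.tr hφ.bijective (f.maps.comap φ.obj), ?_⟩,
    (hf.comap φ.obj).transport φ.maps φ.tr hφ.bijective⟩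
  intro X hX a
  apply (hφ.bijective _ _ (C.Q.tr_pair hX Fin.last_pos)).1
  refine (φ.maps.lin_transport φ.tr hφ.bijective (f.maps.comap φ.obj) 0 X hX a).trans ?_
  exact f.maps_one (φ.obj ∘ X) (φ.tr hX) _

/-- The set of strong homotopy classes of `A∞`-structures on `C`, that is, `A∞(C) / G_C`. -/
def AInfClasses (C : GradedPreCategory.{w, u, v} k N) : Type (max u v) :=
  Quot (StronglyHomotopic (C := C))

/-- The map `φ^* : A∞(D) / G_D → A∞(C) / G_C` induced by an equivalence `φ : C → D`. -/
def AInfClasses.pullback (φ : GradedFunctor C D) (hφ : φ.IsEquivalence) :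
    AInfClasses D → AInfClasses C :=
  Quot.map (AInfStructure.pullback φ hφ) (StronglyHomotopic.pullback φ hφ)

end Pullback
end
end AInf

/-! A collection of multilinear maps on transversal sequences (`Coch`) is encoded by the maps `x ↦ ∑
F_n(x, …, x)` on the spaces `⨁_{i < j} Hom(X_i, X_j)`. The sums are finite because increasing chains
of positions have bounded length, and by `ext_chat` these maps determine the collection in every
characteristic. Composition of collections becomes composition of maps, and insertion of one
collection into another becomes the noncommutative derivative `∑ F(x, …, x, y, z, …, z)`. After
suspension (`susp`) all signs are absorbed in the operator `T = (-1)^(deg - 1)`: an `A∞`-structure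
is a solution of `sq b = 0`, and a morphism is a solution of `resid b b' f = 0`. Morphisms with
identity linear part are then composed and inverted formally (`resid_comp`, `exists_rightInverse`,
`resid_rightInverse`), so strong homotopy is an equivalence relation.

For the invariance, both pre-categories are placed in one honest graded category in which all
sequences are allowed. A morphism `U → V` is a natural family of maps `Hom(W, U) → Hom(W, V)`, where
`W` is transversal to `U` and `V`. By the extension property such a family is determined by its
values on generic `W`, the families compose, quasi-isomorphisms become invertible, and the morphism
spaces of transversal pairs of `D` are unchanged (`exists_nHom`, `ofHom_bijective`, `nIso_of_qi`).
Adding a copy of the objects of `C` through `φ` gives `sumCat`, in which both `C` and `D` embed.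
Their transversal sequences form classes `T` of lists of objects that are closed under sublists.

Structures and homotopies given on `T` extend to the whole category by obstruction theory
(`exists_extension_structure`, `exists_extension_morphism`). The obstructions are classes in the
Hochschild cohomology relative to `T`, and this cohomology vanishes (`relVanish_susp_coch`). The
reason is that finitely many lists of `T` can be prolonged on the left by an object `W` of which a
given object `X` is a retract. This makes the bar complex modulo the words over `T` exact
(`exists_npr_bd`), exactness improves to a contraction by bimodule maps (`exists_contraction_succ`),
and the contraction produces primitives that vanish on `T` (`exists_dfam_eq`).

Finally, sending every object of `sumCat` to its copy in `D` turns an extension `b` of a structure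
`m` on `D` into one that restricts to `m` on `D` and to `φ^* m` on `C`. Injectivity and surjectivity
of `φ^*` follow by extending homotopies from one of the two pre-categories to `sumCat` and
restricting them to the other (`AInfClasses.pullback_bijective`). -/

namespace AInf
noncomputable section

/-! ### Composition of multilinear maps along blocks -/

section Blocks

/-- `x` before position `p`, `y` at position `p`, and `z` after position `p`. -/
def tri {α : Type*} {ι : Type*} [LinearOrder ι] (x y z : α) (p q : ι) : α :=
  if q < p then x else if q = p then y else z

theorem tri_lt {α : Type*} {ι : Type*} [LinearOrder ι] (x y z : α) {p q : ι} (h : q < p) :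
    tri x y z p q = x := if_pos h

theorem tri_self {α : Type*} {ι : Type*} [LinearOrder ι] (x y z : α) (p : ι) :
    tri x y z p p = y := by simp [tri]

theorem tri_gt {α : Type*} {ι : Type*} [LinearOrder ι] (x y z : α) {p q : ι} (h : p < q) :
    tri x y z p q = z := by simp [tri, h.not_gt, h.ne']

theorem apply_tri {α β : Type*} {ι : Type*} [LinearOrder ι] (g : α → β) (x y z : α) (p q : ι) :
    g (tri x y z p q) = tri (g x) (g y) (g z) p q := by
  unfold tri; split_ifs <;> rfl

/-- The entries of consecutive blocks of lengths `s q + 1`, in order. -/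
def blockIdx {i n : ℕ} (s : Fin (i + 1) → ℕ) (h : ∑ q, (s q + 1) = n + 1) :
    (Σ q : Fin (i + 1), Fin (s q + 1)) ≃ Fin (n + 1) :=
  finSigmaFinEquiv.trans (finCongr h)

theorem blockStart_eq {i : ℕ} (s : Fin (i + 1) → ℕ) (q : Fin (i + 1)) :
    ∑ p : Fin q, (s (Fin.castLE q.2.le p) + 1) = blockStart s q := by
  unfold blockStart
  refine Finset.sum_bij (fun p _ => Fin.castLE q.2.le p) ?_ ?_ ?_ ?_
  · intro p _
    simp only [Finset.mem_filter, Finset.mem_univ, true_and]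
    exact p.2
  · intro p _ p' _ h
    exact Fin.castLE_injective _ h
  · intro p hp
    simp only [Finset.mem_filter, Finset.mem_univ, true_and] at hp
    exact ⟨⟨p, hp⟩, Finset.mem_univ _, rfl⟩
  · intro p _
    rfl

theorem blockIdx_val {i n : ℕ} (s : Fin (i + 1) → ℕ) (h : ∑ q, (s q + 1) = n + 1)
    (x : Σ q : Fin (i + 1), Fin (s q + 1)) :
    (blockIdx s h x : ℕ) = blockStart s x.1 + x.2 := by
  rw [← blockStart_eq]
  exact finSigmaFinEquiv_apply x

theorem blockStart_mono {i : ℕ} (s : Fin (i + 1) → ℕ) {q q' : Fin (i + 1)} (h : q < q') :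
    blockStart s q + (s q + 1) ≤ blockStart s q' := by
  unfold blockStart
  have h1 : insert q (Finset.univ.filter (fun p => p < q)) ⊆
      Finset.univ.filter (fun p => p < q') := by
    intro p hp
    simp only [Finset.mem_insert, Finset.mem_filter, Finset.mem_univ, true_and] at hp ⊢
    rcases hp with rfl | hp
    · exact h
    · exact hp.trans h
  have h2 := Finset.sum_le_sum_of_subset (f := fun p => s p + 1) h1
  rw [Finset.sum_insert (by simp)] at h2
  omega

theorem blockIdx_lt {i n : ℕ} (s : Fin (i + 1) → ℕ) (h : ∑ q, (s q + 1) = n + 1)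
    {q q' : Fin (i + 1)} (hq : q < q') (r : Fin (s q + 1)) (r' : Fin (s q' + 1)) :
    blockIdx s h ⟨q, r⟩ < blockIdx s h ⟨q', r'⟩ := by
  rw [Fin.lt_def, blockIdx_val, blockIdx_val]
  have h1 := blockStart_mono s hq
  have h2 := r.2
  dsimp only
  omega

variable {k : Type w} [Field k] {A : Type v} [AddCommGroup A] [Module k A]

/-- The composition `f (g_0 (…), …, g_i (…))` along consecutive blocks of lengths `s q + 1`. -/
def blk {i n : ℕ} (s : Fin (i + 1) → ℕ) (h : ∑ q, (s q + 1) = n + 1)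
    (f : MultilinearMap k (fun _ : Fin (i + 1) => A) A)
    (g : ∀ q, MultilinearMap k (fun _ : Fin (s q + 1) => A) A) :
    MultilinearMap k (fun _ : Fin (n + 1) => A) A :=
  (f.compMultilinearMap g).domDomCongr (blockIdx s h)

theorem blk_apply {i n : ℕ} (s : Fin (i + 1) → ℕ) (h : ∑ q, (s q + 1) = n + 1)
    (f : MultilinearMap k (fun _ : Fin (i + 1) => A) A)
    (g : ∀ q, MultilinearMap k (fun _ : Fin (s q + 1) => A) A) (a : Fin (n + 1) → A) :
    blk s h f g a = f (fun q => g q (fun r => a (blockIdx s h ⟨q, r⟩))) := rfl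

/-- The sum of the values `φ (x, …, x, y, z, …, z)` over all positions of `y`. -/
def der {n : ℕ} (φ : MultilinearMap k (fun _ : Fin (n + 1) => A) A) (x y z : A) : A :=
  ∑ p, φ (tri x y z p)

/-- The position of `y` lies in exactly one block `q`; earlier blocks are filled with `x` and later
ones with `z`. Summing over the positions inside block `q` gives `der (g q)` by linearity of `f` in
that slot. -/
theorem der_blk {i n : ℕ} (s : Fin (i + 1) → ℕ) (h : ∑ q, (s q + 1) = n + 1)
    (f : MultilinearMap k (fun _ : Fin (i + 1) => A) A)
    (g : ∀ q, MultilinearMap k (fun _ : Fin (s q + 1) => A) A) (x y z : A) :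
    der (blk s h f g) x y z = ∑ q, f (fun q' =>
      tri (g q' (fun _ => x)) (der (g q') x y z) (g q' (fun _ => z)) q q') := by
  unfold der
  rw [← (blockIdx s h).sum_comp, Fintype.sum_sigma]
  refine Finset.sum_congr rfl fun q _ => ?_
  have h1 : ∀ r : Fin (s q + 1), blk s h f g (tri x y z (blockIdx s h ⟨q, r⟩)) =
      f (Function.update (fun q' => tri (g q' (fun _ => x)) 0 (g q' (fun _ => z)) q q') q
        (g q (tri x y z r))) := by
    intro r
    rw [blk_apply]
    congr 1
    funext q'
    rcases lt_trichotomy q' q with hq | rfl | hq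
    · rw [Function.update_of_ne hq.ne, tri_lt _ _ _ hq]
      congr 1
      funext r'
      exact tri_lt _ _ _ (blockIdx_lt s h hq _ _)
    · rw [Function.update_self]
      congr 1
      funext r'
      have h2 : ∀ r r' : Fin (s q' + 1), blockIdx s h ⟨q', r⟩ < blockIdx s h ⟨q', r'⟩ ↔ r < r' := by
        intro r r'
        rw [Fin.lt_def, blockIdx_val, blockIdx_val, Fin.lt_def]
        simp
      rcases lt_trichotomy r' r with hr | rfl | hr
      · rw [tri_lt _ _ _ hr, tri_lt _ _ _ ((h2 _ _).2 hr)]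
      · rw [tri_self, tri_self]
      · rw [tri_gt _ _ _ hr, tri_gt _ _ _ ((h2 _ _).2 hr)]
    · rw [Function.update_of_ne hq.ne', tri_gt _ _ _ hq]
      congr 1
      funext r'
      exact tri_gt _ _ _ (blockIdx_lt s h hq _ _)
  rw [Finset.sum_congr rfl fun r _ => h1 r, ← f.map_update_sum]
  congr 1
  funext q'
  rcases lt_trichotomy q' q with hq | rfl | hq
  · rw [Function.update_of_ne hq.ne, tri_lt _ _ _ hq, tri_lt _ _ _ hq]
  · rw [Function.update_self, tri_self]
  · rw [Function.update_of_ne hq.ne', tri_gt _ _ _ hq, tri_gt _ _ _ hq]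

/-- The sum of the compositions of `f` with members of the families `G q` of total arity
`n + 1`. -/
def tm {i : ℕ} (f : MultilinearMap k (fun _ : Fin (i + 1) => A) A)
    (G : Fin (i + 1) → OpFamily k A A) : OpFamily k A A := fun n =>
  ∑ s ∈ Fintype.piFinset (fun _ : Fin (i + 1) => Finset.range (n + 1)),
    if h : ∑ q, (s q + 1) = n + 1 then blk s h f (fun q => G q (s q)) else 0

/-- No block is longer than the total, so a larger range adds only zeros. A range that does not
depend on `n` allows the sums over `n` and over block lengths to be exchanged. -/
theorem tm_eq_sum {i : ℕ} (f : MultilinearMap k (fun _ : Fin (i + 1) => A) A)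
    (G : Fin (i + 1) → OpFamily k A A) {n K : ℕ} (hK : n + 1 ≤ K) :
    tm f G n = ∑ s ∈ Fintype.piFinset (fun _ : Fin (i + 1) => Finset.range K),
      if h : ∑ q, (s q + 1) = n + 1 then blk s h f (fun q => G q (s q)) else 0 := by
  refine Finset.sum_subset (Fintype.piFinset_subset _ _ fun _ => Finset.range_mono hK) ?_
  intro s _ hs
  refine dif_neg fun h => hs ?_
  rw [Fintype.mem_piFinset]
  intro q
  have h1 := Finset.single_le_sum (f := fun q => s q + 1) (fun _ _ => Nat.zero_le _)
    (Finset.mem_univ q)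
  rw [h] at h1
  rw [Finset.mem_range]
  exact h1

theorem tm_eq_zero {i : ℕ} (f : MultilinearMap k (fun _ : Fin (i + 1) => A) A)
    (G : Fin (i + 1) → OpFamily k A A) {n : ℕ} (h : n < i) : tm f G n = 0 := by
  refine Finset.sum_eq_zero fun s _ => dif_neg fun hs => ?_
  have h1 : ∑ q : Fin (i + 1), 1 ≤ ∑ q, (s q + 1) := Finset.sum_le_sum fun q _ => by omega
  simp only [Finset.sum_const, Finset.card_univ, Fintype.card_fin, smul_eq_mul, mul_one] at h1
  omega

/-- The terms of the expansion of `f` on sums vanish if their arity exceeds `M`. -/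
def BlkVanish (M : ℕ) {i : ℕ} (f : MultilinearMap k (fun _ : Fin (i + 1) => A) A)
    (G : Fin (i + 1) → OpFamily k A A) : Prop :=
  ∀ (n : ℕ) (s : Fin (i + 1) → ℕ) (h : ∑ q, (s q + 1) = n + 1), M ≤ n →
    blk s h f (fun q => G q (s q)) = 0

/-- The polynomial map `x ↦ ∑_n F_n (x, …, x)`. -/
def hat (M : ℕ) (F : OpFamily k A A) (x : A) : A := ∑ n ∈ Finset.range M, F n (fun _ => x)

/-- The sum of all `F_n (x, …, x, y, z, …, z)`. -/
def hder (M : ℕ) (F : OpFamily k A A) (x y z : A) : A := ∑ n ∈ Finset.range M, der (F n) x y z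

/-- A tuple of block lengths has one total arity, so only one `n` can contribute. If that `n` is not
below `M`, the term is zero by `BlkVanish`, and so is `y`. -/
theorem sum_dite_blk {M : ℕ} {i : ℕ} (f : MultilinearMap k (fun _ : Fin (i + 1) => A) A)
    (G : Fin (i + 1) → OpFamily k A A) (hv : BlkVanish M f G) (s : Fin (i + 1) → ℕ)
    (L : ∀ n : ℕ, MultilinearMap k (fun _ : Fin (n + 1) => A) A → A) (hL : ∀ n, L n 0 = 0) (y : A)
    (hy : ∀ n (h : ∑ q, (s q + 1) = n + 1), L n (blk s h f (fun q => G q (s q))) = y) :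
    ∑ n ∈ Finset.range M, L n (if h : ∑ q, (s q + 1) = n + 1 then
      blk s h f (fun q => G q (s q)) else 0) = y := by
  obtain ⟨n, hn⟩ : ∃ n, ∑ q, (s q + 1) = n + 1 := by
    refine ⟨∑ q, (s q + 1) - 1, ?_⟩
    have h1 := Finset.single_le_sum (f := fun q => s q + 1) (fun _ _ => Nat.zero_le _)
      (Finset.mem_univ (0 : Fin (i + 1)))
    omega
  have h0 : ∀ m, m ≠ n → L m (if h : ∑ q, (s q + 1) = m + 1 then
      blk s h f (fun q => G q (s q)) else 0) = 0 := by
    intro m hm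
    rw [dif_neg (by omega), hL]
  by_cases hM : n < M
  · rw [Finset.sum_eq_single n (fun m _ hm => h0 m hm)
      (fun h => absurd (Finset.mem_range.2 hM) h), dif_pos hn, hy]
  · rw [Finset.sum_eq_zero, ← hy n hn, hv n s hn (not_lt.1 hM), hL]
    intro m hm
    exact h0 m (by rw [Finset.mem_range] at hm; omega)

/-- Expand `f` on the sums `∑ G_n(x, …, x)` by multilinearity: there is one term for each tuple of
block lengths. -/
theorem hat_tm {M : ℕ} {i : ℕ} (f : MultilinearMap k (fun _ : Fin (i + 1) => A) A)
    (G : Fin (i + 1) → OpFamily k A A) (hv : BlkVanish M f G) (x : A) :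
    hat M (tm f G) x = f (fun q => hat M (G q) x) := by
  have h1 : hat M (tm f G) x = ∑ n ∈ Finset.range M,
      ∑ s ∈ Fintype.piFinset (fun _ : Fin (i + 1) => Finset.range M),
      (if h : ∑ q, (s q + 1) = n + 1 then blk s h f (fun q => G q (s q)) else 0) (fun _ => x) := by
    refine Finset.sum_congr rfl fun n hn => ?_
    rw [tm_eq_sum f G (Nat.succ_le_of_lt (Finset.mem_range.1 hn)), sum_apply]
  rw [h1, Finset.sum_comm]
  unfold hat
  rw [MultilinearMap.map_sum_finset]
  refine Finset.sum_congr rfl fun s _ => ?_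
  exact sum_dite_blk f G hv s (fun n φ => φ (fun _ => x)) (fun n => rfl) _ (fun n h => rfl)

/-- Leibniz rule: `der_blk` for each tuple of block lengths, combined with the multilinear expansion
of `f` on sums. -/
theorem hder_tm {M : ℕ} {i : ℕ} (f : MultilinearMap k (fun _ : Fin (i + 1) => A) A)
    (G : Fin (i + 1) → OpFamily k A A) (hv : BlkVanish M f G) (x y z : A) :
    hder M (tm f G) x y z = ∑ q, f (fun q' =>
      tri (hat M (G q') x) (hder M (G q') x y z) (hat M (G q') z) q q') := by
  have hd : ∀ {n : ℕ} {ι : Type} (S : Finset ι) (φ : ι → MultilinearMap k (fun _ : Fin (n + 1) => A) A),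
      der (∑ j ∈ S, φ j) x y z = ∑ j ∈ S, der (φ j) x y z := by
    intro n ι S φ
    unfold der
    simp only [sum_apply]
    exact Finset.sum_comm
  have h1 : hder M (tm f G) x y z = ∑ n ∈ Finset.range M,
      ∑ s ∈ Fintype.piFinset (fun _ : Fin (i + 1) => Finset.range M),
      der (if h : ∑ q, (s q + 1) = n + 1 then blk s h f (fun q => G q (s q)) else 0) x y z := by
    refine Finset.sum_congr rfl fun n hn => ?_
    rw [tm_eq_sum f G (Nat.succ_le_of_lt (Finset.mem_range.1 hn)), hd]
  rw [h1, Finset.sum_comm]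
  have h2 : ∀ q q' : Fin (i + 1),
      tri (hat M (G q') x) (hder M (G q') x y z) (hat M (G q') z) q q' = ∑ n ∈ Finset.range M,
        tri (G q' n (fun _ => x)) (der (G q' n) x y z) (G q' n (fun _ => z)) q q' := by
    intro q q'
    unfold tri hat hder
    split_ifs <;> rfl
  simp only [h2]
  rw [Finset.sum_congr rfl fun q _ => f.map_sum_finset (fun q' n =>
    tri (G q' n (fun _ => x)) (der (G q' n) x y z) (G q' n (fun _ => z)) q q')
    (fun _ => Finset.range M)]
  refine Eq.trans ?_ Finset.sum_comm
  refine Finset.sum_congr rfl fun s _ => ?_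
  exact sum_dite_blk f G hv s (fun n φ => der φ x y z) (fun n => Finset.sum_eq_zero fun p _ => rfl) _
    (fun n h => der_blk s h f _ x y z)

/-- The composition `∑ f (g, …, g)` of families. -/
def compO (f g : OpFamily k A A) : OpFamily k A A := fun n =>
  ∑ i ∈ Finset.range (n + 1), tm (f i) (fun _ => g) n

/-- The sum of the compositions `f (a, …, a, y, b, …, b)` of families. -/
def dcompO (f a y b : OpFamily k A A) : OpFamily k A A := fun n =>
  ∑ i ∈ Finset.range (n + 1), ∑ l, tm (f i) (tri a y b l) n

/-- Since `tm (f i) _ n` is zero for `n < i`, the triangular double sum may be completed to a square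
and its order exchanged. -/
theorem sum_range_tm (f : OpFamily k A A) {ι : ℕ → Type} [∀ i, Fintype (ι i)]
    (G : ∀ i, ι i → Fin (i + 1) → OpFamily k A A) (M : ℕ)
    (L : ∀ n : ℕ, MultilinearMap k (fun _ : Fin (n + 1) => A) A →+ A) :
    ∑ n ∈ Finset.range M, L n (∑ i ∈ Finset.range (n + 1), ∑ l, tm (f i) (G i l) n) =
      ∑ i ∈ Finset.range M, ∑ l, ∑ n ∈ Finset.range M, L n (tm (f i) (G i l) n) := by
  have h1 : ∀ n ∈ Finset.range M,
      L n (∑ i ∈ Finset.range (n + 1), ∑ l, tm (f i) (G i l) n) =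
      ∑ i ∈ Finset.range M, ∑ l, L n (tm (f i) (G i l) n) := by
    intro n hn
    rw [map_sum]
    simp only [map_sum]
    refine Finset.sum_subset (Finset.range_mono (Finset.mem_range.1 hn)) fun i _ hi => ?_
    refine Finset.sum_eq_zero fun l _ => ?_
    rw [tm_eq_zero _ _ (by simpa using hi), map_zero]
  rw [Finset.sum_congr rfl h1, Finset.sum_comm]
  exact Finset.sum_congr rfl fun i _ => Finset.sum_comm

/-- Evaluation of multilinear maps, as a homomorphism. -/
def evalHom {n : ℕ} (a : Fin (n + 1) → A) :
    MultilinearMap k (fun _ : Fin (n + 1) => A) A →+ A where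
  toFun φ := φ a
  map_zero' := rfl
  map_add' _ _ := rfl

/-- `der`, as a homomorphism. -/
def derHom (n : ℕ) (x y z : A) : MultilinearMap k (fun _ : Fin (n + 1) => A) A →+ A where
  toFun φ := der φ x y z
  map_zero' := by simp [der]
  map_add' _ _ := by simp [der, Finset.sum_add_distrib]

theorem hat_tri (M : ℕ) (a y b : OpFamily k A A) (x : A) {i : ℕ} (l q : Fin (i + 1)) :
    hat M (tri a y b l q) x = tri (hat M a x) (hat M y x) (hat M b x) l q :=
  apply_tri (fun F => hat M F x) a y b l q

theorem hder_tri (M : ℕ) (a y b : OpFamily k A A) (x₁ x₂ x₃ : A) {i : ℕ} (l q : Fin (i + 1)) :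
    hder M (tri a y b l q) x₁ x₂ x₃ =
      tri (hder M a x₁ x₂ x₃) (hder M y x₁ x₂ x₃) (hder M b x₁ x₂ x₃) l q :=
  apply_tri (fun F => hder M F x₁ x₂ x₃) a y b l q

theorem compO_eq (f g : OpFamily k A A) (n : ℕ) : compO f g n =
    ∑ i ∈ Finset.range (n + 1), ∑ _l : Fin 1, tm (f i) (fun _ => g) n := by
  simp [compO]

theorem hat_compO {M : ℕ} (f g : OpFamily k A A) (hv : ∀ i, BlkVanish M (f i) (fun _ => g))
    (x : A) : hat M (compO f g) x = hat M f (hat M g x) := by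
  have h1 := sum_range_tm f (ι := fun _ => Fin 1) (fun i _ _ => g) M (fun n => evalHom (fun _ => x))
  refine Eq.trans ?_ (h1.trans ?_)
  · exact Finset.sum_congr rfl fun n _ => by rw [compO_eq]; rfl
  · refine Finset.sum_congr rfl fun i _ => ?_
    rw [Finset.sum_const, Finset.card_univ, Fintype.card_fin, one_smul]
    exact hat_tm (f i) _ (hv i) x

/-- Chain rule for the noncommutative derivative: one inner factor meets `y`, those to its left see
only `x` and those to its right only `z`. -/
theorem hder_compO {M : ℕ} (f g : OpFamily k A A) (hv : ∀ i, BlkVanish M (f i) (fun _ => g))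
    (x y z : A) :
    hder M (compO f g) x y z = hder M f (hat M g x) (hder M g x y z) (hat M g z) := by
  have h1 := sum_range_tm f (ι := fun _ => Fin 1) (fun i _ _ => g) M (fun n => derHom n x y z)
  refine Eq.trans ?_ (h1.trans ?_)
  · exact Finset.sum_congr rfl fun n _ => by rw [compO_eq]; rfl
  · refine Finset.sum_congr rfl fun i _ => ?_
    rw [Finset.sum_const, Finset.card_univ, Fintype.card_fin, one_smul]
    exact hder_tm (f i) _ (hv i) x y z

theorem hat_dcompO {M : ℕ} (f a y b : OpFamily k A A)
    (hv : ∀ i l, BlkVanish M (f i) (tri a y b l)) (x : A) :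
    hat M (dcompO f a y b) x = hder M f (hat M a x) (hat M y x) (hat M b x) := by
  have h1 := sum_range_tm f (fun i l => tri a y b l) M (fun n => evalHom (fun _ => x))
  refine h1.trans (Finset.sum_congr rfl fun i _ => Finset.sum_congr rfl fun l _ => ?_)
  refine (hat_tm (f i) _ (hv i l) x).trans ?_
  simp only [hat_tri]

/-- The index `l` is the slot of the inner family `y`, and `q` is the slot that is differentiated.
They are kept apart so that the terms with `l ≠ q` can later be cancelled in pairs. -/
theorem hder_dcompO {M : ℕ} (f a y b : OpFamily k A A)
    (hv : ∀ i l, BlkVanish M (f i) (tri a y b l)) (x₁ x₂ x₃ : A) :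
    hder M (dcompO f a y b) x₁ x₂ x₃ = ∑ i ∈ Finset.range M, ∑ l, ∑ q, f i (fun q' => tri
      (tri (hat M a x₁) (hat M y x₁) (hat M b x₁) l q')
      (tri (hder M a x₁ x₂ x₃) (hder M y x₁ x₂ x₃) (hder M b x₁ x₂ x₃) l q')
      (tri (hat M a x₃) (hat M y x₃) (hat M b x₃) l q') q q') := by
  have h1 := sum_range_tm f (fun i l => tri a y b l) M (fun n => derHom n x₁ x₂ x₃)
  refine h1.trans (Finset.sum_congr rfl fun i _ => Finset.sum_congr rfl fun l _ => ?_)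
  refine (hder_tm (f i) _ (hv i l) x₁ x₂ x₃).trans ?_
  simp only [hat_tri, hder_tri]

/-- The terms of the second derivative cancel. -/
theorem hder_dcompO_self {M : ℕ} (f a y b : OpFamily k A A)
    (hv : ∀ i l, BlkVanish M (f i) (tri a y b l)) (T : A →ₗ[k] A) (hT : ∀ x, T (T x) = x)
    (ha : ∀ x, hat M a x = T x) (ha' : ∀ x₁ x₂ x₃, hder M a x₁ x₂ x₃ = T x₂)
    (hb : ∀ x, hat M b x = x) (hb' : ∀ x₁ x₂ x₃, hder M b x₁ x₂ x₃ = x₂)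
    (hy : ∀ x, hat M y (T x) = - T (hat M y x)) (x : A) :
    hder M (dcompO f a y b) (T x) (hat M y x) x =
      hder M f x (hder M y (T x) (hat M y x) x) x := by
  rw [hder_dcompO f a y b hv]
  refine Finset.sum_congr rfl fun i _ => ?_
  simp only [ha, ha', hb, hb', hT, hy]
  set z := hat M y x
  set c := hder M y (T x) z x
  set t : Fin (i + 1) → Fin (i + 1) → A := fun l q => f i (fun q' => tri
      (tri x (-T z) (T x) l q') (tri (T z) c z l q') (tri (T x) z x l q') q q') with ht
  -- Both terms have `x` before slot `l`, `T x` between the slots, `z` in slot `q` and `x` after it.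
  -- Slot `l` holds `-T z` in the first and `T z` in the second; the minus sign comes from `hy`.
  have key : ∀ l q, l < q → t l q = - t q l := by
    intro l q hlq
    simp only [ht]
    set g : Fin (i + 1) → A := fun q' => tri
      (tri x (-T z) (T x) q q') (tri (T z) c z q q') (tri (T x) z x q q') l q' with hg
    have h1 : (fun q' => tri
      (tri x (-T z) (T x) l q') (tri (T z) c z l q') (tri (T x) z x l q') q q') =
        Function.update g l (- g l) := by
      funext q'
      rcases lt_trichotomy q' l with h | rfl | h
      · have h2 := h.trans hlq
        rw [Function.update_of_ne h.ne]
        simp only [hg]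
        rw [tri_lt _ _ _ h2, tri_lt _ _ _ h, tri_lt _ _ _ h, tri_lt _ _ _ h2]
      · rw [Function.update_self]
        simp only [hg]
        rw [tri_lt _ _ _ hlq, tri_self, tri_self, tri_lt _ _ _ hlq]
      · rw [Function.update_of_ne h.ne']
        simp only [hg]
        rw [tri_gt (ι := Fin (i + 1)) _ _ _ h, tri_gt (ι := Fin (i + 1)) _ _ _ h,
          tri_gt (ι := Fin (i + 1)) _ _ _ h, tri_gt (ι := Fin (i + 1)) _ _ _ h]
    rw [h1, (f i).map_update_neg, Function.update_eq_self]
  have hsum : ∑ l, ∑ q, t l q = ∑ l, t l l := by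
    have h2 : ∀ l, ∑ q, t l q = t l l + (∑ q, (if l < q then t l q else 0) +
        ∑ q, (if q < l then t l q else 0)) := by
      intro l
      have h4 : t l l = ∑ q, if l = q then t l q else 0 := by simp
      rw [h4, ← Finset.sum_add_distrib, ← Finset.sum_add_distrib]
      refine Finset.sum_congr rfl fun q _ => ?_
      rcases lt_trichotomy l q with h | h | h
      · simp [h, h.ne, h.not_gt]
      · simp [h]
      · simp [h, h.ne', h.not_gt]
    rw [Finset.sum_congr rfl fun l _ => h2 l, Finset.sum_add_distrib, Finset.sum_add_distrib]
    have h3 : ∑ l, ∑ q, (if l < q then t l q else 0) = - ∑ l, ∑ q, (if q < l then t l q else 0) := by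
      rw [Finset.sum_comm, ← Finset.sum_neg_distrib]
      refine Finset.sum_congr rfl fun l _ => ?_
      rw [← Finset.sum_neg_distrib]
      refine Finset.sum_congr rfl fun q _ => ?_
      split_ifs with h
      · exact key q l h
      · rw [neg_zero]
    rw [h3, neg_add_cancel, add_zero]
  -- On the diagonal `T (T x) = x` turns the arguments into `x, …, x, c, x, …, x`.
  rw [hsum]
  unfold der
  refine Finset.sum_congr rfl fun l _ => ?_
  simp only [ht]
  congr 1
  funext q'
  rcases lt_trichotomy q' l with h | rfl | h
  · rw [tri_lt _ _ _ h, tri_lt _ _ _ h, tri_lt _ _ _ h]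
  · rw [tri_self, tri_self, tri_self]
  · rw [tri_gt _ _ _ h, tri_gt _ _ _ h, tri_gt _ _ _ h]

end Blocks
end
end AInf

namespace AInf
noncomputable section

/-! ### Cochains on a quiver and the induced operations -/

section Cochains

variable {k : Type w} [Field k] {N : ℕ} {Ob : Type u}

/-- `Coch` takes a proof of transversality as an argument; through this instance functions of such
proofs, and hence cochains, form an additive group. -/
instance propPiAddCommGroup {P : Prop} {G : P → Type*} [∀ h, AddCommGroup (G h)] :
    AddCommGroup (∀ h, G h) :=
  letI : Add (∀ h, G h) := ⟨fun f g h => f h + g h⟩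
  letI : Zero (∀ h, G h) := ⟨fun _ => 0⟩
  letI : Neg (∀ h, G h) := ⟨fun f h => - f h⟩
  letI : SMul ℕ (∀ h, G h) := ⟨fun n f h => n • f h⟩
  letI : SMul ℤ (∀ h, G h) := ⟨fun n f h => n • f h⟩
  letI : Sub (∀ h, G h) := ⟨fun f g h => f h - g h⟩
  { add_assoc := fun _ _ _ => funext fun _ => add_assoc _ _ _
    zero_add := fun _ => funext fun _ => zero_add _
    add_zero := fun _ => funext fun _ => add_zero _
    neg_add_cancel := fun _ => funext fun _ => neg_add_cancel _
    add_comm := fun _ _ => funext fun _ => add_comm _ _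
    sub_eq_add_neg := fun _ _ => funext fun _ => sub_eq_add_neg _ _
    nsmul := fun n f => n • f
    nsmul_zero := fun _ => funext fun _ => AddMonoid.nsmul_zero _
    nsmul_succ := fun _ _ => funext fun _ => AddMonoid.nsmul_succ _ _
    zsmul := fun n f => n • f
    zsmul_zero' := fun _ => funext fun _ => SubNegMonoid.zsmul_zero' _
    zsmul_succ' := fun _ _ => funext fun _ => SubNegMonoid.zsmul_succ' _ _
    zsmul_neg' := fun _ _ => funext fun _ => SubNegMonoid.zsmul_neg' _ _ }

/-- Ungraded collections of multilinear maps on transversal sequences. -/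
abbrev Coch (Q : TransversalQuiver.{w, u, v} k N Ob) :=
  ∀ (n : ℕ) (X : Fin (n + 2) → Ob), Q.Tr X →
    MultilinearMap k (fun p : Fin (n + 1) => Q.Hom (X p.castSucc) (X p.succ))
      (Q.Hom (X 0) (X (Fin.last (n + 1))))

/-- Pairs `i < j` of positions. -/
abbrev Pr (M : ℕ) := {q : Fin (M + 1) × Fin (M + 1) // q.1 < q.2}

/-- The pair `(i p, i (p + 1))`. -/
abbrev chainPr {M n : ℕ} (i : Fin (n + 2) ↪o Fin (M + 1)) (p : Fin (n + 1)) : Pr M :=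
  ⟨(i p.castSucc, i p.succ), i.strictMono p.castSucc_lt_succ⟩

/-- The pair `(i 0, i (n + 1))`. -/
abbrev endPr {M n : ℕ} (i : Fin (n + 2) ↪o Fin (M + 1)) : Pr M :=
  ⟨(i 0, i (Fin.last (n + 1))), i.strictMono Fin.last_pos⟩

variable {Q : TransversalQuiver.{w, u, v} k N Ob}

/-- The inclusion of a summand of `⨁_{i < j} Hom (X i) (X j)`. -/
abbrev sgl {M : ℕ} (X : Fin (M + 1) → Ob) (q : Pr M) :
    Q.Hom (X q.1.1) (X q.1.2) →ₗ[k] Q.SeqHom X :=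
  LinearMap.single k (fun q : Pr M => Q.Hom (X q.1.1) (X q.1.2)) q

theorem sgl_same {M : ℕ} (X : Fin (M + 1) → Ob) (q : Pr M) (x : Q.Hom (X q.1.1) (X q.1.2)) :
    sgl (Q := Q) X q x q = x := Pi.single_eq_same _ _

theorem sgl_ne {M : ℕ} (X : Fin (M + 1) → Ob) {q r : Pr M} (h : r ≠ q)
    (x : Q.Hom (X q.1.1) (X q.1.2)) : sgl (Q := Q) X q x r = 0 := Pi.single_eq_of_ne h _

theorem sum_sgl {M : ℕ} (X : Fin (M + 1) → Ob) (x : Q.SeqHom X) :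
    ∑ q, sgl X q (x q) = x := by
  funext r
  rw [Finset.sum_apply, Finset.sum_eq_single r (fun q _ hq => sgl_ne X hq.symm _) (by simp),
    sgl_same]

/-- The operations induced on `⨁_{i < j} Hom (X i) (X j)`. -/
def Coch.tot (F : Coch Q) {M : ℕ} (X : Fin (M + 1) → Ob) (hX : Q.Tr X) :
    OpFamily k (Q.SeqHom X) (Q.SeqHom X) := fun n =>
  ∑ i : Fin (n + 2) ↪o Fin (M + 1),
    (sgl X (endPr i)).compMultilinearMap
      ((F n (X ∘ i) (Q.tr_sub hX i)).compLinearMap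
        (fun p : Fin (n + 1) => LinearMap.proj
          (R := k) (φ := fun q : Pr M => Q.Hom (X q.1.1) (X q.1.2)) (chainPr i p)))

theorem Coch.tot_apply (F : Coch Q) {M : ℕ} (X : Fin (M + 1) → Ob) (hX : Q.Tr X) (n : ℕ)
    (a : Fin (n + 1) → Q.SeqHom X) :
    F.tot X hX n a = ∑ i : Fin (n + 2) ↪o Fin (M + 1),
      sgl X (endPr i) (F n (X ∘ i) (Q.tr_sub hX i) (fun p => a p (chainPr i p))) := by
  unfold Coch.tot
  rw [sum_apply]
  rfl

/-- `x` is supported on the pairs that start at `j`. -/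
def Lsupp {M : ℕ} {X : Fin (M + 1) → Ob} (j : Fin (M + 1)) (x : Q.SeqHom X) : Prop :=
  ∀ r : Pr M, r.1.1 ≠ j → x r = 0

/-- `x` is supported on the pairs that end at `j`. -/
def Rsupp {M : ℕ} {X : Fin (M + 1) → Ob} (j : Fin (M + 1)) (x : Q.SeqHom X) : Prop :=
  ∀ r : Pr M, r.1.2 ≠ j → x r = 0

theorem Lsupp_sgl {M : ℕ} (X : Fin (M + 1) → Ob) (q : Pr M) (x : Q.Hom (X q.1.1) (X q.1.2)) :
    Lsupp (Q := Q) q.1.1 (sgl X q x) :=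
  fun r hr => sgl_ne X (fun h => hr (by rw [h])) x

theorem Rsupp_sgl {M : ℕ} (X : Fin (M + 1) → Ob) (q : Pr M) (x : Q.Hom (X q.1.1) (X q.1.2)) :
    Rsupp (Q := Q) q.1.2 (sgl X q x) :=
  fun r hr => sgl_ne X (fun h => hr (by rw [h])) x

/-- `φ` vanishes if two adjacent entries cannot be composed. -/
def Mid {M : ℕ} {X : Fin (M + 1) → Ob} {B : Type*} [AddCommGroup B] [Module k B] {n : ℕ}
    (φ : MultilinearMap k (fun _ : Fin (n + 1) => Q.SeqHom X) B) : Prop :=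
  ∀ (a : Fin (n + 1) → Q.SeqHom X) (p p' : Fin (n + 1)), (p' : ℕ) = p + 1 →
    ∀ j j', Rsupp j (a p) → Lsupp j' (a p') → j ≠ j' → φ a = 0

/-- `φ` is supported on composable sequences. -/
structure Pathy {M : ℕ} {X : Fin (M + 1) → Ob} {n : ℕ}
    (φ : MultilinearMap k (fun _ : Fin (n + 1) => Q.SeqHom X) (Q.SeqHom X)) : Prop where
  left : ∀ (a : Fin (n + 1) → Q.SeqHom X) j, Lsupp j (a 0) → Lsupp j (φ a)
  right : ∀ (a : Fin (n + 1) → Q.SeqHom X) j, Rsupp j (a (Fin.last n)) → Rsupp j (φ a)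
  mid : Mid φ

/-- Pairs whose ends match glue to one list of positions, which increases strictly because every
pair does. -/
theorem exists_chain {M n : ℕ} (r : Fin (n + 1) → Pr M)
    (h : ∀ p p' : Fin (n + 1), (p' : ℕ) = p + 1 → (r p).1.2 = (r p').1.1) :
    ∃ i : Fin (n + 2) ↪o Fin (M + 1), r = chainPr i := by
  let f : Fin (n + 2) → Fin (M + 1) := Fin.cons (r 0).1.1 (fun p => (r p).1.2)
  have h1 : ∀ p : Fin (n + 1), f p.succ = (r p).1.2 := fun p => rfl
  have h2 : ∀ p : Fin (n + 1), f p.castSucc = (r p).1.1 := by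
    intro p
    obtain ⟨p, hp⟩ := p
    cases p with
    | zero => rfl
    | succ p => exact h ⟨p, by omega⟩ ⟨p + 1, hp⟩ rfl
  have hf : StrictMono f := by
    rw [Fin.strictMono_iff_lt_succ]
    intro p
    rw [h1, h2]
    exact (r p).2
  refine ⟨OrderEmbedding.ofStrictMono f hf, ?_⟩
  funext p
  refine Subtype.ext (Prod.ext ?_ ?_)
  · exact (h2 p).symm
  · exact (h1 p).symm

/-- Expand in the summands of `⨁_{i < j} Hom (X i) (X j)`. Tuples of pairs that do not match up are
killed by both maps, and the remaining ones are chains by `exists_chain`. -/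
theorem Mid.ext {M : ℕ} {X : Fin (M + 1) → Ob} {B : Type*} [AddCommGroup B] [Module k B] {n : ℕ}
    {φ ψ : MultilinearMap k (fun _ : Fin (n + 1) => Q.SeqHom X) B} (hφ : Mid φ) (hψ : Mid ψ)
    (h : ∀ (i : Fin (n + 2) ↪o Fin (M + 1))
      (c : ∀ p : Fin (n + 1), Q.Hom (X (i p.castSucc)) (X (i p.succ))),
      φ (fun p => sgl X (chainPr i p) (c p)) = ψ (fun p => sgl X (chainPr i p) (c p))) :
    φ = ψ := by
  refine MultilinearMap.ext fun a => ?_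
  have ha : a = fun p => ∑ q, sgl X q (a p q) := by
    funext p
    exact (sum_sgl X (a p)).symm
  rw [ha, φ.map_sum, ψ.map_sum]
  refine Finset.sum_congr rfl fun r _ => ?_
  by_cases hr : ∀ p p' : Fin (n + 1), (p' : ℕ) = p + 1 → (r p).1.2 = (r p').1.1
  · obtain ⟨i, rfl⟩ := exists_chain r hr
    exact h i (fun p => a p (chainPr i p))
  · push Not at hr
    obtain ⟨p, p', hp, hne⟩ := hr
    rw [hφ _ p p' hp _ _ (Rsupp_sgl X _ _) (Lsupp_sgl X _ _) hne,
      hψ _ p p' hp _ _ (Rsupp_sgl X _ _) (Lsupp_sgl X _ _) hne]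

theorem Mid.zero {M : ℕ} {X : Fin (M + 1) → Ob} {B : Type*} [AddCommGroup B] [Module k B] {n : ℕ} :
    Mid (0 : MultilinearMap k (fun _ : Fin (n + 1) => Q.SeqHom X) B) :=
  fun _ _ _ _ _ _ _ _ _ => rfl

/-- For `M ≤ n` there is no increasing chain of `n + 2` positions among `M + 1`. This is the source
of all finiteness below: `M` bounds the polynomial maps and yields `BlkVanish`. -/
theorem Pathy.eq_zero {M : ℕ} {X : Fin (M + 1) → Ob} {n : ℕ}
    {φ : MultilinearMap k (fun _ : Fin (n + 1) => Q.SeqHom X) (Q.SeqHom X)} (hφ : Pathy φ)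
    (h : M ≤ n) : φ = 0 := by
  refine hφ.mid.ext Mid.zero fun i _ => ?_
  have h1 := Fintype.card_le_of_injective i i.injective
  simp only [Fintype.card_fin] at h1
  omega

theorem Pathy.zero {M : ℕ} {X : Fin (M + 1) → Ob} {n : ℕ} :
    Pathy (0 : MultilinearMap k (fun _ : Fin (n + 1) => Q.SeqHom X) (Q.SeqHom X)) :=
  ⟨fun _ _ _ _ _ => rfl, fun _ _ _ _ _ => rfl, Mid.zero⟩

theorem Pathy.sum {M : ℕ} {X : Fin (M + 1) → Ob} {n : ℕ} {ι : Type*} (S : Finset ι)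
    {φ : ι → MultilinearMap k (fun _ : Fin (n + 1) => Q.SeqHom X) (Q.SeqHom X)}
    (h : ∀ j ∈ S, Pathy (φ j)) : Pathy (∑ j ∈ S, φ j) := by
  refine ⟨fun a j ha r hr => ?_, fun a j ha r hr => ?_, fun a p p' hp j j' h1 h2 h3 => ?_⟩
  · rw [sum_apply, Finset.sum_apply]
    exact Finset.sum_eq_zero fun t ht => (h t ht).left a j ha r hr
  · rw [sum_apply, Finset.sum_apply]
    exact Finset.sum_eq_zero fun t ht => (h t ht).right a j ha r hr
  · rw [sum_apply]
    exact Finset.sum_eq_zero fun t ht => (h t ht).mid a p p' hp j j' h1 h2 h3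

/-- Two adjacent entries that cannot be composed either lie in one block, where `g` kills them, or
are the last and first entries of consecutive blocks; then the two outputs inherit the mismatch and
`f` kills them. The outer supports pass through the first and last block. -/
theorem Pathy.blk {M : ℕ} {X : Fin (M + 1) → Ob} {i n : ℕ} (s : Fin (i + 1) → ℕ)
    (h : ∑ q, (s q + 1) = n + 1)
    {f : MultilinearMap k (fun _ : Fin (i + 1) => Q.SeqHom X) (Q.SeqHom X)}
    {g : ∀ q, MultilinearMap k (fun _ : Fin (s q + 1) => Q.SeqHom X) (Q.SeqHom X)}
    (hf : Pathy f) (hg : ∀ q, Pathy (g q)) : Pathy (blk s h f g) := by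
  refine ⟨fun a j ha => ?_, fun a j ha => ?_, fun a p p' hp j j' h1 h2 h3 => ?_⟩
  · rw [blk_apply]
    refine hf.left _ j ((hg 0).left _ j ?_)
    have h0 : AInf.blockIdx s h ⟨0, 0⟩ = 0 := by
      refine Fin.ext ?_
      rw [blockIdx_val]
      simp [blockStart]
    rw [h0]
    exact ha
  · rw [blk_apply]
    refine hf.right _ j ((hg (Fin.last i)).right _ j ?_)
    have h0 : AInf.blockIdx s h ⟨Fin.last i, Fin.last _⟩ = Fin.last n := by
      obtain ⟨⟨q, r⟩, hx⟩ := (AInf.blockIdx s h).surjective (Fin.last n)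
      have hq : q = Fin.last i := by
        by_contra hne
        have h4 := blockIdx_lt s h (Fin.lt_last_iff_ne_last.2 hne) r 0
        rw [hx] at h4
        exact absurd h4 (Fin.le_last _).not_gt
      subst hq
      have h5 : (AInf.blockIdx s h ⟨Fin.last i, r⟩ : ℕ) = n := by rw [hx]; rfl
      rw [blockIdx_val] at h5
      have h6 := (AInf.blockIdx s h ⟨Fin.last i, Fin.last _⟩).2
      refine Fin.ext ?_
      rw [blockIdx_val] at h6 ⊢
      have h7 := r.2
      simp only [Fin.val_last] at h6 ⊢
      dsimp only at h5
      omega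
    rw [h0]
    exact ha
  · rw [blk_apply]
    obtain ⟨⟨q, r⟩, rfl⟩ := (AInf.blockIdx s h).surjective p
    obtain ⟨⟨q', r'⟩, rfl⟩ := (AInf.blockIdx s h).surjective p'
    have hv := hp
    rw [blockIdx_val, blockIdx_val] at hv
    dsimp only at hv
    have hr := r.2
    have hr' := r'.2
    rcases lt_trichotomy q' q with hq | rfl | hq
    · have := blockIdx_lt s h hq r' r
      rw [Fin.lt_def] at this
      omega
    · refine f.map_coord_zero q' ((hg q').mid _ r r' (by omega) j j' h1 h2 h3)
    · have hm := blockStart_mono s hq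
      have hlast : r = Fin.last (s q) := Fin.ext (by rw [Fin.val_last]; omega)
      have hzero : r' = 0 := Fin.ext (by rw [Fin.val_zero]; omega)
      subst hlast hzero
      have hqq : (q' : ℕ) = q + 1 := by
        by_contra hne
        have hlt : (q : ℕ) + 1 < q' := by
          rw [Fin.lt_def] at hq
          omega
        have hb : (q : ℕ) + 1 < i + 1 := hlt.trans q'.2
        have h4 := blockIdx_lt s h (q := q) (q' := ⟨q + 1, hb⟩)
          (Fin.lt_def.2 (Nat.lt_succ_self _)) (Fin.last _) 0
        have h5 := blockIdx_lt s h (q := ⟨q + 1, hb⟩) (q' := q') (Fin.lt_def.2 hlt) 0 0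
        rw [Fin.lt_def] at h4 h5
        omega
      exact hf.mid _ q q' hqq j j' ((hg q).right _ j h1) ((hg q').left _ j' h2) h3

theorem Pathy.tm {M : ℕ} {X : Fin (M + 1) → Ob} {i : ℕ}
    {f : MultilinearMap k (fun _ : Fin (i + 1) => Q.SeqHom X) (Q.SeqHom X)}
    {G : Fin (i + 1) → OpFamily k (Q.SeqHom X) (Q.SeqHom X)}
    (hf : Pathy f) (hG : ∀ q n, Pathy (G q n)) (n : ℕ) : Pathy (tm f G n) := by
  refine Pathy.sum _ fun s _ => ?_
  split_ifs with h
  · exact Pathy.blk s h hf fun q => hG q _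
  · exact Pathy.zero

theorem Pathy.tri {M : ℕ} {X : Fin (M + 1) → Ob} {i : ℕ}
    {a y b : OpFamily k (Q.SeqHom X) (Q.SeqHom X)} (ha : ∀ n, Pathy (a n)) (hy : ∀ n, Pathy (y n))
    (hb : ∀ n, Pathy (b n)) (l q : Fin (i + 1)) (n : ℕ) : Pathy (tri a y b l q n) := by
  unfold AInf.tri
  split_ifs
  exacts [ha n, hy n, hb n]

theorem Pathy.compO {M : ℕ} {X : Fin (M + 1) → Ob} {f g : OpFamily k (Q.SeqHom X) (Q.SeqHom X)}
    (hf : ∀ n, Pathy (f n)) (hg : ∀ n, Pathy (g n)) (n : ℕ) : Pathy (compO f g n) :=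
  Pathy.sum _ fun i _ => Pathy.tm (hf i) (fun _ => hg) n

theorem Pathy.dcompO {M : ℕ} {X : Fin (M + 1) → Ob}
    {f a y b : OpFamily k (Q.SeqHom X) (Q.SeqHom X)} (hf : ∀ n, Pathy (f n))
    (ha : ∀ n, Pathy (a n)) (hy : ∀ n, Pathy (y n)) (hb : ∀ n, Pathy (b n)) (n : ℕ) :
    Pathy (dcompO f a y b n) :=
  Pathy.sum _ fun i _ => Pathy.sum _ fun l _ => Pathy.tm (hf i) (Pathy.tri ha hy hb l) n

theorem Pathy.blkVanish {M : ℕ} {X : Fin (M + 1) → Ob} {i : ℕ}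
    {f : MultilinearMap k (fun _ : Fin (i + 1) => Q.SeqHom X) (Q.SeqHom X)}
    {G : Fin (i + 1) → OpFamily k (Q.SeqHom X) (Q.SeqHom X)}
    (hf : Pathy f) (hG : ∀ q n, Pathy (G q n)) : BlkVanish M f G :=
  fun _ s h hn => (Pathy.blk s h hf fun q => hG q _).eq_zero hn

/-! #### Naturality for subsequences -/

/-- The pair `(i q_1, i q_2)`. -/
abbrev mapPr {M m : ℕ} (i : Fin (m + 1) ↪o Fin (M + 1)) (q : Pr m) : Pr M :=
  ⟨(i q.1.1, i q.1.2), i.strictMono q.2⟩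

/-- Extension by zero from a subsequence. -/
def incl {M m : ℕ} (X : Fin (M + 1) → Ob) (i : Fin (m + 1) ↪o Fin (M + 1)) :
    Q.SeqHom (X ∘ i) →ₗ[k] Q.SeqHom X :=
  ∑ q : Pr m, (sgl X (mapPr i q)).comp
    (LinearMap.proj (R := k) (φ := fun q : Pr m => Q.Hom (X (i q.1.1)) (X (i q.1.2))) q)

theorem incl_apply {M m : ℕ} (X : Fin (M + 1) → Ob) (i : Fin (m + 1) ↪o Fin (M + 1))
    (x : Q.SeqHom (X ∘ i)) : incl X i x = ∑ q : Pr m, sgl X (mapPr i q) (x q) := by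
  unfold incl
  rw [LinearMap.sum_apply]
  rfl

theorem incl_sgl {M m : ℕ} (X : Fin (M + 1) → Ob) (i : Fin (m + 1) ↪o Fin (M + 1)) (q : Pr m)
    (x : Q.Hom (X (i q.1.1)) (X (i q.1.2))) :
    incl X i (sgl (Q := Q) (X ∘ i) q x) = sgl X (mapPr i q) x := by
  rw [incl_apply, Finset.sum_eq_single q]
  · rw [sgl_same]
  · intro r _ hr
    rw [sgl_ne _ hr, map_zero]
  · simp

theorem Lsupp.incl {M m : ℕ} {X : Fin (M + 1) → Ob} (i : Fin (m + 1) ↪o Fin (M + 1))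
    {x : Q.SeqHom (X ∘ i)} {j : Fin (m + 1)} (h : Lsupp j x) : Lsupp (i j) (incl X i x) := by
  intro r hr
  rw [incl_apply, Finset.sum_apply]
  refine Finset.sum_eq_zero fun q _ => ?_
  by_cases hq : q.1.1 = j
  · refine sgl_ne X (fun h => hr ?_) _
    rw [h, ← hq]
  · rw [h q hq, map_zero]
    rfl

theorem Rsupp.incl {M m : ℕ} {X : Fin (M + 1) → Ob} (i : Fin (m + 1) ↪o Fin (M + 1))
    {x : Q.SeqHom (X ∘ i)} {j : Fin (m + 1)} (h : Rsupp j x) : Rsupp (i j) (incl X i x) := by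
  intro r hr
  rw [incl_apply, Finset.sum_apply]
  refine Finset.sum_eq_zero fun q _ => ?_
  by_cases hq : q.1.2 = j
  · refine sgl_ne X (fun h => hr ?_) _
    rw [h, ← hq]
  · rw [h q hq, map_zero]
    rfl

theorem Coch.tot_chain (F : Coch Q) {M n : ℕ} (X : Fin (M + 1) → Ob) (hX : Q.Tr X)
    (i : Fin (n + 2) ↪o Fin (M + 1))
    (c : ∀ p : Fin (n + 1), Q.Hom (X (i p.castSucc)) (X (i p.succ))) :
    F.tot X hX n (fun p => sgl X (chainPr i p) (c p)) =
      sgl X (endPr i) (F n (X ∘ i) (Q.tr_sub hX i) c) := by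
  rw [F.tot_apply, Finset.sum_eq_single i]
  · congr 2
    funext p
    exact sgl_same X _ _
  · intro j _ hj
    obtain ⟨p, hp⟩ : ∃ p : Fin (n + 1), chainPr j p ≠ chainPr i p := by
      by_contra hcon
      push Not at hcon
      refine hj (RelEmbedding.ext fun t => ?_)
      have h1 : ∀ p : Fin (n + 1), j p.castSucc = i p.castSucc := fun p =>
        congrArg (fun q : Pr M => q.1.1) (hcon p)
      have h2 : ∀ p : Fin (n + 1), j p.succ = i p.succ := fun p =>
        congrArg (fun q : Pr M => q.1.2) (hcon p)
      cases t using Fin.cases with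
      | zero => exact h1 0
      | succ t => exact h2 t
    have h1 := (F n (X ∘ j) (Q.tr_sub hX j)).map_coord_zero
      (m := fun p => sgl (Q := Q) X (chainPr i p) (c p) (chainPr j p)) p (sgl_ne X hp _)
    rw [h1, map_zero]
  · simp

theorem Coch.tot_pathy (F : Coch Q) {M : ℕ} (X : Fin (M + 1) → Ob) (hX : Q.Tr X) (n : ℕ) :
    Pathy (F.tot X hX n) := by
  refine ⟨fun a j ha r hr => ?_, fun a j ha r hr => ?_, fun a p p' hp j j' h1 h2 h3 => ?_⟩
  · rw [F.tot_apply, Finset.sum_apply]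
    refine Finset.sum_eq_zero fun i _ => ?_
    by_cases hi : i 0 = j
    · exact sgl_ne X (fun h => hr (by rw [h, ← hi])) _
    · have h1 := (F n (X ∘ i) (Q.tr_sub hX i)).map_coord_zero
        (m := fun p => a p (chainPr i p)) 0 (ha _ hi)
      rw [h1, map_zero]
      rfl
  · rw [F.tot_apply, Finset.sum_apply]
    refine Finset.sum_eq_zero fun i _ => ?_
    by_cases hi : i (Fin.last (n + 1)) = j
    · exact sgl_ne X (fun h => hr (by rw [h, ← hi])) _
    · have h1 := (F n (X ∘ i) (Q.tr_sub hX i)).map_coord_zero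
        (m := fun p => a p (chainPr i p)) (Fin.last n) (ha _ hi)
      rw [h1, map_zero]
      rfl
  · rw [F.tot_apply]
    refine Finset.sum_eq_zero fun i _ => ?_
    by_cases hi : i p.succ = j
    · have hpp : p'.castSucc = p.succ := Fin.ext (by simpa using hp)
      have h4 := (F n (X ∘ i) (Q.tr_sub hX i)).map_coord_zero
        (m := fun p => a p (chainPr i p)) p' (h2 _ (by
          show i p'.castSucc ≠ j'
          rw [hpp, hi]
          exact h3))
      rw [h4, map_zero]
    · have h4 := (F n (X ∘ i) (Q.tr_sub hX i)).map_coord_zero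
        (m := fun p => a p (chainPr i p)) p (h1 _ hi)
      rw [h4, map_zero]

/-- By `Mid.ext` it suffices to compare on chains, and a chain in the subsequence is a chain in the
whole sequence through the same objects. -/
theorem Coch.tot_incl (F : Coch Q) {M m : ℕ} (X : Fin (M + 1) → Ob) (hX : Q.Tr X)
    (i : Fin (m + 1) ↪o Fin (M + 1)) (n : ℕ) (a : Fin (n + 1) → Q.SeqHom (X ∘ i)) :
    F.tot X hX n (fun p => incl X i (a p)) =
      incl X i (F.tot (X ∘ i) (Q.tr_sub hX i) n a) := by
  suffices H : (F.tot X hX n).compLinearMap (fun _ => incl X i) =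
      (incl X i).compMultilinearMap (F.tot (X ∘ i) (Q.tr_sub hX i) n) from
    DFunLike.congr_fun H a
  refine Mid.ext (X := X ∘ i) ?_ ?_ ?_
  · intro a p p' hp j j' h1 h2 h3
    exact (F.tot_pathy X hX n).mid _ p p' hp _ _ (h1.incl i) (h2.incl i)
      (fun h => h3 (i.injective h))
  · intro a p p' hp j j' h1 h2 h3
    rw [LinearMap.compMultilinearMap_apply,
      (F.tot_pathy (X ∘ i) (Q.tr_sub hX i) n).mid _ p p' hp _ _ h1 h2 h3, map_zero]
  · intro j c
    rw [LinearMap.compMultilinearMap_apply, F.tot_chain, incl_sgl,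
      MultilinearMap.compLinearMap_apply]
    have h1 := F.tot_chain X hX (j.trans i) c
    refine Eq.trans ?_ h1
    congr 1
    funext p
    exact incl_sgl X i _ _

/-- A family of operations that comes from a cochain. -/
structure IsTot (Φ : ∀ {M : ℕ} (X : Fin (M + 1) → Ob), Q.Tr X →
    OpFamily k (Q.SeqHom X) (Q.SeqHom X)) : Prop where
  pathy : ∀ {M : ℕ} (X : Fin (M + 1) → Ob) (hX : Q.Tr X) (n : ℕ), Pathy (Φ X hX n)
  nat : ∀ {M m : ℕ} (X : Fin (M + 1) → Ob) (hX : Q.Tr X) (i : Fin (m + 1) ↪o Fin (M + 1)) (n : ℕ)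
    (a : Fin (n + 1) → Q.SeqHom (X ∘ i)),
    Φ X hX n (fun p => incl X i (a p)) = incl X i (Φ (X ∘ i) (Q.tr_sub hX i) n a)

/-- The pair of adjacent positions `(p, p + 1)`. -/
abbrev supPr {n : ℕ} (p : Fin (n + 1)) : Pr (n + 1) := ⟨(p.castSucc, p.succ), p.castSucc_lt_succ⟩

/-- The pair of the first and the last position. -/
abbrev topPr (n : ℕ) : Pr (n + 1) := ⟨(0, Fin.last (n + 1)), Fin.last_pos⟩

/-- The cochain that corresponds to a family of operations. -/
def toCoch (Φ : ∀ {M : ℕ} (X : Fin (M + 1) → Ob), Q.Tr X →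
    OpFamily k (Q.SeqHom X) (Q.SeqHom X)) : Coch Q := fun n X hX =>
  (LinearMap.proj (R := k) (φ := fun q : Pr (n + 1) => Q.Hom (X q.1.1) (X q.1.2))
    (topPr n)).compMultilinearMap ((Φ X hX n).compLinearMap (fun p => sgl X (supPr p)))

theorem eq_sgl_top {n : ℕ} {X : Fin (n + 2) → Ob} {y : Q.SeqHom X} (h1 : Lsupp 0 y)
    (h2 : Rsupp (Fin.last (n + 1)) y) : y = sgl X (topPr n) (y (topPr n)) := by
  funext r
  by_cases h : r = topPr n
  · subst h
    rw [sgl_same]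
  · rw [sgl_ne X h]
    by_cases h3 : r.1.1 = 0
    · refine h2 r fun h4 => h ?_
      exact Subtype.ext (Prod.ext h3 h4)
    · exact h1 r h3

/-- By `Mid.ext` chains suffice. Naturality moves a chain to its own subsequence, where the supports
of the first and last entries leave only the top summand (`eq_sgl_top`), which is what `toCoch`
records. -/
theorem IsTot.tot_toCoch {Φ : ∀ {M : ℕ} (X : Fin (M + 1) → Ob), Q.Tr X →
    OpFamily k (Q.SeqHom X) (Q.SeqHom X)} (h : IsTot Φ) {M : ℕ} (X : Fin (M + 1) → Ob)
    (hX : Q.Tr X) : (toCoch Φ).tot X hX = Φ X hX := by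
  funext n
  refine Mid.ext ((toCoch Φ).tot_pathy X hX n).mid (h.pathy X hX n).mid fun i c => ?_
  rw [Coch.tot_chain]
  have h1 := h.nat X hX i n (fun p => sgl (X ∘ i) (supPr p) (c p))
  have h2 : (fun p => incl X i (sgl (Q := Q) (X ∘ i) (supPr p) (c p))) =
      fun p => sgl X (chainPr i p) (c p) := by
    funext p
    exact incl_sgl X i _ _
  rw [h2] at h1
  rw [h1, eq_sgl_top (y := Φ (X ∘ i) (Q.tr_sub hX i) n fun p => sgl (X ∘ i) (supPr p) (c p))
    ((h.pathy _ _ n).left _ _ (Lsupp_sgl _ (supPr 0) _)) ((h.pathy _ _ n).right _ _ (Rsupp_sgl _ (supPr (Fin.last n)) _)),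
    incl_sgl]
  rfl

theorem Coch.tot_sup (F : Coch Q) {n : ℕ} (X : Fin (n + 2) → Ob) (hX : Q.Tr X)
    (c : ∀ p : Fin (n + 1), Q.Hom (X p.castSucc) (X p.succ)) :
    F.tot X hX n (fun p => sgl X (supPr p) (c p)) = sgl X (topPr n) (F n X hX c) :=
  F.tot_chain X hX (RelEmbedding.refl _) c

theorem Coch.toCoch_tot (F : Coch Q) : toCoch (fun X hX => F.tot X hX) = F := by
  funext n X hX
  refine MultilinearMap.ext fun c => ?_
  have h1 := congrFun (F.tot_sup X hX c) (topPr n)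
  rw [sgl_same] at h1
  exact h1

theorem Coch.ext_tot {F G : Coch Q} (h : ∀ {M : ℕ} (X : Fin (M + 1) → Ob) (hX : Q.Tr X),
    F.tot X hX = G.tot X hX) : F = G := by
  rw [← F.toCoch_tot, ← G.toCoch_tot]
  unfold toCoch
  simp only [h]

theorem blk_nat {A B : Type v} [AddCommGroup A] [Module k A] [AddCommGroup B] [Module k B]
    (L : A →ₗ[k] B) {i n : ℕ} (s : Fin (i + 1) → ℕ) (h : ∑ q, (s q + 1) = n + 1)
    (f : MultilinearMap k (fun _ : Fin (i + 1) => A) A)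
    (f' : MultilinearMap k (fun _ : Fin (i + 1) => B) B)
    (g : ∀ q, MultilinearMap k (fun _ : Fin (s q + 1) => A) A)
    (g' : ∀ q, MultilinearMap k (fun _ : Fin (s q + 1) => B) B)
    (hf : ∀ a, f' (fun p => L (a p)) = L (f a))
    (hg : ∀ q a, g' q (fun p => L (a p)) = L (g q a)) (a : Fin (n + 1) → A) :
    blk s h f' g' (fun p => L (a p)) = L (blk s h f g a) := by
  rw [blk_apply, blk_apply, ← hf]
  congr 1
  funext q
  exact hg q _

/-- Families of operations that are intertwined by a linear map. -/
def NatO {A B : Type v} [AddCommGroup A] [Module k A] [AddCommGroup B] [Module k B]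
    (L : A →ₗ[k] B) (f : OpFamily k A A) (f' : OpFamily k B B) : Prop :=
  ∀ n a, f' n (fun p => L (a p)) = L (f n a)

theorem NatO.tm {A B : Type v} [AddCommGroup A] [Module k A] [AddCommGroup B] [Module k B]
    {L : A →ₗ[k] B} {i : ℕ} {f : MultilinearMap k (fun _ : Fin (i + 1) => A) A}
    {f' : MultilinearMap k (fun _ : Fin (i + 1) => B) B}
    {G : Fin (i + 1) → OpFamily k A A} {G' : Fin (i + 1) → OpFamily k B B}
    (hf : ∀ a, f' (fun p => L (a p)) = L (f a)) (hG : ∀ q, NatO L (G q) (G' q)) :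
    NatO L (tm f G) (tm f' G') := by
  intro n a
  unfold AInf.tm
  rw [sum_apply, sum_apply, map_sum]
  refine Finset.sum_congr rfl fun s _ => ?_
  split_ifs with h
  · exact blk_nat L s h f f' _ _ hf (fun q a => hG q _ a) a
  · exact (map_zero L).symm

theorem NatO.tri {A B : Type v} [AddCommGroup A] [Module k A] [AddCommGroup B] [Module k B]
    {L : A →ₗ[k] B} {f g h : OpFamily k A A} {f' g' h' : OpFamily k B B} (hf : NatO L f f')
    (hg : NatO L g g') (hh : NatO L h h') {i : ℕ} (l q : Fin (i + 1)) :
    NatO L (tri f g h l q) (tri f' g' h' l q) := by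
  unfold AInf.tri
  split_ifs
  exacts [hf, hg, hh]

theorem NatO.compO {A B : Type v} [AddCommGroup A] [Module k A] [AddCommGroup B] [Module k B]
    {L : A →ₗ[k] B} {f g : OpFamily k A A} {f' g' : OpFamily k B B} (hf : NatO L f f')
    (hg : NatO L g g') : NatO L (compO f g) (compO f' g') := by
  intro n a
  unfold AInf.compO
  rw [sum_apply, sum_apply, map_sum]
  exact Finset.sum_congr rfl fun i _ => NatO.tm (hf i) (fun _ => hg) n a

theorem NatO.dcompO {A B : Type v} [AddCommGroup A] [Module k A] [AddCommGroup B] [Module k B]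
    {L : A →ₗ[k] B} {f a y b : OpFamily k A A} {f' a' y' b' : OpFamily k B B} (hf : NatO L f f')
    (ha : NatO L a a') (hy : NatO L y y') (hb : NatO L b b') :
    NatO L (dcompO f a y b) (dcompO f' a' y' b') := by
  intro n c
  unfold AInf.dcompO
  rw [sum_apply, sum_apply, map_sum]
  refine Finset.sum_congr rfl fun i _ => ?_
  rw [sum_apply, sum_apply, map_sum]
  exact Finset.sum_congr rfl fun l _ => NatO.tm (hf i) (NatO.tri ha hy hb l) n c

/-- The composition `∑ F (G, …, G)` of cochains. -/
def comp (F G : Coch Q) : Coch Q := toCoch (fun X hX => compO (F.tot X hX) (G.tot X hX))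

/-- The sum of the compositions `F (A, …, A, Y, B, …, B)` of cochains. -/
def dcomp (F A Y B : Coch Q) : Coch Q :=
  toCoch (fun X hX => dcompO (F.tot X hX) (A.tot X hX) (Y.tot X hX) (B.tot X hX))

theorem tot_comp (F G : Coch Q) {M : ℕ} (X : Fin (M + 1) → Ob) (hX : Q.Tr X) :
    (comp F G).tot X hX = compO (F.tot X hX) (G.tot X hX) :=
  IsTot.tot_toCoch ⟨fun X hX n => Pathy.compO (F.tot_pathy X hX) (G.tot_pathy X hX) n,
    fun X hX i => NatO.compO (F.tot_incl X hX i) (G.tot_incl X hX i)⟩ X hX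

theorem tot_dcomp (F A Y B : Coch Q) {M : ℕ} (X : Fin (M + 1) → Ob) (hX : Q.Tr X) :
    (dcomp F A Y B).tot X hX =
      dcompO (F.tot X hX) (A.tot X hX) (Y.tot X hX) (B.tot X hX) :=
  IsTot.tot_toCoch ⟨fun X hX n => Pathy.dcompO (F.tot_pathy X hX) (A.tot_pathy X hX)
    (Y.tot_pathy X hX) (B.tot_pathy X hX) n,
    fun X hX i => NatO.dcompO (F.tot_incl X hX i) (A.tot_incl X hX i) (Y.tot_incl X hX i)
      (B.tot_incl X hX i)⟩ X hX

end Cochains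
end
end AInf

namespace AInf
noncomputable section

/-! ### Polynomial maps of cochains -/

section Der

variable {k : Type w} [Field k] {A : Type v} [AddCommGroup A] [Module k A]

theorem tri_eq_update {α ι : Type*} [LinearOrder ι] (x y z w : α) (p : ι) :
    tri x y z p = Function.update (tri x w z p) p y := by
  funext q
  rcases lt_trichotomy q p with h | rfl | h
  · rw [Function.update_of_ne h.ne, tri_lt _ _ _ h, tri_lt _ _ _ h]
  · rw [Function.update_self, tri_self]
  · rw [Function.update_of_ne h.ne', tri_gt _ _ _ h, tri_gt _ _ _ h]

theorem der_add {n : ℕ} (φ : MultilinearMap k (fun _ : Fin (n + 1) => A) A) (x y y' z : A) :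
    der φ x (y + y') z = der φ x y z + der φ x y' z := by
  unfold der
  rw [← Finset.sum_add_distrib]
  refine Finset.sum_congr rfl fun p _ => ?_
  rw [tri_eq_update x (y + y') z 0 p, φ.map_update_add, ← tri_eq_update, ← tri_eq_update]

theorem hder_add (M : ℕ) (F : OpFamily k A A) (x y y' z : A) :
    hder M F x (y + y') z = hder M F x y z + hder M F x y' z := by
  unfold hder
  rw [← Finset.sum_add_distrib]
  exact Finset.sum_congr rfl fun n _ => der_add _ _ _ _ _

theorem hder_zero (M : ℕ) (F : OpFamily k A A) (x z : A) : hder M F x 0 z = 0 := by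
  have h := hder_add M F x 0 0 z
  simpa using h

theorem hder_neg (M : ℕ) (F : OpFamily k A A) (x y z : A) :
    hder M F x (-y) z = - hder M F x y z := by
  have h := hder_add M F x (-y) y z
  rw [neg_add_cancel, hder_zero] at h
  exact eq_neg_of_add_eq_zero_left h.symm

theorem hder_sub (M : ℕ) (F : OpFamily k A A) (x y y' z : A) :
    hder M F x (y - y') z = hder M F x y z - hder M F x y' z := by
  rw [sub_eq_add_neg, hder_add, hder_neg, sub_eq_add_neg]

/-- Telescoping: pass from `x` to `x + y` one slot at a time, from left to right; `v j` has `x + y`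
in its first `j` slots. -/
theorem apply_add_const {n : ℕ} (φ : MultilinearMap k (fun _ : Fin (n + 1) => A) A) (x y : A) :
    φ (fun _ => x + y) = φ (fun _ => x) + der φ (x + y) y x := by
  let v : ℕ → Fin (n + 1) → A := fun j q => if (q : ℕ) < j then x + y else x
  have h1 : ∀ p : Fin (n + 1), φ (v (p + 1)) - φ (v p) = φ (tri (x + y) y x p) := by
    intro p
    have h2 : v (p + 1) = Function.update (v p) p (x + y) := by
      funext q
      rcases lt_trichotomy q p with h | rfl | h
      · rw [Function.update_of_ne h.ne]
        have := Fin.lt_def.1 h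
        simp only [v]
        rw [if_pos (by omega), if_pos this]
      · rw [Function.update_self]
        simp [v]
      · rw [Function.update_of_ne h.ne']
        have := Fin.lt_def.1 h
        simp only [v]
        rw [if_neg (by omega), if_neg (by omega)]
    have h3 : Function.update (v p) p x = v p := by
      rw [Function.update_eq_self_iff]
      simp [v]
    have h4 : Function.update (v p) p y = tri (x + y) y x p := by
      funext q
      rcases lt_trichotomy q p with h | rfl | h
      · rw [Function.update_of_ne h.ne, tri_lt _ _ _ h]
        exact if_pos (Fin.lt_def.1 h)
      · rw [Function.update_self, tri_self]
      · rw [Function.update_of_ne h.ne', tri_gt _ _ _ h]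
        exact if_neg (Fin.lt_def.1 h).not_gt
    rw [h2, φ.map_update_add, h3, h4, add_sub_cancel_left]
  have h5 : ∑ p : Fin (n + 1), (φ (v (p + 1)) - φ (v p)) = φ (v (n + 1)) - φ (v 0) := by
    rw [Fin.sum_univ_eq_sum_range (fun j => φ (v (j + 1)) - φ (v j)),
      Finset.sum_range_sub (fun j => φ (v j))]
  have h6 : v (n + 1) = fun _ => x + y := by
    funext q
    exact if_pos q.2
  have h7 : v 0 = fun _ => x := by
    funext q
    exact if_neg (Nat.not_lt_zero _)
  rw [Finset.sum_congr rfl fun p _ => h1 p, h6, h7] at h5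
  unfold der
  rw [h5]
  abel

theorem hat_add_arg (M : ℕ) (F : OpFamily k A A) (x y : A) :
    hat M F (x + y) = hat M F x + hder M F (x + y) y x := by
  unfold hat hder
  rw [← Finset.sum_add_distrib]
  exact Finset.sum_congr rfl fun n _ => apply_add_const _ _ _

end Der

section Hats

variable {k : Type w} [Field k] {N : ℕ} {Ob : Type u} {Q : TransversalQuiver.{w, u, v} k N Ob}

/-- The polynomial map of a cochain on `⨁_{i < j} Hom (X i) (X j)`. -/
def chat (F : Coch Q) {M : ℕ} (X : Fin (M + 1) → Ob) (hX : Q.Tr X) (x : Q.SeqHom X) :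
    Q.SeqHom X := hat M (F.tot X hX) x

/-- The derivative of the polynomial map of a cochain. -/
def cder (F : Coch Q) {M : ℕ} (X : Fin (M + 1) → Ob) (hX : Q.Tr X) (x y z : Q.SeqHom X) :
    Q.SeqHom X := hder M (F.tot X hX) x y z

variable {M : ℕ} (X : Fin (M + 1) → Ob) (hX : Q.Tr X)

theorem tot_add (F G : Coch Q) (n : ℕ) :
    (F + G).tot X hX n = F.tot X hX n + G.tot X hX n := by
  refine MultilinearMap.ext fun a => ?_
  change _ = F.tot X hX n a + G.tot X hX n a
  simp only [Coch.tot_apply, ← Finset.sum_add_distrib, ← map_add]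
  rfl

theorem tot_zero_of {F : Coch Q} {n : ℕ} (h : F n = 0) : F.tot X hX n = 0 := by
  refine MultilinearMap.ext fun a => ?_
  rw [Coch.tot_apply, h]
  exact Finset.sum_eq_zero fun i _ => map_zero _

theorem tot_neg (F : Coch Q) (n : ℕ) : (-F).tot X hX n = - F.tot X hX n := by
  rw [eq_neg_iff_add_eq_zero, ← tot_add]
  exact tot_zero_of X hX (by rw [neg_add_cancel]; rfl)

theorem tot_sub (F G : Coch Q) (n : ℕ) :
    (F - G).tot X hX n = F.tot X hX n - G.tot X hX n := by
  rw [sub_eq_add_neg, tot_add, tot_neg, sub_eq_add_neg]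

theorem tot_congr {F G : Coch Q} {n : ℕ} (h : F n = G n) : F.tot X hX n = G.tot X hX n := by
  rw [← sub_eq_zero, ← tot_sub]
  exact tot_zero_of X hX (by change F n - G n = 0; rw [h, sub_self])

theorem chat_add (F G : Coch Q) (x : Q.SeqHom X) :
    chat (F + G) X hX x = chat F X hX x + chat G X hX x := by
  unfold chat hat
  rw [← Finset.sum_add_distrib]
  exact Finset.sum_congr rfl fun n _ => by rw [tot_add]; rfl

theorem chat_neg (F : Coch Q) (x : Q.SeqHom X) : chat (-F) X hX x = - chat F X hX x := by
  unfold chat hat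
  rw [← Finset.sum_neg_distrib]
  exact Finset.sum_congr rfl fun n _ => by rw [tot_neg]; rfl

theorem chat_sub (F G : Coch Q) (x : Q.SeqHom X) :
    chat (F - G) X hX x = chat F X hX x - chat G X hX x := by
  rw [sub_eq_add_neg, chat_add, chat_neg, sub_eq_add_neg]

theorem chat_zero (x : Q.SeqHom X) : chat (0 : Coch Q) X hX x = 0 := by
  have h := chat_add X hX 0 0 x
  simpa using h

theorem cder_add_left (F G : Coch Q) (x y z : Q.SeqHom X) :
    cder (F + G) X hX x y z = cder F X hX x y z + cder G X hX x y z := by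
  unfold cder hder
  rw [← Finset.sum_add_distrib]
  refine Finset.sum_congr rfl fun n _ => ?_
  unfold der
  rw [tot_add, ← Finset.sum_add_distrib]
  rfl

theorem cder_neg_left (F : Coch Q) (x y z : Q.SeqHom X) :
    cder (-F) X hX x y z = - cder F X hX x y z := by
  unfold cder hder
  rw [← Finset.sum_neg_distrib]
  refine Finset.sum_congr rfl fun n _ => ?_
  unfold der
  rw [tot_neg, ← Finset.sum_neg_distrib]
  rfl

theorem cder_sub_left (F G : Coch Q) (x y z : Q.SeqHom X) :
    cder (F - G) X hX x y z = cder F X hX x y z - cder G X hX x y z := by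
  rw [sub_eq_add_neg, cder_add_left, cder_neg_left, sub_eq_add_neg]

theorem cder_zero_left (x y z : Q.SeqHom X) : cder (0 : Coch Q) X hX x y z = 0 := by
  have h := cder_add_left X hX 0 0 x y z
  simpa using h

theorem chat_comp (F G : Coch Q) (x : Q.SeqHom X) :
    chat (comp F G) X hX x = chat F X hX (chat G X hX x) := by
  unfold chat
  rw [tot_comp]
  exact hat_compO _ _ (fun i => (F.tot_pathy X hX i).blkVanish fun _ => G.tot_pathy X hX) x

theorem cder_comp (F G : Coch Q) (x y z : Q.SeqHom X) :
    cder (comp F G) X hX x y z =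
      cder F X hX (chat G X hX x) (cder G X hX x y z) (chat G X hX z) := by
  unfold chat cder
  rw [tot_comp]
  exact hder_compO _ _ (fun i => (F.tot_pathy X hX i).blkVanish fun _ => G.tot_pathy X hX) x y z

theorem chat_dcomp (F A Y B : Coch Q) (x : Q.SeqHom X) :
    chat (dcomp F A Y B) X hX x =
      cder F X hX (chat A X hX x) (chat Y X hX x) (chat B X hX x) := by
  unfold chat cder
  rw [tot_dcomp]
  exact hat_dcompO _ _ _ _ (fun i l => (F.tot_pathy X hX i).blkVanish fun q =>
    Pathy.tri (A.tot_pathy X hX) (Y.tot_pathy X hX) (B.tot_pathy X hX) l q) x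

theorem chat_add_arg (F : Coch Q) (x y : Q.SeqHom X) :
    chat F X hX (x + y) = chat F X hX x + cder F X hX (x + y) y x :=
  hat_add_arg _ _ _ _

-- Evaluate at the sum `x` of arbitrary morphisms `a_p : X_p → X_{p+1}` and take the entry from the
-- first to the last position. A chain contributes only if it consists of unit steps from end to
-- end, so the entry is exactly `F(a_0, …, a_n)`. No polarization and hence no division is needed.
omit X hX M in
theorem ext_chat {F G : Coch Q} (h : ∀ {M : ℕ} (X : Fin (M + 1) → Ob) (hX : Q.Tr X)
    (x : Q.SeqHom X), chat F X hX x = chat G X hX x) : F = G := by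
  suffices H : ∀ (F : Coch Q) (n : ℕ) (X : Fin (n + 2) → Ob) (hX : Q.Tr X)
      (a : ∀ p : Fin (n + 1), Q.Hom (X p.castSucc) (X p.succ)),
      chat F X hX (∑ p, sgl X (supPr p) (a p)) (topPr n) = F n X hX a by
    funext n X hX
    refine MultilinearMap.ext fun a => ?_
    rw [← H, ← H, h]
  intro F n X hX a
  set x : Q.SeqHom X := ∑ p, sgl X (supPr p) (a p) with hx
  have hx1 : ∀ p, x (supPr p) = a p := by
    intro p
    rw [hx, Finset.sum_apply, Finset.sum_eq_single p]
    · exact sgl_same X _ _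
    · intro p' _ hp'
      refine sgl_ne X (fun h => hp' ?_) _
      have h1 := congrArg (fun q : Pr (n + 1) => q.1.2) h
      exact (Fin.succ_injective _ h1).symm
    · simp
  have hx2 : ∀ r : Pr (n + 1), (r.1.2 : ℕ) ≠ r.1.1 + 1 → x r = 0 := by
    intro r hr
    rw [hx, Finset.sum_apply]
    refine Finset.sum_eq_zero fun p _ => sgl_ne X (fun h => hr ?_) _
    rw [h]
    simp
  -- A chain of unit steps from the first to the last position visits every position.
  have hterm : ∀ (m : ℕ) (i : Fin (m + 2) ↪o Fin (n + 2)), i 0 = 0 →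
      i (Fin.last (m + 1)) = Fin.last (n + 1) →
      (∀ p : Fin (m + 1), (i p.succ : ℕ) = i p.castSucc + 1) → m = n := by
    intro m i h0 hl hi
    have h1 : ∀ (j : ℕ) (hj : j < m + 2), (i ⟨j, hj⟩ : ℕ) = j := by
      intro j
      induction j with
      | zero => intro hj; exact congrArg Fin.val h0
      | succ j ih =>
        intro hj
        have h2 : (i ⟨j + 1, hj⟩ : ℕ) = i ⟨j, by omega⟩ + 1 := hi ⟨j, by omega⟩
        rw [h2, ih]
    have h2 := h1 (m + 1) (by omega)
    have h3 := congrArg Fin.val hl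
    rw [Fin.val_last] at h3
    have h4 : (i (Fin.last (m + 1)) : ℕ) = m + 1 := h2
    omega
  have hm : ∀ m, F.tot X hX m (fun _ => x) (topPr n) = if m = n then F n X hX a else 0 := by
    intro m
    rw [F.tot_apply, Finset.sum_apply]
    have hz : ∀ i : Fin (m + 2) ↪o Fin (n + 2), m ≠ n → sgl (Q := Q) X (endPr i)
        (F m (X ∘ i) (Q.tr_sub hX i) (fun p => x (chainPr i p))) (topPr n) = 0 := by
      intro i hmn
      by_cases h1 : topPr n = endPr i
      · have h2 := congrArg (fun q : Pr (n + 1) => q.1.1) h1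
        have h3 := congrArg (fun q : Pr (n + 1) => q.1.2) h1
        by_cases h4 : ∀ p : Fin (m + 1), (i p.succ : ℕ) = i p.castSucc + 1
        · exact absurd (hterm m i h2.symm h3.symm h4) hmn
        · push Not at h4
          obtain ⟨p, hp⟩ := h4
          have h5 := (F m (X ∘ i) (Q.tr_sub hX i)).map_coord_zero
            (m := fun p => x (chainPr i p)) p (hx2 _ hp)
          rw [h5, map_zero]
          rfl
      · exact sgl_ne X h1 _
    split_ifs with hmn
    · subst hmn
      have hu : ∀ i : Fin (m + 2) ↪o Fin (m + 2), i = RelEmbedding.refl _ := by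
        intro i
        have hs : Function.Surjective i := Finite.injective_iff_surjective.1 i.injective
        have h2 : RelIso.ofSurjective i hs = OrderIso.refl _ := Subsingleton.elim _ _
        ext p
        exact congrArg (fun g : Fin (m + 2) ≃o Fin (m + 2) => ((g p : Fin (m + 2)) : ℕ)) h2
      rw [Finset.sum_eq_single (RelEmbedding.refl _) (fun i _ hi => absurd (hu i) hi) (by simp)]
      refine (sgl_same X _ _).trans ?_
      refine congrArg (F m X hX) ?_
      funext p
      exact hx1 p
    · exact Finset.sum_eq_zero fun i _ => hz i hmn
  unfold chat hat
  rw [Finset.sum_apply, Finset.sum_congr rfl fun m _ => hm m]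
  simp

/-- `F (G + H) = F (G) + …`. -/
theorem comp_add (F G H : Coch Q) : comp F (G + H) = comp F G + dcomp F (G + H) H G := by
  refine ext_chat fun X hX x => ?_
  rw [chat_comp, chat_add, chat_add, chat_comp, chat_dcomp, chat_add, chat_add_arg]

omit X hX M in
theorem dcomp_add_left (F F' A Y B : Coch Q) :
    dcomp (F + F') A Y B = dcomp F A Y B + dcomp F' A Y B := by
  refine ext_chat fun X hX x => ?_
  simp only [chat_add, chat_dcomp, cder_add_left]

omit X hX M in
theorem dcomp_add_mid (F A Y Y' B : Coch Q) :
    dcomp F A (Y + Y') B = dcomp F A Y B + dcomp F A Y' B := by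
  refine ext_chat fun X hX x => ?_
  simp only [chat_add, chat_dcomp]
  exact hder_add _ _ _ _ _ _

/-! #### Linear cochains -/

/-- The cochain of arity one given by linear endomorphisms. -/
def linC (L : ∀ X Y, Q.Hom X Y →ₗ[k] Q.Hom X Y) : Coch Q
  | 0 => fun X _ =>
    { toFun := fun a => L (X 0) (X 1) (a 0)
      map_update_add' := by
        intro _ m i x y
        obtain rfl : i = 0 := Fin.fin_one_eq_zero i
        simp only [Function.update_self, map_add]
      map_update_smul' := by
        intro _ m i c x
        obtain rfl : i = 0 := Fin.fin_one_eq_zero i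
        simp only [Function.update_self, map_smul] }
  | _ + 1 => fun _ _ => 0

/-- The endomorphism of `⨁_{i < j} Hom (X i) (X j)` given by linear endomorphisms. -/
def seqMap (L : ∀ X Y, Q.Hom X Y →ₗ[k] Q.Hom X Y) {M : ℕ} (X : Fin (M + 1) → Ob) :
    Q.SeqHom X →ₗ[k] Q.SeqHom X :=
  LinearMap.pi fun q => (L (X q.1.1) (X q.1.2)).comp (LinearMap.proj q)

theorem seqMap_sgl (L : ∀ X Y, Q.Hom X Y →ₗ[k] Q.Hom X Y) (q : Pr M)
    (x : Q.Hom (X q.1.1) (X q.1.2)) :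
    seqMap L X (sgl X q x) = sgl X q (L _ _ x) := by
  funext r
  by_cases h : r = q
  · subst h
    rw [sgl_same]
    change L _ _ (sgl X r x r) = _
    rw [sgl_same]
  · rw [sgl_ne X h]
    change L _ _ (sgl X q x r) = _
    rw [sgl_ne X h, map_zero]

theorem tot_linC_zero (L : ∀ X Y, Q.Hom X Y →ₗ[k] Q.Hom X Y) (a : Fin 1 → Q.SeqHom X) :
    (linC L).tot X hX 0 a = seqMap L X (a 0) := by
  suffices H : (linC L).tot X hX 0 =
      ((seqMap L X).compMultilinearMap (MultilinearMap.ofSubsingleton k (Q.SeqHom X) (Q.SeqHom X)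
        (0 : Fin 1) LinearMap.id)) from DFunLike.congr_fun H a
  refine Mid.ext ((linC L).tot_pathy X hX 0).mid ?_ fun i c => ?_
  · intro a p p' hp
    omega
  · rw [Coch.tot_chain, LinearMap.compMultilinearMap_apply]
    exact (seqMap_sgl X L (chainPr i 0) (c 0)).symm

theorem tot_linC_succ (L : ∀ X Y, Q.Hom X Y →ₗ[k] Q.Hom X Y) (n : ℕ) :
    (linC L).tot X hX (n + 1) = 0 := tot_zero_of X hX rfl

theorem chat_linC (L : ∀ X Y, Q.Hom X Y →ₗ[k] Q.Hom X Y) (x : Q.SeqHom X) :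
    chat (linC L) X hX x = seqMap L X x := by
  -- For `M = 0` the sum that defines `chat` is empty; the equality holds because there are no pairs
  -- of positions.
  cases M with
  | zero => funext q; exact absurd q.2 (by omega)
  | succ M =>
    unfold chat hat
    rw [Finset.sum_range_succ', Finset.sum_eq_zero, zero_add, tot_linC_zero]
    intro n _
    rw [tot_linC_succ]
    rfl

theorem cder_linC (L : ∀ X Y, Q.Hom X Y →ₗ[k] Q.Hom X Y) (x y z : Q.SeqHom X) :
    cder (linC L) X hX x y z = seqMap L X y := by
  cases M with
  | zero => funext q; exact absurd q.2 (by omega)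
  | succ M =>
    unfold cder hder
    rw [Finset.sum_range_succ', Finset.sum_eq_zero, zero_add]
    · unfold der
      rw [Fin.sum_univ_one, tot_linC_zero, tri_self]
    · intro n _
      rw [tot_linC_succ]
      exact Finset.sum_eq_zero fun p _ => rfl

end Hats
end
end AInf

namespace AInf
noncomputable section

/-! ### Low order terms of compositions -/

section Low

variable {k : Type w} [Field k]

section Ops

variable {A : Type v} [AddCommGroup A] [Module k A]

theorem blk_zero_left {i n : ℕ} (s : Fin (i + 1) → ℕ) (h : ∑ q, (s q + 1) = n + 1)
    (g : ∀ q, MultilinearMap k (fun _ : Fin (s q + 1) => A) A) : blk s h 0 g = 0 := rfl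

theorem blk_zero_right {i n : ℕ} (s : Fin (i + 1) → ℕ) (h : ∑ q, (s q + 1) = n + 1)
    (f : MultilinearMap k (fun _ : Fin (i + 1) => A) A)
    (g : ∀ q, MultilinearMap k (fun _ : Fin (s q + 1) => A) A) (l : Fin (i + 1)) (hg : g l = 0) :
    blk s h f g = 0 := by
  refine MultilinearMap.ext fun a => ?_
  rw [blk_apply]
  refine f.map_coord_zero l ?_
  rw [hg]
  rfl

theorem le_of_sum_succ {i n : ℕ} {s : Fin (i + 1) → ℕ} (h : ∑ q, (s q + 1) = n + 1) :
    i ≤ n ∧ ∀ l, s l + i ≤ n := by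
  have h1 : ∀ l, s l + i ≤ n := by
    intro l
    rw [Finset.sum_add_distrib] at h
    have h2 := Finset.single_le_sum (f := s) (fun _ _ => Nat.zero_le _) (Finset.mem_univ l)
    simp only [Finset.sum_const, Finset.card_univ, Fintype.card_fin, smul_eq_mul, mul_one] at h
    omega
  exact ⟨le_trans (Nat.le_add_left _ _) (h1 0), h1⟩

/-- The numbers `s q` add up to `n - i`, so if one of them uses up this amount, the others vanish.
-/
theorem other_eq_zero {i n : ℕ} {s : Fin (i + 1) → ℕ} (h : ∑ q, (s q + 1) = n + 1)
    {l : Fin (i + 1)} (hl : n ≤ s l + i) {q : Fin (i + 1)} (hq : q ≠ l) : s q = 0 := by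
  rw [Finset.sum_add_distrib] at h
  have h2 : s l + s q ≤ ∑ q, s q := by
    rw [← Finset.sum_pair hq.symm]
    exact Finset.sum_le_sum_of_subset (Finset.subset_univ _)
  simp only [Finset.sum_const, Finset.card_univ, Fintype.card_fin, smul_eq_mul, mul_one] at h
  omega

theorem tm_congr {i n : ℕ} {f f' : MultilinearMap k (fun _ : Fin (i + 1) => A) A}
    {G G' : Fin (i + 1) → OpFamily k A A}
    (H : ∀ s : Fin (i + 1) → ℕ, ∑ q, (s q + 1) = n + 1 → (f = 0 ∧ f' = 0) ∨
      (∃ l, G l (s l) = 0 ∧ G' l (s l) = 0) ∨ (f = f' ∧ ∀ q, G q (s q) = G' q (s q))) :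
    tm f G n = tm f' G' n := by
  refine Finset.sum_congr rfl fun s _ => ?_
  by_cases h : ∑ q, (s q + 1) = n + 1
  · rw [dif_pos h, dif_pos h]
    rcases H s h with ⟨rfl, rfl⟩ | ⟨l, h1, h2⟩ | ⟨rfl, h1⟩
    · rfl
    · rw [blk_zero_right s h _ _ l h1, blk_zero_right s h _ _ l h2]
    · congr 1
      funext q
      exact h1 q
  · rw [dif_neg h, dif_neg h]

theorem compO_congr {f f' g g' : OpFamily k A A} {n : ℕ} (hf : ∀ i ≤ n, f i = f' i)
    (hg : ∀ i ≤ n, g i = g' i) : compO f g n = compO f' g' n := by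
  refine Finset.sum_congr rfl fun i hi => tm_congr fun s h => Or.inr (Or.inr ⟨?_, fun q => ?_⟩)
  · exact hf i (Nat.lt_succ_iff.1 (Finset.mem_range.1 hi))
  · exact hg _ (le_trans (Nat.le_add_right _ _) ((le_of_sum_succ h).2 q))

theorem dcompO_congr {f f' a a' y y' b b' : OpFamily k A A} {n : ℕ}
    (H : ∀ (i : ℕ) (l : Fin (i + 1)) (s : Fin (i + 1) → ℕ), ∑ q, (s q + 1) = n + 1 →
      (f i = 0 ∧ f' i = 0) ∨ (y (s l) = 0 ∧ y' (s l) = 0) ∨ (f i = f' i ∧ y (s l) = y' (s l) ∧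
        (∀ q < l, a (s q) = a' (s q)) ∧ ∀ q > l, b (s q) = b' (s q))) :
    dcompO f a y b n = dcompO f' a' y' b' n := by
  refine Finset.sum_congr rfl fun i _ => Finset.sum_congr rfl fun l _ => tm_congr fun s h => ?_
  rcases H i l s h with h1 | h1 | ⟨h1, h2, h3, h4⟩
  · exact Or.inl h1
  · refine Or.inr (Or.inl ⟨l, ?_⟩)
    rwa [tri_self, tri_self]
  · refine Or.inr (Or.inr ⟨h1, fun q => ?_⟩)
    rcases lt_trichotomy q l with hq | rfl | hq
    · rw [tri_lt _ _ _ hq, tri_lt _ _ _ hq, h3 q hq]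
    · rw [tri_self, tri_self, h2]
    · rw [tri_gt _ _ _ hq, tri_gt _ _ _ hq, h4 q hq]

end Ops

variable {N : ℕ} {Ob : Type u} {Q : TransversalQuiver.{w, u, v} k N Ob}

theorem Coch.ext_at {F G : Coch Q} {n : ℕ}
    (h : ∀ (X : Fin (n + 2) → Ob) (hX : Q.Tr X), F.tot X hX n = G.tot X hX n) : F n = G n := by
  rw [← F.toCoch_tot, ← G.toCoch_tot]
  unfold toCoch
  funext X hX
  simp only [h]

theorem comp_congr {F F' G G' : Coch Q} {n : ℕ} (hF : ∀ i ≤ n, F i = F' i)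
    (hG : ∀ i ≤ n, G i = G' i) : comp F G n = comp F' G' n := by
  refine Coch.ext_at fun X hX => ?_
  rw [tot_comp, tot_comp]
  exact compO_congr (fun i hi => tot_congr X hX (hF i hi)) (fun i hi => tot_congr X hX (hG i hi))

/-- The leading term lemmas below are instances: a term with outer index `i` and middle index `s l`
satisfies `s l + i ≤ n`, so the vanishing of low components of `F` or `Y` removes all but a few
terms. -/
theorem dcomp_congr {F F' A A' Y Y' B B' : Coch Q} {n : ℕ}
    (H : ∀ (i : ℕ) (l : Fin (i + 1)) (s : Fin (i + 1) → ℕ), ∑ q, (s q + 1) = n + 1 →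
      (F i = 0 ∧ F' i = 0) ∨ (Y (s l) = 0 ∧ Y' (s l) = 0) ∨ (F i = F' i ∧ Y (s l) = Y' (s l) ∧
        (∀ q < l, A (s q) = A' (s q)) ∧ ∀ q > l, B (s q) = B' (s q))) :
    dcomp F A Y B n = dcomp F' A' Y' B' n := by
  refine Coch.ext_at fun X hX => ?_
  rw [tot_dcomp, tot_dcomp]
  refine dcompO_congr fun i l s h => ?_
  rcases H i l s h with ⟨h1, h2⟩ | ⟨h1, h2⟩ | ⟨h1, h2, h3, h4⟩
  · exact Or.inl ⟨tot_zero_of X hX h1, tot_zero_of X hX h2⟩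
  · exact Or.inr (Or.inl ⟨tot_zero_of X hX h1, tot_zero_of X hX h2⟩)
  · exact Or.inr (Or.inr ⟨tot_congr X hX h1, tot_congr X hX h2,
      fun q hq => tot_congr X hX (h3 q hq), fun q hq => tot_congr X hX (h4 q hq)⟩)

/-- The identity cochain. -/
def idC (Q : TransversalQuiver.{w, u, v} k N Ob) : Coch Q := linC fun _ _ => LinearMap.id

theorem chat_idC {M : ℕ} (X : Fin (M + 1) → Ob) (hX : Q.Tr X) (x : Q.SeqHom X) :
    chat (idC Q) X hX x = x := chat_linC X hX _ x

theorem cder_idC {M : ℕ} (X : Fin (M + 1) → Ob) (hX : Q.Tr X) (x y z : Q.SeqHom X) :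
    cder (idC Q) X hX x y z = y := cder_linC X hX _ x y z

theorem dcomp_idC_left (A Y B : Coch Q) : dcomp (idC Q) A Y B = Y :=
  ext_chat fun X hX x => by rw [chat_dcomp, cder_idC]

theorem dcomp_zero_mid (F A B : Coch Q) : dcomp F A 0 B = 0 :=
  ext_chat fun X hX x => (chat_dcomp X hX F A 0 B x).trans (by
    rw [chat_zero]; exact hder_zero _ _ _ _)

theorem dcomp_zero_left (A Y B : Coch Q) : dcomp 0 A Y B = 0 :=
  ext_chat fun X hX x => by rw [chat_dcomp, cder_zero_left, chat_zero]

theorem dcomp_neg_mid (F A Y B : Coch Q) : dcomp F A (-Y) B = - dcomp F A Y B :=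
  ext_chat fun X hX x => by
    rw [chat_neg, chat_dcomp, chat_dcomp, chat_neg]; exact hder_neg _ _ _ _ _

theorem comp_idC_left (F : Coch Q) : comp (idC Q) F = F :=
  ext_chat fun X hX x => by rw [chat_comp, chat_idC]

theorem comp_idC_right (F : Coch Q) : comp F (idC Q) = F :=
  ext_chat fun X hX x => by rw [chat_comp, chat_idC]

/-- The component of index `t`. -/
def only (t : ℕ) (F : Coch Q) : Coch Q := fun j => if j = t then F j else 0

theorem only_self (t : ℕ) (F : Coch Q) : only t F t = F t := if_pos rfl

theorem only_ne {t j : ℕ} (h : j ≠ t) (F : Coch Q) : only t F j = 0 := if_neg h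

theorem dcomp_eq_zero_of_lt {F A Y B : Coch Q} {t n : ℕ} (hY : ∀ j < t, Y j = 0) (hn : n < t) :
    dcomp F A Y B n = 0 := by
  have h : dcomp F A Y B n = dcomp F A 0 B n := by
    refine dcomp_congr fun i l s h => Or.inr (Or.inl ⟨hY _ ?_, rfl⟩)
    have := (le_of_sum_succ h).2 l
    omega
  rw [h, dcomp_zero_mid]
  rfl

/-- From `s l + i ≤ t` either `i = 0` or the middle index is below `t`. So `F` enters only through
its linear part, which may be replaced by the identity cochain. -/
theorem dcomp_eq_of_id {F A Y B : Coch Q} {t : ℕ} (hF : F 0 = idC Q 0) (hY : ∀ j < t, Y j = 0) :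
    dcomp F A Y B t = Y t := by
  have h : dcomp F A Y B t = dcomp (idC Q) A Y B t := by
    refine dcomp_congr fun i l s h => ?_
    have h1 := (le_of_sum_succ h).2 l
    cases i with
    | zero => exact Or.inr (Or.inr ⟨hF, rfl, fun _ _ => rfl, fun _ _ => rfl⟩)
    | succ i => exact Or.inr (Or.inl ⟨hY _ (by omega), hY _ (by omega)⟩)
  rw [h, dcomp_idC_left]

theorem dcomp_eq_zero_of_le {F A Y B : Coch Q} {t n : ℕ} (hF : F 0 = 0) (hY : ∀ j < t, Y j = 0)
    (hn : n ≤ t) : dcomp F A Y B n = 0 := by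
  have h : dcomp F A Y B n = dcomp F A 0 B n := by
    refine dcomp_congr fun i l s h => ?_
    have h1 := (le_of_sum_succ h).2 l
    cases i with
    | zero => exact Or.inl ⟨hF, hF⟩
    | succ i => exact Or.inr (Or.inl ⟨hY _ (by omega), rfl⟩)
  rw [h, dcomp_zero_mid]
  rfl

/-- With `i ≥ 1` and `s l ≥ t`, total index `t + 1` forces `i = 1` and `s l = t`, and the other
block has length one. Hence only `F 1`, `Y t` and the linear parts of `A` and `B` enter. -/
theorem dcomp_lead {F A A' Y B B' : Coch Q} {t : ℕ} (hF : F 0 = 0)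
    (hY : ∀ j < t, Y j = 0) (hA : A 0 = A' 0) (hB : B 0 = B' 0) :
    dcomp F A Y B (t + 1) = dcomp (only 1 F) A' (only t Y) B' (t + 1) := by
  refine dcomp_congr fun i l s h => ?_
  have h1 := (le_of_sum_succ h).2 l
  rcases i with _ | _ | i
  · exact Or.inl ⟨hF, only_ne (by omega) F⟩
  · by_cases hl : s l = t
    · have h2 : ∀ q, q ≠ l → s q = 0 := fun q hq => other_eq_zero h (by omega) hq
      refine Or.inr (Or.inr ⟨(only_self 1 F).symm, ?_, fun q hq => ?_, fun q hq => ?_⟩)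
      · rw [hl, only_self]
      · rw [h2 q hq.ne, hA]
      · rw [h2 q hq.ne', hB]
    · exact Or.inr (Or.inl ⟨hY _ (by omega), only_ne hl Y⟩)
  · exact Or.inr (Or.inl ⟨hY _ (by omega), only_ne (by omega) Y⟩)

theorem dcomp_left_eq_zero {W A Y B : Coch Q} {t n : ℕ} (hW : ∀ j < t, W j = 0) (hY : Y 0 = 0)
    (hn : n ≤ t) : dcomp W A Y B n = 0 := by
  have h : dcomp W A Y B n = dcomp W A 0 B n := by
    refine dcomp_congr fun i l s h => ?_
    have h1 := (le_of_sum_succ h).2 l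
    by_cases hi : i < t
    · exact Or.inl ⟨hW i hi, hW i hi⟩
    · refine Or.inr (Or.inl ⟨?_, rfl⟩)
      rw [show s l = 0 by omega, hY]
  rw [h, dcomp_zero_mid]
  rfl

/-- The mirror image of `dcomp_lead`: `i ≥ t` and `s l ≥ 1` force `i = t`, `s l = 1` and blocks of
length one elsewhere. -/
theorem dcomp_left_lead {W A A' Y B B' : Coch Q} {t : ℕ} (hW : ∀ j < t, W j = 0) (hY : Y 0 = 0)
    (hA : A 0 = A' 0) (hB : B 0 = B' 0) :
    dcomp W A Y B (t + 1) = dcomp (only t W) A' (only 1 Y) B' (t + 1) := by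
  refine dcomp_congr fun i l s h => ?_
  have h1 := (le_of_sum_succ h).2 l
  by_cases hi : i = t
  · subst hi
    by_cases hl : s l = 1
    · have h2 : ∀ q, q ≠ l → s q = 0 := fun q hq => other_eq_zero h (by omega) hq
      refine Or.inr (Or.inr ⟨(only_self i W).symm, ?_, fun q hq => ?_, fun q hq => ?_⟩)
      · rw [hl, only_self]
      · rw [h2 q hq.ne, hA]
      · rw [h2 q hq.ne', hB]
    · refine Or.inr (Or.inl ⟨?_, only_ne hl Y⟩)
      rw [show s l = 0 by omega, hY]
  · by_cases hi2 : i < t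
    · exact Or.inl ⟨hW i hi2, only_ne hi W⟩
    · refine Or.inr (Or.inl ⟨?_, only_ne (by omega) Y⟩)
      rw [show s l = 0 by omega, hY]

theorem dcomp_left_right_eq_zero {W A Y B : Coch Q} {t m n : ℕ} (hW : ∀ j < t, W j = 0)
    (hY : ∀ j < m, Y j = 0) (hn : n < t + m) : dcomp W A Y B n = 0 := by
  have h : dcomp W A Y B n = dcomp W A 0 B n := by
    refine dcomp_congr fun i l s h => ?_
    have h1 := (le_of_sum_succ h).2 l
    by_cases hi : i < t
    · exact Or.inl ⟨hW i hi, hW i hi⟩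
    · exact Or.inr (Or.inl ⟨hY _ (by omega), rfl⟩)
  rw [h, dcomp_zero_mid]
  rfl

theorem comp_zero (F G : Coch Q) (hF : F 0 = idC Q 0) (hG : G 0 = idC Q 0) :
    comp F G 0 = idC Q 0 := by
  have h : comp F G 0 = comp (idC Q) (idC Q) 0 := by
    refine comp_congr (fun i hi => ?_) (fun i hi => ?_) <;> obtain rfl : i = 0 := by omega
    exacts [hF, hG]
  rw [h, comp_idC_left]

/-- A sequence of modifications in higher and higher degrees has a limit. -/
theorem exists_limit {S : ℕ → Type*} (Pr : ℕ → (∀ n, S n) → Prop) (t₀ : ℕ)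
    (h₀ : ∃ b, Pr t₀ b)
    (step : ∀ t ≥ t₀, ∀ b, Pr t b → ∃ b', Pr (t + 1) b' ∧ ∀ j < t, b' j = b j) :
    ∃ b : ∀ n, S n, ∀ t ≥ t₀, ∃ b', Pr t b' ∧ ∀ j < t, b j = b' j := by
  obtain ⟨b₀, h₀⟩ := h₀
  choose! g hg hg' using step
  let c : ℕ → (∀ n, S n) := fun i => Nat.rec b₀ (fun i b => g (t₀ + i) b) i
  have hc : ∀ i, Pr (t₀ + i) (c i) := by
    intro i
    induction i with
    | zero => exact h₀
    | succ i ih => exact hg _ (Nat.le_add_right _ _) _ ih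
  have hs : ∀ i m, ∀ j < t₀ + i, c (i + m) j = c i j := by
    intro i m
    induction m with
    | zero => intro j _; rfl
    | succ m ih =>
      intro j hj
      rw [← ih j hj]
      exact hg' _ (Nat.le_add_right _ _) _ (hc (i + m)) j (by omega)
  -- Stage `i` freezes all components below `t₀ + i`, so component `n` no longer changes from stage
  -- `n + 1` on.
  refine ⟨fun n => c (n + 1) n, fun t ht => ⟨c (t - t₀), ?_, fun j hj => ?_⟩⟩
  · have := hc (t - t₀)
    rwa [Nat.add_sub_cancel' ht] at this
  · rcases le_total (j + 1) (t - t₀) with h | h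
    · obtain ⟨m, hm⟩ := Nat.exists_eq_add_of_le h
      rw [hm]
      exact (hs (j + 1) m j (by omega)).symm
    · obtain ⟨m, hm⟩ := Nat.exists_eq_add_of_le h
      change c (j + 1) j = _
      rw [hm]
      exact hs (t - t₀) m j (by omega)

end Low
end
end AInf

namespace AInf
noncomputable section

/-! ### Degrees and signs -/

section Degrees

variable {k : Type w} [Field k] {N : ℕ}

section Ops

variable {A : Type v} [AddCommGroup A] [Module k A] (g : ZMod N → Submodule k A)

/-- `φ` has degree `e - (n + 1)`. -/
def OpDeg (e : ℤ) {n : ℕ} (φ : MultilinearMap k (fun _ : Fin (n + 1) => A) A) : Prop :=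
  ∀ (d : Fin (n + 1) → ZMod N) (a : Fin (n + 1) → A), (∀ p, a p ∈ g (d p)) →
    φ a ∈ g ((∑ p, d p) + ((e - (n + 1) : ℤ) : ZMod N))

variable {g}

theorem OpDeg.zero (e : ℤ) (n : ℕ) :
    OpDeg g e (0 : MultilinearMap k (fun _ : Fin (n + 1) => A) A) :=
  fun _ _ _ => Submodule.zero_mem _

theorem OpDeg.sum {e : ℤ} {n : ℕ} {ι : Type*} (S : Finset ι)
    {φ : ι → MultilinearMap k (fun _ : Fin (n + 1) => A) A} (h : ∀ j ∈ S, OpDeg g e (φ j)) :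
    OpDeg g e (∑ j ∈ S, φ j) := by
  intro d a ha
  rw [sum_apply]
  exact Submodule.sum_mem _ fun j hj => h j hj d a ha

/-- The inner maps shift the degree by `e₁ q - (s q + 1)`. As the block lengths add up to `n + 1`,
the total shift depends on the blocks only through `n`. -/
theorem OpDeg.blk {i n : ℕ} (s : Fin (i + 1) → ℕ) (h : ∑ q, (s q + 1) = n + 1)
    {f : MultilinearMap k (fun _ : Fin (i + 1) => A) A}
    {G : ∀ q, MultilinearMap k (fun _ : Fin (s q + 1) => A) A} {e e' : ℤ} {e₁ : Fin (i + 1) → ℤ}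
    (hf : OpDeg g e f) (hG : ∀ q, OpDeg g (e₁ q) (G q)) (he : e' = e + ∑ q, (e₁ q - 1)) :
    OpDeg g e' (blk s h f G) := by
  intro d a ha
  have h1 := hf _ _ fun q => hG q (fun r => d (blockIdx s h ⟨q, r⟩))
    (fun r => a (blockIdx s h ⟨q, r⟩)) fun r => ha _
  rw [blk_apply]
  convert h1 using 1
  congr 1
  rw [Finset.sum_add_distrib, ← (blockIdx s h).sum_comp d, Fintype.sum_sigma, add_assoc]
  congr 1
  rw [← Int.cast_sum, ← Int.cast_add]
  congr 1
  have h2 : ((∑ q, (s q + 1) : ℕ) : ℤ) = ((n + 1 : ℕ) : ℤ) := by rw [h]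
  push_cast at h2
  rw [he]
  simp only [Finset.sum_sub_distrib, Finset.sum_add_distrib, Finset.sum_const, Finset.card_univ,
    Fintype.card_fin, nsmul_eq_mul, mul_one] at h2 ⊢
  push_cast at h2 ⊢
  linarith

theorem OpDeg.tm {i : ℕ} {f : MultilinearMap k (fun _ : Fin (i + 1) => A) A}
    {G : Fin (i + 1) → OpFamily k A A} {e e' : ℤ} {e₁ : Fin (i + 1) → ℤ}
    (hf : OpDeg g e f) (hG : ∀ q n, OpDeg g (e₁ q) (G q n)) (he : e' = e + ∑ q, (e₁ q - 1)) (n : ℕ) :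
    OpDeg g e' (tm f G n) := by
  refine OpDeg.sum _ fun s _ => ?_
  split_ifs with h
  · exact OpDeg.blk s h hf (fun q => hG q _) he
  · exact OpDeg.zero _ _

theorem OpDeg.compO {F G : OpFamily k A A} {e : ℤ} (hF : ∀ n, OpDeg g e (F n))
    (hG : ∀ n, OpDeg g 1 (G n)) (n : ℕ) : OpDeg g e (compO F G n) :=
  OpDeg.sum _ fun i _ => OpDeg.tm (hF i) (fun _ => hG) (by simp) n

theorem OpDeg.dcompO {F a y b : OpFamily k A A} {e e₁ e' : ℤ} (hF : ∀ n, OpDeg g e (F n))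
    (ha : ∀ n, OpDeg g 1 (a n)) (hy : ∀ n, OpDeg g e₁ (y n)) (hb : ∀ n, OpDeg g 1 (b n))
    (he : e' = e + e₁ - 1) (n : ℕ) : OpDeg g e' (dcompO F a y b n) := by
  refine OpDeg.sum _ fun i _ => OpDeg.sum _ fun l _ =>
    OpDeg.tm (e₁ := fun q => if q = l then e₁ else 1) (hF i) (fun q n => ?_) ?_ n
  · rcases lt_trichotomy q l with h | rfl | h
    · rw [tri_lt _ _ _ h, if_neg h.ne]
      exact ha n
    · rw [tri_self, if_pos rfl]
      exact hy n
    · rw [tri_gt _ _ _ h, if_neg h.ne']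
      exact hb n
  · rw [Finset.sum_eq_single l (fun q _ hq => by rw [if_neg hq, sub_self]) (by simp), if_pos rfl, he]
    ring

end Ops

variable {Ob : Type u} {Q : TransversalQuiver.{w, u, v} k N Ob}

/-- A cochain whose component of index `n` has degree `e - (n + 1)`. -/
def IsDeg (e : ℤ) (F : Coch Q) : Prop :=
  ∀ (n : ℕ) (X : Fin (n + 2) → Ob) (hX : Q.Tr X) (d : Fin (n + 1) → ZMod N)
    (a : ∀ p : Fin (n + 1), Q.Hom (X p.castSucc) (X p.succ)),
    (∀ p, a p ∈ Q.gr (X p.castSucc) (X p.succ) (d p)) →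
      F n X hX a ∈ Q.gr (X 0) (X (Fin.last (n + 1))) ((∑ p, d p) + ((e - (n + 1) : ℤ) : ZMod N))

theorem sgl_mem {M : ℕ} (X : Fin (M + 1) → Ob) (q : Pr M) (d : ZMod N)
    {x : Q.Hom (X q.1.1) (X q.1.2)} (hx : x ∈ Q.gr _ _ d) : sgl X q x ∈ Q.seqGr X d := by
  intro r _
  by_cases h : r = q
  · subst h
    rw [sgl_same]
    exact hx
  · rw [sgl_ne X h]
    exact Submodule.zero_mem _

theorem IsDeg.tot {e : ℤ} {F : Coch Q} (hF : IsDeg e F) {M : ℕ} (X : Fin (M + 1) → Ob)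
    (hX : Q.Tr X) (n : ℕ) : OpDeg (Q.seqGr X) e (F.tot X hX n) := by
  intro d a ha
  rw [F.tot_apply]
  exact Submodule.sum_mem _ fun i _ => sgl_mem X _ _
    (hF n (X ∘ i) (Q.tr_sub hX i) d _ fun p => ha p (chainPr i p) (Set.mem_univ _))

theorem IsDeg.of_tot {e : ℤ} {F : Coch Q}
    (h : ∀ (n : ℕ) (X : Fin (n + 2) → Ob) (hX : Q.Tr X), OpDeg (Q.seqGr X) e (F.tot X hX n)) :
    IsDeg e F := by
  intro n X hX d a ha
  have h1 := h n X hX d (fun p => sgl X (supPr p) (a p)) fun p => sgl_mem X _ _ (ha p)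
  have h2 := h1 (topPr n) (Set.mem_univ _)
  rwa [F.tot_sup, sgl_same] at h2

theorem IsDeg.comp {e : ℤ} {F G : Coch Q} (hF : IsDeg e F) (hG : IsDeg 1 G) :
    IsDeg e (comp F G) := IsDeg.of_tot fun n X hX => by
  rw [tot_comp]
  exact OpDeg.compO (hF.tot X hX) (hG.tot X hX) n

theorem IsDeg.dcomp {e e₁ e' : ℤ} {F A Y B : Coch Q} (hF : IsDeg e F) (hA : IsDeg 1 A)
    (hY : IsDeg e₁ Y) (hB : IsDeg 1 B) (he : e' = e + e₁ - 1) : IsDeg e' (dcomp F A Y B) :=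
  IsDeg.of_tot fun n X hX => by
    rw [tot_dcomp]
    exact OpDeg.dcompO (hF.tot X hX) (hA.tot X hX) (hY.tot X hX) (hB.tot X hX) he n

theorem IsDeg.add {e : ℤ} {F G : Coch Q} (hF : IsDeg e F) (hG : IsDeg e G) : IsDeg e (F + G) :=
  fun n X hX d a ha => Submodule.add_mem _ (hF n X hX d a ha) (hG n X hX d a ha)

theorem IsDeg.neg {e : ℤ} {F : Coch Q} (hF : IsDeg e F) : IsDeg e (-F) :=
  fun n X hX d a ha => Submodule.neg_mem _ (hF n X hX d a ha)

theorem IsDeg.sub {e : ℤ} {F G : Coch Q} (hF : IsDeg e F) (hG : IsDeg e G) : IsDeg e (F - G) := by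
  rw [sub_eq_add_neg]
  exact hF.add hG.neg

theorem IsDeg.only {e : ℤ} {F : Coch Q} (hF : IsDeg e F) (t : ℕ) : IsDeg e (only t F) := by
  intro n X hX d a ha
  unfold AInf.only
  split_ifs
  · exact hF n X hX d a ha
  · exact Submodule.zero_mem _

theorem IsDeg.linC {L : ∀ X Y, Q.Hom X Y →ₗ[k] Q.Hom X Y}
    (hL : ∀ X Y d a, a ∈ Q.gr X Y d → L X Y a ∈ Q.gr X Y d) : IsDeg 1 (linC L) := by
  intro n X hX d a ha
  cases n with
  | zero =>
    have h1 := hL _ _ _ _ (ha 0)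
    have h2 : (∑ p, d p) + (((1 : ℤ) - ((0 : ℕ) + 1) : ℤ) : ZMod N) = d 0 := by simp
    rw [h2]
    exact h1
  | succ n => exact Submodule.zero_mem _

theorem IsDeg.idC : IsDeg 1 (idC Q) := IsDeg.linC fun _ _ _ _ h => h

/-! #### Signs -/

variable (k) in
/-- The sign `(-1)^x` as an element of the ground field. -/
def sg (x : ZMod 2) : k := ((((-1 : ℤˣ) ^ x : ℤˣ) : ℤ) : k)

theorem sg_add (x y : ZMod 2) : sg k (x + y) = sg k x * sg k y := by
  unfold sg
  rw [uzpow_add]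
  push_cast
  rfl

theorem sg_zero : sg k 0 = 1 := by simp [sg]

theorem sg_one : sg k 1 = -1 := by simp [sg]

theorem sg_mul_self (x : ZMod 2) : sg k x * sg k x = 1 := by
  rw [← sg_add, CharTwo.add_self_eq_zero, sg_zero]

theorem sg_sum {ι : Type*} (S : Finset ι) (f : ι → ZMod 2) :
    sg k (∑ j ∈ S, f j) = ∏ j ∈ S, sg k (f j) := by
  classical
  induction S using Finset.induction_on with
  | empty => simp [sg_zero]
  | insert j S hj ih => rw [Finset.sum_insert hj, Finset.prod_insert hj, sg_add, ih]

theorem units_smul_eq {A : Type*} [AddCommGroup A] [Module k A] (x : ZMod 2) (a : A) :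
    ((-1 : ℤˣ) ^ x) • a = sg k x • a := by
  rw [Units.smul_def, sg, Int.cast_smul_eq_zsmul]

theorem sg_smul_eq_iff {A : Type*} [AddCommGroup A] [Module k A] (x : ZMod 2) (a b : A) :
    sg k x • a = b ↔ a = sg k x • b := by
  constructor
  · rintro rfl
    rw [smul_smul, sg_mul_self, one_smul]
  · rintro rfl
    rw [smul_smul, sg_mul_self, one_smul]

theorem parity_add (hN : 2 ∣ N) (x y : ZMod N) : parity (x + y) = parity x + parity y :=
  ZMod.cast_add hN x y

theorem parity_zero : parity (0 : ZMod N) = 0 := ZMod.cast_zero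

theorem parity_intCast (hN : 2 ∣ N) (x : ℤ) : parity (x : ZMod N) = (x : ZMod 2) :=
  ZMod.cast_intCast hN x

theorem parity_sum (hN : 2 ∣ N) {ι : Type*} (S : Finset ι) (f : ι → ZMod N) :
    parity (∑ j ∈ S, f j) = ∑ j ∈ S, parity (f j) := by
  classical
  induction S using Finset.induction_on with
  | empty => simp [parity_zero]
  | insert j S hj ih => rw [Finset.sum_insert hj, Finset.sum_insert hj, parity_add hN, ih]

section Tau

variable {A : Type v} [AddCommGroup A] [Module k A] {g : ZMod N → Submodule k A}

/-- Multiplication by `(-1)^deg`. -/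
def tauL (h : DirectSum.IsInternal g) : A →ₗ[k] A :=
  letI := h.chooseDecomposition
  (DirectSum.toModule k _ A (fun d => sg k (parity d) • (g d).subtype)).comp
    (DirectSum.decomposeLinearEquiv g).toLinearMap

theorem tauL_of_mem (h : DirectSum.IsInternal g) {d : ZMod N} {a : A} (ha : a ∈ g d) :
    tauL h a = sg k (parity d) • a := by
  let _ := h.chooseDecomposition
  unfold tauL
  simp only [LinearMap.comp_apply]
  change DirectSum.toModule k _ A _ (DirectSum.decompose g a) = _
  rw [DirectSum.decompose_of_mem g ha]
  exact DirectSum.toModule_lof k d _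

theorem tauL_mem (h : DirectSum.IsInternal g) {d : ZMod N} {a : A} (ha : a ∈ g d) :
    tauL h a ∈ g d := by
  rw [tauL_of_mem h ha]
  exact Submodule.smul_mem _ _ ha

theorem tauL_pow_of_mem (h : DirectSum.IsInternal g) (j : ℕ) {d : ZMod N} {a : A}
    (ha : a ∈ g d) : (tauL h ^ j) a = sg k (j * parity d) • a := by
  induction j with
  | zero => simp [sg_zero]
  | succ j ih =>
    rw [pow_succ', Module.End.mul_apply, ih, map_smul, tauL_of_mem h ha, smul_smul, ← sg_add]
    congr 2
    push_cast
    ring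

theorem linearMap_ext_homogeneous {B : Type*} [AddCommGroup B] [Module k B]
    (h : DirectSum.IsInternal g) {L L' : A →ₗ[k] B} (hL : ∀ d, ∀ a ∈ g d, L a = L' a) : L = L' := by
  ext a
  have ha : a ∈ ⨆ i, g i := by
    rw [h.submodule_iSup_eq_top]
    trivial
  induction ha using Submodule.iSup_induction' with
  | mem i x hx => exact hL i x hx
  | zero => rw [map_zero, map_zero]
  | add x y _ _ hx hy => rw [map_add, map_add, hx, hy]

theorem tauL_tauL (h : DirectSum.IsInternal g) (a : A) : tauL h (tauL h a) = a := by
  have h1 : (tauL h).comp (tauL h) = LinearMap.id := by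
    refine linearMap_ext_homogeneous h fun d a ha => ?_
    rw [LinearMap.comp_apply, tauL_of_mem h ha, map_smul, tauL_of_mem h ha, smul_smul, sg_mul_self,
      one_smul]
    rfl
  exact LinearMap.congr_fun h1 a

theorem tauL_pow_mul_self (h : DirectSum.IsInternal g) (j : ℕ) : tauL h ^ j * tauL h ^ j = 1 := by
  rw [← (Commute.refl (tauL h)).mul_pow]
  have h1 : tauL h * tauL h = 1 := LinearMap.ext fun a => tauL_tauL h a
  rw [h1, one_pow]

end Tau

/-- Multiplication by `(-1)^deg` on a morphism space. -/
abbrev TransversalQuiver.tau (Q : TransversalQuiver.{w, u, v} k N Ob) (X Y : Ob) :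
    Q.Hom X Y →ₗ[k] Q.Hom X Y := tauL (Q.isInternal X Y)

/-- Multiplication by the `p`-th power of `(-1)^(deg - 1)`. -/
def tC (Q : TransversalQuiver.{w, u, v} k N Ob) (p : ℕ) : Coch Q :=
  linC fun X Y => (-Q.tau X Y) ^ p

theorem neg_tau_pow_mem (p : ℕ) {X Y : Ob} {d : ZMod N} {a : Q.Hom X Y} (ha : a ∈ Q.gr X Y d) :
    ((-Q.tau X Y) ^ p) a ∈ Q.gr X Y d := by
  induction p with
  | zero => exact ha
  | succ p ih =>
    rw [pow_succ', Module.End.mul_apply]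
    exact Submodule.neg_mem _ (tauL_mem _ ih)

theorem IsDeg.tC (p : ℕ) : IsDeg 1 (tC Q p) := IsDeg.linC fun _ _ _ _ => neg_tau_pow_mem p

theorem tC_zero : tC Q 0 = idC Q := by
  unfold tC idC
  simp only [pow_zero]
  rfl

theorem tC_two : tC Q 2 = idC Q := by
  unfold tC idC
  congr 1
  funext X Y
  refine LinearMap.ext fun a => ?_
  rw [pow_two, neg_mul_neg, Module.End.mul_apply, tauL_tauL]
  rfl

/-- Multiplication by `(-1)^(deg - 1)` on `⨁_{i < j} Hom (X i) (X j)`. -/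
abbrev seqT {M : ℕ} (X : Fin (M + 1) → Ob) : Q.SeqHom X →ₗ[k] Q.SeqHom X :=
  seqMap (fun X Y => (-Q.tau X Y) ^ 1) X

theorem seqT_of_mem {M : ℕ} (X : Fin (M + 1) → Ob) {d : ZMod N} {a : Q.SeqHom X}
    (ha : a ∈ Q.seqGr X d) : seqT X a = - sg k (parity d) • a := by
  funext q
  change ((-Q.tau _ _) ^ 1) (a q) = - sg k (parity d) • a q
  rw [pow_one, LinearMap.neg_apply, tauL_of_mem _ (ha q (Set.mem_univ _)), neg_smul]

theorem seqT_seqT {M : ℕ} (X : Fin (M + 1) → Ob) (a : Q.SeqHom X) : seqT X (seqT X a) = a := by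
  funext q
  change ((-Q.tau _ _) ^ 1) (((-Q.tau _ _) ^ 1) (a q)) = a q
  rw [pow_one, LinearMap.neg_apply, LinearMap.neg_apply, map_neg, neg_neg, tauL_tauL]

theorem chat_tC {M : ℕ} (X : Fin (M + 1) → Ob) (hX : Q.Tr X) (x : Q.SeqHom X) :
    chat (tC Q 1) X hX x = seqT X x := chat_linC X hX _ x

theorem seq_ext_homogeneous {M : ℕ} {X : Fin (M + 1) → Ob} {n : ℕ} {B : Type v} [AddCommGroup B]
    [Module k B] {φ ψ : MultilinearMap k (fun _ : Fin (n + 1) => Q.SeqHom X) B}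
    (h : ∀ (d : Fin (n + 1) → ZMod N) (a : Fin (n + 1) → Q.SeqHom X),
      (∀ p, a p ∈ Q.seqGr X (d p)) → φ a = ψ a) : φ = ψ := by
  refine MultilinearMap.ext fun a => ?_
  have ha : a = fun p => ∑ q, sgl X q (a p q) := by
    funext p
    exact (sum_sgl X (a p)).symm
  rw [ha, φ.map_sum, ψ.map_sum]
  refine Finset.sum_congr rfl fun r _ => ?_
  have h1 : φ.compLinearMap (fun p => sgl X (r p)) = ψ.compLinearMap (fun p => sgl X (r p)) :=
    multilinear_ext_homogeneous _ (fun p => Q.isInternal _ _) _ _ fun d c hc =>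
      h d _ fun p => sgl_mem X (r p) (d p) (hc p)
  exact DFunLike.congr_fun h1 fun p => a p (r p)

/-- The inputs contribute `(-1)^(d_p - 1)` each, and the output has degree `∑ d_p + e - (n + 1)`;
the two signs differ by `(-1)^(e - 1)`. Thus `T` commutes with morphisms (`e = 1`) and anticommutes
with structures (`e = 2`). -/
theorem tot_seqT (hN : 2 ∣ N) {e : ℤ} {F : Coch Q} (hF : IsDeg e F) {M : ℕ}
    (X : Fin (M + 1) → Ob) (hX : Q.Tr X) (n : ℕ) (a : Fin (n + 1) → Q.SeqHom X) :
    F.tot X hX n (fun p => seqT X (a p)) =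
      sg k ((e - 1 : ℤ) : ZMod 2) • seqT X (F.tot X hX n a) := by
  suffices H : (F.tot X hX n).compLinearMap (fun _ => seqT X) =
      sg k ((e - 1 : ℤ) : ZMod 2) • (seqT X).compMultilinearMap (F.tot X hX n) from
    DFunLike.congr_fun H a
  refine seq_ext_homogeneous fun d a ha => ?_
  have h1 : ∀ p, seqT X (a p) = sg k (1 + parity (d p)) • a p := by
    intro p
    rw [seqT_of_mem X (ha p), sg_add, sg_one, neg_one_mul]
  have h2 := hF.tot X hX n d a ha
  rw [MultilinearMap.compLinearMap_apply, smul_apply,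
    LinearMap.compMultilinearMap_apply, seqT_of_mem X h2]
  simp only [h1]
  rw [MultilinearMap.map_smul_univ, ← sg_sum, smul_smul, ← neg_one_mul, ← sg_one, ← sg_add,
    ← sg_add]
  congr 2
  rw [parity_add hN, parity_sum hN, parity_intCast hN, Finset.sum_add_distrib]
  simp only [Finset.sum_const, Finset.card_univ, Fintype.card_fin, nsmul_eq_mul, mul_one]
  push_cast
  have h3 : (2 : ZMod 2) = 0 := rfl
  linear_combination (-(e : ZMod 2) + n + 1) * h3

theorem chat_seqT (hN : 2 ∣ N) {e : ℤ} {F : Coch Q} (hF : IsDeg e F) {M : ℕ}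
    (X : Fin (M + 1) → Ob) (hX : Q.Tr X) (x : Q.SeqHom X) :
    chat F X hX (seqT X x) = sg k ((e - 1 : ℤ) : ZMod 2) • seqT X (chat F X hX x) := by
  unfold chat hat
  rw [map_sum, Finset.smul_sum]
  exact Finset.sum_congr rfl fun n _ => tot_seqT hN hF X hX n _

theorem chat_seqT_one (hN : 2 ∣ N) {F : Coch Q} (hF : IsDeg 1 F) {M : ℕ}
    (X : Fin (M + 1) → Ob) (hX : Q.Tr X) (x : Q.SeqHom X) :
    chat F X hX (seqT X x) = seqT X (chat F X hX x) := by
  rw [chat_seqT hN hF]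
  simp [sg_zero]

theorem chat_seqT_two (hN : 2 ∣ N) {F : Coch Q} (hF : IsDeg 2 F) {M : ℕ}
    (X : Fin (M + 1) → Ob) (hX : Q.Tr X) (x : Q.SeqHom X) :
    chat F X hX (seqT X x) = - seqT X (chat F X hX x) := by
  rw [chat_seqT hN hF]
  norm_num [sg_one]

end Degrees
end
end AInf

namespace AInf
noncomputable section

/-! ### Suspension -/

section BlockIdx

theorem blockStart_single {i : ℕ} (l q : Fin (i + 1)) (j : ℕ) :
    blockStart (Pi.single l j) q = if (q : ℕ) ≤ l then (q : ℕ) else q + j := by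
  unfold blockStart
  rw [Finset.sum_add_distrib]
  have h1 : ∑ p ∈ Finset.univ.filter (fun p => p < q), 1 = (q : ℕ) := by
    rw [Finset.sum_const, smul_eq_mul, mul_one]
    have : Finset.univ.filter (fun p => p < q) = Finset.Iio q := by ext; simp
    rw [this, Fin.card_Iio]
  rw [h1, Finset.sum_pi_single' l j]
  simp only [Finset.mem_filter, Finset.mem_univ, true_and, Fin.lt_def]
  split_ifs <;> omega

theorem sum_blocks {B : Type*} [AddCommMonoid B] {i n : ℕ} (s : Fin (i + 1) → ℕ)
    (h : ∑ q, (s q + 1) = n + 1) (g : ℕ → B) :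
    ∑ P ∈ Finset.range (n + 1), g P =
      ∑ q, ∑ r ∈ Finset.range (s q + 1), g (blockStart s q + r) := by
  rw [Finset.sum_range, ← (blockIdx s h).sum_comp, Fintype.sum_sigma]
  refine Finset.sum_congr rfl fun q _ => ?_
  rw [Finset.sum_range]
  exact Finset.sum_congr rfl fun r _ => by rw [blockIdx_val]

theorem blockStart_le {i n : ℕ} (s : Fin (i + 1) → ℕ) (h : ∑ q, (s q + 1) = n + 1)
    (q : Fin (i + 1)) : blockStart s q ≤ n := by
  have h1 := (blockIdx s h ⟨q, 0⟩).2
  rw [blockIdx_val] at h1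
  simp only [Fin.val_zero] at h1
  omega

theorem sum_blocks_before {B : Type*} [AddCommMonoid B] {i n : ℕ} (s : Fin (i + 1) → ℕ)
    (h : ∑ q, (s q + 1) = n + 1) (g : ℕ → B) (q' : Fin (i + 1)) :
    ∑ P ∈ Finset.range (blockStart s q'), g P =
      ∑ q, if q < q' then ∑ r ∈ Finset.range (s q + 1), g (blockStart s q + r) else 0 := by
  have h1 : ∑ P ∈ Finset.range (blockStart s q'), g P =
      ∑ P ∈ Finset.range (n + 1), if P < blockStart s q' then g P else 0 := by
    rw [← Finset.sum_filter]
    refine Finset.sum_congr ?_ fun _ _ => rfl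
    ext P
    have := blockStart_le s h q'
    simp only [Finset.mem_range, Finset.mem_filter]
    omega
  rw [h1, sum_blocks s h]
  refine Finset.sum_congr rfl fun q _ => ?_
  split_ifs with hq
  · refine Finset.sum_congr rfl fun r hr => if_pos ?_
    have h2 := blockStart_mono s hq
    rw [Finset.mem_range] at hr
    omega
  · refine Finset.sum_eq_zero fun r hr => if_neg ?_
    rcases (not_lt.1 hq).eq_or_lt with h2 | h2
    · subst h2
      omega
    · have h2 := blockStart_mono s h2
      omega

theorem blockStart_eq_add {i : ℕ} (s : Fin (i + 1) → ℕ) (q : Fin (i + 1)) :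
    blockStart s q = q + ∑ p, if p < q then s p else 0 := by
  unfold blockStart
  rw [Finset.sum_add_distrib, add_comm, ← Finset.sum_filter]
  congr 1
  rw [Finset.sum_const, smul_eq_mul, mul_one]
  have : Finset.univ.filter (fun p => p < q) = Finset.Iio q := by ext; simp
  rw [this, Fin.card_Iio]

end BlockIdx

section Suspension

variable {k : Type w} [Field k] {N : ℕ}

section Ops

variable {A : Type v} [AddCommGroup A] [Module k A]

theorem opFamily_apply_eq (F : OpFamily k A A) {j j' : ℕ} (h : j = j') (c c' : ℕ → A)
    (hc : ∀ r, c r = c' r) : F j (fun r : Fin (j + 1) => c r) = F j' (fun r => c' r) := by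
  subst h
  simp only [hc]

/-- As `a` and `b` are linear, every block except the one at `l` has length one, and `Pi.single l (n
- i)` is the only tuple of lengths that contributes. -/
theorem tm_tri_linear {i n : ℕ} (hi : i ≤ n) (f : MultilinearMap k (fun _ : Fin (i + 1) => A) A)
    {a y b : OpFamily k A A} {L L' : A → A} (ha : ∀ j, a (j + 1) = 0) (hb : ∀ j, b (j + 1) = 0)
    (ha' : ∀ c, a 0 c = L (c 0)) (hb' : ∀ c, b 0 c = L' (c 0)) (l : Fin (i + 1)) (x : ℕ → A) :
    tm f (tri a y b l) n (fun p => x p) = f (fun q => if (q : ℕ) < l then L (x q) else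
      if (q : ℕ) = l then y (n - i) (fun r => x (l + r)) else L' (x (q + (n - i)))) := by
  have hs0 : ∑ q, ((Pi.single l (n - i) : Fin (i + 1) → ℕ) q + 1) = n + 1 := by
    rw [Finset.sum_add_distrib, Finset.sum_pi_single' l (n - i)]
    simp
    omega
  unfold tm
  rw [sum_apply, Finset.sum_eq_single (Pi.single l (n - i))]
  · rw [dif_pos hs0, blk_apply]
    congr 1
    funext q
    have hx : ∀ r, x (blockIdx _ hs0 ⟨q, r⟩) =
        x ((if (q : ℕ) ≤ l then (q : ℕ) else q + (n - i)) + r) := by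
      intro r
      rw [blockIdx_val, blockStart_single]
    simp only [hx]
    rcases lt_trichotomy q l with hq | rfl | hq
    · have hq' := Fin.lt_def.1 hq
      rw [tri_lt _ _ _ hq, if_pos hq', opFamily_apply_eq a (j' := 0) (Pi.single_eq_of_ne hq.ne _)
        (fun r => x ((if (q : ℕ) ≤ l then (q : ℕ) else q + (n - i)) + r)) _ (fun _ => rfl), ha',
        if_pos hq'.le]
      rfl
    · rw [tri_self, if_neg (lt_irrefl _), if_pos rfl]
      refine opFamily_apply_eq y (Pi.single_eq_same (M := fun _ => ℕ) q (n - i))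
        (fun r => x ((if (q : ℕ) ≤ q then (q : ℕ) else q + (n - i)) + r))
        (fun r => x (q + r)) fun r => ?_
      rw [if_pos le_rfl]
    · have hq' := Fin.lt_def.1 hq
      rw [tri_gt _ _ _ hq, if_neg hq'.not_gt, if_neg hq'.ne',
        opFamily_apply_eq b (j' := 0) (Pi.single_eq_of_ne hq.ne' _)
        (fun r => x ((if (q : ℕ) ≤ l then (q : ℕ) else q + (n - i)) + r)) _ (fun _ => rfl), hb',
        if_neg hq'.not_ge]
      rfl
  · intro s _ hs
    by_cases h : ∑ q, (s q + 1) = n + 1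
    · rw [dif_pos h]
      have h1 : ∃ q, q ≠ l ∧ s q ≠ 0 := by
        by_contra hcon
        push Not at hcon
        refine hs ?_
        have h2 : s = Pi.single l (s l) := by
          funext q
          by_cases hq : q = l
          · subst hq
            rw [Pi.single_eq_same]
          · rw [Pi.single_eq_of_ne hq, hcon q hq]
        have h3 := h
        rw [h2, Finset.sum_add_distrib, Finset.sum_pi_single' l (s l)] at h3
        simp at h3
        rw [h2]
        congr 1
        omega
      obtain ⟨q, hq, hq0⟩ := h1
      obtain ⟨m, hm⟩ := Nat.exists_eq_succ_of_ne_zero hq0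
      rw [blk_zero_right s h f _ q]
      · rfl
      · rcases lt_or_gt_of_ne hq with hq | hq
        · rw [tri_lt _ _ _ hq, hm]
          exact ha m
        · rw [tri_gt _ _ _ hq, hm]
          exact hb m
    · rw [dif_neg h]
      rfl
  · intro h
    refine absurd ?_ h
    rw [Fintype.mem_piFinset]
    intro q
    rw [Finset.mem_range]
    by_cases hq : q = l
    · subst hq
      rw [Pi.single_eq_same]
      omega
    · rw [Pi.single_eq_of_ne hq]
      omega

end Ops

variable {Ob : Type u} {Q : TransversalQuiver.{w, u, v} k N Ob}

/-- The suspension `(a_0, …, a_n) ↦ F ((-1)^(n deg a_0) a_0, …, (-1)^(deg a_(n-1)) a_(n-1), a_n)` of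
a cochain. -/
def susp (F : Coch Q) : Coch Q := fun n X hX =>
  (F n X hX).compLinearMap fun p : Fin (n + 1) => (Q.tau (X p.castSucc) (X p.succ)) ^ (n - p : ℕ)

theorem susp_susp (F : Coch Q) : susp (susp F) = F := by
  funext n X hX
  refine MultilinearMap.ext fun a => ?_
  change F n X hX (fun p => ((Q.tau _ _) ^ (n - p : ℕ)) (((Q.tau _ _) ^ (n - p : ℕ)) (a p))) = _
  congr 1
  funext p
  rw [← Module.End.mul_apply, tauL_pow_mul_self]
  rfl

theorem susp_eq_zero {F : Coch Q} {n : ℕ} (h : F n = 0) : susp F n = 0 := by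
  funext X hX
  refine MultilinearMap.ext fun a => ?_
  change F n X hX _ = 0
  rw [h]
  rfl

theorem susp_congr {F G : Coch Q} {n : ℕ} (h : F n = G n) : susp F n = susp G n := by
  unfold susp
  rw [h]

theorem tau_pow_mem (j : ℕ) {X Y : Ob} {d : ZMod N} {a : Q.Hom X Y} (ha : a ∈ Q.gr X Y d) :
    (Q.tau X Y ^ j) a ∈ Q.gr X Y d := by
  rw [tauL_pow_of_mem _ _ ha]
  exact Submodule.smul_mem _ _ ha

theorem IsDeg.susp {e : ℤ} {F : Coch Q} (hF : IsDeg e F) : IsDeg e (susp F) :=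
  fun n X hX d _ ha => hF n X hX d _ fun p => tau_pow_mem _ (ha p)

theorem tot_susp (F : Coch Q) {M : ℕ} (X : Fin (M + 1) → Ob) (hX : Q.Tr X) (n : ℕ)
    (a : Fin (n + 1) → Q.SeqHom X) : (susp F).tot X hX n a =
      F.tot X hX n (fun p => seqMap (fun X Y => Q.tau X Y ^ (n - p : ℕ)) X (a p)) := by
  rw [Coch.tot_apply, Coch.tot_apply]
  rfl

theorem tot_susp_of_mem (F : Coch Q) {M : ℕ} (X : Fin (M + 1) → Ob) (hX : Q.Tr X) (n : ℕ)
    (d : Fin (n + 1) → ZMod N) (a : Fin (n + 1) → Q.SeqHom X) (ha : ∀ p, a p ∈ Q.seqGr X (d p)) :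
    (susp F).tot X hX n a =
      sg k (∑ p : Fin (n + 1), ((n : ZMod 2) + ((p : ℕ) : ZMod 2)) * parity (d p)) •
        F.tot X hX n a := by
  rw [tot_susp, sg_sum, ← MultilinearMap.map_smul_univ]
  congr 1
  funext p q
  change (Q.tau _ _ ^ (n - p : ℕ)) (a p q) =
    sg k (((n : ZMod 2) + ((p : ℕ) : ZMod 2)) * parity (d p)) • a p q
  rw [tauL_pow_of_mem _ _ (ha p q (Set.mem_univ _)), Nat.cast_sub (Nat.lt_succ_iff.1 p.2),
    CharTwo.sub_eq_add]

/-- The sign of the suspension. -/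
def suspSign {N : ℕ} (n : ℕ) (d : ℕ → ZMod N) : ZMod 2 :=
  ∑ s ∈ Finset.range (n + 1), ((n : ZMod 2) + (s : ZMod 2)) * parity (d s)

/-- On homogeneous inputs `susp` multiplies by a sign that is linear in the degrees. When these
signs and those of `T` are moved outside, each term keeps its sign `ε` and acquires `suspSign n d`,
which depends on the inputs only and is therefore common to all terms. -/
theorem dcompO_susp (hN : 2 ∣ N) (F : Coch Q) {μ : Coch Q} (hμ : IsDeg 2 μ) {M : ℕ}
    (X : Fin (M + 1) → Ob) (hX : Q.Tr X) (n : ℕ) (d : ℕ → ZMod N) (a : ℕ → Q.SeqHom X)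
    (ha : ∀ s, a s ∈ Q.seqGr X (d s)) :
    dcompO ((susp F).tot X hX) ((tC Q 1).tot X hX) ((susp μ).tot X hX) ((idC Q).tot X hX) n
      (fun p => a p) =
      sg k (suspSign n d) • insertionSum (F.tot X hX) (μ.tot X hX) n d a := by
  unfold dcompO insertionSum
  rw [sum_apply, Finset.Nat.sum_antidiagonal_eq_sum_range_succ_mk, Finset.smul_sum]
  refine Finset.sum_congr rfl fun i hi => ?_
  have hin : i ≤ n := Nat.lt_succ_iff.1 (Finset.mem_range.1 hi)
  rw [sum_apply, Finset.sum_range, Finset.smul_sum]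
  refine Finset.sum_congr rfl fun l _ => ?_
  rw [tm_tri_linear hin _ (a := (tC Q 1).tot X hX) (b := (idC Q).tot X hX)
    (L := seqT X) (L' := fun x => x) (fun j => tot_linC_succ X hX _ j)
    (fun j => tot_linC_succ X hX _ j)
    (fun c => tot_linC_zero X hX _ c) (fun c => tot_linC_zero X hX _ c), units_smul_eq (k := k), smul_smul]
  dsimp only
  generalize hj : n - i = j
  obtain rfl : n = i + j := by omega
  set D : ℕ → ZMod 2 := fun s => parity (d s) with hD
  have hl : (l : ℕ) ≤ i := Nat.lt_succ_iff.1 l.2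
  have h2 : (2 : ZMod 2) = 0 := rfl
  -- the entries of the inner sequence
  have hin1 := tot_susp_of_mem μ X hX j (fun r => d (l + r)) (fun r => a (l + r)) (fun r => ha _)
  have hdeg := hμ.tot X hX j (fun r => d (l + r)) (fun r => a (l + r)) (fun r => ha _)
  set dl : ZMod N := (∑ p : Fin (j + 1), d (l + p)) + ((2 - (j + 1) : ℤ) : ZMod N) with hdl
  set dd : Fin (i + 1) → ZMod N := fun q => if (q : ℕ) < l then d q else if (q : ℕ) = l then dl else
    d (q + j) with hdd
  set ζ : ZMod 2 := ∑ p : Fin (j + 1), ((j : ZMod 2) + ((p : ℕ) : ZMod 2)) * D (l + p) with hζ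
  have hins : ∀ q : Fin (i + 1), insertOp (μ.tot X hX j) l a q ∈ Q.seqGr X (dd q) := by
    intro q
    simp only [insertOp, hdd]
    split_ifs
    exacts [ha _, hdeg, ha _]
  have hc : (fun q : Fin (i + 1) => if (q : ℕ) < l then seqT X (a q)
      else if (q : ℕ) = l then (susp μ).tot X hX j (fun r => a (l + r)) else
        a (q + j)) =
      fun q : Fin (i + 1) => sg k (if (q : ℕ) < l then 1 + D q else if (q : ℕ) = l then ζ else 0) •
        insertOp (μ.tot X hX j) l a q := by
    funext q
    unfold insertOp
    split_ifs with h1 h1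
    · rw [seqT_of_mem X (ha q), sg_add, sg_one, neg_one_mul]
    · exact hin1
    · rw [sg_zero, one_smul]
  rw [hc, tot_susp_of_mem F X hX i dd _ (fun q => Submodule.smul_mem _ _ (hins q)),
    MultilinearMap.map_smul_univ, ← sg_sum, smul_smul, ← sg_add, ← sg_add]
  congr 2
  -- the signs
  have hdlp : parity dl = (∑ r ∈ Finset.range (j + 1), D (l + r)) + (1 + j) := by
    rw [hdl, parity_add hN, parity_sum hN, parity_intCast hN, Finset.sum_range]
    congr 1
    push_cast
    linear_combination (-(j : ZMod 2)) * h2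
  have hζ' : ζ = ∑ r ∈ Finset.range (j + 1), ((j : ZMod 2) + (r : ZMod 2)) * D (l + r) := by
    rw [hζ, Finset.sum_range]
  -- Here `t` counts the entries after the inserted operation; sums over positions split into the
  -- parts before, inside and after it.
  obtain ⟨t, ht⟩ := Nat.exists_eq_add_of_le hl
  have hsplit : ∀ g : ℕ → ZMod 2, ∑ s ∈ Finset.range (i + j + 1), g s =
      ∑ s ∈ Finset.range l, g s + (∑ r ∈ Finset.range (j + 1), g (l + r) +
        ∑ r ∈ Finset.range t, g (l + 1 + r + j)) := by
    intro g
    rw [show i + j + 1 = (l : ℕ) + ((j + 1) + t) by omega, Finset.sum_range_add, Finset.sum_range_add]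
    congr 2
    exact Finset.sum_congr rfl fun r _ => congrArg g (by ring)
  have hsplit' : ∀ g : ℕ → ZMod 2, ∑ q : Fin (i + 1), g q =
      ∑ s ∈ Finset.range l, g s + (g l + ∑ r ∈ Finset.range t, g (l + 1 + r)) := by
    intro g
    have hi1 : i + 1 = (l : ℕ) + (1 + t) := by omega
    rw [← Finset.sum_range g]
    refine (congrArg (fun m => ∑ s ∈ Finset.range m, g s) hi1).trans ?_
    rw [Finset.sum_range_add, Finset.sum_range_add, Finset.sum_range_one]
    congr 2
    exact Finset.sum_congr rfl fun r _ => congrArg g (by ring)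
  -- `U q` collects the sign at slot `q` of the outer map: its suspension sign together with the
  -- sign of `T` before slot `l` and the inner suspension sign at slot `l`.
  obtain ⟨U, hU⟩ : ∃ U : ℕ → ZMod 2, U = fun q : ℕ => if q < (l : ℕ) then ((i : ZMod 2) + q + 1) * D q + 1
      else if q = l then (i + q) * parity dl + ζ else (i + q) * D (q + j) := ⟨_, rfl⟩
  have hL : ∑ q : Fin (i + 1), ((i : ZMod 2) + ((q : ℕ) : ZMod 2)) * parity (dd q) +
      ∑ q : Fin (i + 1), (if (q : ℕ) < l then 1 + D q else if (q : ℕ) = l then ζ else 0) =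
      ∑ q : Fin (i + 1), U q := by
    rw [← Finset.sum_add_distrib]
    refine Finset.sum_congr rfl fun q _ => ?_
    simp only [hdd, hU]
    split_ifs <;> simp only [hD] <;> ring
  refine (add_comm _ _).trans ?_
  rw [add_comm, hL]
  refine (hsplit' U).trans ?_
  rw [suspSign, hsplit]
  have e1 : ∑ s ∈ Finset.range (l : ℕ), U s =
      ∑ s ∈ Finset.range (l : ℕ), (((i + j : ℕ) : ZMod 2) + s) * parity (d s) +
        (((j + 1 : ℕ) : ZMod 2) * ∑ s ∈ Finset.range (l : ℕ), D s + l) := by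
    have e0 : (((l : ℕ) : ZMod 2)) = ∑ s ∈ Finset.range (l : ℕ), 1 := by simp
    rw [e0, Finset.mul_sum, ← Finset.sum_add_distrib, ← Finset.sum_add_distrib]
    refine Finset.sum_congr rfl fun s hs => ?_
    simp only [hU, if_pos (Finset.mem_range.1 hs)]
    push_cast
    linear_combination (-(j : ZMod 2) * D s) * h2
  have e2 : U l =
      ∑ r ∈ Finset.range (j + 1), (((i + j : ℕ) : ZMod 2) + ((l + r : ℕ) : ZMod 2)) *
        parity (d (l + r)) + (i + l) * (1 + j) := by
    simp only [hU, lt_irrefl, if_false, if_true]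
    rw [hdlp, hζ', mul_add, Finset.mul_sum, add_right_comm, ← Finset.sum_add_distrib]
    congr 1
    refine Finset.sum_congr rfl fun r _ => ?_
    push_cast
    ring
  have e3 : ∑ r ∈ Finset.range t, U (l + 1 + r) =
      ∑ r ∈ Finset.range t, (((i + j : ℕ) : ZMod 2) + ((l + 1 + r + j : ℕ) : ZMod 2)) *
        parity (d (l + 1 + r + j)) := by
    refine Finset.sum_congr rfl fun r _ => ?_
    have h3 : ¬ ((l : ℕ) + 1 + r < l) := by omega
    have h4 : ¬ ((l : ℕ) + 1 + r = l) := by omega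
    simp only [hU, if_neg h3, if_neg h4]
    push_cast
    linear_combination (-(j : ZMod 2) * D (l + 1 + r + j)) * h2
  rw [e1, e2, e3]
  push_cast
  linear_combination (l : ZMod 2) * h2

/-- The analogue of `dcompO_susp` for decompositions into blocks: the sign `γ` is what remains of
the suspension signs after the common factor `suspSign n d` is taken out. -/
theorem compO_susp (hN : 2 ∣ N) (F : Coch Q) {f : Coch Q} (hf : IsDeg 1 f) {M : ℕ}
    (X : Fin (M + 1) → Ob) (hX : Q.Tr X) (n : ℕ) (d : ℕ → ZMod N) (a : ℕ → Q.SeqHom X)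
    (ha : ∀ s, a s ∈ Q.seqGr X (d s)) :
    compO ((susp F).tot X hX) ((susp f).tot X hX) n (fun p => a p) =
      sg k (suspSign n d) • blockSum (F.tot X hX) (f.tot X hX) n d a := by
  unfold compO blockSum
  rw [sum_apply, Finset.smul_sum]
  refine Finset.sum_congr rfl fun i hi => ?_
  have hin : i ≤ n := Nat.lt_succ_iff.1 (Finset.mem_range.1 hi)
  have hiff : ∀ s : Fin (i + 1) → ℕ, ∑ q, (s q + 1) = n + 1 ↔
      s ∈ Finset.Nat.antidiagonalTuple (i + 1) (n - i) := by
    intro s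
    rw [Finset.Nat.mem_antidiagonalTuple, Finset.sum_add_distrib]
    simp only [Finset.sum_const, Finset.card_univ, Fintype.card_fin, smul_eq_mul, mul_one]
    omega
  have hsub : Finset.Nat.antidiagonalTuple (i + 1) (n - i) ⊆
      Fintype.piFinset (fun _ : Fin (i + 1) => Finset.range (n + 1)) := by
    intro s hs
    rw [Fintype.mem_piFinset]
    intro q
    have := (le_of_sum_succ ((hiff s).2 hs)).2 q
    rw [Finset.mem_range]
    omega
  unfold tm
  rw [← Finset.sum_subset hsub (fun s _ hs => dif_neg fun h => hs ((hiff s).1 h)), sum_apply,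
    Finset.smul_sum]
  refine Finset.sum_congr rfl fun s hs => ?_
  have h := (hiff s).2 hs
  rw [dif_pos h, blk_apply, units_smul_eq (k := k), smul_smul]
  set D : ℕ → ZMod 2 := fun s => parity (d s) with hD
  have h2 : (2 : ZMod 2) = 0 := rfl
  simp only [blockIdx_val]
  set ζ : Fin (i + 1) → ZMod 2 := fun q =>
    ∑ r : Fin (s q + 1), ((s q : ZMod 2) + ((r : ℕ) : ZMod 2)) * D (blockStart s q + r) with hζ
  set dd : Fin (i + 1) → ZMod N := fun q =>
    (∑ r : Fin (s q + 1), d (blockStart s q + r)) + ((1 - (s q + 1) : ℤ) : ZMod N) with hdd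
  have hc : (fun q => (susp f).tot X hX (s q) (fun r => a (blockStart s q + r))) =
      fun q => sg k (ζ q) • f.tot X hX (s q) (fun r => a (blockStart s q + r)) := by
    funext q
    exact tot_susp_of_mem f X hX (s q) (fun r => d (blockStart s q + r))
      (fun r => a (blockStart s q + r)) (fun r => ha _)
  have hdeg : ∀ q, f.tot X hX (s q) (fun r => a (blockStart s q + r)) ∈ Q.seqGr X (dd q) := fun q =>
    hf.tot X hX (s q) (fun r => d (blockStart s q + r))
      (fun r => a (blockStart s q + r)) (fun r => ha _)
  rw [hc, tot_susp_of_mem F X hX i dd _ (fun q => Submodule.smul_mem _ _ (hdeg q)),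
    MultilinearMap.map_smul_univ, ← sg_sum, smul_smul, ← sg_add, ← sg_add]
  congr 2
  have hddp : ∀ q, parity (dd q) =
      (∑ r ∈ Finset.range (s q + 1), D (blockStart s q + r)) + s q := by
    intro q
    rw [hdd, parity_add hN, parity_sum hN, parity_intCast hN, Finset.sum_range]
    congr 1
    push_cast
    linear_combination (-(s q : ZMod 2)) * h2
  have hζ' : ∀ q, ζ q =
      ∑ r ∈ Finset.range (s q + 1), ((s q : ZMod 2) + (r : ZMod 2)) * D (blockStart s q + r) := by
    intro q
    simp only [hζ]
    rw [Finset.sum_range]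
  simp only [hddp, hζ']
  set Z : Fin (i + 1) → ZMod 2 := fun q => ∑ r ∈ Finset.range (s q + 1), D (blockStart s q + r)
    with hZ
  have hb : ∀ q, ∑ P ∈ Finset.range (blockStart s q), D P = ∑ q', if q' < q then Z q' else 0 :=
    sum_blocks_before s h D
  -- Exchange of summation: `γ` pairs each block with the entries before it, while the suspension
  -- signs are collected by the block that contains the entry.
  have hswap : ∑ q : Fin (i + 1), (s q : ZMod 2) * ∑ P ∈ Finset.range (blockStart s q), D P =
      ∑ q, (∑ p, if q < p then (s p : ZMod 2) else 0) * Z q := by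
    simp only [hb, Finset.mul_sum, Finset.sum_mul]
    rw [Finset.sum_comm]
    refine Finset.sum_congr rfl fun q _ => Finset.sum_congr rfl fun p _ => ?_
    split_ifs <;> simp
  have hsus : suspSign n d = ∑ q : Fin (i + 1), ∑ r ∈ Finset.range (s q + 1),
      ((n : ZMod 2) + ((blockStart s q + r : ℕ) : ZMod 2)) * D (blockStart s q + r) :=
    sum_blocks s h _
  rw [hswap, hsus]
  rw [← Finset.sum_add_distrib, ← Finset.sum_add_distrib, ← Finset.sum_add_distrib]
  refine Finset.sum_congr rfl fun q _ => ?_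
  have hq : (q : ℕ) ≤ i := Nat.lt_succ_iff.1 q.2
  -- The coefficient of the total degree of block `q` is, modulo two, the sum of the numbers `s p`
  -- over the later blocks.
  have hcoef : (i : ZMod 2) + (q : ℕ) + s q + n + blockStart s q =
      ∑ p, if q < p then (s p : ZMod 2) else 0 := by
    have h3 : (n : ZMod 2) = i + ∑ p, (s p : ZMod 2) := by
      have h4 := congrArg (fun x : ℕ => (x : ZMod 2)) h
      simp only [Finset.sum_add_distrib, Finset.sum_const, Finset.card_univ, Fintype.card_fin,
        smul_eq_mul, mul_one] at h4
      push_cast at h4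
      linear_combination -h4
    have h5 : ∑ p, (s p : ZMod 2) = (∑ p, if p < q then (s p : ZMod 2) else 0) + s q +
        ∑ p, if q < p then (s p : ZMod 2) else 0 := by
      have h6 : (s q : ZMod 2) = ∑ p, if p = q then (s p : ZMod 2) else 0 := by simp
      rw [h6, ← Finset.sum_add_distrib, ← Finset.sum_add_distrib]
      refine Finset.sum_congr rfl fun p _ => ?_
      rcases lt_trichotomy p q with hp | rfl | hp
      · simp [hp, hp.ne, hp.not_gt]
      · simp
      · simp [hp, hp.ne', hp.not_gt]
    rw [h3, h5, blockStart_eq_add]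
    push_cast
    linear_combination ((i : ZMod 2) + (q : ℕ) + s q + ∑ p, if p < q then (s p : ZMod 2) else 0) * h2
  rw [← hcoef, Nat.cast_mul, Nat.cast_sub hq, CharTwo.sub_eq_add, mul_add, add_right_comm]
  have hk : ((i : ZMod 2) + (q : ℕ)) * ∑ r ∈ Finset.range (s q + 1), D (blockStart s q + r) +
      ∑ r ∈ Finset.range (s q + 1), ((s q : ZMod 2) + r) * D (blockStart s q + r) =
      ∑ r ∈ Finset.range (s q + 1), ((n : ZMod 2) + ((blockStart s q + r : ℕ) : ZMod 2)) *
        D (blockStart s q + r) + ((i : ZMod 2) + (q : ℕ) + s q + n + blockStart s q) * Z q := by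
    simp only [hZ, Finset.mul_sum]
    rw [← Finset.sum_add_distrib, ← Finset.sum_add_distrib]
    refine Finset.sum_congr rfl fun r _ => ?_
    push_cast
    linear_combination (-((n : ZMod 2) + blockStart s q) * D (blockStart s q + r)) * h2
  linear_combination hk

end Suspension
end
end AInf

namespace AInf
noncomputable section

/-! ### `A∞`-structures and morphisms as equations between cochains -/

section Equations

variable {k : Type w} [Field k] {N : ℕ} {Ob : Type u} {Q : TransversalQuiver.{w, u, v} k N Ob}

/-- The obstruction of `b` to be an `A∞`-structure. -/
def sq (b : Coch Q) : Coch Q := dcomp b (tC Q 1) b (idC Q)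

/-- The obstruction of `f` to be an `A∞`-morphism from `b` to `b'`. -/
def resid (b b' f : Coch Q) : Coch Q := comp b' f - dcomp f (tC Q 1) b (idC Q)

theorem chat_sq (b : Coch Q) {M : ℕ} (X : Fin (M + 1) → Ob) (hX : Q.Tr X) (x : Q.SeqHom X) :
    chat (sq b) X hX x = cder b X hX (seqT X x) (chat b X hX x) x := by
  rw [sq, chat_dcomp, chat_tC, chat_idC]

theorem chat_resid (b b' f : Coch Q) {M : ℕ} (X : Fin (M + 1) → Ob) (hX : Q.Tr X)
    (x : Q.SeqHom X) : chat (resid b b' f) X hX x =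
      chat b' X hX (chat f X hX x) - cder f X hX (seqT X x) (chat b X hX x) x := by
  rw [resid, chat_sub, chat_comp, chat_dcomp, chat_tC, chat_idC]

/-- The extension of a finite sequence by zero. -/
def extendZero {A : Type*} [Zero A] {n : ℕ} (a : Fin n → A) (s : ℕ) : A :=
  if h : s < n then a ⟨s, h⟩ else 0

theorem extendZero_val {A : Type*} [Zero A] {n : ℕ} (a : Fin n → A) (p : Fin n) :
    extendZero a p = a p := dif_pos p.2

theorem extendZero_mem {M : ℕ} {X : Fin (M + 1) → Ob} {n : ℕ} {d : Fin n → ZMod N}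
    {a : Fin n → Q.SeqHom X} (ha : ∀ p, a p ∈ Q.seqGr X (d p)) (s : ℕ) :
    extendZero a s ∈ Q.seqGr X (extendZero d s) := by
  unfold extendZero
  split_ifs
  · exact ha _
  · exact Submodule.zero_mem _

/-- By `dcompO_susp` the two expressions differ by a sign on homogeneous inputs. Finite tuples are
extended by zero to the infinite sequences that occur in `IsAInfAlgebra`. -/
theorem isAInfAlgebra_iff (hN : 2 ∣ N) {F : Coch Q} (hF : IsDeg 2 F) {M : ℕ}
    (X : Fin (M + 1) → Ob) (hX : Q.Tr X) :
    IsAInfAlgebra (Q.seqGr X) (F.tot X hX) ↔ ∀ n, (sq (susp F)).tot X hX n = 0 := by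
  unfold sq
  rw [tot_dcomp]
  constructor
  · intro h n
    refine seq_ext_homogeneous fun d a ha => ?_
    have h1 := dcompO_susp hN F hF X hX n (extendZero d) (extendZero a) (extendZero_mem ha)
    rw [h n _ _ (extendZero_mem ha), smul_zero] at h1
    simp only [extendZero_val] at h1
    exact h1
  · intro h n d a ha
    have h1 := dcompO_susp hN F hF X hX n d a ha
    rw [h n, eq_comm, sg_smul_eq_iff] at h1
    rw [h1]
    exact smul_zero _

theorem isAInfMorphism_iff (hN : 2 ∣ N) {μ μ' f : Coch Q} (hμ : IsDeg 2 μ) (hf : IsDeg 1 f) {M : ℕ}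
    (X : Fin (M + 1) → Ob) (hX : Q.Tr X) :
    IsAInfMorphism (Q.seqGr X) (μ.tot X hX) (μ'.tot X hX) (f.tot X hX) ↔
      ∀ n, (resid (susp μ) (susp μ') (susp f)).tot X hX n = 0 := by
  unfold resid
  simp only [tot_sub, sub_eq_zero, tot_dcomp, tot_comp]
  constructor
  · intro h n
    refine seq_ext_homogeneous fun d a ha => ?_
    have h1 := dcompO_susp hN f hμ X hX n (extendZero d) (extendZero a) (extendZero_mem ha)
    have h2 := compO_susp hN μ' hf X hX n (extendZero d) (extendZero a) (extendZero_mem ha)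
    rw [h n _ _ (extendZero_mem ha)] at h2
    simpa only [extendZero_val] using h2.trans h1.symm
  · intro h n d a ha
    have h1 := dcompO_susp hN f hμ X hX n d a ha
    have h2 := compO_susp hN μ' hf X hX n d a ha
    rw [h n, h1, sg_smul_eq_iff, smul_smul, sg_mul_self, one_smul] at h2
    exact h2.symm

theorem Coch.eq_zero_of_tot {F : Coch Q} (h : ∀ {M : ℕ} (X : Fin (M + 1) → Ob) (hX : Q.Tr X) (n : ℕ),
    F.tot X hX n = 0) : F = 0 :=
  Coch.ext_tot fun X hX => funext fun n => (h X hX n).trans (tot_zero_of X hX rfl).symm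

theorem isAInf_iff (hN : 2 ∣ N) (μ : MultiMaps Q Q 2) : IsAInf μ ↔ sq (susp μ.map) = 0 := by
  constructor
  · intro h
    exact Coch.eq_zero_of_tot fun X hX n => (isAInfAlgebra_iff hN μ.map_mem X hX).1 (h _ X hX) n
  · intro h M X hX
    refine (isAInfAlgebra_iff hN μ.map_mem X hX).2 fun n => ?_
    rw [h]
    exact tot_zero_of X hX rfl

theorem isAInfMor_iff (hN : 2 ∣ N) (μ μ' : MultiMaps Q Q 2) (f : MultiMaps Q Q 1) :
    IsAInfMor μ μ' (fun h => h) f ↔ resid (susp μ.map) (susp μ'.map) (susp f.map) = 0 := by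
  constructor
  · intro h
    exact Coch.eq_zero_of_tot fun X hX n =>
      (isAInfMorphism_iff hN μ.map_mem f.map_mem X hX).1 (h _ X hX) n
  · intro h M X hX
    refine (isAInfMorphism_iff hN μ.map_mem f.map_mem X hX).2 fun n => ?_
    rw [h]
    exact tot_zero_of X hX rfl

/-- Differentiating `f(T x, …, b(x), …, x)` once more along `b` gives second derivatives of `f`,
which cancel in pairs because `b` anticommutes with `T`, and one term with the derivative of `b`,
which is `sq b`. -/
theorem cder_dcomp_self (hN : 2 ∣ N) {b : Coch Q} (hb : IsDeg 2 b) (f : Coch Q) {M : ℕ}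
    (X : Fin (M + 1) → Ob) (hX : Q.Tr X) (x : Q.SeqHom X) :
    cder (dcomp f (tC Q 1) b (idC Q)) X hX (seqT X x) (chat b X hX x) x =
      cder f X hX x (chat (sq b) X hX x) x := by
  rw [chat_sq]
  unfold cder
  rw [tot_dcomp]
  exact hder_dcompO_self _ _ _ _ (fun i l => (f.tot_pathy X hX i).blkVanish fun q =>
    Pathy.tri ((tC Q 1).tot_pathy X hX) (b.tot_pathy X hX) ((idC Q).tot_pathy X hX) l q)
    (seqT X) (seqT_seqT X) (chat_linC X hX _) (cder_linC X hX _) (chat_linC X hX _)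
    (cder_linC X hX _) (chat_seqT_two hN hb X hX) x

/-- The Bianchi identity `[b, [b, b]] = 0`, as the case `f = b` of `cder_dcomp_self`. It makes the
first non-zero component of `sq b` a Hochschild cocycle. -/
theorem dcomp_sq (hN : 2 ∣ N) {b : Coch Q} (hb : IsDeg 2 b) :
    dcomp (sq b) (tC Q 1) b (idC Q) = dcomp b (idC Q) (sq b) (idC Q) := by
  refine ext_chat fun X hX x => ?_
  rw [chat_dcomp, chat_dcomp, chat_tC, chat_idC]
  exact cder_dcomp_self hN hb b X hX x

/-- The Bianchi identity for morphisms. In the derivative of the residual along `b` the part coming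
from `f` vanishes by `sq b = 0`; the part coming from `b'` is compared with `sq b' = 0` at the point
`f(x)`. It makes the first non-zero component of the residual a cocycle. -/
theorem dcomp_resid (hN : 2 ∣ N) {b b' f : Coch Q} (hb : IsDeg 2 b) (hsb : sq b = 0)
    (hsb' : sq b' = 0) (hf : IsDeg 1 f) :
    dcomp b' (comp (tC Q 1) f) (resid b b' f) f + dcomp (resid b b' f) (tC Q 1) b (idC Q) = 0 := by
  refine ext_chat fun X hX x => ?_
  have h1 : cder (resid b b' f) X hX (seqT X x) (chat b X hX x) x =
      cder b' X hX (seqT X (chat f X hX x)) (cder f X hX (seqT X x) (chat b X hX x) x)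
        (chat f X hX x) := by
    rw [resid, cder_sub_left, cder_dcomp_self hN hb, hsb, chat_zero, cder_comp, chat_seqT_one hN hf]
    rw [show cder f X hX x 0 x = 0 from hder_zero _ _ _ _, sub_zero]
  have h2 : cder b' X hX (seqT X (chat f X hX x)) (chat b' X hX (chat f X hX x)) (chat f X hX x) =
      0 := by
    rw [← chat_sq, hsb', chat_zero]
  rw [chat_add, chat_dcomp, chat_dcomp, chat_comp, chat_tC, chat_tC, chat_idC, chat_zero, h1,
    chat_resid]
  unfold cder at h2 ⊢
  rw [hder_sub, h2]
  abel

theorem resid_idC (b : Coch Q) : resid b b (idC Q) = 0 := by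
  rw [resid, comp_idC_right, dcomp_idC_left, sub_self]

/-- Chain rule: substitute the equation of `f` at `x` and that of `g` at `f(x)`, using that `f`
commutes with `T`. -/
theorem resid_comp (hN : 2 ∣ N) {b b' b'' f g : Coch Q} (hf : IsDeg 1 f)
    (h1 : resid b b' f = 0) (h2 : resid b' b'' g = 0) : resid b b'' (comp g f) = 0 := by
  refine ext_chat fun X hX x => ?_
  have e1 := chat_resid b b' f X hX x
  have e2 := chat_resid b' b'' g X hX (chat f X hX x)
  rw [h1, chat_zero, eq_comm, sub_eq_zero] at e1
  rw [h2, chat_zero, eq_comm, sub_eq_zero] at e2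
  rw [chat_resid, chat_comp, e2, cder_comp, chat_seqT_one hN hf, e1, sub_self, chat_zero]

/-- Morphisms with identity linear part have right inverses. -/
theorem exists_rightInverse {f : Coch Q} (hf : IsDeg 1 f) (hf0 : f 0 = idC Q 0) :
    ∃ g : Coch Q, IsDeg 1 g ∧ g 0 = idC Q 0 ∧ comp f g = idC Q := by
  obtain ⟨g, hg⟩ := exists_limit
    (fun t (g : Coch Q) => IsDeg 1 g ∧ g 0 = idC Q 0 ∧ ∀ j < t, comp f g j = idC Q j) 1
    ⟨idC Q, IsDeg.idC, rfl, fun j hj => by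
      obtain rfl : j = 0 := by omega
      exact comp_zero _ _ hf0 rfl⟩ (by
    rintro t ht g ⟨h1, h2, h3⟩
    -- The error in component `t` is subtracted from `g`. Since the linear part of `f` is the
    -- identity, this changes `comp f g` by exactly the error in component `t` and not at all below.
    have hw : IsDeg 1 (only t (comp f g - idC Q)) := ((hf.comp h1).sub IsDeg.idC).only t
    set w := only t (comp f g - idC Q) with hwdef
    have hw0 : ∀ j < t, (-w) j = 0 := by
      intro j hj
      change - w j = 0
      rw [hwdef, only_ne hj.ne, neg_zero]
    have hlow : ∀ j < t, (g + -w) j = g j := by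
      intro j hj
      change g j + (-w) j = g j
      rw [hw0 j hj, add_zero]
    refine ⟨g + -w, ⟨h1.add hw.neg, (hlow 0 ht).trans h2, fun j hj => ?_⟩, hlow⟩
    rw [comp_add]
    change comp f g j + dcomp f (g + -w) (-w) g j = _
    rcases (Nat.lt_succ_iff.1 hj).lt_or_eq with hj | rfl
    · rw [dcomp_eq_zero_of_lt hw0 hj, add_zero, h3 j hj]
    · rw [dcomp_eq_of_id hf0 hw0]
      change comp f g j + - w j = _
      rw [hwdef, only_self]
      change comp f g j + - (comp f g j - idC Q j) = _
      abel)
  refine ⟨g, fun n => ?_, ?_, ?_⟩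
  · obtain ⟨g', h1, h2⟩ := hg (n + 1) (by omega)
    rw [h2 n (by omega)]
    exact h1.1 n
  · obtain ⟨g', h1, h2⟩ := hg 1 le_rfl
    rw [h2 0 (by omega), h1.2.1]
  · funext n
    obtain ⟨g', h1, h2⟩ := hg (n + 1) (by omega)
    rw [← h1.2.2 n (by omega)]
    exact comp_congr (fun _ _ => rfl) fun i hi => h2 i (by omega)

/-- The leading component of `dcomp f A r B` is that of `r`. -/
theorem eq_zero_of_dcomp_eq_zero {f A r B : Coch Q} (hf : f 0 = idC Q 0)
    (h : dcomp f A r B = 0) : r = 0 := by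
  funext n
  induction n using Nat.strong_induction_on with
  | _ n ih =>
    rw [← dcomp_eq_of_id (A := A) (B := B) hf ih, h]

/-- Apply the derivative of `f` to the residual of `g`. By the chain rule for `comp f g = idC Q` and
the equation of `f` at `g(x)` the result is zero, and the derivative of `f` is injective because its
linear part is the identity. -/
theorem resid_rightInverse (hN : 2 ∣ N) {b b' f g : Coch Q} (hg : IsDeg 1 g)
    (hf0 : f 0 = idC Q 0) (h : resid b b' f = 0) (hfg : comp f g = idC Q) : resid b' b g = 0 := by
  refine eq_zero_of_dcomp_eq_zero (A := comp (tC Q 1) g) (B := g) hf0 ?_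
  refine ext_chat fun X hX x => ?_
  have e1 := chat_resid b b' f X hX (chat g X hX x)
  have e2 : chat f X hX (chat g X hX x) = x := by rw [← chat_comp, hfg, chat_idC]
  have e3 : cder f X hX (seqT X (chat g X hX x)) (cder g X hX (seqT X x) (chat b' X hX x) x)
      (chat g X hX x) = chat b' X hX x := by
    have e4 := cder_comp X hX f g (seqT X x) (chat b' X hX x) x
    rw [hfg, cder_idC, chat_seqT_one hN hg] at e4
    exact e4.symm
  rw [h, chat_zero, eq_comm, sub_eq_zero, e2] at e1
  rw [chat_dcomp, chat_comp, chat_tC, chat_resid, chat_zero]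
  unfold cder at e1 e3 ⊢
  rw [hder_sub, e3, ← e1, sub_self]

theorem eq_idC_zero_iff (F : Coch Q) : F 0 = idC Q 0 ↔ ∀ (X : Fin 2 → Ob) (hX : Q.Tr X)
    (a : ∀ p : Fin 1, Q.Hom (X p.castSucc) (X p.succ)), F 0 X hX a = a 0 := by
  constructor
  · intro h X hX a
    rw [h]
    rfl
  · intro h
    funext X hX
    exact MultilinearMap.ext fun a => h X hX a

theorem susp_idC : susp (idC Q) = idC Q := by
  funext n X hX
  cases n with
  | zero =>
    refine MultilinearMap.ext fun a => ?_
    change ((Q.tau _ _) ^ 0) (a 0) = a 0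
    rw [pow_zero]
    rfl
  | succ n => rfl

theorem susp_zero_eq {F : Coch Q} (h : F 0 = idC Q 0) : susp F 0 = idC Q 0 := by
  rw [susp_congr h, susp_idC]

end Equations

/-! ### Strong homotopy as an equivalence relation -/

section Equivalence

variable {k : Type w} [Field k] {N : ℕ} {C : GradedPreCategory.{w, u, v} k N}

/-- `susp` is an involution that preserves degrees and identity linear parts, so gauge maps and
their suspensions correspond to each other. -/
theorem stronglyHomotopic_iff (hN : 2 ∣ N) (m m' : AInfStructure C) :
    StronglyHomotopic m m' ↔ ∃ f : Coch C.Q, IsDeg 1 f ∧ f 0 = idC C.Q 0 ∧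
      resid (susp m.ops.map) (susp m'.ops.map) f = 0 := by
  constructor
  · rintro ⟨f, hf⟩
    exact ⟨susp f.maps.map, IsDeg.susp f.maps.map_mem,
      susp_zero_eq ((eq_idC_zero_iff _).2 f.maps_one), (isAInfMor_iff hN _ _ _).1 hf⟩
  · rintro ⟨f, h1, h2, h3⟩
    refine ⟨⟨⟨susp f, IsDeg.susp h1⟩, (eq_idC_zero_iff _).1 (susp_zero_eq h2)⟩,
      (isAInfMor_iff hN _ _ _).2 ?_⟩
    rw [susp_susp]
    exact h3

theorem stronglyHomotopic_equivalence (hN : 2 ∣ N) :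
    Equivalence (StronglyHomotopic (C := C)) where
  refl m := (stronglyHomotopic_iff hN m m).2 ⟨idC C.Q, IsDeg.idC, rfl, resid_idC _⟩
  symm {m m'} h := by
    obtain ⟨f, h1, h2, h3⟩ := (stronglyHomotopic_iff hN m m').1 h
    obtain ⟨g, g1, g2, g3⟩ := exists_rightInverse h1 h2
    exact (stronglyHomotopic_iff hN m' m).2 ⟨g, g1, g2, resid_rightInverse hN g1 h2 h3 g3⟩
  trans {m m' m''} h h' := by
    obtain ⟨f, h1, h2, h3⟩ := (stronglyHomotopic_iff hN m m').1 h
    obtain ⟨g, g1, g2, g3⟩ := (stronglyHomotopic_iff hN m' m'').1 h'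
    exact (stronglyHomotopic_iff hN m m'').2 ⟨comp g f, g1.comp h1, comp_zero _ _ g2 h2,
      resid_comp hN h1 h3 g3⟩

end Equivalence
end
end AInf

namespace AInf
noncomputable section

/-! ### Extension of structures and morphisms from a class of sequences -/

section Extension

variable {k : Type w} [Field k] {N : ℕ} {Ob : Type u} {Q : TransversalQuiver.{w, u, v} k N Ob}

theorem ofFn_comp_sublist {m n : ℕ} (X : Fin n → Ob) (i : Fin m ↪o Fin n) :
    (List.ofFn (X ∘ i)).Sublist (List.ofFn X) := by
  rw [List.sublist_iff_exists_fin_orderEmbedding_get_eq]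
  refine ⟨((Fin.castOrderIso (by simp)).toOrderEmbedding.trans i).trans
    (Fin.castOrderIso (by simp)).toOrderEmbedding, fun j => ?_⟩
  simp
  rfl

/-- Cochains that agree on a class of sequences. -/
def AgreeOn (T : Set (List Ob)) (F G : Coch Q) : Prop :=
  ∀ (n : ℕ) (X : Fin (n + 2) → Ob) (hX : Q.Tr X), List.ofFn X ∈ T → F n X hX = G n X hX

variable {T : Set (List Ob)}

/-- The operations on `⨁_{i < j} Hom (X i) (X j)` only involve subsequences of `X`, and `T` is
closed under passing to them. -/
theorem AgreeOn.tot (hT : ∀ L ∈ T, ∀ L' : List Ob, L'.Sublist L → L' ∈ T) {F G : Coch Q}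
    (h : AgreeOn T F G) {M : ℕ} (X : Fin (M + 1) → Ob) (hX : Q.Tr X) (hXT : List.ofFn X ∈ T) :
    F.tot X hX = G.tot X hX := by
  funext n
  unfold Coch.tot
  refine Finset.sum_congr rfl fun i _ => ?_
  rw [h n (X ∘ i) _ (hT _ hXT _ (ofFn_comp_sublist X i))]

theorem AgreeOn.of_tot {F G : Coch Q}
    (h : ∀ (n : ℕ) (X : Fin (n + 2) → Ob) (hX : Q.Tr X), List.ofFn X ∈ T →
      F.tot X hX n = G.tot X hX n) : AgreeOn T F G := by
  intro n X hX hXT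
  have h1 := h n X hX hXT
  have h2 := F.toCoch_tot
  have h3 := G.toCoch_tot
  rw [← congrFun (congrFun (congrFun h2 n) X) hX, ← congrFun (congrFun (congrFun h3 n) X) hX]
  unfold toCoch
  simp only [h1]

theorem AgreeOn.refl (F : Coch Q) : AgreeOn T F F := fun _ _ _ _ => rfl

theorem AgreeOn.trans {F G H : Coch Q} (h : AgreeOn T F G) (h' : AgreeOn T G H) : AgreeOn T F H :=
  fun n X hX hXT => (h n X hX hXT).trans (h' n X hX hXT)

theorem AgreeOn.add {F G F' G' : Coch Q} (h : AgreeOn T F G) (h' : AgreeOn T F' G') :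
    AgreeOn T (F + F') (G + G') := fun n X hX hXT => by
  change F n X hX + F' n X hX = G n X hX + G' n X hX
  rw [h n X hX hXT, h' n X hX hXT]

theorem AgreeOn.neg {F G : Coch Q} (h : AgreeOn T F G) : AgreeOn T (-F) (-G) :=
  fun n X hX hXT => by
    change - F n X hX = - G n X hX
    rw [h n X hX hXT]

theorem AgreeOn.sub {F G F' G' : Coch Q} (h : AgreeOn T F G) (h' : AgreeOn T F' G') :
    AgreeOn T (F - F') (G - G') := by
  rw [sub_eq_add_neg, sub_eq_add_neg]
  exact h.add h'.neg

theorem AgreeOn.only {F : Coch Q} (h : AgreeOn T F 0) (t : ℕ) : AgreeOn T (only t F) 0 := by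
  intro n X hX hXT
  unfold AInf.only
  split_ifs
  · exact h n X hX hXT
  · rfl

theorem AgreeOn.comp (hT : ∀ L ∈ T, ∀ L' : List Ob, L'.Sublist L → L' ∈ T) {F G F' G' : Coch Q}
    (h : AgreeOn T F F') (h' : AgreeOn T G G') : AgreeOn T (comp F G) (comp F' G') :=
  AgreeOn.of_tot fun n X hX hXT => by
    rw [tot_comp, tot_comp, h.tot hT X hX hXT, h'.tot hT X hX hXT]

theorem AgreeOn.dcomp (hT : ∀ L ∈ T, ∀ L' : List Ob, L'.Sublist L → L' ∈ T)
    {F A Y B F' A' Y' B' : Coch Q} (hF : AgreeOn T F F') (hA : AgreeOn T A A') (hY : AgreeOn T Y Y')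
    (hB : AgreeOn T B B') : AgreeOn T (dcomp F A Y B) (dcomp F' A' Y' B') :=
  AgreeOn.of_tot fun n X hX hXT => by
    rw [tot_dcomp, tot_dcomp, hF.tot hT X hX hXT, hA.tot hT X hX hXT, hY.tot hT X hX hXT,
      hB.tot hT X hX hXT]

theorem AgreeOn.sq (hT : ∀ L ∈ T, ∀ L' : List Ob, L'.Sublist L → L' ∈ T) {F F' : Coch Q}
    (h : AgreeOn T F F') : AgreeOn T (sq F) (sq F') :=
  h.dcomp hT (AgreeOn.refl _) h (AgreeOn.refl _)

theorem AgreeOn.resid (hT : ∀ L ∈ T, ∀ L' : List Ob, L'.Sublist L → L' ∈ T)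
    {b b₁ b' b₁' f f₁ : Coch Q} (h : AgreeOn T b b₁) (h' : AgreeOn T b' b₁') (hf : AgreeOn T f f₁) :
    AgreeOn T (resid b b' f) (resid b₁ b₁' f₁) :=
  (h'.comp hT hf).sub (hf.dcomp hT (AgreeOn.refl _) h (AgreeOn.refl _))

/-- The Hochschild differential of cochains, for the suspended composition `β`. -/
def delta (p : ℕ) (β z : Coch Q) : Coch Q :=
  dcomp β (tC Q p) z (idC Q) - (-1 : ℤ) ^ p • dcomp z (tC Q 1) β (idC Q)

/-- The label `p` fixes the sign convention: `0` is used for corrections of morphisms, `1` for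
residuals and corrections of structures, `2` for squares. -/
theorem delta_zero (β z : Coch Q) :
    delta 0 β z = dcomp β (idC Q) z (idC Q) - dcomp z (tC Q 1) β (idC Q) := by
  rw [delta, tC_zero, pow_zero, one_smul]

theorem delta_one (β z : Coch Q) :
    delta 1 β z = dcomp β (tC Q 1) z (idC Q) + dcomp z (tC Q 1) β (idC Q) := by
  rw [delta, pow_one, neg_one_smul, sub_neg_eq_add]

theorem delta_two (β z : Coch Q) :
    delta 2 β z = dcomp β (idC Q) z (idC Q) - dcomp z (tC Q 1) β (idC Q) := by
  rw [delta, tC_two, neg_one_sq, one_smul]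

theorem dcomp_neg_left (F A Y B : Coch Q) : dcomp (-F) A Y B = - dcomp F A Y B := by
  have h := dcomp_add_left (-F) F A Y B
  rw [neg_add_cancel, dcomp_zero_left] at h
  exact eq_neg_of_add_eq_zero_left h.symm

theorem delta_neg (p : ℕ) (β z : Coch Q) : delta p β (-z) = - delta p β z := by
  rw [delta, delta, dcomp_neg_left, dcomp_neg_mid, smul_neg]
  abel

/-- Cocycles that vanish on `T` are coboundaries of cochains that vanish on `T`. -/
def RelVanish (T : Set (List Ob)) (β : Coch Q) (p : ℕ) : Prop :=
  ∀ (n : ℕ) (z : Coch Q), IsDeg (p + 2) z → (∀ j, j ≠ n + 1 → z j = 0) →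
    delta (p + 1) β z (n + 2) = 0 → AgreeOn T z 0 →
    ∃ w : Coch Q, IsDeg (p + 1) w ∧ (∀ j, j ≠ n → w j = 0) ∧ AgreeOn T w 0 ∧
      delta p β w (n + 1) = z (n + 1)

theorem only_congr {F G : Coch Q} {t : ℕ} (h : F t = G t) : only t F = only t G := by
  funext j
  unfold only
  split_ifs with hj
  · subst hj
    exact h
  · rfl

theorem only_eq_self {F : Coch Q} {t : ℕ} (h : ∀ j, j ≠ t → F j = 0) : only t F = F := by
  funext j
  unfold only
  split_ifs with hj
  · rfl
  · exact (h j hj).symm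

theorem only_neg (F : Coch Q) (t : ℕ) : only t (-F) = - only t F := by
  funext j
  change (if j = t then (- F j) else 0) = - (if j = t then F j else 0)
  split_ifs
  · rfl
  · rw [neg_zero]

/-- Extension of an `A∞`-structure. -/
theorem exists_extension_structure (hN : 2 ∣ N)
    (hT : ∀ L ∈ T, ∀ L' : List Ob, L'.Sublist L → L' ∈ T) {b₀ : Coch Q} (hb₀ : IsDeg 2 b₀)
    (h0 : b₀ 0 = 0) (h2 : sq b₀ 2 = 0) (hTb : AgreeOn T (sq b₀) 0)
    (hR : RelVanish T (only 1 b₀) 1) :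
    ∃ b : Coch Q, IsDeg 2 b ∧ b 0 = 0 ∧ b 1 = b₀ 1 ∧ AgreeOn T b b₀ ∧ sq b = 0 := by
  obtain ⟨b, hb⟩ := exists_limit
    (fun t (b : Coch Q) => IsDeg 2 b ∧ b 0 = 0 ∧ b 1 = b₀ 1 ∧ AgreeOn T b b₀ ∧
      ∀ j ≤ t, sq b j = 0) 2
    ⟨b₀, hb₀, h0, rfl, AgreeOn.refl _, fun j hj => by
      have hl : ∀ j < 1, b₀ j = 0 := by
        intro j hj
        obtain rfl : j = 0 := by omega
        exact h0
      rcases hj.lt_or_eq with hj | rfl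
      · exact dcomp_eq_zero_of_le h0 hl (by omega)
      · exact h2⟩ (by
    rintro t ht b ⟨hdeg, hb0, hb1, hbT, hsq⟩
    set β := only 1 b₀ with hβ
    have hβb : only 1 b = β := only_congr hb1
    have hsl : ∀ j < t + 1, sq b j = 0 := fun j hj => hsq j (by omega)
    -- Component `t + 2` of the Bianchi identity involves only the product `b 1` and the first
    -- possibly non-zero component of `sq b`, and says that the latter is a cocycle.
    have hz : delta 2 β (only (t + 1) (sq b)) (t + 2) = 0 := by
      have e1 := congrFun (dcomp_sq hN hdeg) (t + 1 + 1)
      rw [dcomp_left_lead (A' := tC Q 1) (B' := idC Q) hsl hb0 rfl rfl,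
        dcomp_lead (A' := idC Q) (B' := idC Q) hb0 hsl rfl rfl, hβb] at e1
      rw [delta_two]
      exact sub_eq_zero.2 e1.symm
    obtain ⟨w, hw1, hw2, hw3, hw4⟩ := hR t (only (t + 1) (sq b))
      ((IsDeg.dcomp hdeg (IsDeg.tC 1) hdeg IsDeg.idC (by norm_num)).only _)
      (fun j hj => only_ne hj _) hz (((hbT.sq hT).trans hTb).only _)
    have hvl : ∀ j < t, (-w) j = 0 := by
      intro j hj
      change - w j = 0
      rw [hw2 j hj.ne, neg_zero]
    have hlow : ∀ j < t, (b + -w) j = b j := by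
      intro j hj
      change b j + (-w) j = b j
      rw [hvl j hj, add_zero]
    have hvo : only t (-w) = -w := by rw [only_neg, only_eq_self hw2]
    refine ⟨b + -w, ⟨hdeg.add hw1.neg, (hlow 0 (by omega)).trans hb0,
      (hlow 1 (by omega)).trans hb1, ?_, fun j hj => ?_⟩, hlow⟩
    · have := hbT.add hw3.neg
      rwa [neg_zero, add_zero] at this
    -- The terms linear in `w` start at index `t + 1`, where they add up to `-delta 1 β w`. The
    -- quadratic term starts at index `2 * t`, which is beyond `t + 1` since `t ≥ 2`.
    · have hexp : sq (b + -w) = sq b + dcomp b (tC Q 1) (-w) (idC Q) +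
          (dcomp (-w) (tC Q 1) b (idC Q) + dcomp (-w) (tC Q 1) (-w) (idC Q)) := by
        rw [sq, dcomp_add_left, dcomp_add_mid, dcomp_add_mid]
        rfl
      rw [hexp]
      change sq b j + dcomp b (tC Q 1) (-w) (idC Q) j +
        (dcomp (-w) (tC Q 1) b (idC Q) j + dcomp (-w) (tC Q 1) (-w) (idC Q) j) = 0
      rw [dcomp_left_right_eq_zero hvl hvl (by omega), add_zero]
      rcases hj.lt_or_eq with hj | rfl
      · rw [hsq j (by omega), dcomp_eq_zero_of_le hb0 hvl (by omega),
          dcomp_left_eq_zero hvl hb0 (by omega), add_zero, add_zero]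
      · rw [dcomp_lead (A' := tC Q 1) (B' := idC Q) hb0 hvl rfl rfl,
          dcomp_left_lead (A' := tC Q 1) (B' := idC Q) hvl hb0 rfl rfl, hvo, hβb]
        refine (add_assoc _ _ _).trans ?_
        have e2 := congrFun (delta_neg 1 β w) (t + 1)
        rw [delta_one] at e2
        refine (congrArg (fun x => sq b (t + 1) + x) e2).trans ?_
        change sq b (t + 1) + - delta 1 β w (t + 1) = 0
        rw [hw4, only_self, add_neg_cancel])
  refine ⟨b, fun n => ?_, ?_, ?_, fun n => ?_, ?_⟩
  · obtain ⟨b', h1, h2⟩ := hb (n + 2) (by omega)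
    rw [h2 n (by omega)]
    exact h1.1 n
  · obtain ⟨b', h1, h2⟩ := hb 2 le_rfl
    rw [h2 0 (by omega), h1.2.1]
  · obtain ⟨b', h1, h2⟩ := hb 2 le_rfl
    rw [h2 1 (by omega), h1.2.2.1]
  · obtain ⟨b', h1, h2⟩ := hb (n + 2) (by omega)
    rw [h2 n (by omega)]
    exact h1.2.2.2.1 n
  · funext n
    -- `sq b n` depends on the components of `b` up to index `n` only, so it may be computed at a
    -- finite stage.
    obtain ⟨b', h1, h2⟩ := hb (n + 2) (by omega)
    have e1 := h1.2.2.2.2 n (by omega)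
    refine Eq.trans (dcomp_congr fun i l s h => Or.inr (Or.inr ⟨h2 _ ?_, h2 _ ?_, fun _ _ => rfl,
      fun _ _ => rfl⟩)) e1
    · have := (le_of_sum_succ h).1
      omega
    · have := (le_of_sum_succ h).2 l
      omega

/-- Write `f = id + (f - id)`: the correction starts at index two, as `b` and `f - id` have no
linear part. -/
theorem comp_one_of_id {b f : Coch Q} (hb : b 0 = 0) (hf : f 0 = idC Q 0) {j : ℕ} (hj : j ≤ 1) :
    comp b f j = b j := by
  have h1 : f = idC Q + (f - idC Q) := by abel
  have h2 : ∀ j < 1, (f - idC Q) j = 0 := by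
    intro j hj
    obtain rfl : j = 0 := by omega
    change f 0 - idC Q 0 = 0
    rw [hf, sub_self]
  rw [h1, comp_add, comp_idC_right]
  change b j + dcomp b _ _ _ j = b j
  rw [dcomp_eq_zero_of_le hb h2 hj, add_zero]

/-- Extension of an `A∞`-morphism. -/
theorem exists_extension_morphism (hN : 2 ∣ N)
    (hT : ∀ L ∈ T, ∀ L' : List Ob, L'.Sublist L → L' ∈ T) {b b' f₀ : Coch Q} (hb : IsDeg 2 b)
    (hb' : IsDeg 2 b') (hb0 : b 0 = 0) (hb0' : b' 0 = 0) (hb1 : b 1 = b' 1) (hsb : sq b = 0)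
    (hsb' : sq b' = 0) (hf₀ : IsDeg 1 f₀) (hf0 : f₀ 0 = idC Q 0)
    (hTf : AgreeOn T (resid b b' f₀) 0) (hR : RelVanish T (only 1 b) 0) :
    ∃ f : Coch Q, IsDeg 1 f ∧ f 0 = idC Q 0 ∧ AgreeOn T f f₀ ∧ resid b b' f = 0 := by
  have hl : ∀ j < 1, b j = 0 := by
    intro j hj
    obtain rfl : j = 0 := by omega
    exact hb0
  have hββ : only 1 b' = only 1 b := only_congr hb1.symm
  obtain ⟨f, hf⟩ := exists_limit
    (fun t (f : Coch Q) => IsDeg 1 f ∧ f 0 = idC Q 0 ∧ AgreeOn T f f₀ ∧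
      ∀ j ≤ t, resid b b' f j = 0) 1
    ⟨f₀, hf₀, hf0, AgreeOn.refl _, fun j hj => by
      change comp b' f₀ j - dcomp f₀ (tC Q 1) b (idC Q) j = 0
      rw [comp_one_of_id hb0' hf0 hj, sub_eq_zero]
      rcases hj.lt_or_eq with h | rfl
      · rw [dcomp_eq_zero_of_lt hl h]
        obtain rfl : j = 0 := by omega
        exact hb0'
      · rw [dcomp_eq_of_id hf0 hl, hb1]⟩ (by
    rintro t ht f ⟨hdeg, hf0, hfT, hres⟩
    set β := only 1 b with hβ
    have hsl : ∀ j < t + 1, resid b b' f j = 0 := fun j hj => hres j (by omega)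
    have hTf0 : comp (tC Q 1) f 0 = tC Q 1 0 := by
      rw [comp_congr (F' := tC Q 1) (G' := idC Q) (fun _ _ => rfl), comp_idC_right]
      intro i hi
      obtain rfl : i = 0 := by omega
      exact hf0
    -- Component `t + 2` of `dcomp_resid`; the products of `b` and `b'` are both `β`.
    have hz : delta 1 β (only (t + 1) (resid b b' f)) (t + 2) = 0 := by
      have e1 := congrFun (dcomp_resid hN hb hsb hsb' hdeg) (t + 1 + 1)
      change dcomp b' (comp (tC Q 1) f) (resid b b' f) f (t + 1 + 1) +
        dcomp (resid b b' f) (tC Q 1) b (idC Q) (t + 1 + 1) = 0 at e1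
      rw [dcomp_left_lead (A' := tC Q 1) (B' := idC Q) hsl hb0 rfl rfl,
        dcomp_lead (A' := tC Q 1) (B' := idC Q) hb0' hsl hTf0 hf0, hββ] at e1
      rw [delta_one]
      exact e1
    obtain ⟨w, hw1, hw2, hw3, hw4⟩ := hR t (only (t + 1) (resid b b' f))
      (((hb'.comp hdeg).sub (IsDeg.dcomp hdeg (IsDeg.tC 1) hb IsDeg.idC (by norm_num))).only _)
      (fun j hj => only_ne hj _) hz (((AgreeOn.resid hT (AgreeOn.refl _) (AgreeOn.refl _) hfT).trans
        hTf).only _)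
    have hvl : ∀ j < t, (-w) j = 0 := by
      intro j hj
      change - w j = 0
      rw [hw2 j hj.ne, neg_zero]
    have hlow : ∀ j < t, (f + -w) j = f j := by
      intro j hj
      change f j + (-w) j = f j
      rw [hvl j hj, add_zero]
    have hvo : only t (-w) = -w := by rw [only_neg, only_eq_self hw2]
    have hf0' := (hlow 0 (by omega)).trans hf0
    refine ⟨f + -w, ⟨hdeg.add hw1.neg, hf0', ?_, fun j hj => ?_⟩, hlow⟩
    · have := hfT.add hw3.neg
      rwa [neg_zero, add_zero] at this
    -- `comp_add` is exact, so there is no quadratic remainder. The derivative of `b'` is taken with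
    -- `f - w` on the left and `f` on the right, both of which have identity linear part.
    · have hexp : resid b b' (f + -w) = resid b b' f +
          (dcomp b' (f + -w) (-w) f - dcomp (-w) (tC Q 1) b (idC Q)) := by
        rw [resid, comp_add, dcomp_add_left, resid]
        abel
      rw [hexp]
      change resid b b' f j + (dcomp b' (f + -w) (-w) f j - dcomp (-w) (tC Q 1) b (idC Q) j) = 0
      rcases hj.lt_or_eq with hj | rfl
      · rw [hres j (by omega), dcomp_eq_zero_of_le hb0' hvl (by omega),
          dcomp_left_eq_zero hvl hb0 (by omega), sub_zero, add_zero]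
      · rw [dcomp_lead (A' := idC Q) (B' := idC Q) hb0' hvl hf0' hf0,
          dcomp_left_lead (A' := tC Q 1) (B' := idC Q) hvl hb0 rfl rfl, hvo, hββ]
        have e2 := congrFun (delta_neg 0 β w) (t + 1)
        rw [delta_zero] at e2
        refine (congrArg (fun x => resid b b' f (t + 1) + x) e2).trans ?_
        change resid b b' f (t + 1) + - delta 0 β w (t + 1) = 0
        rw [hw4, only_self, add_neg_cancel])
  refine ⟨f, fun n => ?_, ?_, fun n => ?_, ?_⟩
  · obtain ⟨f', h1, h2⟩ := hf (n + 1) (by omega)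
    rw [h2 n (by omega)]
    exact h1.1 n
  · obtain ⟨f', h1, h2⟩ := hf 1 le_rfl
    rw [h2 0 (by omega), h1.2.1]
  · obtain ⟨f', h1, h2⟩ := hf (n + 1) (by omega)
    rw [h2 n (by omega)]
    exact h1.2.2.1 n
  · funext n
    obtain ⟨f', h1, h2⟩ := hf (n + 1) (by omega)
    have e1 := h1.2.2.2 n (by omega)
    refine Eq.trans ?_ e1
    have e2 : comp b' f n = comp b' f' n :=
      comp_congr (fun _ _ => rfl) fun i hi => h2 i (by omega)
    have e3 : dcomp f (tC Q 1) b (idC Q) n = dcomp f' (tC Q 1) b (idC Q) n := by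
      refine dcomp_congr fun i l s h =>
        Or.inr (Or.inr ⟨h2 _ ?_, rfl, fun _ _ => rfl, fun _ _ => rfl⟩)
      have := (le_of_sum_succ h).1
      omega
    change comp b' f n - dcomp f (tC Q 1) b (idC Q) n =
      comp b' f' n - dcomp f' (tC Q 1) b (idC Q) n
    rw [e2, e3]

end Extension
end
end AInf

namespace AInf
noncomputable section

/-! ### Graded categories and the bar complex -/

section Bar

variable {k : Type w} [Field k] {N : ℕ} {Ob : Type u}

/-- The structure of a graded linear category on a quiver; compositions are written in the order
of the morphisms. -/
structure CatStr (Q : TransversalQuiver.{w, u, v} k N Ob) where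
  one : ∀ X, Q.Hom X X
  mul : ∀ {X Y Z}, Q.Hom X Y →ₗ[k] Q.Hom Y Z →ₗ[k] Q.Hom X Z
  one_mul : ∀ {X Y} (a : Q.Hom X Y), mul (one X) a = a
  mul_one : ∀ {X Y} (a : Q.Hom X Y), mul a (one Y) = a
  mul_assoc : ∀ {X Y Z W} (a : Q.Hom X Y) (b : Q.Hom Y Z) (c : Q.Hom Z W),
    mul (mul a b) c = mul a (mul b c)
  one_mem : ∀ X, one X ∈ Q.gr X X 0
  mul_mem : ∀ {X Y Z} {a : Q.Hom X Y} {b : Q.Hom Y Z} {d e}, a ∈ Q.gr X Y d → b ∈ Q.gr Y Z e →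
    mul a b ∈ Q.gr X Z (d + e)

variable (Q : TransversalQuiver.{w, u, v} k N Ob)

/-- `⨁ Hom(U, Z_1) ⊗ Hom(Z_1, Z_2) ⊗ ⋯ ⊗ Hom(Z_n, V)`, as a bundled module. -/
def barMod : ℕ → Ob → Ob → ModuleCat.{max u v} k
  | 0, U, V => ModuleCat.of k (ULift.{u} (Q.Hom U V))
  | n + 1, U, V => ModuleCat.of k (DirectSum Ob fun Z => TensorProduct k (Q.Hom U Z) (barMod n Z V))

/-- `⨁ Hom(U, Z_1) ⊗ Hom(Z_1, Z_2) ⊗ ⋯ ⊗ Hom(Z_n, V)`, the sum over all objects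
`Z_1, …, Z_n`. -/
def Bar (n : ℕ) (U V : Ob) : Type (max u v) := barMod Q n U V

instance (n : ℕ) (U V : Ob) : AddCommGroup (Bar Q n U V) :=
  inferInstanceAs (AddCommGroup (barMod Q n U V))

instance (n : ℕ) (U V : Ob) : Module k (Bar Q n U V) :=
  inferInstanceAs (Module k (barMod Q n U V))

namespace Bar

variable {Q}

/-- Words of length one. -/
def of {U V : Ob} : Q.Hom U V ≃ₗ[k] Bar Q 0 U V := ULift.moduleEquiv.symm

open Classical in
/-- A word with a letter added on the left. -/
def cons {n : ℕ} {U Z V : Ob} : Q.Hom U Z →ₗ[k] Bar Q n Z V →ₗ[k] Bar Q (n + 1) U V :=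
  (TensorProduct.mk k (Q.Hom U Z) (barMod Q n Z V)).compr₂
    (DirectSum.lof k Ob (fun Z => TensorProduct k (Q.Hom U Z) (barMod Q n Z V)) Z)

open Classical in
/-- Linear maps on words are determined by their values on the words `u ω`. -/
def elim {n : ℕ} {U V : Ob} {M : Type*} [AddCommGroup M] [Module k M]
    (f : ∀ Z, Q.Hom U Z →ₗ[k] Bar Q n Z V →ₗ[k] M) : Bar Q (n + 1) U V →ₗ[k] M :=
  DirectSum.toModule k Ob M fun Z => TensorProduct.lift (f Z)

@[simp] theorem elim_cons {n : ℕ} {U V Z : Ob} {M : Type*} [AddCommGroup M] [Module k M]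
    (f : ∀ Z, Q.Hom U Z →ₗ[k] Bar Q n Z V →ₗ[k] M) (x : Q.Hom U Z) (ω : Bar Q n Z V) :
    elim f (cons x ω) = f Z x ω := by
  classical
  have h1 := DirectSum.toModule_lof (φ := fun Z => TensorProduct.lift (f Z)) k Z
    (x ⊗ₜ[k] (ω : barMod Q n Z V) : TensorProduct k (Q.Hom U Z) (barMod Q n Z V))
  refine Eq.trans ?_ (h1.trans (TensorProduct.lift.tmul _ _))
  unfold elim
  congr!

open Classical in
theorem ext_cons {n : ℕ} {U V : Ob} {M : Type*} [AddCommGroup M] [Module k M]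
    {f g : Bar Q (n + 1) U V →ₗ[k] M}
    (h : ∀ Z (x : Q.Hom U Z) (ω : Bar Q n Z V), f (cons x ω) = g (cons x ω)) : f = g := by
  refine DirectSum.linearMap_ext k fun Z => TensorProduct.ext' fun x ω => ?_
  exact h Z x ω

variable (H : CatStr Q)

/-- A word with a letter added on the right. -/
def app : ∀ {n : ℕ} {U Z V : Ob}, Bar Q n U Z →ₗ[k] Q.Hom Z V →ₗ[k] Bar Q (n + 1) U V
  | 0, _, _, _ => (cons.compl₂ of.toLinearMap).comp of.symm.toLinearMap
  | n + 1, _, _, _ => elim fun _ => LinearMap.mk₂ k (fun x ω => (cons x).comp (app ω))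
      (fun _ _ _ => by ext; simp) (fun _ _ _ => by ext; simp) (fun _ _ _ => by ext; simp)
      (fun _ _ _ => by ext; simp)

@[simp] theorem app_of {U Z V : Ob} (a : Q.Hom U Z) (b : Q.Hom Z V) :
    app (of a) b = cons a (of b) := by simp [app]

@[simp] theorem app_cons {n : ℕ} {U Y Z V : Ob} (a : Q.Hom U Y) (ω : Bar Q n Y Z)
    (b : Q.Hom Z V) : app (cons a ω) b = cons a (app ω b) := by simp [app]

/-- Linear maps on words are determined by their values on the words `ω v`. -/
def relim {V : Ob} {M : Type*} [AddCommGroup M] [Module k M] : ∀ {n : ℕ} {U : Ob},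
    (∀ Z, Bar Q n U Z →ₗ[k] Q.Hom Z V →ₗ[k] M) →ₗ[k] (Bar Q (n + 1) U V →ₗ[k] M)
  | 0, _ =>
    { toFun := fun f => elim fun Z =>
        ((LinearMap.lcomp k M of.symm.toLinearMap).comp (f Z)).comp of.toLinearMap
      map_add' := fun f g => ext_cons fun _ _ _ => by simp
      map_smul' := fun c f => ext_cons fun _ _ _ => by simp }
  | n + 1, _ =>
    { toFun := fun f => elim fun Z => relim.comp
        (LinearMap.pi fun y => (LinearMap.llcomp k _ _ _ (f y)).comp cons)
      map_add' := fun f g => ext_cons fun Z x ω => by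
        simp only [elim_cons, LinearMap.add_apply, LinearMap.comp_apply]
        rw [← LinearMap.add_apply, ← map_add]
        rfl
      map_smul' := fun c f => ext_cons fun Z x ω => by
        simp only [elim_cons, LinearMap.smul_apply, LinearMap.comp_apply, RingHom.id_apply]
        rw [← LinearMap.smul_apply, ← map_smul]
        rfl }

@[simp] theorem relim_app {n : ℕ} {U Z V : Ob} {M : Type*} [AddCommGroup M] [Module k M]
    (f : ∀ Z, Bar Q n U Z →ₗ[k] Q.Hom Z V →ₗ[k] M) (ω : Bar Q n U Z) (b : Q.Hom Z V) :
    relim f (app ω b) = f Z ω b := by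
  induction n generalizing U with
  | zero =>
    obtain ⟨a, rfl⟩ := of.surjective ω
    simp [relim]
  | succ n ih =>
    suffices h : (relim f).comp ((LinearMap.applyₗ b).comp app.flip.flip) = _ from
      LinearMap.congr_fun (g := (f Z).flip b) h ω
    refine ext_cons fun Y x ω => ?_
    simp [relim, ih]

theorem ext_app {n : ℕ} {U V : Ob} {M : Type*} [AddCommGroup M] [Module k M]
    {f g : Bar Q (n + 1) U V →ₗ[k] M}
    (h : ∀ Z (ω : Bar Q n U Z) (b : Q.Hom Z V), f (app ω b) = g (app ω b)) : f = g := by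
  induction n generalizing U with
  | zero =>
    refine ext_cons fun Z x ω => ?_
    obtain ⟨b, rfl⟩ := of.surjective ω
    simpa using h Z (of x) b
  | succ n ih =>
    refine ext_cons fun Z x ω => ?_
    refine LinearMap.congr_fun (f := f.comp (cons x)) (g := g.comp (cons x)) (ih ?_) ω
    intro Y ω b
    simpa using h Y (cons x ω) b

/-- Multiplication of the first letter of a word. -/
def lact : ∀ {n : ℕ} {U X V : Ob}, Q.Hom U X →ₗ[k] Bar Q n X V →ₗ[k] Bar Q n U V
  | 0, _, _, _ => (H.mul.compl₂ of.symm.toLinearMap).compr₂ of.toLinearMap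
  | _ + 1, _, _, _ =>
    { toFun := fun u => elim fun _ => cons.comp (H.mul u)
      map_add' := fun u u' => ext_cons fun _ _ _ => by simp
      map_smul' := fun c u => ext_cons fun _ _ _ => by simp }

@[simp] theorem lact_of {U X V : Ob} (a : Q.Hom U X) (b : Q.Hom X V) :
    lact H a (of b) = of (H.mul a b) := by simp [lact]

@[simp] theorem lact_cons {n : ℕ} {U X Y V : Ob} (a : Q.Hom U X) (b : Q.Hom X Y)
    (ω : Bar Q n Y V) : lact H a (cons b ω) = cons (H.mul a b) ω := by simp [lact]

/-- Multiplication of the last letter of a word. -/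
def ract : ∀ {n : ℕ} {U X V : Ob}, Bar Q n U X →ₗ[k] Q.Hom X V →ₗ[k] Bar Q n U V
  | 0, _, _, _ => (H.mul.comp of.symm.toLinearMap).compr₂ of.toLinearMap
  | n + 1, _, _, _ => elim fun _ => LinearMap.mk₂ k (fun x ω => (cons x).comp (ract ω))
      (fun _ _ _ => by ext; simp) (fun _ _ _ => by ext; simp) (fun _ _ _ => by ext; simp)
      (fun _ _ _ => by ext; simp)

@[simp] theorem ract_of {U X V : Ob} (a : Q.Hom U X) (b : Q.Hom X V) :
    ract H (of a) b = of (H.mul a b) := by simp [ract]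

@[simp] theorem ract_cons {n : ℕ} {U X Y V : Ob} (a : Q.Hom U Y) (ω : Bar Q n Y X)
    (b : Q.Hom X V) : ract H (cons a ω) b = cons a (ract H ω b) := by simp [ract]

/-- The differential of the bar complex. -/
def bd : ∀ {n : ℕ} {U V : Ob}, Bar Q (n + 1) U V →ₗ[k] Bar Q n U V
  | 0, _, _ => elim fun _ => lact H
  | n + 1, _, _ => elim fun _ => lact H - cons.compl₂ bd

@[simp] theorem bd_cons_of {U Z V : Ob} (x : Q.Hom U Z) (b : Q.Hom Z V) :
    bd H (cons x (of b)) = of (H.mul x b) := by simp [bd]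

@[simp] theorem bd_cons {n : ℕ} {U Z V : Ob} (x : Q.Hom U Z) (ω : Bar Q (n + 1) Z V) :
    bd H (cons x ω) = lact H x ω - cons x (bd H ω) := by simp [bd]

open Classical in
theorem cons_induction {n : ℕ} {U V : Ob} {P : Bar Q (n + 1) U V → Prop} (h0 : P 0)
    (hadd : ∀ ω ω', P ω → P ω' → P (ω + ω'))
    (hc : ∀ (Z : Ob) (a : Q.Hom U Z) (ω : Bar Q n Z V), P (cons a ω)) (ω : Bar Q (n + 1) U V) :
    P ω := by
  refine DirectSum.induction_on (β := fun Z => TensorProduct k (Q.Hom U Z) (barMod Q n Z V))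
    (motive := fun ω : DirectSum Ob fun Z => TensorProduct k (Q.Hom U Z) (barMod Q n Z V) =>
      P ω) ω h0 ?_ (fun x y => hadd x y)
  intro Z t
  induction t using TensorProduct.induction_on with
  | zero =>
    rw [map_zero]
    exact h0
  | tmul x ω => exact hc Z x ω
  | add x y hx hy =>
    rw [map_add]
    exact hadd _ _ hx hy

/-- Induction on words. -/
theorem induction {P : ∀ {n : ℕ} {U V : Ob}, Bar Q n U V → Prop}
    (h0 : ∀ {U V : Ob} (a : Q.Hom U V), P (of a))
    (hadd : ∀ {n : ℕ} {U V : Ob} (ω ω' : Bar Q n U V), P ω → P ω' → P (ω + ω'))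
    (hc : ∀ {n : ℕ} {U Z V : Ob} (a : Q.Hom U Z) (ω : Bar Q n Z V), P ω → P (cons a ω))
    {n : ℕ} {U V : Ob} (ω : Bar Q n U V) : P ω := by
  induction n generalizing U with
  | zero =>
    obtain ⟨a, rfl⟩ := of.surjective ω
    exact h0 a
  | succ n ih =>
    refine cons_induction (P := P) ?_ hadd (fun Z a ω => hc a ω (ih ω)) ω
    -- The case of the zero word follows from `hc` because `cons 0 0 = 0`.
    have h1 := hc (0 : Q.Hom U V) (0 : Bar Q n V V) (ih _)
    rwa [map_zero] at h1

theorem lact_one {n : ℕ} {U V : Ob} (ω : Bar Q n U V) : lact H (H.one U) ω = ω := by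
  induction ω using induction with
  | h0 a => simp [H.one_mul]
  | hadd ω ω' h h' => rw [map_add, h, h']
  | hc a ω _ => simp [H.one_mul]

theorem lact_mul {n : ℕ} {U X Y V : Ob} (a : Q.Hom U X) (b : Q.Hom X Y) (ω : Bar Q n Y V) :
    lact H (H.mul a b) ω = lact H a (lact H b ω) := by
  induction ω using induction with
  | h0 c => simp [H.mul_assoc]
  | hadd ω ω' h h' => simp only [map_add, h, h']
  | hc c ω _ => simp [H.mul_assoc]

theorem bd_lact {n : ℕ} {U X V : Ob} (a : Q.Hom U X) (ω : Bar Q (n + 1) X V) :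
    bd H (lact H a ω) = lact H a (bd H ω) := by
  cases n with
  | zero =>
    refine LinearMap.congr_fun (f := (bd H).comp (lact H a)) (g := (lact H a).comp (bd H))
      (ext_cons fun Z x ω => ?_) ω
    obtain ⟨b, rfl⟩ := of.surjective ω
    simp [H.mul_assoc]
  | succ n =>
    refine LinearMap.congr_fun (f := (bd H).comp (lact H a)) (g := (lact H a).comp (bd H))
      (ext_cons fun Z x ω => ?_) ω
    simp [lact_mul]

theorem bd_bd {n : ℕ} {U V : Ob} (ω : Bar Q (n + 2) U V) : bd H (bd H ω) = 0 := by
  induction n generalizing U with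
  | zero =>
    refine LinearMap.congr_fun (f := (bd H).comp (bd H)) (g := 0)
      (ext_cons fun Z x ω => ?_) ω
    rw [LinearMap.comp_apply, bd_cons, map_sub, bd_lact]
    obtain ⟨b, hb⟩ := of.surjective (bd H ω)
    rw [← hb]
    simp
  | succ n ih =>
    refine LinearMap.congr_fun (f := (bd H).comp (bd H)) (g := 0)
      (ext_cons fun Z x ω => ?_) ω
    rw [LinearMap.comp_apply, bd_cons, map_sub, bd_lact, bd_cons, ih]
    simp

theorem lact_ract {n : ℕ} {U X Y V : Ob} (a : Q.Hom U X) (ω : Bar Q n X Y) (b : Q.Hom Y V) :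
    lact H a (ract H ω b) = ract H (lact H a ω) b := by
  induction ω using induction with
  | h0 c => simp [H.mul_assoc]
  | hadd ω ω' h h' => simp only [map_add, LinearMap.add_apply, h, h']
  | hc c ω _ => simp

theorem ract_mul {n : ℕ} {U X Y V : Ob} (ω : Bar Q n U X) (a : Q.Hom X Y) (b : Q.Hom Y V) :
    ract H ω (H.mul a b) = ract H (ract H ω a) b := by
  induction ω using induction with
  | h0 c => simp [H.mul_assoc]
  | hadd ω ω' h h' => simp only [map_add, LinearMap.add_apply, h, h']
  | hc c ω h => simp [h]

theorem ract_app {n : ℕ} {U X Y V : Ob} (ω : Bar Q n U X) (a : Q.Hom X Y) (b : Q.Hom Y V) :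
    ract H (app ω a) b = app ω (H.mul a b) := by
  induction ω using induction with
  | h0 c => simp
  | hadd ω ω' h h' => simp only [map_add, LinearMap.add_apply, h, h']
  | hc c ω h => simp [h]

theorem lact_app {n : ℕ} {U X Y V : Ob} (a : Q.Hom U X) (ω : Bar Q n X Y) (b : Q.Hom Y V) :
    lact H a (app ω b) = app (lact H a ω) b := by
  induction ω using induction with
  | h0 c => simp
  | hadd ω ω' h h' => simp only [map_add, LinearMap.add_apply, h, h']
  | hc c ω h => simp

theorem bd_ract {n : ℕ} {U X V : Ob} (ω : Bar Q (n + 1) U X) (b : Q.Hom X V) :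
    bd H (ract H ω b) = ract H (bd H ω) b := by
  induction n generalizing U with
  | zero =>
    refine LinearMap.congr_fun (f := (bd H).comp ((ract H).flip b))
      (g := ((ract H).flip b).comp (bd H)) (ext_cons fun Z x ω => ?_) ω
    obtain ⟨b, rfl⟩ := of.surjective ω
    simp [H.mul_assoc]
  | succ n ih =>
    refine LinearMap.congr_fun (f := (bd H).comp ((ract H).flip b))
      (g := ((ract H).flip b).comp (bd H)) (ext_cons fun Z x ω => ?_) ω
    simp [ih, lact_ract]

theorem bd_app {n : ℕ} {U X V : Ob} (ω : Bar Q (n + 1) U X) (b : Q.Hom X V) :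
    bd H (app ω b) = app (bd H ω) b + (-1 : ℤ) ^ (n + 1) • ract H ω b := by
  induction n generalizing U with
  | zero =>
    refine LinearMap.congr_fun (f := (bd H).comp (app.flip b))
      (g := (app.flip b).comp (bd H) + (-1 : ℤ) ^ (0 + 1) • (ract H).flip b)
      (ext_cons fun Z x ω => ?_) ω
    obtain ⟨b, rfl⟩ := of.surjective ω
    simp [sub_eq_add_neg]
  | succ n ih =>
    refine LinearMap.congr_fun (f := (bd H).comp (app.flip b))
      (g := (app.flip b).comp (bd H) + (-1 : ℤ) ^ (n + 1 + 1) • (ract H).flip b)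
      (ext_cons fun Z x ω => ?_) ω
    simp [ih, lact_app, pow_succ]
    abel

end Bar
end Bar
end
end AInf

namespace AInf
noncomputable section

/-! ### Relative exactness of the bar complex -/

namespace Bar

variable {k : Type w} [Field k] {N : ℕ} {Ob : Type u} {Q : TransversalQuiver.{w, u, v} k N Ob}

open Classical in
/-- The projection to the words whose list of inner objects is in `T`. -/
def pr (T : Set (List Ob)) : ∀ {n : ℕ} {U V : Ob}, Bar Q n U V →ₗ[k] Bar Q n U V
  | 0, _, _ => if [] ∈ T then LinearMap.id else 0
  | _ + 1, _, _ => elim fun Z => cons.compl₂ (pr {L | Z :: L ∈ T})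

open Classical in
theorem pr_of (T : Set (List Ob)) {U V : Ob} (a : Q.Hom U V) :
    pr T (of a) = if [] ∈ T then of a else 0 := by
  unfold pr
  split_ifs <;> rfl

@[simp] theorem pr_cons (T : Set (List Ob)) {n : ℕ} {U Z V : Ob} (a : Q.Hom U Z)
    (ω : Bar Q n Z V) : pr T (cons a ω) = cons a (pr {L | Z :: L ∈ T} ω) := by simp [pr]

theorem pr_app (T : Set (List Ob)) {n : ℕ} {U Z V : Ob} (ω : Bar Q n U Z) (b : Q.Hom Z V) :
    pr T (app ω b) = app (pr {L | L ++ [Z] ∈ T} ω) b := by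
  induction ω using induction generalizing T with
  | @h0 _ Y a =>
    by_cases h : [Y] ∈ T <;> simp [pr_of, h]
  | hadd ω ω' h h' => simp only [map_add, LinearMap.add_apply, h, h']
  | hc a ω h => simp [h]

theorem pr_pr (S T : Set (List Ob)) {n : ℕ} {U V : Ob} (ω : Bar Q n U V) :
    pr T (pr S ω) = pr (S ∩ T) ω := by
  induction ω using induction generalizing S T with
  | h0 a =>
    by_cases h : [] ∈ S <;> by_cases h' : [] ∈ T <;> simp [pr_of, h, h']
  | hadd ω ω' h h' => simp only [map_add, h, h']
  | hc a ω h =>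
    simp only [pr_cons, h]
    rfl

theorem pr_mono {S T : Set (List Ob)} (hST : S ⊆ T) {n : ℕ} {U V : Ob} (ω : Bar Q n U V)
    (h : pr S ω = ω) : pr T ω = ω := by
  rw [← h, pr_pr, Set.inter_eq_left.2 hST]

/-- An element of the bar complex is a finite sum of words, and each word has one list of inner
objects. -/
theorem exists_finite (T : Set (List Ob)) {n : ℕ} {U V : Ob} (ω : Bar Q n U V) (h : pr T ω = ω) :
    ∃ S ⊆ T, S.Finite ∧ pr S ω = ω := by
  suffices H : ∃ S : Set (List Ob), S.Finite ∧ pr S ω = ω by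
    obtain ⟨S, hS, hω⟩ := H
    refine ⟨S ∩ T, Set.inter_subset_right, hS.inter_of_left T, ?_⟩
    rw [← pr_pr, hω, h]
  clear h T
  induction ω using induction with
  | h0 a => exact ⟨{[]}, Set.finite_singleton _, by simp [pr_of]⟩
  | hadd ω ω' h h' =>
    obtain ⟨S, hS, hω⟩ := h
    obtain ⟨S', hS', hω'⟩ := h'
    refine ⟨S ∪ S', hS.union hS', ?_⟩
    rw [map_add, pr_mono Set.subset_union_left ω hω, pr_mono Set.subset_union_right ω' hω']
  | @hc n U Z V a ω h =>
    obtain ⟨S, hS, hω⟩ := h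
    refine ⟨(fun L => Z :: L) '' S, hS.image _, ?_⟩
    have h1 : S ⊆ {L | Z :: L ∈ (fun L => Z :: L) '' S} := fun L hL => ⟨L, hL, rfl⟩
    rw [pr_cons, pr_mono h1 ω hω]

variable (H : CatStr Q)

theorem pr_lact (T : Set (List Ob)) {n : ℕ} {U X V : Ob} (a : Q.Hom U X) (ω : Bar Q n X V) :
    pr T (lact H a ω) = lact H a (pr T ω) := by
  induction ω using induction with
  | h0 b => simp only [lact_of, pr_of]; split_ifs <;> simp
  | hadd ω ω' h h' => simp only [map_add, h, h']
  | hc b ω h => simp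

theorem pr_ract (T : Set (List Ob)) {n : ℕ} {U X V : Ob} (ω : Bar Q n U X) (b : Q.Hom X V) :
    pr T (ract H ω b) = ract H (pr T ω) b := by
  induction ω using induction generalizing T with
  | h0 b => simp only [ract_of, pr_of]; split_ifs <;> simp
  | hadd ω ω' h h' => simp only [map_add, LinearMap.add_apply, h, h']
  | hc b ω h => simp [h]

/-- The differential deletes one inner object from each list. As `T` is closed under sublists, the
words over `T` form a subcomplex. -/
theorem pr_bd_pr {T : Set (List Ob)} (hT : ∀ L ∈ T, ∀ L' : List Ob, L'.Sublist L → L' ∈ T)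
    {n : ℕ} {U V : Ob} (ω : Bar Q (n + 1) U V) : pr T (bd H (pr T ω)) = bd H (pr T ω) := by
  induction n generalizing U T with
  | zero =>
    refine LinearMap.congr_fun (f := (pr T).comp ((bd H).comp (pr T)))
      (g := (bd H).comp (pr T)) (ext_cons fun Z x ω => ?_) ω
    obtain ⟨b, rfl⟩ := of.surjective ω
    by_cases h : [Z] ∈ T
    · have h1 := hT _ h [] (List.nil_sublist _)
      simp [pr_of, h, h1]
    · simp [pr_of, h]
  | succ n ih =>
    refine LinearMap.congr_fun (f := (pr T).comp ((bd H).comp (pr T)))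
      (g := (bd H).comp (pr T)) (ext_cons fun Z x ω => ?_) ω
    have h1 : {L | Z :: L ∈ T} ⊆ T := fun L hL => hT _ hL _ (List.sublist_cons_self _ _)
    simp only [LinearMap.comp_apply, pr_cons, bd_cons, map_sub, pr_lact, pr_pr]
    rw [Set.inter_eq_left.2 h1, ih (T := {L | Z :: L ∈ T})
      fun L hL L' hL' => hT _ hL _ (hL'.cons_cons Z)]

/-- The projection to the words whose list of inner objects is not in `T`. -/
def npr (T : Set (List Ob)) {n : ℕ} {U V : Ob} : Bar Q n U V →ₗ[k] Bar Q n U V :=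
  LinearMap.id - pr T

theorem npr_apply (T : Set (List Ob)) {n : ℕ} {U V : Ob} (ω : Bar Q n U V) :
    npr T ω = ω - pr T ω := rfl

theorem npr_pr (T : Set (List Ob)) {n : ℕ} {U V : Ob} (ω : Bar Q n U V) : npr T (pr T ω) = 0 := by
  rw [npr_apply, pr_pr, Set.inter_self, sub_self]

theorem npr_npr (T : Set (List Ob)) {n : ℕ} {U V : Ob} (ω : Bar Q n U V) :
    npr T (npr T ω) = npr T ω := by
  conv_lhs => rw [npr_apply T ω, map_sub, npr_pr, sub_zero]

theorem npr_lact (T : Set (List Ob)) {n : ℕ} {U X V : Ob} (a : Q.Hom U X) (ω : Bar Q n X V) :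
    npr T (lact H a ω) = lact H a (npr T ω) := by
  rw [npr_apply, npr_apply, pr_lact, map_sub]

theorem npr_ract (T : Set (List Ob)) {n : ℕ} {U X V : Ob} (ω : Bar Q n U X) (b : Q.Hom X V) :
    npr T (ract H ω b) = ract H (npr T ω) b := by
  rw [npr_apply, npr_apply, pr_ract, map_sub, LinearMap.sub_apply]

theorem npr_zero {T : Set (List Ob)} (hT : [] ∈ T) {U V : Ob} (ω : Bar Q 0 U V) : npr T ω = 0 := by
  obtain ⟨a, rfl⟩ := of.surjective ω
  rw [npr_apply, pr_of, if_pos hT, sub_self]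

/-- The words over `T` form a subcomplex, so `npr` followed by `bd` describes the differential of
the quotient complex. -/
theorem npr_bd_npr {T : Set (List Ob)} (hT : ∀ L ∈ T, ∀ L' : List Ob, L'.Sublist L → L' ∈ T)
    {n : ℕ} {U V : Ob} (ω : Bar Q (n + 1) U V) : npr T (bd H (npr T ω)) = npr T (bd H ω) := by
  rw [npr_apply T ω, map_sub, map_sub, ← pr_bd_pr H hT, npr_pr, sub_zero]

/-- Every finite collection of lists in `T` can be extended on the left by an object that has a
given object as a retract. -/
def _root_.AInf.CatStr.Extends (T : Set (List Ob)) : Prop :=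
  ∀ S : Set (List Ob), S.Finite → S ⊆ T → ∀ X : Ob,
    ∃ (W : Ob) (q : Q.Hom X W) (q' : Q.Hom W X), H.mul q q' = H.one X ∧ ∀ L ∈ S, W :: L ∈ T

variable {H}

/-- Relative exactness, the only place where the retract condition enters. Let `bd y` involve the
finite set `S` of lists in `T`, and let `q q' = 1` with `W` prolonging all of `S`. The boundary of
the word `q (q' y)` is `y` minus the word `q (q' bd y)`, and the latter lies over `T`. -/
theorem exists_npr_bd {T : Set (List Ob)} (hW : H.Extends T) {n : ℕ} {U V : Ob}
    (y : Bar Q (n + 1) U V) (hy : npr T (bd H y) = 0) : ∃ w, npr T (bd H w) = npr T y := by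
  obtain ⟨S, hST, hS, hSy⟩ := exists_finite T (bd H y) (sub_eq_zero.1 hy).symm
  obtain ⟨W, q, q', hq, hWS⟩ := hW S hS hST U
  refine ⟨cons q (lact H q' y), ?_⟩
  have h1 : pr T (cons q (lact H q' (bd H y))) = cons q (lact H q' (bd H y)) := by
    have h2 : S ⊆ {L | W :: L ∈ T} := fun L hL => hWS L hL
    rw [pr_cons, pr_lact, pr_mono h2 _ hSy]
  rw [bd_cons, ← lact_mul, hq, lact_one, bd_lact, map_sub, ← h1, npr_pr, sub_zero]

/-- Over a field the relative differential splits onto its range, and the splitting extends to all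
words. It need not respect the actions of the category; `exists_contraction_succ` repairs this. -/
theorem exists_section {T : Set (List Ob)}
    (hT : ∀ L ∈ T, ∀ L' : List Ob, L'.Sublist L → L' ∈ T) (hW : H.Extends T) (n : ℕ) (U V : Ob) :
    ∃ s : Bar Q (n + 1) U V →ₗ[k] Bar Q (n + 2) U V, (∀ y, npr T (s y) = s y) ∧
      ∀ y, npr T (bd H y) = 0 → npr T y = y → npr T (bd H (s y)) = y := by
  let f : Bar Q (n + 2) U V →ₗ[k] Bar Q (n + 1) U V := (npr T).comp (bd H)
  obtain ⟨g, hg⟩ := f.rangeRestrict.exists_rightInverse_of_surjective f.range_rangeRestrict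
  obtain ⟨s, hs⟩ := LinearMap.exists_extend g
  refine ⟨(npr T).comp s, fun y => npr_npr T _, fun y hy hy' => ?_⟩
  obtain ⟨w, hw⟩ := exists_npr_bd hW y hy
  rw [hy'] at hw
  have h1 : s y = g ⟨y, w, hw⟩ := by rw [← hs]; rfl
  rw [LinearMap.comp_apply, npr_bd_npr H hT, h1]
  exact congrArg Subtype.val (LinearMap.congr_fun hg ⟨y, w, hw⟩)

/-- Maps of bimodules that vanish on the words with inner objects in `T` and take values in the
other words. -/
structure IsRel (H : CatStr Q) (T : Set (List Ob)) {n : ℕ}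
    (h : ∀ U V, Bar Q n U V →ₗ[k] Bar Q (n + 1) U V) : Prop where
  lact : ∀ {U X V} (a : Q.Hom U X) (ω : Bar Q n X V), h U V (lact H a ω) = lact H a (h X V ω)
  ract : ∀ {U X V} (ω : Bar Q n U X) (b : Q.Hom X V), h U V (ract H ω b) = ract H (h U X ω) b
  pr : ∀ {U V} (ω : Bar Q n U V), h U V (pr T ω) = 0
  npr : ∀ {U V} (ω : Bar Q n U V), npr T (h U V ω) = h U V ω

theorem IsRel.bd_npr {T : Set (List Ob)} (hT : ∀ L ∈ T, ∀ L' : List Ob, L'.Sublist L → L' ∈ T)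
    {n : ℕ} {h : ∀ U V, Bar Q n U V →ₗ[k] Bar Q (n + 1) U V} (hh : IsRel H T h) {U V : Ob}
    (ω : Bar Q (n + 1) U V) : h U V (bd H (Bar.pr T ω)) = 0 := by
  rw [← pr_bd_pr H hT, hh.pr]

/-- The map `npr - h bd` takes values in relative cycles and so lifts through the differential by
`s`. From index one on, a bimodule map may be prescribed freely on the words `1 ω 1`, since the
outer letters are then free; the lift is used on these words only and spread by the two actions. As
`y` commutes with both actions, the homotopy equation spreads too (`key`). -/
theorem exists_contraction_succ {T : Set (List Ob)}
    (hT : ∀ L ∈ T, ∀ L' : List Ob, L'.Sublist L → L' ∈ T) (hW : H.Extends T) {n : ℕ}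
    {h : ∀ U V, Bar Q n U V →ₗ[k] Bar Q (n + 1) U V} (hh : IsRel H T h)
    (hb : ∀ {U V} (ω : Bar Q (n + 1) U V), npr T (bd H (h U V (bd H ω))) = npr T (bd H ω)) :
    ∃ h' : ∀ U V, Bar Q (n + 1) U V →ₗ[k] Bar Q (n + 2) U V, IsRel H T h' ∧
      ∀ {U V} (ω : Bar Q (n + 1) U V), npr T (bd H (h' U V ω)) + h U V (bd H ω) = npr T ω := by
  choose s hs hs' using fun U V => exists_section hT hW n U V
  let y : ∀ U V, Bar Q (n + 1) U V →ₗ[k] Bar Q (n + 1) U V := fun U V =>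
    npr T - (h U V).comp (bd H)
  have hy : ∀ {U V} (ω : Bar Q (n + 1) U V), npr T (bd H (s U V (y U V ω))) = y U V ω := by
    intro U V ω
    have h0 : y U V ω = npr T ω - h U V (bd H ω) := rfl
    refine hs' U V _ ?_ ?_
    · rw [h0, map_sub, map_sub, hb, npr_bd_npr H hT, sub_self]
    · rw [h0, map_sub, npr_npr, hh.npr]
  have hy0 : ∀ {U V} (ω : Bar Q (n + 1) U V), s U V (y U V (Bar.pr T ω)) = 0 := by
    intro U V ω
    have h0 : y U V (Bar.pr T ω) = npr T (Bar.pr T ω) - h U V (bd H (Bar.pr T ω)) := rfl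
    rw [h0, npr_pr, hh.bd_npr hT, sub_zero, map_zero]
  have key : ∀ {U X Y V} (a : Q.Hom U X) (ω : Bar Q (n + 1) X Y) (b : Q.Hom Y V),
      npr T (bd H (Bar.ract H (Bar.lact H a (s X Y (y X Y ω))) b)) +
        h U V (bd H (Bar.ract H (Bar.lact H a ω) b)) = npr T (Bar.ract H (Bar.lact H a ω) b) := by
    intro U X Y V a ω b
    have h0 : y X Y ω = npr T ω - h X Y (bd H ω) := rfl
    rw [bd_ract, bd_lact, npr_ract, npr_lact, hy, h0, bd_ract, bd_lact, hh.ract, hh.lact, npr_ract,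
      npr_lact, map_sub, map_sub, LinearMap.sub_apply, sub_add_cancel]
  cases n with
  | zero =>
    -- With only one inner object there is no word between the outer letters: the generators are
    -- `1_Z 1_Z`, one for each object.
    let g : ∀ Z, Bar Q 2 Z Z := fun Z => s Z Z (y Z Z (cons (H.one Z) (of (H.one Z))))
    let h' : ∀ U V, Bar Q 1 U V →ₗ[k] Bar Q 2 U V := fun U V => elim fun Z =>
      ((Bar.ract H).comp ((Bar.lact H).flip (g Z))).compl₂ of.symm.toLinearMap
    have h1 : ∀ {U Z V} (a : Q.Hom U Z) (b : Q.Hom Z V),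
        h' U V (cons a (of b)) = Bar.ract H (Bar.lact H a (g Z)) b := fun a b => by simp [h']
    have h2 : ∀ {U Z V} (a : Q.Hom U Z) (b : Q.Hom Z V), cons a (of b) =
        Bar.ract H (Bar.lact H a (cons (H.one Z) (of (H.one Z)))) b := fun a b => by
      simp [H.one_mul, H.mul_one]
    have hext : ∀ {U V : Ob} {M : Type (max u v)} [AddCommGroup M] [Module k M]
        {f g : Bar Q 1 U V →ₗ[k] M} (_ : ∀ Z (a : Q.Hom U Z) (b : Q.Hom Z V),
          f (cons a (of b)) = g (cons a (of b))) (ω), f ω = g ω := by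
      intro U V M _ _ f g hfg ω
      refine LinearMap.congr_fun (ext_cons fun Z a ω => ?_) ω
      obtain ⟨b, rfl⟩ := of.surjective ω
      exact hfg Z a b
    refine ⟨h', ⟨?_, ?_, ?_, ?_⟩, ?_⟩
    · intro U X V a ω
      refine hext (f := (h' U V).comp (Bar.lact H a)) (g := (Bar.lact H a).comp (h' X V)) ?_ ω
      intro Z b c
      rw [LinearMap.comp_apply, LinearMap.comp_apply, lact_cons, h1, h1, lact_mul, lact_ract]
    · intro U X V ω b
      refine hext (f := (h' U V).comp ((Bar.ract H).flip b))
        (g := ((Bar.ract H).flip b).comp (h' U X)) ?_ ω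
      intro Z a c
      simp only [LinearMap.comp_apply, LinearMap.flip_apply, ract_cons, ract_of]
      rw [h1, h1, ract_mul]
    · intro U V ω
      refine hext (f := (h' U V).comp (Bar.pr T)) (g := 0) ?_ ω
      intro Z a b
      rw [LinearMap.comp_apply, h2 a b, pr_ract, pr_lact, pr_cons, pr_of]
      split_ifs with hZ
      · have h3 := hy0 (cons (H.one Z) (of (H.one Z)))
        rw [pr_cons, pr_of, if_pos hZ] at h3
        rw [← h2, h1]
        simp only [g]
        rw [h3]
        simp
      · simp
    · intro U V ω
      refine hext (f := (npr T).comp (h' U V)) (g := h' U V) ?_ ω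
      intro Z a b
      rw [LinearMap.comp_apply, h1, npr_ract, npr_lact, hs]
    · intro U V ω
      refine hext (f := (npr T).comp ((bd H).comp (h' U V)) + (h U V).comp (bd H)) (g := npr T) ?_ ω
      intro Z a b
      have h3 := key a (cons (H.one Z) (of (H.one Z))) b
      rw [← h2] at h3
      rw [LinearMap.add_apply, LinearMap.comp_apply, LinearMap.comp_apply, h1]
      exact h3
  | succ n =>
    -- Now the generators are `1 ω 1`, and the lift has to be linear in the word `ω`.
    let g : ∀ X Y, Bar Q n X Y →ₗ[k] Bar Q (n + 3) X Y := fun X Y =>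
      (s X Y).comp ((y X Y).comp ((cons (H.one X)).comp (app.flip (H.one Y))))
    have hg : ∀ {X Y} ω, g X Y ω = s X Y (y X Y (cons (H.one X) (app ω (H.one Y)))) :=
      fun ω => rfl
    let h' : ∀ U V, Bar Q (n + 2) U V →ₗ[k] Bar Q (n + 3) U V := fun U V => elim fun Z =>
      relim.comp (LinearMap.pi fun Y =>
        (LinearMap.llcomp k _ _ _ (Bar.ract H)).comp ((LinearMap.lcomp k _ (g Z Y)).comp (Bar.lact H)))
    have h1 : ∀ {U X Y V} (a : Q.Hom U X) (ω : Bar Q n X Y) (b : Q.Hom Y V),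
        h' U V (cons a (app ω b)) = Bar.ract H (Bar.lact H a (g X Y ω)) b := fun a ω b => by
      simp [h']
    have h2 : ∀ {U X Y V} (a : Q.Hom U X) (ω : Bar Q n X Y) (b : Q.Hom Y V), cons a (app ω b) =
        Bar.ract H (Bar.lact H a (cons (H.one X) (app ω (H.one Y)))) b := fun a ω b => by
      simp [H.one_mul, H.mul_one, ract_app]
    have hext : ∀ {U V : Ob} {M : Type (max u v)} [AddCommGroup M] [Module k M]
        {f g : Bar Q (n + 2) U V →ₗ[k] M} (_ : ∀ X Y (a : Q.Hom U X) (ω : Bar Q n X Y)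
          (b : Q.Hom Y V), f (cons a (app ω b)) = g (cons a (app ω b))) (ω), f ω = g ω := by
      intro U V M _ _ f g hfg ω
      refine LinearMap.congr_fun (ext_cons fun Z a ω => ?_) ω
      refine LinearMap.congr_fun (f := f.comp (cons a)) (g := g.comp (cons a)) (ext_app ?_) ω
      exact fun Y ω b => hfg Z Y a ω b
    refine ⟨h', ⟨?_, ?_, ?_, ?_⟩, ?_⟩
    · intro U X V a ω
      refine hext (f := (h' U V).comp (Bar.lact H a)) (g := (Bar.lact H a).comp (h' X V)) ?_ ω
      intro _ _ b c d
      rw [LinearMap.comp_apply, LinearMap.comp_apply, lact_cons, h1, h1, lact_mul, lact_ract]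
    · intro U X V ω b
      refine hext (f := (h' U V).comp ((Bar.ract H).flip b))
        (g := ((Bar.ract H).flip b).comp (h' U X)) ?_ ω
      intro _ _ a c d
      simp only [LinearMap.comp_apply, LinearMap.flip_apply, ract_cons, ract_app]
      rw [h1, h1, ract_mul]
    · intro U V ω
      refine hext (f := (h' U V).comp (Bar.pr T)) (g := 0) ?_ ω
      intro X Y a b c
      have h3 := hy0 (cons (H.one X) (app b (H.one Y)))
      rw [pr_cons, pr_app, ← hg] at h3
      rw [LinearMap.comp_apply, pr_cons, pr_app, h1, h3]
      simp
    · intro U V ω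
      refine hext (f := (npr T).comp (h' U V)) (g := h' U V) ?_ ω
      intro X Y a b c
      rw [LinearMap.comp_apply, h1, npr_ract, npr_lact, hg, hs]
    · intro U V ω
      refine hext (f := (npr T).comp ((bd H).comp (h' U V)) + (h U V).comp (bd H)) (g := npr T) ?_ ω
      intro X Y a b c
      have h3 := key a (cons (H.one X) (app b (H.one Y))) c
      rw [← h2] at h3
      rw [LinearMap.add_apply, LinearMap.comp_apply, LinearMap.comp_apply, h1]
      exact h3

/-- Words without inner objects lie over `T`, so the zero map starts the induction. The homotopy
equation evaluated on boundaries, where `bd (bd ω) = 0`, is the hypothesis of the next step. -/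
theorem exists_contraction {T : Set (List Ob)} (hT0 : [] ∈ T)
    (hT : ∀ L ∈ T, ∀ L' : List Ob, L'.Sublist L → L' ∈ T) (hW : H.Extends T) (n : ℕ) :
    ∃ h : ∀ U V, Bar Q n U V →ₗ[k] Bar Q (n + 1) U V, IsRel H T h ∧
      ∀ {U V} (ω : Bar Q (n + 1) U V), npr T (bd H (h U V (bd H ω))) = npr T (bd H ω) := by
  induction n with
  | zero =>
    refine ⟨fun U V => 0, ⟨?_, ?_, ?_, ?_⟩, fun ω => ?_⟩
    · intros; simp
    · intros; simp
    · intros; simp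
    · intros; simp
    · rw [npr_zero hT0, npr_zero hT0]
  | succ n ih =>
    obtain ⟨h, hh, hb⟩ := ih
    obtain ⟨h', hh', hb'⟩ := exists_contraction_succ hT hW hh hb
    refine ⟨h', hh', fun ω => ?_⟩
    have h1 := hb' (bd H ω)
    rwa [bd_bd, map_zero, add_zero] at h1

end Bar
end
end AInf

namespace AInf
noncomputable section

/-! ### Cochains on the bar complex -/

namespace Bar

variable {k : Type w} [Field k] {N : ℕ} {Ob : Type u} {Q : TransversalQuiver.{w, u, v} k N Ob}

/-- Families of linear maps from the bar complex to the morphism spaces. -/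
abbrev Fam (Q : TransversalQuiver.{w, u, v} k N Ob) (n : ℕ) := ∀ U V, Bar Q n U V →ₗ[k] Q.Hom U V

variable (H : CatStr Q) (σ : ∀ U V, Q.Hom U V →ₗ[k] Q.Hom U V)

/-- The family `a ω ↦ σ(a) ζ(ω)`. -/
def lfam {n : ℕ} (ζ : Fam Q n) : Fam Q (n + 1) := fun U V =>
  elim fun Z => (H.mul.comp (σ U Z)).compl₂ (ζ Z V)

/-- The family `ω b ↦ ζ(ω) b`. -/
def rfam {n : ℕ} (ζ : Fam Q n) : Fam Q (n + 1) := fun U V =>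
  relim fun Z => H.mul.comp (ζ U Z)

@[simp] theorem lfam_cons {n : ℕ} (ζ : Fam Q n) {U Z V : Ob} (a : Q.Hom U Z) (ω : Bar Q n Z V) :
    lfam H σ ζ U V (cons a ω) = H.mul (σ U Z a) (ζ Z V ω) := by simp [lfam]

@[simp] theorem rfam_app {n : ℕ} (ζ : Fam Q n) {U Z V : Ob} (ω : Bar Q n U Z) (b : Q.Hom Z V) :
    rfam H ζ U V (app ω b) = H.mul (ζ U Z ω) b := by simp [rfam]

/-- The Hochschild differential of a family. -/
def dfam {n : ℕ} (ζ : Fam Q n) : Fam Q (n + 1) := fun U V =>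
  lfam H σ ζ U V - (ζ U V).comp (bd H) + (-1 : ℤ) ^ n • rfam H ζ U V

theorem dfam_apply {n : ℕ} (ζ : Fam Q n) {U V : Ob} (ω : Bar Q (n + 1) U V) :
    dfam H σ ζ U V ω =
      lfam H σ ζ U V ω - ζ U V (bd H ω) + (-1 : ℤ) ^ n • rfam H ζ U V ω := rfl

theorem ext_cons_app {n : ℕ} {U V : Ob} {M : Type*} [AddCommGroup M] [Module k M]
    {f g : Bar Q (n + 2) U V →ₗ[k] M} (h : ∀ X Y (a : Q.Hom U X) (ω : Bar Q n X Y)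
      (b : Q.Hom Y V), f (cons a (app ω b)) = g (cons a (app ω b))) : f = g := by
  refine ext_cons fun Z a ω => ?_
  refine LinearMap.congr_fun (f := f.comp (cons a)) (g := g.comp (cons a)) (ext_app ?_) ω
  exact fun Y ω b => h Z Y a ω b

theorem rfam_ract {n : ℕ} (ζ : Fam Q n) {U X V : Ob} (ω : Bar Q (n + 1) U X) (b : Q.Hom X V) :
    rfam H ζ U V (ract H ω b) = H.mul (rfam H ζ U X ω) b := by
  refine LinearMap.congr_fun (f := (rfam H ζ U V).comp ((ract H).flip b))
    (g := (H.mul.flip b).comp (rfam H ζ U X)) (ext_app fun Z ω c => ?_) ω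
  simp [ract_app, H.mul_assoc]

variable {H σ} (hσ : ∀ {U V W} (a : Q.Hom U V) (b : Q.Hom V W),
  σ U W (H.mul a b) = H.mul (σ U V a) (σ V W b))

include hσ in
theorem lfam_lact {n : ℕ} (ζ : Fam Q n) {U X V : Ob} (a : Q.Hom U X) (ω : Bar Q (n + 1) X V) :
    lfam H σ ζ U V (lact H a ω) = H.mul (σ U X a) (lfam H σ ζ X V ω) := by
  refine LinearMap.congr_fun (f := (lfam H σ ζ U V).comp (lact H a))
    (g := (H.mul (σ U X a)).comp (lfam H σ ζ X V)) (ext_cons fun Z b ω => ?_) ω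
  simp [hσ, H.mul_assoc]

-- The assignment `a ω b ↦ σ(a) ζ(ω) b` turns families into bimodule maps, with left action twisted
-- by `σ`. It turns the Hochschild differential into composition with `bd`.
include hσ in
theorem lfam_rfam_bd {n : ℕ} (ζ : Fam Q n) {U V : Ob} (ω : Bar Q (n + 3) U V) :
    lfam H σ (rfam H ζ) U V (bd H ω) = lfam H σ (rfam H (dfam H σ ζ)) U V ω := by
  have hlr : ∀ {X Y V} (ω : Bar Q (n + 1) X Y) (b : Q.Hom Y V),
      lfam H σ (rfam H ζ) X V (app ω b) = H.mul (lfam H σ ζ X Y ω) b := by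
    intro X Y V ω b
    refine LinearMap.congr_fun (f := (lfam H σ (rfam H ζ) X V).comp (app.flip b))
      (g := (H.mul.flip b).comp (lfam H σ ζ X Y)) (ext_cons fun Z a ω => ?_) ω
    simp [H.mul_assoc]
  refine LinearMap.congr_fun (f := (lfam H σ (rfam H ζ) U V).comp (bd H))
    (ext_cons_app fun X Y a ω b => ?_) ω
  rw [LinearMap.comp_apply, bd_cons, map_sub, lfam_lact hσ, lfam_cons, lfam_cons, rfam_app,
    bd_app, map_add, rfam_app, map_zsmul, rfam_ract, hlr, dfam_apply, ← map_sub]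
  congr 1
  simp only [map_add, map_sub, map_zsmul, LinearMap.add_apply, LinearMap.sub_apply,
    LinearMap.smul_apply, pow_succ, mul_neg, mul_one, neg_smul]
  abel

/-- A family vanishes on `T` if it vanishes on the words whose list of objects is in `T`. -/
def VanishOn (T : Set (List Ob)) {n : ℕ} (ζ : Fam Q n) : Prop :=
  ∀ (U V : Ob) (ω : Bar Q n U V), ζ U V (pr {L | U :: (L ++ [V]) ∈ T} ω) = 0

-- Let `Z` be the bimodule map of the cocycle `ζ`, so `Z` vanishes on boundaries and on words over
-- `T`. With the relative contraction `h`, put `η(ω) = Z(h(1 ω 1))`. The bimodule map of `η` is `Z ∘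
-- h`, and applying `Z` to the homotopy equation shows that the differential of `η` is `ζ`.
include hσ in
theorem exists_dfam_eq (hσ1 : ∀ U, σ U U (H.one U) = H.one U) {T : Set (List Ob)} (hT0 : [] ∈ T)
    (hT : ∀ L ∈ T, ∀ L' : List Ob, L'.Sublist L → L' ∈ T) (hW : H.Extends T) {n : ℕ}
    (ζ : Fam Q (n + 1)) (hζ : dfam H σ ζ = 0) (hζT : VanishOn T ζ) :
    ∃ η : Fam Q n, dfam H σ η = ζ ∧ VanishOn T η := by
  obtain ⟨h, hh, hb⟩ := exists_contraction hT0 hT hW (n + 2)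
  obtain ⟨h', -, hb'⟩ := exists_contraction_succ hT hW hh hb
  let Z := lfam H σ (rfam H ζ)
  have hZbd : ∀ {U V} (ω : Bar Q (n + 4) U V), Z U V (bd H ω) = 0 := by
    intro U V ω
    refine (lfam_rfam_bd hσ ζ ω).trans ?_
    rw [hζ]
    refine LinearMap.congr_fun (f := lfam H σ (rfam H 0) U V) (g := 0)
      (ext_cons_app fun X Y a ω b => ?_) ω
    simp
  have hZpr : ∀ {U V} (ω : Bar Q (n + 3) U V), Z U V (pr T ω) = 0 := by
    intro U V ω
    refine LinearMap.congr_fun (f := (Z U V).comp (pr T)) (g := 0)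
      (ext_cons_app fun X Y a ω b => ?_) ω
    rw [LinearMap.comp_apply, pr_cons, pr_app]
    have h1 := hζT X Y ω
    simp only [Z, lfam_cons, rfam_app]
    erw [h1]
    simp
  have hZnpr : ∀ {U V} (ω : Bar Q (n + 3) U V), Z U V (npr T ω) = Z U V ω := by
    intro U V ω
    rw [npr_apply, map_sub, hZpr, sub_zero]
  have hZlact : ∀ {U X V} (a : Q.Hom U X) (ω : Bar Q (n + 3) X V),
      Z U V (lact H a ω) = H.mul (σ U X a) (Z X V ω) := fun a ω => lfam_lact hσ _ a ω
  have hZract : ∀ {U X V} (ω : Bar Q (n + 3) U X) (b : Q.Hom X V),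
      Z U V (ract H ω b) = H.mul (Z U X ω) b := by
    intro U X V ω b
    refine LinearMap.congr_fun (f := (Z U V).comp ((ract H).flip b))
      (g := (H.mul.flip b).comp (Z U X)) (ext_cons fun Y a ω => ?_) ω
    simp [Z, rfam_ract, H.mul_assoc]
  let η : Fam Q n := fun U V =>
    (Z U V).comp ((h U V).comp ((cons (H.one U)).comp (app.flip (H.one V))))
  have hη : ∀ {U V} ω, η U V ω = Z U V (h U V (cons (H.one U) (app ω (H.one V)))) := fun ω => rfl
  have hηZ : ∀ {U V} (ω : Bar Q (n + 2) U V), lfam H σ (rfam H η) U V ω = Z U V (h U V ω) := by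
    intro U V ω
    refine LinearMap.congr_fun (g := (Z U V).comp (h U V)) (ext_cons_app fun X Y a ω b => ?_) ω
    have h2 : cons a (app ω b) = ract H (lact H a (cons (H.one X) (app ω (H.one Y)))) b := by
      simp [H.one_mul, H.mul_one, ract_app]
    rw [LinearMap.comp_apply, h2, hh.ract, hh.lact, hZract, hZlact, ← hη, ← h2, lfam_cons,
      rfam_app, H.mul_assoc]
  refine ⟨η, ?_, ?_⟩
  · funext U V
    refine LinearMap.ext fun ω => ?_
    have h1 := lfam_rfam_bd hσ η (cons (H.one U) (app ω (H.one V)))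
    rw [hηZ] at h1
    have h2 := congrArg (Z U V) (hb' (cons (H.one U) (app ω (H.one V))))
    rw [map_add, hZnpr, hZnpr, hZbd, zero_add, h1] at h2
    simpa [Z, hσ1, H.one_mul, H.mul_one] using h2
  · intro U V ω
    -- The inner objects of `1 ω 1` are `U`, those of `ω`, and `V`; this is the list that occurs in
    -- `VanishOn`, and `h` kills such words over `T`.
    have h1 := hh.pr (cons (H.one U) (app ω (H.one V)))
    rw [pr_cons, pr_app] at h1
    refine (congrArg (Z U V) h1).trans (map_zero _)

end Bar
end
end AInf

namespace AInf
noncomputable section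

/-! ### Words of composable morphisms -/

section Words

variable {k : Type w} [Field k] {N : ℕ} {Ob : Type u} {Q : TransversalQuiver.{w, u, v} k N Ob}

/-- The entry of an element of `⨁_{i < j} Hom (X i) (X j)` at any two positions. -/
def ent {M : ℕ} {X : Fin (M + 1) → Ob} (s t : Fin (M + 1)) : Q.SeqHom X →ₗ[k] Q.Hom (X s) (X t) :=
  if h : s < t then LinearMap.proj (R := k) (φ := fun q : Pr M => Q.Hom (X q.1.1) (X q.1.2))
    ⟨(s, t), h⟩ else 0

theorem ent_of_lt {M : ℕ} {X : Fin (M + 1) → Ob} {s t : Fin (M + 1)} (h : s < t)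
    (x : Q.SeqHom X) : ent s t x = x ⟨(s, t), h⟩ := by
  unfold ent
  rw [dif_pos h]
  rfl

theorem ent_of_not_lt {M : ℕ} {X : Fin (M + 1) → Ob} {s t : Fin (M + 1)} (h : ¬ s < t)
    (x : Q.SeqHom X) : ent s t x = 0 := by
  unfold ent
  rw [dif_neg h]
  rfl

theorem ent_of_Lsupp {M : ℕ} {X : Fin (M + 1) → Ob} {j s : Fin (M + 1)} {x : Q.SeqHom X}
    (h : Lsupp j x) (hs : s ≠ j) (t : Fin (M + 1)) : ent s t x = 0 := by
  by_cases hst : s < t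
  · rw [ent_of_lt hst, h _ hs]
  · exact ent_of_not_lt hst x

theorem ent_of_Rsupp {M : ℕ} {X : Fin (M + 1) → Ob} {j t : Fin (M + 1)} {x : Q.SeqHom X}
    (h : Rsupp j x) (ht : t ≠ j) (s : Fin (M + 1)) : ent s t x = 0 := by
  by_cases hst : s < t
  · rw [ent_of_lt hst, h _ ht]
  · exact ent_of_not_lt hst x

theorem ent_sgl {M : ℕ} (X : Fin (M + 1) → Ob) (q : Pr M) (x : Q.Hom (X q.1.1) (X q.1.2)) :
    ent q.1.1 q.1.2 (sgl (Q := Q) X q x) = x := by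
  rw [ent_of_lt q.2, sgl_same]

open Bar in
/-- The sum of the words `x_0(s, t_1) x_1(t_1, t_2) ⋯ x_n(t_n, e)`. -/
def wd {M : ℕ} {X : Fin (M + 1) → Ob} : ∀ (n : ℕ) (s e : Fin (M + 1)),
    MultilinearMap k (fun _ : Fin (n + 1) => Q.SeqHom X) (Bar Q n (X s) (X e))
  | 0, s, e => (LinearMap.comp of.toLinearMap (ent s e)).compMultilinearMap
      (MultilinearMap.ofSubsingleton k (Q.SeqHom X) (Q.SeqHom X) (0 : Fin 1) LinearMap.id)
  | n + 1, s, e => ∑ t, LinearMap.uncurryLeft (M := fun _ : Fin (n + 2) => Q.SeqHom X)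
      { toFun := fun a => (cons (ent s t a)).compMultilinearMap (wd n t e)
        map_add' := fun a b => by ext; simp
        map_smul' := fun c a => by ext; simp }

theorem wd_zero {M : ℕ} {X : Fin (M + 1) → Ob} (s e : Fin (M + 1)) (a : Fin 1 → Q.SeqHom X) :
    wd 0 s e a = Bar.of (ent s e (a 0)) := rfl

theorem wd_succ {M n : ℕ} {X : Fin (M + 1) → Ob} (s e : Fin (M + 1))
    (a : Fin (n + 2) → Q.SeqHom X) :
    wd (n + 1) s e a = ∑ t, Bar.cons (ent s t (a 0)) (wd n t e (fun p => a p.succ)) := by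
  rw [wd, sum_apply]
  rfl

/-- Each letter strictly raises the position, as `ent` is zero on pairs that are not increasing. -/
theorem wd_of_not_lt {M n : ℕ} {X : Fin (M + 1) → Ob} {s e : Fin (M + 1)} (h : ¬ s < e)
    (a : Fin (n + 1) → Q.SeqHom X) : wd n s e a = 0 := by
  induction n generalizing s with
  | zero => rw [wd_zero, ent_of_not_lt h, map_zero]
  | succ n ih =>
    rw [wd_succ]
    refine Finset.sum_eq_zero fun t _ => ?_
    by_cases hst : s < t
    · rw [ih (fun hte => h (hst.trans hte)), map_zero]
    · rw [ent_of_not_lt hst, map_zero, LinearMap.zero_apply]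

theorem wd_of_Lsupp {M n : ℕ} {X : Fin (M + 1) → Ob} {j s : Fin (M + 1)} (hs : s ≠ j)
    (e : Fin (M + 1)) {a : Fin (n + 1) → Q.SeqHom X} (h : Lsupp j (a 0)) : wd n s e a = 0 := by
  cases n with
  | zero => rw [wd_zero, ent_of_Lsupp h hs, map_zero]
  | succ n =>
    rw [wd_succ]
    refine Finset.sum_eq_zero fun t _ => ?_
    rw [ent_of_Lsupp h hs, map_zero, LinearMap.zero_apply]

theorem mid_wd {M n : ℕ} {X : Fin (M + 1) → Ob} (s e : Fin (M + 1)) :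
    Mid (wd (Q := Q) (X := X) n s e) := by
  intro a p p' hp j j' h1 h2 h3
  induction n generalizing s with
  | zero => omega
  | succ n ih =>
    rw [wd_succ]
    refine Finset.sum_eq_zero fun t _ => ?_
    cases p using Fin.cases with
    | zero =>
      obtain rfl : p' = Fin.succ 0 := Fin.ext (by simpa using hp)
      by_cases ht : t = j
      · subst ht
        rw [wd_of_Lsupp h3 e h2, map_zero]
      · rw [ent_of_Rsupp h1 ht, map_zero, LinearMap.zero_apply]
    | succ p =>
      cases p' using Fin.cases with
      | zero => simp at hp
      | succ p' =>
        rw [ih t (fun p => a p.succ) p p' (by simpa using hp) h1 h2, map_zero]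

/-- The word of a composable sequence of morphisms. -/
def word : ∀ {n : ℕ} (X : Fin (n + 2) → Ob) (_ : ∀ p : Fin (n + 1), Q.Hom (X p.castSucc) (X p.succ)),
    Bar Q n (X 0) (X (Fin.last (n + 1)))
  | 0, _, a => Bar.of (a 0)
  | _ + 1, X, a => Bar.cons (a 0) (word (fun p => X p.succ) (fun p => a p.succ))

/-- A subsequence without its first position. -/
def tailEmb {M n : ℕ} (i : Fin (n + 3) ↪o Fin (M + 1)) : Fin (n + 2) ↪o Fin (M + 1) :=
  OrderEmbedding.ofStrictMono (fun p => i p.succ)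
    fun _ _ h => i.strictMono (Fin.succ_lt_succ_iff.2 h)

/-- At each step only the letter that leads to the next position of the chain is non-zero. -/
theorem wd_chain {M n : ℕ} (X : Fin (M + 1) → Ob) (i : Fin (n + 2) ↪o Fin (M + 1))
    (c : ∀ p : Fin (n + 1), Q.Hom (X (i p.castSucc)) (X (i p.succ))) :
    wd n (i 0) (i (Fin.last (n + 1))) (fun p => sgl X (chainPr i p) (c p)) = word (X ∘ i) c := by
  induction n with
  | zero => exact congrArg Bar.of (ent_sgl X (chainPr i 0) (c 0))
  | succ n ih =>
    rw [wd_succ, Finset.sum_eq_single (i 1)]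
    · have h1 := ih (tailEmb i) (fun p => c p.succ)
      refine Eq.trans ?_ (congrArg (Bar.cons (c 0)) h1)
      have h2 := ent_sgl (Q := Q) X (chainPr i 0) (c 0)
      exact congrArg (fun y => Bar.cons y _) h2
    · intro t _ ht
      rw [ent_of_Rsupp (Rsupp_sgl X (chainPr i 0) (c 0)) ht]
      exact LinearMap.congr_fun (map_zero Bar.cons) _
    · simp

theorem wd_chain_left {M n : ℕ} (X : Fin (M + 1) → Ob) (i : Fin (n + 2) ↪o Fin (M + 1))
    (c : ∀ p : Fin (n + 1), Q.Hom (X (i p.castSucc)) (X (i p.succ))) {s e : Fin (M + 1)}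
    (h : s ≠ i 0) : wd n s e (fun p => sgl (Q := Q) X (chainPr i p) (c p)) = 0 :=
  wd_of_Lsupp h e (Lsupp_sgl X (chainPr i 0) (c 0))

theorem wd_chain_right {M n : ℕ} (X : Fin (M + 1) → Ob) (i : Fin (n + 2) ↪o Fin (M + 1))
    (c : ∀ p : Fin (n + 1), Q.Hom (X (i p.castSucc)) (X (i p.succ))) {s e : Fin (M + 1)}
    (h : e ≠ i (Fin.last (n + 1))) : wd n s e (fun p => sgl (Q := Q) X (chainPr i p) (c p)) = 0 := by
  induction n generalizing s with
  | zero =>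
    rw [wd_zero, ent_of_Rsupp (Rsupp_sgl X (chainPr i 0) (c 0)) h, map_zero]
  | succ n ih =>
    rw [wd_succ]
    refine Finset.sum_eq_zero fun t _ => ?_
    have h1 := ih (tailEmb i) (fun p => c p.succ) (s := t) h
    exact (congrArg (Bar.cons _) h1).trans (map_zero _)

/-- The word of a composable sequence as a multilinear map. -/
def wordM {n : ℕ} (X : Fin (n + 2) → Ob) :
    MultilinearMap k (fun p : Fin (n + 1) => Q.Hom (X p.castSucc) (X p.succ))
      (Bar Q n (X 0) (X (Fin.last (n + 1)))) :=
  (wd n 0 (Fin.last (n + 1))).compLinearMap fun p => sgl X (supPr p)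

theorem wordM_apply {n : ℕ} (X : Fin (n + 2) → Ob)
    (c : ∀ p : Fin (n + 1), Q.Hom (X p.castSucc) (X p.succ)) : wordM X c = word X c :=
  wd_chain X (RelEmbedding.refl _) c

/-- A cochain in arity `n + 1` and a family of linear maps on words that correspond to each
other. -/
def Matches {n : ℕ} (hQ : ∀ {n : ℕ} (X : Fin (n + 1) → Ob), Q.Tr X) (z : Coch Q)
    (ζ : Bar.Fam Q n) : Prop :=
  ∀ (X : Fin (n + 2) → Ob) c, z n X (hQ X) c = ζ _ _ (word X c)

variable {hQ : ∀ {n : ℕ} (X : Fin (n + 1) → Ob), Q.Tr X}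

/-- Both sides vanish on entries that cannot be composed, so chains suffice, and on a chain the
claim is the hypothesis. -/
theorem Matches.tot {n : ℕ} {z : Coch Q} {ζ : Bar.Fam Q n} (h : Matches hQ z ζ) {M : ℕ}
    (X : Fin (M + 1) → Ob) (x : Fin (n + 1) → Q.SeqHom X) (s e : Fin (M + 1)) :
    ent s e (z.tot X (hQ X) n x) = ζ (X s) (X e) (wd n s e x) := by
  by_cases hse : s < e
  · refine DFunLike.congr_fun (f := (ent s e).compMultilinearMap (z.tot X (hQ X) n))
      (g := (ζ (X s) (X e)).compMultilinearMap (wd n s e)) (Mid.ext ?_ ?_ fun i c => ?_) x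
    · intro a p p' hp j j' h1 h2 h3
      rw [LinearMap.compMultilinearMap_apply,
        (z.tot_pathy X (hQ X) n).mid a p p' hp j j' h1 h2 h3, map_zero]
    · intro a p p' hp j j' h1 h2 h3
      rw [LinearMap.compMultilinearMap_apply, mid_wd s e a p p' hp j j' h1 h2 h3, map_zero]
    · rw [LinearMap.compMultilinearMap_apply, LinearMap.compMultilinearMap_apply, z.tot_chain]
      by_cases hs : s = i 0
      · by_cases he : e = i (Fin.last (n + 1))
        · subst hs he
          rw [wd_chain]
          exact (ent_sgl X (endPr i) _).trans (h (X ∘ i) c)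
        · rw [wd_chain_right X i c he, map_zero]
          exact ent_of_Rsupp (Rsupp_sgl X (endPr i) _) he s
      · rw [wd_chain_left X i c hs, map_zero]
        exact ent_of_Lsupp (Lsupp_sgl X (endPr i) _) hs e
  · rw [ent_of_not_lt hse, wd_of_not_lt hse, map_zero]

open Classical in
/-- The linear map on words that is given by multilinear maps on composable sequences. -/
def liftBar {B : Type*} [AddCommGroup B] [Module k B] : ∀ {n : ℕ} {U V : Ob},
    (∀ X : Fin (n + 2) → Ob,
      MultilinearMap k (fun p : Fin (n + 1) => Q.Hom (X p.castSucc) (X p.succ)) B) →ₗ[k]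
      (Bar Q n U V →ₗ[k] B)
  | 0, U, V =>
    { toFun := fun ζ =>
        { toFun := fun a => (ζ (Fin.cons U fun _ => V)).curryLeft (Bar.of.symm a)
            (fun p => p.elim0)
          map_add' := fun a b => DFunLike.congr_fun
            ((ζ (Fin.cons U fun _ => V)).curryLeft.map_add (Bar.of.symm a) (Bar.of.symm b)) _
          map_smul' := fun c a => DFunLike.congr_fun
            ((ζ (Fin.cons U fun _ => V)).curryLeft.map_smul c (Bar.of.symm a)) _ }
      map_add' := fun ζ ξ => rfl
      map_smul' := fun c ζ => rfl }
  | n + 1, U, V =>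
    -- A first letter in `Hom U Z` is fed to all sequences `X'` through `LinearMap.single`, so that
    -- those not starting at `Z` receive zero; no transport along an equality of objects is needed.
    { toFun := fun ζ => Bar.elim fun Z => liftBar.comp (LinearMap.pi fun X' : Fin (n + 2) → Ob =>
        ((ζ (Fin.cons U X')).curryLeft.comp (LinearMap.proj (R := k)
          (φ := fun Y => Q.Hom U Y) (X' 0))).comp
          (LinearMap.single k (fun Y => Q.Hom U Y) Z))
      map_add' := fun f g => Bar.ext_cons fun Z x ω => by
        simp only [Bar.elim_cons, LinearMap.add_apply, LinearMap.comp_apply]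
        rw [← LinearMap.add_apply, ← map_add]
        rfl
      map_smul' := fun c f => Bar.ext_cons fun Z x ω => by
        simp only [Bar.elim_cons, LinearMap.smul_apply, LinearMap.comp_apply, RingHom.id_apply]
        rw [← LinearMap.smul_apply, ← map_smul]
        rfl }

theorem liftBar_word {B : Type*} [AddCommGroup B] [Module k B] {n : ℕ}
    (ζ : ∀ X : Fin (n + 2) → Ob,
      MultilinearMap k (fun p : Fin (n + 1) => Q.Hom (X p.castSucc) (X p.succ)) B)
    (X : Fin (n + 2) → Ob) (c : ∀ p : Fin (n + 1), Q.Hom (X p.castSucc) (X p.succ)) :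
    liftBar ζ (word X c) = ζ X c := by
  classical
  induction n with
  | zero =>
    obtain ⟨U, X, rfl⟩ : ∃ U X', X = Fin.cons U X' := ⟨X 0, Fin.tail X, (Fin.cons_self_tail X).symm⟩
    obtain ⟨V, rfl⟩ : ∃ V, X = fun _ => V := ⟨X 0, funext fun p => by rw [Subsingleton.elim (α := Fin 1) p 0]⟩
    have h1 : (liftBar ζ : Bar Q 0 U V →ₗ[k] B) (Bar.of (c 0)) =
      (ζ (Fin.cons U fun _ => V)).curryLeft (c 0) (fun p => p.elim0) := rfl
    refine h1.trans ?_
    refine congrArg (ζ (Fin.cons U fun _ => V)) (funext fun p => ?_)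
    obtain rfl : p = 0 := Subsingleton.elim (α := Fin 1) _ _
    rfl
  | succ n ih =>
    obtain ⟨U, X, rfl⟩ : ∃ U X', X = Fin.cons U X' := ⟨X 0, Fin.tail X, (Fin.cons_self_tail X).symm⟩
    have h1 : (liftBar ζ : Bar Q (n + 1) U (X (Fin.last (n + 1))) →ₗ[k] B)
        (Bar.cons (c 0) (word X (fun p => c p.succ))) = _ :=
      (Bar.elim_cons _ _ _).trans (ih _ X (fun p => c p.succ))
    refine h1.trans ?_
    refine Eq.trans (b := (ζ (Fin.cons U X)).curryLeft (c 0) (fun p => c p.succ)) ?_ ?_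
    · refine congrArg (fun y => (ζ (Fin.cons U X)).curryLeft y (fun p => c p.succ)) ?_
      exact Pi.single_eq_same (M := fun Y => Q.Hom U Y) (X 0) (c 0)
    · refine congrArg (ζ (Fin.cons U X)) (funext fun p => ?_)
      cases p using Fin.cases <;> rfl

theorem exists_matches_fam (hQ : ∀ {n : ℕ} (X : Fin (n + 1) → Ob), Q.Tr X) (n : ℕ) (z : Coch Q) :
    ∃ ζ : Bar.Fam Q n, Matches hQ z ζ := by
  classical
  -- `liftBar` needs a target that does not depend on the sequence: the values are put into the
  -- product of all morphism spaces and projected afterwards.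
  refine ⟨fun U V => (LinearMap.proj (R := k) (φ := fun q : Ob × Ob => Q.Hom q.1 q.2) (U, V)).comp
    (liftBar fun X => (LinearMap.single k (fun q : Ob × Ob => Q.Hom q.1 q.2)
      (X 0, X (Fin.last (n + 1)))).compMultilinearMap (z n X (hQ X))), fun X c => ?_⟩
  rw [LinearMap.comp_apply, liftBar_word]
  exact (Pi.single_eq_same (M := fun q : Ob × Ob => Q.Hom q.1 q.2) (X 0, X (Fin.last (n + 1)))
    (z n X (hQ X) c)).symm

theorem exists_matches_coch (hQ : ∀ {n : ℕ} (X : Fin (n + 1) → Ob), Q.Tr X) (n : ℕ)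
    (ζ : Bar.Fam Q n) : ∃ z : Coch Q, Matches hQ z ζ ∧ ∀ j ≠ n, z j = 0 := by
  refine ⟨fun j => if h : j = n then h ▸ fun X _ => (ζ _ _).compMultilinearMap (wordM X) else 0,
    fun X c => ?_, fun j hj => dif_neg hj⟩
  dsimp only
  rw [dif_pos rfl]
  exact congrArg _ (wordM_apply X c)

theorem Bar.word_induction {n : ℕ} {C : ∀ {U V : Ob}, Bar Q n U V → Prop}
    (h0 : ∀ U V, C (0 : Bar Q n U V)) (hadd : ∀ {U V : Ob} (ω ω' : Bar Q n U V), C ω → C ω' → C (ω + ω'))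
    (h : ∀ (X : Fin (n + 2) → Ob) c, C (word X c)) {U V : Ob} (ω : Bar Q n U V) : C ω := by
  induction n generalizing U with
  | zero =>
    obtain ⟨a, rfl⟩ := Bar.of.surjective ω
    exact h (Fin.cons U fun _ => V) (fun p => match p with | 0 => a)
  | succ n ih =>
    refine Bar.cons_induction (P := C) (h0 _ _) hadd (fun Z a ω => ?_) ω
    refine ih (C := fun {Y V} ω => ∀ U (a : Q.Hom U Y), C (Bar.cons a ω)) ?_ ?_ ?_ ω U a
    · intro Y V U a
      rw [map_zero]
      exact h0 _ _
    · intro Y V ω ω' hω hω' U a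
      rw [map_add]
      exact hadd _ _ (hω U a) (hω' U a)
    · intro X c U a
      exact h (Fin.cons U X) (fun p => Fin.cases a c p)

theorem Bar.Fam.ext_word {n : ℕ} {ζ ζ' : Bar.Fam Q n}
    (h : ∀ (X : Fin (n + 2) → Ob) c, ζ _ _ (word X c) = ζ' _ _ (word X c)) : ζ = ζ' := by
  funext U V
  refine LinearMap.ext fun ω => ?_
  refine Bar.word_induction (C := fun {U V} ω => ζ U V ω = ζ' U V ω) ?_ ?_ h ω
  · intro U V
    rw [map_zero, map_zero]
  · intro U V ω ω' h h'
    rw [map_add, map_add, h, h']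

theorem pr_word (T : Set (List Ob)) [DecidablePred (· ∈ T)] {n : ℕ} (X : Fin (n + 2) → Ob)
    (c : ∀ p : Fin (n + 1), Q.Hom (X p.castSucc) (X p.succ)) :
    Bar.pr {L | X 0 :: (L ++ [X (Fin.last (n + 1))]) ∈ T} (word X c) =
      if List.ofFn X ∈ T then word X c else 0 := by
  classical
  induction n generalizing T with
  | zero =>
    have h1 : List.ofFn X = X 0 :: ([] ++ [X (Fin.last (0 + 1))]) := by
      rw [List.ofFn_succ, List.ofFn_succ, List.ofFn_zero]
      rfl
    rw [h1]
    refine (Bar.pr_of _ (c 0)).trans ?_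
    split_ifs with h3 h4 h4
    · rfl
    · exact absurd h3 h4
    · exact absurd h4 h3
    · rfl
  | succ n ih =>
    have h1 := ih {L | X 0 :: L ∈ T} (fun p => X p.succ) (fun p => c p.succ)
    have h2 : List.ofFn X = X 0 :: List.ofFn (fun p => X p.succ) := List.ofFn_succ
    refine (Bar.pr_cons _ (c 0) (word (fun p => X p.succ) (fun p => c p.succ))).trans ?_
    refine (congrArg (Bar.cons (c 0)) h1).trans ?_
    rw [h2]
    split_ifs with h3 h4 h4
    · rfl
    · exact absurd h3 h4
    · exact absurd h4 h3
    · exact map_zero _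

theorem Matches.vanishOn_iff {n : ℕ} {T : Set (List Ob)} {z : Coch Q} {ζ : Bar.Fam Q n}
    (h : Matches hQ z ζ) : Bar.VanishOn T ζ ↔
      ∀ (X : Fin (n + 2) → Ob), List.ofFn X ∈ T → z n X (hQ X) = 0 := by
  classical
  constructor
  · intro hζ X hX
    refine MultilinearMap.ext fun c => ?_
    have h1 := hζ _ _ (word X c)
    rw [pr_word, if_pos hX] at h1
    exact (h X c).trans h1
  · intro hz U V ω
    refine Bar.word_induction (C := fun {U V} ω =>
      ζ U V (Bar.pr {L | U :: (L ++ [V]) ∈ T} ω) = 0) ?_ ?_ ?_ ω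
    · intro U V
      rw [map_zero, map_zero]
    · intro U V ω ω' h h'
      rw [map_add, map_add, h, h', add_zero]
    · intro X c
      rw [pr_word]
      split_ifs with hX
      · rw [← h X c, hz X hX]
        rfl
      · exact map_zero _

end Words
end
end AInf

namespace AInf
noncomputable section

/-! ### The Hochschild differential -/

section Hochschild

variable {k : Type w} [Field k] {N : ℕ} {Ob : Type u} {Q : TransversalQuiver.{w, u, v} k N Ob}

theorem seq_ext_ent {M : ℕ} {X : Fin (M + 1) → Ob} {x y : Q.SeqHom X}
    (h : ∀ s e, ent s e x = ent s e y) : x = y := by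
  funext q
  have h1 := h q.1.1 q.1.2
  rwa [ent_of_lt q.2, ent_of_lt q.2] at h1

theorem ent_seqMap (L : ∀ X Y, Q.Hom X Y →ₗ[k] Q.Hom X Y) {M : ℕ} {X : Fin (M + 1) → Ob}
    (s e : Fin (M + 1)) (x : Q.SeqHom X) : ent s e (seqMap L X x) = L _ _ (ent s e x) := by
  by_cases h : s < e
  · rw [ent_of_lt h, ent_of_lt h]
    rfl
  · rw [ent_of_not_lt h, ent_of_not_lt h, map_zero]

namespace CatStr

variable (H : CatStr Q)

/-- The product of `⨁_{i < j} Hom (X i) (X j)`. -/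
def seqMul {M : ℕ} (X : Fin (M + 1) → Ob) : Q.SeqHom X →ₗ[k] Q.SeqHom X →ₗ[k] Q.SeqHom X :=
  LinearMap.mk₂ k (fun a b q => ∑ t, H.mul (ent q.1.1 t a) (ent t q.1.2 b))
    (fun a a' b => by
      funext q
      simp only [map_add, LinearMap.add_apply, Finset.sum_add_distrib, Pi.add_apply])
    (fun c a b => by
      funext q
      simp only [map_smul, LinearMap.smul_apply, Finset.smul_sum, Pi.smul_apply])
    (fun a b b' => by
      funext q
      simp only [map_add, Finset.sum_add_distrib, Pi.add_apply])
    (fun c a b => by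
      funext q
      simp only [map_smul, Finset.smul_sum, Pi.smul_apply])

theorem ent_seqMul {M : ℕ} (X : Fin (M + 1) → Ob) (a b : Q.SeqHom X) (s e : Fin (M + 1)) :
    ent s e (H.seqMul X a b) = ∑ t, H.mul (ent s t a) (ent t e b) := by
  by_cases h : s < e
  · rw [ent_of_lt h]
    rfl
  · rw [ent_of_not_lt h]
    refine (Finset.sum_eq_zero fun t _ => ?_).symm
    by_cases h1 : s < t
    · rw [ent_of_not_lt (fun h2 => h (h1.trans h2)), map_zero]
    · rw [ent_of_not_lt h1, map_zero, LinearMap.zero_apply]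

theorem seqMul_mem {M : ℕ} (X : Fin (M + 1) → Ob) {a b : Q.SeqHom X} {d e : ZMod N}
    (ha : a ∈ Q.seqGr X d) (hb : b ∈ Q.seqGr X e) : H.seqMul X a b ∈ Q.seqGr X (d + e) := by
  have hent : ∀ {a : Q.SeqHom X} {d : ZMod N}, a ∈ Q.seqGr X d → ∀ s t,
      ent s t a ∈ Q.gr (X s) (X t) d := by
    intro a d ha s t
    by_cases h : s < t
    · rw [ent_of_lt h]
      exact ha ⟨(s, t), h⟩ (Set.mem_univ _)
    · rw [ent_of_not_lt h]
      exact Submodule.zero_mem _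
  intro q _
  change ∑ t, H.mul (ent q.1.1 t a) (ent t q.1.2 b) ∈ Q.gr (X q.1.1) (X q.1.2) (d + e)
  exact Submodule.sum_mem (Q.gr (X q.1.1) (X q.1.2) (d + e)) fun t _ =>
    H.mul_mem (hent ha _ _) (hent hb _ _)

variable (hQ : ∀ {n : ℕ} (X : Fin (n + 1) → Ob), Q.Tr X)

/-- The composition as a family of linear maps on words of length two. -/
def mulFam : Bar.Fam Q 1 := fun _ _ => Bar.of.symm.toLinearMap.comp (Bar.bd H)

/-- The composition as a cochain. -/
def coch : Coch Q := Classical.choose (exists_matches_coch hQ 1 H.mulFam)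

theorem matches_coch : Matches hQ (H.coch hQ) H.mulFam :=
  (Classical.choose_spec (exists_matches_coch hQ 1 H.mulFam)).1

theorem coch_ne {j : ℕ} (hj : j ≠ 1) : H.coch hQ j = 0 :=
  (Classical.choose_spec (exists_matches_coch hQ 1 H.mulFam)).2 j hj

theorem coch_apply (X : Fin 3 → Ob) (c : ∀ p : Fin 2, Q.Hom (X p.castSucc) (X p.succ)) :
    H.coch hQ 1 X (hQ X) c = H.mul (Y := X 1) (c 0) (c 1) := by
  refine (H.matches_coch hQ X c).trans ?_
  have h1 : word X c = Bar.cons (c 0) (Bar.of (c 1)) := rfl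
  rw [h1]
  change Bar.of.symm (Bar.bd H (Bar.cons (c 0) (Bar.of (c 1)))) = _
  rw [Bar.bd_cons_of, LinearEquiv.symm_apply_apply]

theorem isDeg_coch : IsDeg 2 (H.coch hQ) := by
  intro n X hX d a ha
  by_cases hn : n = 1
  · subst hn
    have h1 := H.mul_mem (ha 0) (ha 1)
    have h2 : d 0 + d 1 + (((2 : ℤ) - (((1 : ℕ) : ℤ) + 1) : ℤ) : ZMod N) = d 0 + d 1 := by norm_num
    rw [coch_apply, Fin.sum_univ_two, h2]
    exact h1
  · rw [H.coch_ne hQ hn]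
    exact Submodule.zero_mem _

theorem tot_coch {M : ℕ} (X : Fin (M + 1) → Ob) (x : Fin 2 → Q.SeqHom X) :
    (H.coch hQ).tot X (hQ X) 1 x = H.seqMul X (x 0) (x 1) := by
  refine seq_ext_ent fun s e => ?_
  rw [(H.matches_coch hQ).tot, ent_seqMul, wd_succ, map_sum]
  refine Finset.sum_congr rfl fun t _ => ?_
  change Bar.of.symm (Bar.bd H (Bar.cons _ (Bar.of _))) = _
  rw [Bar.bd_cons_of, LinearEquiv.symm_apply_apply]
  rfl

end CatStr

variable (H : CatStr Q) {hQ : ∀ {n : ℕ} (X : Fin (n + 1) → Ob), Q.Tr X}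

section Merge

variable {M : ℕ} {X : Fin (M + 1) → Ob}

/-- The sequence with the product of the entries `l` and `l + 1` as entry `l`. -/
def merge (l : ℕ) (x : ℕ → Q.SeqHom X) : ℕ → Q.SeqHom X := fun q =>
  if q < l then x q else if q = l then H.seqMul X (x l) (x (l + 1)) else x (q + 1)

theorem merge_succ_zero (l : ℕ) (x : ℕ → Q.SeqHom X) : merge H (l + 1) x 0 = x 0 := by
  simp [merge]

theorem merge_succ_succ (l : ℕ) (x : ℕ → Q.SeqHom X) (q : ℕ) :
    merge H (l + 1) x (q + 1) = merge H l (fun q => x (q + 1)) q := by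
  simp only [merge, add_lt_add_iff_right, add_left_inj]

/-- The sum over the position between the first two letters is the matrix product `seqMul`. -/
theorem sum_lact_wd (n : ℕ) (s e : Fin (M + 1)) (x : ℕ → Q.SeqHom X) :
    ∑ t, Bar.lact H (ent s t (x 0)) (wd n t e fun p => x (p + 1)) =
      wd n s e fun p => merge H 0 x p := by
  cases n with
  | zero =>
    simp only [wd_zero, Bar.lact_of]
    rw [← map_sum]
    refine congrArg Bar.of ?_
    exact (H.ent_seqMul X (x 0) (x 1) s e).symm
  | succ n =>
    simp only [wd_succ, map_sum, Bar.lact_cons]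
    rw [Finset.sum_comm]
    refine Finset.sum_congr rfl fun t _ => ?_
    have h1 := H.ent_seqMul X (x 0) (x 1) s t
    refine Eq.trans ?_ (congrArg (fun y => Bar.cons y (wd n t e fun p => x (p + 1 + 1))) h1.symm)
    rw [map_sum, LinearMap.sum_apply]
    rfl

/-- Each step of the recursion for `bd` merges the first two letters and passes the remaining merges
on with a minus sign, which accumulates to `(-1)^l`. -/
theorem bd_wd (n : ℕ) (s e : Fin (M + 1)) (x : ℕ → Q.SeqHom X) :
    Bar.bd H (wd (n + 1) s e fun p => x p) =
      ∑ l ∈ Finset.range (n + 1), (-1 : ℤ) ^ l • wd n s e fun p => merge H l x p := by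
  induction n generalizing s x with
  | zero =>
    rw [wd_succ, map_sum, Finset.sum_range_one, pow_zero, one_smul, ← sum_lact_wd]
    refine Finset.sum_congr rfl fun t _ => ?_
    rw [wd_zero, Bar.bd_cons_of, wd_zero, Bar.lact_of]
    rfl
  | succ n ih =>
    rw [wd_succ, map_sum, Finset.sum_range_succ', pow_zero, one_smul, ← sum_lact_wd]
    simp only [Bar.bd_cons, Finset.sum_sub_distrib]
    refine (sub_eq_add_neg _ _).trans ((add_comm _ _).trans ?_)
    congr 1
    have h1 : ∀ t, Bar.bd H (wd (n + 1) t e fun p : Fin (n + 2) => x (p.succ : Fin (n + 3))) =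
        ∑ l ∈ Finset.range (n + 1), (-1 : ℤ) ^ l • wd n t e fun p =>
          merge H l (fun q => x (q + 1)) p := fun t => ih t fun q => x (q + 1)
    simp only [h1, map_sum, map_zsmul, Fin.val_zero]
    rw [Finset.sum_comm, ← Finset.sum_neg_distrib]
    refine Finset.sum_congr rfl fun l _ => ?_
    rw [← Finset.smul_sum, pow_succ, mul_neg_one, neg_smul, wd_succ]
    refine congrArg (fun y => -((-1 : ℤ) ^ l • y)) (Finset.sum_congr rfl fun t _ => ?_)
    have h2 : (fun p : Fin (n + 1) => merge H (l + 1) x (p.succ : Fin (n + 2))) =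
        fun p : Fin (n + 1) => merge H l (fun q => x (q + 1)) p :=
      funext fun p => merge_succ_succ H l x p
    rw [h2]
    exact congrArg (fun y => Bar.cons (ent s t y) _) (merge_succ_zero H l x).symm

theorem wd_app (n : ℕ) (s e : Fin (M + 1)) (x : ℕ → Q.SeqHom X) :
    (wd (n + 1) s e fun p => x p) =
      ∑ t, Bar.app (wd n s t fun p => x p) (ent t e (x (n + 1))) := by
  induction n generalizing s x with
  | zero =>
    rw [wd_succ]
    refine Finset.sum_congr rfl fun t _ => ?_
    rw [wd_zero, wd_zero, Bar.app_of]
    rfl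
  | succ n ih =>
    rw [wd_succ]
    have h1 : ∀ t, (wd (n + 1) t e fun p : Fin (n + 2) => x (p.succ : Fin (n + 3))) =
      ∑ u, Bar.app (wd n t u fun p => x (p + 1)) (ent u e (x (n + 1 + 1))) :=
        fun t => ih t fun q => x (q + 1)
    simp only [h1, map_sum]
    rw [Finset.sum_comm]
    refine Finset.sum_congr rfl fun u _ => ?_
    rw [wd_succ, map_sum, LinearMap.sum_apply]
    refine Finset.sum_congr rfl fun t _ => ?_
    rw [Bar.app_cons]
    rfl

end Merge

variable (hQ) (σ : ∀ U V, Q.Hom U V →ₗ[k] Q.Hom U V)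

/-- The Hochschild differential of a cochain, on `⨁_{i < j} Hom (X i) (X j)`. -/
def hoch (z : Coch Q) (n : ℕ) {M : ℕ} (X : Fin (M + 1) → Ob) (x : ℕ → Q.SeqHom X) : Q.SeqHom X :=
  H.seqMul X (seqMap σ X (x 0)) (z.tot X (hQ X) n fun p => x (p + 1)) -
    ∑ l ∈ Finset.range (n + 1), (-1 : ℤ) ^ l • z.tot X (hQ X) n (fun p => merge H l x p) +
    (-1 : ℤ) ^ n • H.seqMul X (z.tot X (hQ X) n fun p => x p) (x (n + 1))

variable {hQ} {σ}

/-- The three groups of terms of `hoch` correspond to splitting off the first letter (`wd_succ`),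
merging two letters (`bd_wd`) and splitting off the last one (`wd_app`). -/
theorem Matches.ent_hoch {n : ℕ} {z : Coch Q} {ζ : Bar.Fam Q n} (h : Matches hQ z ζ) {M : ℕ}
    (X : Fin (M + 1) → Ob) (x : ℕ → Q.SeqHom X) (s e : Fin (M + 1)) :
    ent s e (hoch H hQ σ z n X x) =
      Bar.dfam H σ ζ (X s) (X e) (wd (n + 1) s e fun p => x p) := by
  unfold hoch
  rw [Bar.dfam_apply, map_add, map_sub, map_sum, map_zsmul, H.ent_seqMul, H.ent_seqMul, bd_wd,
    map_sum]
  congr 1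
  · congr 1
    · rw [wd_succ, map_sum]
      refine Finset.sum_congr rfl fun t _ => ?_
      rw [Bar.lfam_cons, ent_seqMap, h.tot]
      rfl
    · refine Finset.sum_congr rfl fun l _ => ?_
      rw [map_zsmul, map_zsmul, h.tot]
  · rw [wd_app, map_sum]
    refine congrArg _ (Finset.sum_congr rfl fun t _ => ?_)
    rw [Bar.rfam_app, h.tot]

theorem Matches.hoch_eq {n : ℕ} {z z' : Coch Q} {ζ : Bar.Fam Q n} {ζ' : Bar.Fam Q (n + 1)}
    (h : Matches hQ z ζ) (h' : Matches hQ z' ζ') (hd : Bar.dfam H σ ζ = ζ') {M : ℕ}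
    (X : Fin (M + 1) → Ob) (x : ℕ → Q.SeqHom X) :
    hoch H hQ σ z n X x = z'.tot X (hQ X) (n + 1) fun p => x p := by
  refine seq_ext_ent fun s e => ?_
  rw [h.ent_hoch, h'.tot, hd]

/-- Families are determined by words in homogeneous letters, and such a word is the `wd` of elements
supported on adjacent positions. -/
theorem Matches.dfam_eq {n : ℕ} {z z' : Coch Q} {ζ : Bar.Fam Q n} {ζ' : Bar.Fam Q (n + 1)}
    (h : Matches hQ z ζ) (h' : Matches hQ z' ζ')
    (hd : ∀ (M : ℕ) (X : Fin (M + 1) → Ob) (d : ℕ → ZMod N) (x : ℕ → Q.SeqHom X),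
      (∀ s, x s ∈ Q.seqGr X (d s)) →
        hoch H hQ σ z n X x = z'.tot X (hQ X) (n + 1) fun p => x p) : Bar.dfam H σ ζ = ζ' := by
  refine Bar.Fam.ext_word fun X c => ?_
  rw [← wordM_apply]
  have key : (Bar.dfam H σ ζ (X 0) (X (Fin.last (n + 1 + 1)))).compMultilinearMap (wordM X) =
      (ζ' (X 0) (X (Fin.last (n + 1 + 1)))).compMultilinearMap (wordM X) := ?_
  · exact DFunLike.congr_fun key c
  refine multilinear_ext_homogeneous (fun p => Q.gr (X p.castSucc) (X p.succ))
    (fun p => Q.isInternal _ _) _ _ fun d c hc => ?_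
  have h1 := congrArg (fun y : Q.SeqHom X => ent 0 (Fin.last (n + 1 + 1)) y)
    (hd _ X (fun q => if hq : q < n + 2 then d ⟨q, hq⟩ else 0)
      (fun q => if hq : q < n + 2 then sgl X (supPr ⟨q, hq⟩) (c ⟨q, hq⟩) else 0) (fun q => by
        by_cases hq : q < n + 2
        · rw [dif_pos hq, dif_pos hq]
          exact sgl_mem X _ _ (hc _)
        · rw [dif_neg hq, dif_neg hq]
          exact (Q.seqGr X 0).zero_mem))
  beta_reduce at h1
  rw [h.ent_hoch, h'.tot] at h1
  have h2 : (fun p : Fin (n + 1 + 1) => if hq : (p : ℕ) < n + 2 then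
      sgl (Q := Q) X (supPr ⟨p, hq⟩) (c ⟨p, hq⟩) else 0) = fun p => sgl X (supPr p) (c p) := by
    funext p
    rw [dif_pos p.2]
  rw [h2] at h1
  exact h1

end Hochschild
end
end AInf

namespace AInf
noncomputable section

/-! ### Comparison of `delta` with the Hochschild differential -/

section Delta

variable {k : Type w} [Field k] {N : ℕ} {Ob : Type u} {Q : TransversalQuiver.{w, u, v} k N Ob}

theorem neg_one_pow_smul {A : Type*} [AddCommGroup A] [Module k A] (l : ℕ) (x : A) :
    ((-1 : ℤ) ^ l) • x = sg k (l : ZMod 2) • x := by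
  induction l with
  | zero => simp [sg_zero]
  | succ l ih =>
    rw [pow_succ, mul_neg_one, neg_smul, ih, Nat.cast_succ, sg_add, sg_one, mul_neg_one, neg_smul]

theorem tot_zsmul (c : ℤ) (F : Coch Q) {M : ℕ} (X : Fin (M + 1) → Ob) (hX : Q.Tr X) (n : ℕ) :
    (c • F).tot X hX n = c • F.tot X hX n :=
  (AddMonoidHom.mk' (fun F : Coch Q => F.tot X hX n) fun F G =>
    tot_add X hX F G n).map_zsmul c F

variable (H : CatStr Q) (hQ : ∀ {n : ℕ} (X : Fin (n + 1) → Ob), Q.Tr X)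

theorem tot_susp_coch {M : ℕ} (X : Fin (M + 1) → Ob) (x : Fin 2 → Q.SeqHom X) :
    (susp (H.coch hQ)).tot X (hQ X) 1 x =
      H.seqMul X (seqMap (fun X Y => Q.tau X Y) X (x 0)) (x 1) := by
  rw [tot_susp, H.tot_coch]
  simp only [Fin.val_zero, Fin.val_one, Nat.sub_zero, pow_one, Nat.sub_self, pow_zero]
  rfl

theorem seqMap_pow_of_mem (j : ℕ) {M : ℕ} (X : Fin (M + 1) → Ob) {d : ZMod N} {a : Q.SeqHom X}
    (ha : a ∈ Q.seqGr X d) :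
    seqMap (fun X Y => Q.tau X Y ^ j) X a = sg k (j * parity d) • a := by
  funext q
  exact tauL_pow_of_mem _ j (ha q (Set.mem_univ _))

theorem seqMap_neg_pow_of_mem (j : ℕ) {M : ℕ} (X : Fin (M + 1) → Ob) {d : ZMod N} {a : Q.SeqHom X}
    (ha : a ∈ Q.seqGr X d) :
    seqMap (fun X Y => (-Q.tau X Y) ^ j) X a = sg k (j + j * parity d) • a := by
  funext q
  have hq := ha q (Set.mem_univ _)
  change ((-Q.tau _ _) ^ j) (a q) = sg k (j + j * parity d) • a q
  induction j with
  | zero => simp [sg_zero]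
  | succ j ih =>
    rw [pow_succ', Module.End.mul_apply, ih, map_smul, LinearMap.neg_apply, tauL_of_mem _ hq,
      ← neg_smul, smul_smul, ← neg_one_mul (sg k (parity d)), ← sg_one, ← sg_add, ← sg_add]
    congr 2
    push_cast
    ring

theorem insertOp_coch {M : ℕ} (X : Fin (M + 1) → Ob) (l : ℕ) (a : ℕ → Q.SeqHom X) :
    insertOp ((H.coch hQ).tot X (hQ X) 1) l a = merge H l a := by
  funext q
  simp only [insertOp, merge, H.tot_coch hQ]
  rfl

/-- Only outer index `n` and inner index one survive, and then the sign `ε` reduces to `(-1)^l`. -/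
theorem insertionSum_coch {n : ℕ} {ζ : Coch Q} (hζ : ∀ j ≠ n, ζ j = 0) {M : ℕ}
    (X : Fin (M + 1) → Ob) (d : ℕ → ZMod N) (a : ℕ → Q.SeqHom X) :
    insertionSum (ζ.tot X (hQ X)) ((H.coch hQ).tot X (hQ X)) (n + 1) d a =
      ∑ l ∈ Finset.range (n + 1), (-1 : ℤ) ^ l • ζ.tot X (hQ X) n (fun p => merge H l a p) := by
  unfold insertionSum
  rw [Finset.sum_eq_single (n, 1)]
  · refine Finset.sum_congr rfl fun l _ => ?_
    rw [insertOp_coch, units_smul_eq (k := k), neg_one_pow_smul (k := k)]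
    congr 2
    have h2 : (2 : ZMod 2) = 0 := rfl
    push_cast
    linear_combination (∑ s ∈ Finset.range l, parity (d s) + n) * h2
  · intro ij hij hne
    rw [Finset.HasAntidiagonal.mem_antidiagonal] at hij
    have h1 : ij.1 ≠ n := fun h => hne (Prod.ext h (by dsimp only; omega))
    have h0 : ζ.tot X (hQ X) ij.1 = 0 := tot_zero_of X (hQ X) (hζ _ h1)
    refine Finset.sum_eq_zero fun l _ => ?_
    rw [h0]
    exact smul_zero _
  · intro h
    exact absurd (Finset.HasAntidiagonal.mem_antidiagonal.2 (show (n, 1).1 + (n, 1).2 = n + 1 from rfl)) h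

theorem tm_zero_left {A : Type v} [AddCommGroup A] [Module k A] {i : ℕ}
    (G : Fin (i + 1) → OpFamily k A A) (n : ℕ) : tm 0 G n = 0 :=
  Finset.sum_eq_zero fun s _ => by
    split_ifs with h
    · exact blk_zero_left s h _
    · rfl

/-- The product has two slots. If `z` is its second factor, the letter in front is twisted by
`(-τ)^p`; in both cases suspension applies `τ` to the first factor. -/
theorem dcompO_coch {n p : ℕ} (z : Coch Q) {M : ℕ}
    (X : Fin (M + 1) → Ob) (a : ℕ → Q.SeqHom X) :
    dcompO ((susp (H.coch hQ)).tot X (hQ X)) ((tC Q p).tot X (hQ X)) (z.tot X (hQ X))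
      ((idC Q).tot X (hQ X)) (n + 1) (fun q => a q) =
    H.seqMul X (seqMap (fun X Y => Q.tau X Y) X (z.tot X (hQ X) n fun q => a q)) (a (n + 1)) +
    H.seqMul X (seqMap (fun X Y => Q.tau X Y) X (seqMap (fun X Y => (-Q.tau X Y) ^ p) X (a 0)))
      (z.tot X (hQ X) n fun q => a (q + 1)) := by
  unfold dcompO
  rw [sum_apply, Finset.sum_eq_single 1]
  · rw [sum_apply, Fin.sum_univ_two]
    have h1 := fun l => tm_tri_linear (n := n + 1) (Nat.succ_le_succ (Nat.zero_le n))
      ((susp (H.coch hQ)).tot X (hQ X) 1) (a := (tC Q p).tot X (hQ X)) (y := z.tot X (hQ X))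
      (b := (idC Q).tot X (hQ X)) (L := seqMap (fun X Y => (-Q.tau X Y) ^ p) X) (L' := fun x => x)
      (fun j => tot_linC_succ X (hQ X) _ j) (fun j => tot_linC_succ X (hQ X) _ j)
      (fun c => tot_linC_zero X (hQ X) _ c) (fun c => tot_linC_zero X (hQ X) _ c) l a
    rw [h1, h1, tot_susp_coch, tot_susp_coch]
    simp only [Fin.val_zero, Fin.val_one, Nat.add_sub_cancel, lt_irrefl, if_false, if_true,
      zero_add, Nat.one_ne_zero, Nat.not_lt_zero, Nat.lt_one_iff]
    simp only [add_comm 1]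
    rfl
  · intro i _ hi
    have h0 : (susp (H.coch hQ)).tot X (hQ X) i = 0 :=
      tot_zero_of X (hQ X) (susp_eq_zero (H.coch_ne hQ hi))
    rw [sum_apply]
    refine Finset.sum_eq_zero fun l _ => ?_
    rw [h0, tm_zero_left]
    rfl
  · intro h
    exact absurd (Finset.mem_range.2 (by omega)) h

/-- After the suspension signs are moved outside, the three groups of terms share one sign. What
remains of the dependence on the degree of `a_0` is the twist `τ^(p + n)` of the left action. -/
theorem tot_delta_susp (hN : 2 ∣ N) {p n : ℕ} {ζ : Coch Q} (hζ : IsDeg (p + 1) ζ)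
    (hζn : ∀ j ≠ n, ζ j = 0) {M : ℕ} (X : Fin (M + 1) → Ob) (d : ℕ → ZMod N)
    (a : ℕ → Q.SeqHom X) (ha : ∀ s, a s ∈ Q.seqGr X (d s)) :
    (delta p (susp (H.coch hQ)) (susp ζ)).tot X (hQ X) (n + 1) (fun q => a q) =
      sg k (p + suspSign (n + 1) d) • hoch H hQ (fun U V => Q.tau U V ^ (p + n)) ζ n X a := by
  have h2 : (2 : ZMod 2) = 0 := rfl
  have hs : ∑ s ∈ Finset.range (n + 1), ((n : ZMod 2) + (s : ZMod 2)) * parity (d s) +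
      ∑ s ∈ Finset.range (n + 1), parity (d s) = suspSign (n + 1) d := by
    rw [suspSign, Finset.sum_range_succ _ (n + 1), ← Finset.sum_add_distrib]
    have : (((n + 1 : ℕ) : ZMod 2) + ((n + 1 : ℕ) : ZMod 2)) * parity (d (n + 1)) = 0 := by
      linear_combination (((n + 1 : ℕ) : ZMod 2) * parity (d (n + 1))) * h2
    rw [this, add_zero]
    refine Finset.sum_congr rfl fun s _ => ?_
    push_cast
    ring
  have hs' : suspSign (n + 1) d = ((n + 1 : ℕ) : ZMod 2) * parity (d 0) +
      ∑ s ∈ Finset.range (n + 1), ((n : ZMod 2) + (s : ZMod 2)) * parity (d (s + 1)) := by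
    rw [suspSign, Finset.sum_range_succ', add_comm]
    congr 1
    · push_cast
      ring
    · refine Finset.sum_congr rfl fun s _ => ?_
      push_cast
      linear_combination parity (d (s + 1)) * h2
  have h1 := tot_susp_of_mem ζ X (hQ X) n (fun q => d q) (fun q => a q) (fun q => ha q)
  have h1' := tot_susp_of_mem ζ X (hQ X) n (fun q => d (q + 1)) (fun q => a (q + 1))
    (fun q => ha _)
  have hd := hζ.tot X (hQ X) n (fun q => d q) (fun q => a q) (fun q => ha q)
  have hp : parity ((∑ q : Fin (n + 1), d q) + ((((p : ℤ) + 1) - (n + 1) : ℤ) : ZMod N)) =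
      ∑ s ∈ Finset.range (n + 1), parity (d s) + (p + n) := by
    rw [parity_add hN, parity_sum hN, parity_intCast hN, Finset.sum_range]
    congr 1
    push_cast
    linear_combination (-(n : ZMod 2)) * h2
  have hτ : seqMap (fun X Y => Q.tau X Y) X (ζ.tot X (hQ X) n fun q => a q) =
      sg k (∑ s ∈ Finset.range (n + 1), parity (d s) + (p + n)) •
        ζ.tot X (hQ X) n fun q => a q := by
    have h3 := seqMap_pow_of_mem 1 X hd
    simp only [pow_one, Nat.cast_one, one_mul, hp] at h3
    exact h3
  have hτ' : seqMap (fun X Y => Q.tau X Y) X (a 0) = sg k (parity (d 0)) • a 0 := by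
    have h3 := seqMap_pow_of_mem 1 X (ha 0)
    simpa only [pow_one, Nat.cast_one, one_mul] using h3
  rw [delta, tot_sub, tot_zsmul, tot_dcomp, tot_dcomp, sub_apply,
    smul_apply, dcompO_coch, dcompO_susp hN ζ (H.isDeg_coch hQ) X (hQ X) (n + 1) d a ha,
    insertionSum_coch H hQ hζn, h1, h1', seqMap_neg_pow_of_mem _ X (ha 0)]
  unfold hoch
  rw [seqMap_pow_of_mem _ X (ha 0), ← Finset.sum_range (fun s => ((n : ZMod 2) + (s : ZMod 2)) * parity (d s)),
    ← Finset.sum_range (fun s => ((n : ZMod 2) + (s : ZMod 2)) * parity (d (s + 1)))]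
  simp only [map_smul, LinearMap.smul_apply, hτ, hτ', smul_sub, smul_add, neg_one_pow_smul (k := k) n, neg_one_pow_smul (k := k) p, smul_smul, ← sg_add]
  rw [add_sub_assoc, add_comm]
  congr 1
  · congr 1
    congr 2
    rw [hs']
    push_cast
    linear_combination (-(n : ZMod 2) * parity (d 0)) * h2
  · congr 2
    rw [← hs]
    ring

end Delta
end
end AInf

namespace AInf
noncomputable section

/-! ### Homogeneous parts and vanishing of the relative Hochschild cohomology -/

section Proj

variable {k : Type w} [Field k] {N : ℕ} {A : Type v} [AddCommGroup A] [Module k A]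
  {g : ZMod N → Submodule k A}

/-- The projection to the homogeneous component of degree `c`. -/
def projL (h : DirectSum.IsInternal g) (c : ZMod N) : A →ₗ[k] A :=
  letI := h.chooseDecomposition
  (g c).subtype.comp ((DirectSum.component k _ (fun d => g d) c).comp
    (DirectSum.decomposeLinearEquiv g).toLinearMap)

theorem projL_mem (h : DirectSum.IsInternal g) (c : ZMod N) (a : A) : projL h c a ∈ g c :=
  SetLike.coe_mem _

theorem projL_of_mem (h : DirectSum.IsInternal g) {c : ZMod N} {a : A} (ha : a ∈ g c) :
    projL h c a = a := by
  let _ := h.chooseDecomposition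
  exact DirectSum.decompose_of_mem_same g ha

theorem projL_of_mem_ne (h : DirectSum.IsInternal g) {c d : ZMod N} {a : A} (ha : a ∈ g d)
    (hcd : d ≠ c) : projL h c a = 0 := by
  let _ := h.chooseDecomposition
  exact DirectSum.decompose_of_mem_ne g ha hcd

/-- For each tuple `d` of degrees compose the restriction of `φ` with `P (∑ d)`; these pieces
assemble to one multilinear map on the direct sums of homogeneous components. -/
theorem exists_multilinear_hpart {n : ℕ} {A : Fin n → Type v} {B : Type v'}
    [∀ p, AddCommGroup (A p)] [∀ p, Module k (A p)] [AddCommGroup B] [Module k B]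
    {gA : ∀ p, ZMod N → Submodule k (A p)} (hA : ∀ p, DirectSum.IsInternal (gA p))
    (P : ZMod N → B →ₗ[k] B) (φ : MultilinearMap k A B) : ∃ φ' : MultilinearMap k A B,
      ∀ (d : Fin n → ZMod N) (a : ∀ p, A p), (∀ p, a p ∈ gA p (d p)) →
        φ' a = P (∑ p, d p) (φ a) := by
  let _ := fun p => (hA p).chooseDecomposition
  refine ⟨(MultilinearMap.fromDirectSumEquiv (fun d : Fin n → ZMod N =>
    (P (∑ p, d p)).compMultilinearMap
      (φ.compLinearMap fun p => (gA p (d p)).subtype))).compLinearMap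
    (fun p => (DirectSum.decomposeLinearEquiv (gA p)).toLinearMap), fun d a ha => ?_⟩
  rw [MultilinearMap.compLinearMap_apply]
  have h1 : (fun p => (DirectSum.decomposeLinearEquiv (gA p)).toLinearMap (a p)) =
      fun p => DirectSum.lof k _ (fun i => gA p i) (d p) ⟨a p, ha p⟩ := by
    funext p
    exact DirectSum.decompose_of_mem (gA p) (ha p)
  rw [h1, MultilinearMap.fromDirectSumEquiv_lof]
  rfl

end Proj

section HPart

variable {k : Type w} [Field k] {N : ℕ} {Ob : Type u} {Q : TransversalQuiver.{w, u, v} k N Ob}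

/-- `w'` is the homogeneous part of degree label `e` of `w`. -/
def IsHPart (e : ℤ) (w w' : Coch Q) : Prop :=
  ∀ (n : ℕ) (X : Fin (n + 2) → Ob) (hX : Q.Tr X) (d : Fin (n + 1) → ZMod N)
    (a : ∀ p : Fin (n + 1), Q.Hom (X p.castSucc) (X p.succ)),
    (∀ p, a p ∈ Q.gr (X p.castSucc) (X p.succ) (d p)) →
      w' n X hX a = projL (Q.isInternal _ _) ((∑ p, d p) + ((e - (n + 1) : ℤ) : ZMod N))
        (w n X hX a)

theorem exists_isHPart (e : ℤ) (w : Coch Q) : ∃ w' : Coch Q, IsHPart e w w' := by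
  choose w' hw' using fun (n : ℕ) (X : Fin (n + 2) → Ob) (hX : Q.Tr X) =>
    exists_multilinear_hpart (fun p : Fin (n + 1) => Q.isInternal (X p.castSucc) (X p.succ))
      (fun d => projL (Q.isInternal _ _) (d + ((e - (n + 1) : ℤ) : ZMod N))) (w n X hX)
  exact ⟨w', hw'⟩

theorem IsHPart.isDeg {e : ℤ} {w w' : Coch Q} (h : IsHPart e w w') : IsDeg e w' :=
  fun n X hX d a ha => by
    rw [h n X hX d a ha]
    exact projL_mem _ _ _

theorem IsHPart.eq_zero {e : ℤ} {w w' : Coch Q} (h : IsHPart e w w') {n : ℕ}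
    {X : Fin (n + 2) → Ob} {hX : Q.Tr X} (h0 : w n X hX = 0) : w' n X hX = 0 :=
  multilinear_ext_homogeneous _ (fun p => Q.isInternal _ _) _ _ fun d a ha => by
    rw [h n X hX d a ha, h0]
    exact map_zero _

theorem IsHPart.tot {e : ℤ} {w w' : Coch Q} (h : IsHPart e w w') {M : ℕ} (X : Fin (M + 1) → Ob)
    (hX : Q.Tr X) {n : ℕ} {d : Fin (n + 1) → ZMod N} {a : Fin (n + 1) → Q.SeqHom X}
    (ha : ∀ p, a p ∈ Q.seqGr X (d p)) : w'.tot X hX n a =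
      seqMap (fun X Y => projL (Q.isInternal X Y) ((∑ p, d p) + ((e - (n + 1) : ℤ) : ZMod N))) X
        (w.tot X hX n a) := by
  rw [Coch.tot_apply, Coch.tot_apply, map_sum]
  refine Finset.sum_congr rfl fun i _ => ?_
  rw [seqMap_sgl, h n (X ∘ i) _ d _ (fun p => ha p (chainPr i p) (Set.mem_univ _))]

end HPart

section Rel

variable {k : Type w} [Field k] {N : ℕ} {Ob : Type u} {Q : TransversalQuiver.{w, u, v} k N Ob}

theorem ent_mem {M : ℕ} {X : Fin (M + 1) → Ob} {a : Q.SeqHom X} {d : ZMod N}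
    (ha : a ∈ Q.seqGr X d) (s t : Fin (M + 1)) : ent s t a ∈ Q.gr (X s) (X t) d := by
  by_cases h : s < t
  · rw [ent_of_lt h]
    exact ha ⟨(s, t), h⟩ (Set.mem_univ _)
  · rw [ent_of_not_lt h]
    exact Submodule.zero_mem _

variable (H : CatStr Q) {hQ : ∀ {n : ℕ} (X : Fin (n + 1) → Ob), Q.Tr X}

theorem CatStr.mul_projL {X Y Z : Ob} {a : Q.Hom X Y} {d : ZMod N} (ha : a ∈ Q.gr X Y d)
    (c : ZMod N) (b : Q.Hom Y Z) : H.mul a (projL (Q.isInternal Y Z) c b) =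
      projL (Q.isInternal X Z) (d + c) (H.mul a b) := by
  refine LinearMap.congr_fun (f := (H.mul a).comp (projL (Q.isInternal Y Z) c))
    (g := (projL (Q.isInternal X Z) (d + c)).comp (H.mul a))
    (linearMap_ext_homogeneous (Q.isInternal Y Z) fun e b hb => ?_) b
  rw [LinearMap.comp_apply, LinearMap.comp_apply]
  by_cases he : e = c
  · subst he
    rw [projL_of_mem _ hb, projL_of_mem _ (H.mul_mem ha hb)]
  · rw [projL_of_mem_ne _ hb he, projL_of_mem_ne _ (H.mul_mem ha hb) fun h => he (add_left_cancel h),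
      map_zero]

theorem CatStr.projL_mul {X Y Z : Ob} {b : Q.Hom Y Z} {d : ZMod N} (hb : b ∈ Q.gr Y Z d)
    (c : ZMod N) (a : Q.Hom X Y) : H.mul (projL (Q.isInternal X Y) c a) b =
      projL (Q.isInternal X Z) (c + d) (H.mul a b) := by
  refine LinearMap.congr_fun (f := (H.mul.flip b).comp (projL (Q.isInternal X Y) c))
    (g := (projL (Q.isInternal X Z) (c + d)).comp (H.mul.flip b))
    (linearMap_ext_homogeneous (Q.isInternal X Y) fun e a ha => ?_) a
  rw [LinearMap.comp_apply, LinearMap.comp_apply, LinearMap.flip_apply, LinearMap.flip_apply]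
  by_cases he : e = c
  · subst he
    rw [projL_of_mem _ ha, projL_of_mem _ (H.mul_mem ha hb)]
  · rw [projL_of_mem_ne _ ha he, projL_of_mem_ne _ (H.mul_mem ha hb) fun h => he (add_right_cancel h),
      map_zero, LinearMap.zero_apply]

theorem CatStr.tau_mul {X Y Z : Ob} (hN : 2 ∣ N) (j : ℕ) (a : Q.Hom X Y) (b : Q.Hom Y Z) :
    (Q.tau X Z ^ j) (H.mul a b) = H.mul ((Q.tau X Y ^ j) a) ((Q.tau Y Z ^ j) b) := by
  refine LinearMap.congr_fun (f := (Q.tau X Z ^ j).comp (H.mul.flip b))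
    (g := (H.mul.flip ((Q.tau Y Z ^ j) b)).comp (Q.tau X Y ^ j))
    (linearMap_ext_homogeneous (Q.isInternal X Y) fun d a ha => ?_) a
  refine LinearMap.congr_fun (f := (Q.tau X Z ^ j).comp (H.mul a))
    (g := (H.mul ((Q.tau X Y ^ j) a)).comp (Q.tau Y Z ^ j))
    (linearMap_ext_homogeneous (Q.isInternal Y Z) fun e b hb => ?_) b
  rw [LinearMap.comp_apply, LinearMap.comp_apply, tauL_pow_of_mem _ _ ha, tauL_pow_of_mem _ _ hb,
    tauL_pow_of_mem _ _ (H.mul_mem ha hb), map_smul, map_smul, LinearMap.smul_apply, smul_smul,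
    ← sg_add, parity_add hN]
  congr 2
  ring

theorem CatStr.tau_one (j : ℕ) (X : Ob) : (Q.tau X X ^ j) (H.one X) = H.one X := by
  rw [tauL_pow_of_mem _ _ (H.one_mem X), parity_zero, mul_zero, sg_zero, one_smul]

theorem seqMul_seqMap_projL {M : ℕ} (X : Fin (M + 1) → Ob) {a : Q.SeqHom X} {d : ZMod N}
    (ha : a ∈ Q.seqGr X d) (c : ZMod N) (b : Q.SeqHom X) :
    H.seqMul X a (seqMap (fun X Y => projL (Q.isInternal X Y) c) X b) =
      seqMap (fun X Y => projL (Q.isInternal X Y) (d + c)) X (H.seqMul X a b) := by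
  refine seq_ext_ent fun s e => ?_
  rw [ent_seqMap, H.ent_seqMul, H.ent_seqMul, map_sum]
  refine Finset.sum_congr rfl fun t _ => ?_
  rw [ent_seqMap, H.mul_projL (ent_mem ha s t)]

theorem seqMap_projL_seqMul {M : ℕ} (X : Fin (M + 1) → Ob) {b : Q.SeqHom X} {d : ZMod N}
    (hb : b ∈ Q.seqGr X d) (c : ZMod N) (a : Q.SeqHom X) :
    H.seqMul X (seqMap (fun X Y => projL (Q.isInternal X Y) c) X a) b =
      seqMap (fun X Y => projL (Q.isInternal X Y) (c + d)) X (H.seqMul X a b) := by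
  refine seq_ext_ent fun s e => ?_
  rw [ent_seqMap, H.ent_seqMul, H.ent_seqMul, map_sum]
  refine Finset.sum_congr rfl fun t _ => ?_
  rw [ent_seqMap, H.projL_mul (ent_mem hb t e)]

theorem seqMap_projL_of_mem {M : ℕ} {X : Fin (M + 1) → Ob} {c : ZMod N} {a : Q.SeqHom X}
    (ha : a ∈ Q.seqGr X c) : seqMap (fun X Y => projL (Q.isInternal X Y) c) X a = a := by
  funext q
  exact projL_of_mem _ (ha q (Set.mem_univ _))

/-- The degrees of a sequence with the entries `l` and `l + 1` multiplied. -/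
def mergeDeg (l : ℕ) (d : ℕ → ZMod N) : ℕ → ZMod N := fun q =>
  if q < l then d q else if q = l then d l + d (l + 1) else d (q + 1)

theorem sum_mergeDeg {l n : ℕ} (hl : l ≤ n) (d : ℕ → ZMod N) :
    ∑ q ∈ Finset.range (n + 1), mergeDeg l d q = ∑ q ∈ Finset.range (n + 2), d q := by
  induction l generalizing n d with
  | zero =>
    rw [Finset.sum_range_succ', Finset.sum_range_succ' _ (n + 1), Finset.sum_range_succ' _ n,
      add_assoc]
    simp [mergeDeg, add_comm]
  | succ l ih =>
    obtain ⟨n, rfl⟩ : ∃ m, n = m + 1 := ⟨n - 1, by omega⟩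
    rw [Finset.sum_range_succ', Finset.sum_range_succ' _ (n + 2), ← ih (by omega) fun q => d (q + 1)]
    congr 1
    refine Finset.sum_congr rfl fun q _ => ?_
    simp only [mergeDeg, add_lt_add_iff_right, add_left_inj]

theorem merge_mem {M : ℕ} {X : Fin (M + 1) → Ob} {d : ℕ → ZMod N} {x : ℕ → Q.SeqHom X}
    (hx : ∀ s, x s ∈ Q.seqGr X (d s)) (l q : ℕ) : merge H l x q ∈ Q.seqGr X (mergeDeg l d q) := by
  unfold merge mergeDeg
  split_ifs
  exacts [hx _, H.seqMul_mem X (hx _) (hx _), hx _]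

/-- All terms of `hoch` use the same letters and so have the same total degree, and projections to
homogeneous components pass through multiplication by homogeneous elements with the degree shifted
accordingly. -/
theorem IsHPart.hoch {e : ℤ} {w w' : Coch Q} (h : IsHPart e w w') {n : ℕ}
    {σ : ∀ U V, Q.Hom U V →ₗ[k] Q.Hom U V}
    (hσ : ∀ {U V d} {a : Q.Hom U V}, a ∈ Q.gr U V d → σ U V a ∈ Q.gr U V d) {M : ℕ}
    (X : Fin (M + 1) → Ob) {d : ℕ → ZMod N} {x : ℕ → Q.SeqHom X}
    (hx : ∀ s, x s ∈ Q.seqGr X (d s)) : AInf.hoch H hQ σ w' n X x =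
      seqMap (fun X Y => projL (Q.isInternal X Y)
        (∑ s ∈ Finset.range (n + 2), d s + ((e - (n + 1) : ℤ) : ZMod N))) X
          (AInf.hoch H hQ σ w n X x) := by
  have hx0 : seqMap σ X (x 0) ∈ Q.seqGr X (d 0) := fun q _ => hσ (hx 0 q (Set.mem_univ _))
  unfold AInf.hoch
  rw [map_add, map_sub, map_sum, map_zsmul]
  congr 1
  · congr 1
    · rw [h.tot X (hQ X) (d := fun p => d (p + 1)) fun p => hx _, seqMul_seqMap_projL H X hx0, ← Finset.sum_range (fun s => d (s + 1)),
        Finset.sum_range_succ' _ (n + 1), add_comm _ (d 0), add_assoc]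
    · refine Finset.sum_congr rfl fun l hl => ?_
      rw [h.tot X (hQ X) (d := fun p => mergeDeg l d p) fun p => merge_mem H hx l p, map_zsmul,
        ← Finset.sum_range, sum_mergeDeg (Nat.lt_succ_iff.1 (Finset.mem_range.1 hl))]
  · rw [h.tot X (hQ X) (d := fun p => d p) fun p => hx _, seqMap_projL_seqMul H X (hx (n + 1)),
      ← Finset.sum_range, Finset.sum_range_succ _ (n + 1), add_right_comm]

/-- Up to sign and suspension, `delta` is the Hochschild differential twisted by a power of `τ`,
which is multiplicative because degrees have a parity. `Bar.exists_dfam_eq` gives a primitive that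
vanishes on `T`, and its homogeneous part of the right degree is still a primitive. -/
theorem relVanish_susp_coch (hN : 2 ∣ N) {T : Set (List Ob)} (hT0 : [] ∈ T)
    (hT : ∀ L ∈ T, ∀ L' : List Ob, L'.Sublist L → L' ∈ T) (hW : H.Extends T) (p : ℕ) :
    RelVanish T (susp (H.coch hQ)) p := by
  intro n z hz hz0 hdz hzT
  -- The sign `(-1)^p` that `tot_delta_susp` will produce is put into `z` beforehand.
  obtain ⟨z', hz', hz0', hdz', hzT', hzz'⟩ : ∃ z' : Coch Q, IsDeg (p + 2) z' ∧
      (∀ j ≠ n + 1, z' j = 0) ∧ delta (p + 1) (susp (H.coch hQ)) z' (n + 2) = 0 ∧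
      AgreeOn T z' 0 ∧ ∀ {M : ℕ} (X : Fin (M + 1) → Ob),
        z'.tot X (hQ X) (n + 1) = sg k p • z.tot X (hQ X) (n + 1) := by
    rcases Nat.even_or_odd p with hp | hp
    · refine ⟨z, hz, hz0, hdz, hzT, fun X => ?_⟩
      rw [(ZMod.natCast_eq_zero_iff_even).2 hp, sg_zero, one_smul]
    · refine ⟨-z, hz.neg, fun j hj => ?_, ?_, ?_, fun X => ?_⟩
      · change -z j = 0
        rw [hz0 j hj, neg_zero]
      · rw [delta_neg]
        change -delta _ _ _ _ = 0
        rw [hdz, neg_zero]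
      · have h1 := hzT.neg
        rwa [neg_zero] at h1
      · rw [(ZMod.natCast_eq_one_iff_odd).2 hp, sg_one]
        refine (tot_neg X (hQ X) z (n + 1)).trans (MultilinearMap.ext fun a => ?_)
        exact (neg_one_smul k _).symm
  let σ : ∀ U V, Q.Hom U V →ₗ[k] Q.Hom U V := fun U V => Q.tau U V ^ (p + n)
  -- The twist for the cocycle (label `p + 1`, index `n + 1`) agrees with the twist for the
  -- primitive (label `p`, index `n`) because `τ² = 1`.
  have hσ : (fun U V => Q.tau U V ^ (p + 1 + (n + 1))) = σ := by
    funext U V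
    have h1 := tauL_pow_mul_self (Q.isInternal U V) 1
    rw [← pow_add] at h1
    change _ = Q.tau U V ^ (p + n)
    rw [show p + 1 + (n + 1) = p + n + (1 + 1) by ring, pow_add, h1, mul_one]
  have hs : susp (susp z') = z' := susp_susp z'
  obtain ⟨ζ, hζ⟩ := exists_matches_fam hQ (n + 1) (susp z')
  have hzero : Matches hQ (0 : Coch Q) (0 : Bar.Fam Q (n + 2)) := fun X c => rfl
  have hd : Bar.dfam H σ ζ = 0 := by
    refine hζ.dfam_eq H hzero fun M X d x hx => ?_
    have h1 := tot_delta_susp H hQ hN (p := p + 1) (n := n + 1) (ζ := susp z')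
      (by have := hz'.susp; push_cast; rwa [add_assoc]) (fun j hj => susp_eq_zero (hz0' j hj)) X d x hx
    rw [hs, tot_zero_of X (hQ X) hdz', hσ] at h1
    have h2 := (sg_smul_eq_iff _ _ _).1 h1.symm
    rw [h2, tot_zero_of X (hQ X) rfl]
    exact smul_zero _
  have hζT : Bar.VanishOn T ζ := by
    refine hζ.vanishOn_iff.2 fun X hX => ?_
    have h1 := hzT' (n + 1) X (hQ X) hX
    refine MultilinearMap.ext fun c => ?_
    change z' _ X _ _ = 0
    rw [h1]
    rfl
  obtain ⟨η, hη, hηT⟩ := Bar.exists_dfam_eq (H := H) (σ := σ) (fun a b => H.tau_mul hN _ a b)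
    (fun U => H.tau_one _ U) hT0 hT hW ζ hd hζT
  obtain ⟨w₀, hw₀, hw₀n⟩ := exists_matches_coch hQ n η
  -- The contraction ignores the grading, so `η` need not be homogeneous.
  obtain ⟨w, hw⟩ := exists_isHPart (p + 1) w₀
  have hwn : ∀ j ≠ n, w j = 0 := fun j hj => by
    funext X hX
    exact hw.eq_zero (by rw [hw₀n j hj]; rfl)
  refine ⟨susp w, hw.isDeg.susp, fun j hj => susp_eq_zero (hwn j hj), ?_, ?_⟩
  · intro j X hX hXT
    have h1 : w j X hX = 0 := by
      by_cases hj : j = n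
      · subst hj
        exact hw.eq_zero (hw₀.vanishOn_iff.1 hηT X hXT)
      · rw [hwn j hj]
        rfl
    refine MultilinearMap.ext fun c => ?_
    change w j X hX _ = 0
    rw [h1]
    rfl
  · refine Coch.ext_at fun X hX => ?_
    refine seq_ext_homogeneous fun d₀ a₀ ha₀ => ?_
    let d : ℕ → ZMod N := fun q => if hq : q < n + 2 then d₀ ⟨q, hq⟩ else 0
    let a : ℕ → Q.SeqHom X := fun q => if hq : q < n + 2 then a₀ ⟨q, hq⟩ else 0
    have had : ∀ q, a q ∈ Q.seqGr X (d q) := fun q => by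
      by_cases hq : q < n + 2
      · simp only [a, d, dif_pos hq]
        exact ha₀ _
      · simp only [a, d, dif_neg hq]
        exact (Q.seqGr X 0).zero_mem
    have haf : a₀ = fun q : Fin (n + 1 + 1) => a q := by
      funext q
      simp only [a, dif_pos q.2]
    have hy := hz'.susp.tot X (hQ X) (n + 1) (fun q => d q) (fun q => a q) fun q => had q
    have hdeg : ∑ s ∈ Finset.range (n + 2), d s + (((p + 1 : ℤ) - (n + 1) : ℤ) : ZMod N) =
        (∑ q : Fin (n + 1 + 1), d q) + (((p + 2 : ℤ) - ((n + 1 : ℕ) + 1) : ℤ) : ZMod N) := by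
      rw [Finset.sum_range]
      congr 2
      push_cast
      ring
    have h1 : hoch H hQ σ w n X a = (susp z').tot X (hQ X) (n + 1) fun q => a q := by
      rw [hw.hoch H (fun {U V d a} h => tau_pow_mem (Q := Q) (p + n) h) X had,
        hw₀.hoch_eq H hζ hη, hdeg]
      exact seqMap_projL_of_mem hy
    rw [haf, tot_delta_susp H hQ hN hw.isDeg hwn X d a had, h1,
      tot_susp_of_mem z' X (hQ X) (n + 1) (fun q => d q) _ fun q => had q, hzz' X,
      ← Finset.sum_range (fun s => (((n + 1 : ℕ) : ZMod 2) + (s : ZMod 2)) * parity (d s))]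
    change sg k (p + suspSign (n + 1) d) • sg k (suspSign (n + 1) d) • sg k p •
      z.tot X (hQ X) (n + 1) (fun q => a q) = _
    rw [smul_smul, smul_smul, ← sg_add, ← sg_add]
    have h2 : (2 : ZMod 2) = 0 := rfl
    have h3 : (p : ZMod 2) + suspSign (n + 1) d + suspSign (n + 1) d + p = 0 := by
      linear_combination (p + suspSign (n + 1) d) * h2
    rw [h3, sg_zero, one_smul]

end Rel
end
end AInf

namespace AInf
noncomputable section

/-! ### The graded category of a graded pre-category -/

section TrList

variable {k : Type w} [Field k] {N : ℕ} {Ob : Type u}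

/-- All non-empty subsequences of the list `L` are transversal. -/
def TransversalQuiver.TrL (Q : TransversalQuiver.{w, u, v} k N Ob) (L : List Ob) : Prop :=
  ∀ (n : ℕ) (X : Fin (n + 1) → Ob), (List.ofFn X).Sublist L → Q.Tr X

variable {Q : TransversalQuiver.{w, u, v} k N Ob} {L : List Ob} {U V W X Y Z : Ob}

theorem TransversalQuiver.TrL.sub (h : Q.TrL L) {L' : List Ob} (hL : L'.Sublist L) : Q.TrL L' :=
  fun n X hX => h n X (hX.trans hL)

theorem TransversalQuiver.TrL.tr {n : ℕ} {X : Fin (n + 1) → Ob} (h : Q.TrL (List.ofFn X)) :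
    Q.Tr X :=
  h n X (List.Sublist.refl _)

theorem TransversalQuiver.trL_ofFn {n : ℕ} {X : Fin (n + 1) → Ob} (h : Q.Tr X) :
    Q.TrL (List.ofFn X) := by
  intro m Y hY
  rw [List.sublist_iff_exists_fin_orderEmbedding_get_eq] at hY
  obtain ⟨f, hf⟩ := hY
  have h1 := Q.tr_sub h (((Fin.castOrderIso (List.length_ofFn (f := Y)).symm).toOrderEmbedding.trans
    f).trans (Fin.castOrderIso (List.length_ofFn (f := X))).toOrderEmbedding)
  convert h1 using 1
  funext p
  have h2 := hf (Fin.cast (List.length_ofFn (f := Y)).symm p)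
  rw [List.get_ofFn, List.get_ofFn] at h2
  exact h2

theorem TransversalQuiver.trL_nil : Q.TrL [] := fun n X h => by
  have := h.length_le
  simp at this

theorem TransversalQuiver.trL_single (X : Ob) : Q.TrL [X] :=
  Q.trL_ofFn (Q.tr_single ![X])

theorem TransversalQuiver.TrL.drop₀ (h : Q.TrL (X :: L)) : Q.TrL L :=
  h.sub (List.sublist_cons_self _ _)

theorem TransversalQuiver.TrL.drop₁ (h : Q.TrL (X :: Y :: L)) : Q.TrL (X :: L) :=
  h.sub ((List.sublist_cons_self _ _).cons_cons _)

theorem TransversalQuiver.TrL.drop₂ (h : Q.TrL (X :: Y :: Z :: L)) : Q.TrL (X :: Y :: L) :=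
  h.sub (((List.sublist_cons_self _ _).cons_cons _).cons_cons _)

theorem TransversalQuiver.TrL.drop₃ (h : Q.TrL (X :: Y :: Z :: W :: L)) :
    Q.TrL (X :: Y :: Z :: L) :=
  h.sub ((((List.sublist_cons_self _ _).cons_cons _).cons_cons _).cons_cons _)

end TrList

/-! ### The category of natural families of a pre-category -/

section PreCat

variable {k : Type w} [Field k] {N : ℕ} {Ob : Type u}

/-- An associative composition of transversal morphisms, with a class of quasi-isomorphisms
such that every object admits a quasi-isomorphism from an object transversal to finitely many
given transversal sequences. -/
structure PreCatStr (Q : TransversalQuiver.{w, u, v} k N Ob) where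
  mul : ∀ {X Y Z}, Q.Hom X Y →ₗ[k] Q.Hom Y Z →ₗ[k] Q.Hom X Z
  mul_assoc : ∀ {X Y Z W} (a : Q.Hom X Y) (b : Q.Hom Y Z) (c : Q.Hom Z W), Q.TrL [X, Y, Z, W] →
    mul (mul a b) c = mul a (mul b c)
  mul_mem : ∀ {X Y Z} {a : Q.Hom X Y} {b : Q.Hom Y Z} {d e}, a ∈ Q.gr X Y d → b ∈ Q.gr Y Z e →
    mul a b ∈ Q.gr X Z (d + e)
  Qi : ∀ {X Y}, Q.Hom X Y → Prop
  qi_mem : ∀ {X Y} {f : Q.Hom X Y}, Qi f → f ∈ Q.gr X Y 0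
  qi_left : ∀ {W X Y} {f : Q.Hom X Y}, Qi f → Q.TrL [W, X, Y] →
    Function.Bijective (mul.flip f : Q.Hom W X →ₗ[k] Q.Hom W Y)
  qi_right : ∀ {X Y Z} {f : Q.Hom X Y}, Qi f → Q.TrL [X, Y, Z] →
    Function.Bijective (mul f : Q.Hom Y Z →ₗ[k] Q.Hom X Z)
  exists_qi : ∀ S : Set (List Ob), S.Finite → (∀ L ∈ S, Q.TrL L) → ∀ X : Ob,
    ∃ (W : Ob) (q : Q.Hom W X), Qi q ∧ ∀ L ∈ S, Q.TrL (W :: L)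

namespace PreCatStr

variable {Q : TransversalQuiver.{w, u, v} k N Ob} (P : PreCatStr Q)

/-- The space of natural families of maps `Hom(W, U) → Hom(W, V)`, for the objects `W` such that
`(W, U)` and `(W, V)` are transversal. -/
def NHom (U V : Ob) : Submodule k (∀ W, Q.Hom W U →ₗ[k] Q.Hom W V) where
  carrier := {θ | (∀ W, ¬(Q.TrL [W, U] ∧ Q.TrL [W, V]) → θ W = 0) ∧
    ∀ (W' W : Ob) (a : Q.Hom W' W) (x : Q.Hom W U), Q.TrL [W', W, U] → Q.TrL [W', W, V] →
      θ W' (P.mul a x) = P.mul a (θ W x)}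
  zero_mem' := ⟨fun _ _ => rfl, fun W' W a x _ _ => (map_zero (P.mul a)).symm⟩
  add_mem' := fun {θ θ'} h h' => ⟨fun W hW => by
    rw [Pi.add_apply, h.1 W hW, h'.1 W hW, add_zero], fun W' W a x hU hV => by
    rw [Pi.add_apply, Pi.add_apply, LinearMap.add_apply, LinearMap.add_apply, h.2 W' W a x hU hV,
      h'.2 W' W a x hU hV, map_add]⟩
  smul_mem' := fun c θ h => ⟨fun W hW => by
    rw [Pi.smul_apply, h.1 W hW, smul_zero], fun W' W a x hU hV => by
    rw [Pi.smul_apply, Pi.smul_apply, LinearMap.smul_apply, LinearMap.smul_apply,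
      h.2 W' W a x hU hV, map_smul]⟩

variable {P} {U V Z : Ob}

theorem nat_apply (θ : P.NHom U V) {W' W : Ob} (a : Q.Hom W' W) (x : Q.Hom W U)
    (hU : Q.TrL [W', W, U]) (hV : Q.TrL [W', W, V]) :
    θ.1 W' (P.mul a x) = P.mul a (θ.1 W x) :=
  θ.2.2 W' W a x hU hV

/-- Choose a quasi-isomorphism `r : W₁ → W` from an object transversal to `S`. By naturality `θ W`
is determined by `θ W₁`, because multiplication with `r` is injective. -/
theorem NHom.ext_on {S : Set (List Ob)} (hS : S.Finite) (hST : ∀ L ∈ S, Q.TrL L)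
    {θ θ' : P.NHom U V} (h : ∀ W, (∀ L ∈ S, Q.TrL (W :: L)) → θ.1 W = θ'.1 W) : θ = θ' := by
  refine Subtype.ext (funext fun W => ?_)
  by_cases hW : Q.TrL [W, U] ∧ Q.TrL [W, V]
  · obtain ⟨W₁, r, hr, hW₁⟩ := P.exists_qi (insert [W, U] (insert [W, V] S))
      ((hS.insert _).insert _)
      (by rintro L (rfl | rfl | hL); exacts [hW.1, hW.2, hST L hL]) W
    have hU : Q.TrL [W₁, W, U] := hW₁ _ (by simp)
    have hV : Q.TrL [W₁, W, V] := hW₁ _ (by simp)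
    refine LinearMap.ext fun x => (P.qi_right hr hV).1 ?_
    rw [← nat_apply θ r x hU hV, ← nat_apply θ' r x hU hV, h W₁ fun L hL => hW₁ L (by simp [hL])]
  · rw [θ.2.1 W hW, θ'.2.1 W hW]

/-- Naturality leaves no choice: `t x` is the preimage of `θ₀ W₁ (r x)` under multiplication with a
quasi-isomorphism `r : W₁ → W`. To see that every other morphism `r' : W₂ → W` is compatible with
this value, compare on an object `W₃` that maps to both `W₁` and `W₂` over `W`. -/
theorem exists_extend {S : Set (List Ob)} (hS : S.Finite) (hST : ∀ L ∈ S, Q.TrL L)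
    (θ₀ : ∀ W, Q.Hom W U →ₗ[k] Q.Hom W V)
    (hθ₀ : ∀ (W' W : Ob) (a : Q.Hom W' W) (x : Q.Hom W U), (∀ L ∈ S, Q.TrL (W' :: W :: L)) →
      θ₀ W' (P.mul a x) = P.mul a (θ₀ W x)) (W : Ob) (hU : Q.TrL [W, U]) (hV : Q.TrL [W, V]) :
    ∃ t : Q.Hom W U →ₗ[k] Q.Hom W V, ∀ (W₂ : Ob) (r : Q.Hom W₂ W) (x : Q.Hom W U),
      Q.TrL [W₂, W, U] → Q.TrL [W₂, W, V] → (∀ L ∈ S, Q.TrL (W₂ :: L)) →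
        P.mul r (t x) = θ₀ W₂ (P.mul r x) := by
  obtain ⟨W₁, r, hr, hW₁⟩ := P.exists_qi (insert [W, U] (insert [W, V] S))
    ((hS.insert _).insert _) (by rintro L (rfl | rfl | hL); exacts [hU, hV, hST L hL]) W
  have hU₁ : Q.TrL [W₁, W, U] := hW₁ _ (by simp)
  have hV₁ : Q.TrL [W₁, W, V] := hW₁ _ (by simp)
  have hS₁ : ∀ L ∈ S, Q.TrL (W₁ :: L) := fun L hL => hW₁ L (by simp [hL])
  let e := LinearEquiv.ofBijective (P.mul r) (P.qi_right hr hV₁)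
  have he : ∀ x, P.mul r (e.symm x) = x := fun x => e.apply_symm_apply x
  refine ⟨e.symm.toLinearMap.comp ((θ₀ W₁).comp (P.mul r)), fun W₂ r' x hU₂ hV₂ hS₂ => ?_⟩
  obtain ⟨W₃, t, ht, hW₃⟩ := P.exists_qi
    ({[W₂, W, U], [W₂, W, V], [W₁, W, U], [W₁, W, V]} ∪
      ((List.cons W₁ '' S) ∪ (List.cons W₂ '' S)))
    ((Set.toFinite _).union ((hS.image _).union (hS.image _))) (by
      rintro L ((rfl | rfl | rfl | rfl) | (⟨L, hL, rfl⟩ | ⟨L, hL, rfl⟩))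
      exacts [hU₂, hV₂, hU₁, hV₁, hS₁ L hL, hS₂ L hL]) W₂
  have h2U : Q.TrL [W₃, W₂, W, U] := hW₃ _ (by simp)
  have h2V : Q.TrL [W₃, W₂, W, V] := hW₃ _ (by simp)
  have h1U : Q.TrL [W₃, W₁, W, U] := hW₃ _ (by simp)
  have h1V : Q.TrL [W₃, W₁, W, V] := hW₃ _ (by simp)
  -- As `r` is a quasi-isomorphism, the composite `W₃ → W₂ → W` factors through it.
  obtain ⟨s, hs⟩ := (P.qi_left hr h1U.drop₃).2 (P.mul t r')
  rw [LinearMap.flip_apply] at hs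
  refine (P.qi_right ht h2V.drop₂).1 ?_
  rw [LinearMap.comp_apply, LinearMap.comp_apply, LinearEquiv.coe_coe, ← P.mul_assoc _ _ _ h2V,
    ← hs, P.mul_assoc _ _ _ h1V, he, ← hθ₀ W₃ W₁ s _ fun L hL => hW₃ _
      (Or.inr (Or.inl ⟨L, hL, rfl⟩)), ← P.mul_assoc _ _ _ h1U, hs, P.mul_assoc _ _ _ h2U,
    hθ₀ W₃ W₂ t _ fun L hL => hW₃ _ (Or.inr (Or.inr ⟨L, hL, rfl⟩))]

/-- The values come from `exists_extend`. Naturality of the extension, and its agreement with `θ₀`,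
are checked after multiplication with a quasi-isomorphism from an object transversal to `S`. -/
theorem exists_nHom {S : Set (List Ob)} (hS : S.Finite) (hST : ∀ L ∈ S, Q.TrL L)
    (θ₀ : ∀ W, Q.Hom W U →ₗ[k] Q.Hom W V)
    (hθ₀ : ∀ (W' W : Ob) (a : Q.Hom W' W) (x : Q.Hom W U), (∀ L ∈ S, Q.TrL (W' :: W :: L)) →
      θ₀ W' (P.mul a x) = P.mul a (θ₀ W x)) :
    ∃ θ : P.NHom U V, ∀ W, Q.TrL [W, U] → Q.TrL [W, V] → (∀ L ∈ S, Q.TrL (W :: L)) →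
      θ.1 W = θ₀ W := by
  have h : ∀ W, ∃ t : Q.Hom W U →ₗ[k] Q.Hom W V, (¬(Q.TrL [W, U] ∧ Q.TrL [W, V]) → t = 0) ∧
      ((Q.TrL [W, U] ∧ Q.TrL [W, V]) → ∀ (W₂ : Ob) (r : Q.Hom W₂ W) (x : Q.Hom W U),
        Q.TrL [W₂, W, U] → Q.TrL [W₂, W, V] → (∀ L ∈ S, Q.TrL (W₂ :: L)) →
          P.mul r (t x) = θ₀ W₂ (P.mul r x)) := by
    intro W
    by_cases hW : Q.TrL [W, U] ∧ Q.TrL [W, V]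
    · obtain ⟨t, ht⟩ := exists_extend hS hST θ₀ hθ₀ W hW.1 hW.2
      exact ⟨t, fun h => absurd hW h, fun _ => ht⟩
    · exact ⟨0, fun _ => rfl, fun h => absurd h hW⟩
  choose θ h0 hθ using h
  refine ⟨⟨θ, h0, fun W' W a x hU hV => ?_⟩, fun W hU hV hW => LinearMap.ext fun x => ?_⟩
  · obtain ⟨W₁, r, hr, hW₁⟩ := P.exists_qi (insert [W', W, U] (insert [W', W, V] S))
      ((hS.insert _).insert _) (by rintro L (rfl | rfl | hL); exacts [hU, hV, hST L hL]) W'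
    have hU₁ : Q.TrL [W₁, W', W, U] := hW₁ _ (by simp)
    have hV₁ : Q.TrL [W₁, W', W, V] := hW₁ _ (by simp)
    have hS₁ : ∀ L ∈ S, Q.TrL (W₁ :: L) := fun L hL => hW₁ L (by simp [hL])
    refine (P.qi_right hr hV₁.drop₂).1 ?_
    rw [hθ W' ⟨hU.drop₁, hV.drop₁⟩ W₁ r _ hU₁.drop₂ hV₁.drop₂ hS₁, ← P.mul_assoc _ _ _ hU₁,
      ← P.mul_assoc _ _ _ hV₁, hθ W ⟨hU.drop₀, hV.drop₀⟩ W₁ _ _ hU₁.drop₁ hV₁.drop₁ hS₁]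
  · obtain ⟨W₁, r, hr, hW₁⟩ := P.exists_qi
      (insert [W, U] (insert [W, V] (S ∪ (List.cons W '' S))))
      (((hS.union (hS.image _)).insert _).insert _)
      (by
        rintro L (rfl | rfl | hL | ⟨L, hL, rfl⟩)
        exacts [hU, hV, hST L hL, hW L hL]) W
    have hU₁ : Q.TrL [W₁, W, U] := hW₁ _ (by simp)
    have hV₁ : Q.TrL [W₁, W, V] := hW₁ _ (by simp)
    refine (P.qi_right hr hV₁).1 ?_
    change P.mul r (θ W x) = _
    rw [hθ W ⟨hU, hV⟩ W₁ r x hU₁ hV₁ fun L hL => hW₁ L (by simp [hL]),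
      hθ₀ W₁ W r x fun L hL => hW₁ _ (Or.inr (Or.inr (Or.inr ⟨L, hL, rfl⟩)))]

/-! #### Composition -/

/-- The pointwise composite is natural only where `W` is transversal to `V` as well; the remaining
`W` transversal to `U` and `Z` need the extension. -/
theorem exists_comp (θ : P.NHom U V) (η : P.NHom V Z) : ∃ ξ : P.NHom U Z,
    ∀ W, Q.TrL [W, U] → Q.TrL [W, V] → Q.TrL [W, Z] → ξ.1 W = (η.1 W).comp (θ.1 W) := by
  obtain ⟨ξ, hξ⟩ := exists_nHom (P := P) (S := {[U], [V], [Z]}) (Set.toFinite _)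
    (by rintro L (rfl | rfl | rfl) <;> exact Q.trL_single _) (fun W => (η.1 W).comp (θ.1 W))
    (fun W' W a x h => by
      have hU : Q.TrL [W', W, U] := h _ (by simp)
      have hV : Q.TrL [W', W, V] := h _ (by simp)
      have hZ : Q.TrL [W', W, Z] := h _ (by simp)
      rw [LinearMap.comp_apply, LinearMap.comp_apply, nat_apply θ a x hU hV, nat_apply η a _ hV hZ])
  refine ⟨ξ, fun W hU hV hZ => hξ W hU hZ ?_⟩
  rintro L (rfl | rfl | rfl)
  exacts [hU, hV, hZ]

theorem NHom.ext_single {θ θ' : P.NHom U V} (F : List Ob)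
    (h : ∀ W, (∀ X ∈ F, Q.TrL [W, X]) → θ.1 W = θ'.1 W) : θ = θ' := by
  refine NHom.ext_on (S := (fun X => [X]) '' {X | X ∈ F}) (F.finite_toSet.image _) ?_
    fun W hW => h W fun X hX => hW _ ⟨X, hX, rfl⟩
  rintro L ⟨X, -, rfl⟩
  exact Q.trL_single X

variable (P) in
/-- Composition of natural families. -/
def nmul : P.NHom U V →ₗ[k] P.NHom V Z →ₗ[k] P.NHom U Z :=
  LinearMap.mk₂ k (fun θ η => (exists_comp θ η).choose)
    (fun θ θ' η => NHom.ext_single [U, V, Z] fun W h => by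
      have hU : Q.TrL [W, U] := h _ (by simp)
      have hV : Q.TrL [W, V] := h _ (by simp)
      have hZ : Q.TrL [W, Z] := h _ (by simp)
      change _ = (exists_comp θ η).choose.1 W + (exists_comp θ' η).choose.1 W
      rw [(exists_comp _ η).choose_spec W hU hV hZ, (exists_comp _ η).choose_spec W hU hV hZ,
        (exists_comp _ η).choose_spec W hU hV hZ]
      exact LinearMap.comp_add _ _ _)
    (fun c θ η => NHom.ext_single [U, V, Z] fun W h => by
      have hU : Q.TrL [W, U] := h _ (by simp)
      have hV : Q.TrL [W, V] := h _ (by simp)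
      have hZ : Q.TrL [W, Z] := h _ (by simp)
      change _ = c • (exists_comp θ η).choose.1 W
      rw [(exists_comp _ η).choose_spec W hU hV hZ, (exists_comp _ η).choose_spec W hU hV hZ]
      exact LinearMap.comp_smul _ _ _)
    (fun θ η η' => NHom.ext_single [U, V, Z] fun W h => by
      have hU : Q.TrL [W, U] := h _ (by simp)
      have hV : Q.TrL [W, V] := h _ (by simp)
      have hZ : Q.TrL [W, Z] := h _ (by simp)
      change _ = (exists_comp θ η).choose.1 W + (exists_comp θ η').choose.1 W
      rw [(exists_comp θ _).choose_spec W hU hV hZ, (exists_comp θ _).choose_spec W hU hV hZ,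
        (exists_comp θ _).choose_spec W hU hV hZ]
      exact LinearMap.add_comp _ _ _)
    (fun c θ η => NHom.ext_single [U, V, Z] fun W h => by
      have hU : Q.TrL [W, U] := h _ (by simp)
      have hV : Q.TrL [W, V] := h _ (by simp)
      have hZ : Q.TrL [W, Z] := h _ (by simp)
      change _ = c • (exists_comp θ η).choose.1 W
      rw [(exists_comp θ _).choose_spec W hU hV hZ, (exists_comp θ _).choose_spec W hU hV hZ]
      exact LinearMap.smul_comp _ _ _)

theorem nmul_apply (θ : P.NHom U V) (η : P.NHom V Z) {W : Ob} (hU : Q.TrL [W, U])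
    (hV : Q.TrL [W, V]) (hZ : Q.TrL [W, Z]) : (P.nmul θ η).1 W = (η.1 W).comp (θ.1 W) :=
  (exists_comp θ η).choose_spec W hU hV hZ

variable (P) in
open Classical in
/-- The identity family. -/
def none (U : Ob) : P.NHom U U :=
  ⟨fun W => if Q.TrL [W, U] then LinearMap.id else 0, fun W hW => if_neg fun h => hW ⟨h, h⟩,
    fun W' W a x hU _ => by
      beta_reduce
      rw [if_pos hU.drop₁, if_pos hU.drop₀]
      rfl⟩

theorem none_apply {W : Ob} (hU : Q.TrL [W, U]) : (P.none U).1 W = LinearMap.id :=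
  if_pos hU

/-! #### Evaluation -/

variable (P) in
/-- Evaluation at a morphism. -/
def ev {W : Ob} (q : Q.Hom W U) (V : Ob) : P.NHom U V →ₗ[k] Q.Hom W V :=
  ((LinearMap.applyₗ q).comp (LinearMap.proj W)).comp (P.NHom U V).subtype

theorem ev_apply {W : Ob} (q : Q.Hom W U) (θ : P.NHom U V) : P.ev q V θ = θ.1 W q := rfl

/-- Yoneda: for `W` transversal to the sequences `(W₀, U)` and `(W₀, V)`, every element of `Hom(W,
U)` is `c q` for a unique `c`, and naturality forces `θ(c q) = c θ(q)`. Conversely this formula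
defines a family that is natural on such `W`, and `exists_nHom` extends it. -/
theorem ev_bijective {W₀ : Ob} {q : Q.Hom W₀ U} (hq : P.Qi q) (hU : Q.TrL [W₀, U])
    (hV : Q.TrL [W₀, V]) : Function.Bijective (P.ev q V) := by
  have hST : ∀ L ∈ ({[W₀, U], [W₀, V]} : Set (List Ob)), Q.TrL L := by
    rintro L (rfl | rfl)
    exacts [hU, hV]
  refine ⟨(injective_iff_map_eq_zero _).2 fun θ hθ => ?_, fun x₀ => ?_⟩
  · refine NHom.ext_on (Set.toFinite _) hST fun W hW => LinearMap.ext fun x => ?_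
    have hWU : Q.TrL [W, W₀, U] := hW _ (by simp)
    have hWV : Q.TrL [W, W₀, V] := hW _ (by simp)
    obtain ⟨c, rfl⟩ := (P.qi_left hq hWU).2 x
    rw [LinearMap.flip_apply, nat_apply θ c q hWU hWV, ← ev_apply, hθ, map_zero]
    rfl
  · have h0 : ∀ W, ∃ t : Q.Hom W U →ₗ[k] Q.Hom W V, Q.TrL [W, W₀, U] →
        ∀ c, t (P.mul c q) = P.mul c x₀ := by
      intro W
      by_cases hW : Q.TrL [W, W₀, U]
      · let e := LinearEquiv.ofBijective (P.mul.flip q) (P.qi_left hq hW)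
        refine ⟨(P.mul.flip x₀).comp e.symm.toLinearMap, fun _ c => ?_⟩
        rw [LinearMap.comp_apply, LinearEquiv.coe_coe]
        exact congrArg (P.mul.flip x₀) (e.symm_apply_apply c)
      · exact ⟨0, fun h => absurd h hW⟩
    choose θ₀ hθ₀ using h0
    obtain ⟨θ, hθ⟩ := exists_nHom (P := P) (Set.toFinite _) hST θ₀ fun W' W a x h => by
      have hWU : Q.TrL [W', W, W₀, U] := h _ (by simp)
      have hWV : Q.TrL [W', W, W₀, V] := h _ (by simp)
      obtain ⟨c, rfl⟩ := (P.qi_left hq hWU.drop₀).2 x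
      rw [LinearMap.flip_apply, ← P.mul_assoc _ _ _ hWU, hθ₀ W' hWU.drop₁, hθ₀ W hWU.drop₀,
        P.mul_assoc _ _ _ hWV]
    refine ⟨θ, ?_⟩
    obtain ⟨W₁, r, hr, hW₁⟩ := P.exists_qi _ (Set.toFinite _) hST W₀
    have hWU : Q.TrL [W₁, W₀, U] := hW₁ _ (by simp)
    have hWV : Q.TrL [W₁, W₀, V] := hW₁ _ (by simp)
    refine (P.qi_right hr hWV).1 ?_
    rw [ev_apply, ← nat_apply θ r q hWU hWV, hθ W₁ hWU.drop₁ hWV.drop₁ hW₁, hθ₀ W₁ hWU]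

/-! #### The grading -/

variable (P) in
/-- Natural families of degree `d`. -/
def ngr (U V : Ob) (d : ZMod N) : Submodule k (P.NHom U V) where
  carrier := {θ | ∀ W, Q.TrL [W, U] → Q.TrL [W, V] → ∀ e, ∀ x ∈ Q.gr W U e,
    θ.1 W x ∈ Q.gr W V (e + d)}
  zero_mem' := fun W _ _ e x _ => (Q.gr W V (e + d)).zero_mem
  add_mem' := fun h h' W hU hV e x hx =>
    (Q.gr W V (e + d)).add_mem (h W hU hV e x hx) (h' W hU hV e x hx)
  smul_mem' := fun c θ h W hU hV e x hx => (Q.gr W V (e + d)).smul_mem c (h W hU hV e x hx)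

/-- Multiplications with quasi-isomorphisms are bijective of degree zero, so they reflect degrees.
They carry the degree of `θ(q)` to the degree of `θ` on every `W`. -/
theorem mem_ngr_iff {W₀ : Ob} {q : Q.Hom W₀ U} (hq : P.Qi q) (hU : Q.TrL [W₀, U])
    (hV : Q.TrL [W₀, V]) {θ : P.NHom U V} {d : ZMod N} :
    θ ∈ P.ngr U V d ↔ P.ev q V θ ∈ Q.gr W₀ V d := by
  refine ⟨fun h => ?_, fun h W hWU hWV e x hx => ?_⟩
  · have h1 := h W₀ hU hV 0 q (P.qi_mem hq)
    rwa [zero_add] at h1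
  · obtain ⟨W₁, r, hr, hW₁⟩ := P.exists_qi {[W, U], [W, V], [W₀, U], [W₀, V]} (Set.toFinite _)
      (by rintro L (rfl | rfl | rfl | rfl); exacts [hWU, hWV, hU, hV]) W
    have h1 : Q.TrL [W₁, W, U] := hW₁ _ (by simp)
    have h2 : Q.TrL [W₁, W, V] := hW₁ _ (by simp)
    have h3 : Q.TrL [W₁, W₀, U] := hW₁ _ (by simp)
    have h4 : Q.TrL [W₁, W₀, V] := hW₁ _ (by simp)
    refine mem_of_map_mem _ _ (Q.isInternal W V) (Q.isInternal W₁ V) (P.mul r)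
      (P.qi_right hr h2).1 (fun d a ha => ?_) _ _ ?_
    · have h5 := P.mul_mem (P.qi_mem hr) ha
      rwa [zero_add] at h5
    · rw [← nat_apply θ r x h1 h2]
      have h5 := P.mul_mem (P.qi_mem hr) hx
      obtain ⟨c, hc⟩ := (P.qi_left hq h3).2 (P.mul r x)
      rw [zero_add, ← hc] at h5
      have h6 := mem_of_map_mem _ _ (Q.isInternal W₁ W₀) (Q.isInternal W₁ U) (P.mul.flip q)
        (P.qi_left hq h3).1 (fun d a ha => by
          have h7 := P.mul_mem ha (P.qi_mem hq)
          rwa [add_zero] at h7) _ _ h5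
      rw [← hc, LinearMap.flip_apply, nat_apply θ c q h3 h4]
      exact P.mul_mem h6 h

theorem exists_ev (F : List Ob) (U : Ob) : ∃ (W : Ob) (q : Q.Hom W U), P.Qi q ∧
    Q.TrL [W, U] ∧ ∀ X ∈ F, Q.TrL [W, X] := by
  obtain ⟨W, q, hq, hW⟩ := P.exists_qi ((fun X => [X]) '' {X | X ∈ U :: F})
    ((U :: F).finite_toSet.image _) (by rintro L ⟨X, -, rfl⟩; exact Q.trL_single X) U
  exact ⟨W, q, hq, hW _ ⟨U, by simp, rfl⟩, fun X hX => hW _ ⟨X, by simp [hX], rfl⟩⟩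

theorem _root_.DirectSum.IsInternal.comap_equiv {A : Type v} {B : Type v'} [AddCommGroup A]
    [Module k A] [AddCommGroup B] [Module k B] {g : ZMod N → Submodule k B}
    (h : DirectSum.IsInternal g) (e : A ≃ₗ[k] B) :
    DirectSum.IsInternal fun d => (g d).comap e.toLinearMap := by
  rw [DirectSum.isInternal_submodule_iff_iSupIndep_and_iSup_eq_top] at h ⊢
  have h1 : (fun d => (g d).comap e.toLinearMap) =
      (Submodule.orderIsoMapComap e.symm) ∘ g := by
    funext d
    exact (Submodule.map_equiv_eq_comap_symm e.symm (g d)).symm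
  rw [h1]
  refine ⟨h.1.map_orderIso _, ?_⟩
  have h2 := (Submodule.orderIsoMapComap e.symm).map_iSup g
  rw [h.2, map_top] at h2
  exact h2.symm

/-- The grading is that of `Hom(W, V)`, transported by evaluation at a quasi-isomorphism `W → U`. -/
theorem ngr_isInternal (U V : Ob) : DirectSum.IsInternal (P.ngr U V) := by
  obtain ⟨W, q, hq, hU, hV⟩ := exists_ev (P := P) [V] U
  have h1 := (Q.isInternal W V).comap_equiv
    (LinearEquiv.ofBijective (P.ev q V) (ev_bijective hq hU (hV V (by simp))))
  have h2 : P.ngr U V = fun d => (Q.gr W V d).comap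
      (LinearEquiv.ofBijective (P.ev q V) (ev_bijective hq hU (hV V (by simp)))).toLinearMap := by
    funext d
    exact Submodule.ext fun θ => mem_ngr_iff hq hU (hV V (by simp))
  rw [h2]
  exact h1

theorem none_nmul (θ : P.NHom U V) : P.nmul (P.none U) θ = θ :=
  NHom.ext_single [U, V] fun W h => by
    have hU : Q.TrL [W, U] := h _ (by simp)
    have hV : Q.TrL [W, V] := h _ (by simp)
    rw [nmul_apply _ θ hU hU hV, none_apply hU, LinearMap.comp_id]

theorem nmul_none (θ : P.NHom U V) : P.nmul θ (P.none V) = θ :=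
  NHom.ext_single [U, V] fun W h => by
    have hU : Q.TrL [W, U] := h _ (by simp)
    have hV : Q.TrL [W, V] := h _ (by simp)
    rw [nmul_apply θ _ hU hV hV, none_apply hV, LinearMap.id_comp]

theorem nmul_assoc {Y : Ob} (a : P.NHom U V) (b : P.NHom V Z) (c : P.NHom Z Y) :
    P.nmul (P.nmul a b) c = P.nmul a (P.nmul b c) :=
  NHom.ext_single [U, V, Z, Y] fun W h => by
    have hU : Q.TrL [W, U] := h _ (by simp)
    have hV : Q.TrL [W, V] := h _ (by simp)
    have hZ : Q.TrL [W, Z] := h _ (by simp)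
    have hY : Q.TrL [W, Y] := h _ (by simp)
    rw [nmul_apply _ c hU hZ hY, nmul_apply a b hU hV hZ, nmul_apply a _ hU hV hY,
      nmul_apply b c hV hZ hY, LinearMap.comp_assoc]

theorem none_mem (U : Ob) : P.none U ∈ P.ngr U U 0 := fun W h _ e x hx => by
  rw [none_apply h, add_zero]
  exact hx

theorem nmul_mem {a : P.NHom U V} {b : P.NHom V Z} {d e : ZMod N} (ha : a ∈ P.ngr U V d)
    (hb : b ∈ P.ngr V Z e) : P.nmul a b ∈ P.ngr U Z (d + e) := by
  obtain ⟨W, q, hq, hU, h⟩ := exists_ev (P := P) [V, Z] U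
  have hV : Q.TrL [W, V] := h _ (by simp)
  have hZ : Q.TrL [W, Z] := h _ (by simp)
  refine (mem_ngr_iff hq hU hZ).2 ?_
  rw [ev_apply, nmul_apply a b hU hV hZ]
  exact hb W hV hZ d _ ((mem_ngr_iff hq hU hV).1 ha)

variable (P) in
/-- The morphism spaces of natural families. All sequences of objects are transversal. -/
def nQuiver : TransversalQuiver.{w, u, max u v} k N Ob where
  Hom U V := P.NHom U V
  gr := P.ngr
  isInternal := ngr_isInternal
  Tr _ := True
  tr_single _ := trivial
  tr_sub _ _ := trivial

variable (P) in
/-- The graded category of natural families. -/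
def nCat : CatStr P.nQuiver where
  one := P.none
  mul := P.nmul
  one_mul := none_nmul
  mul_one := nmul_none
  mul_assoc := nmul_assoc
  one_mem := none_mem
  mul_mem := nmul_mem

/-! #### The morphism from the pre-category -/

theorem exists_ofHom (hUV : Q.TrL [U, V]) (f : Q.Hom U V) : ∃ θ : P.NHom U V,
    ∀ W, Q.TrL [W, U, V] → ∀ x, θ.1 W x = P.mul x f := by
  obtain ⟨θ, hθ⟩ := exists_nHom (P := P) (S := {[U, V]}) (Set.toFinite _)
    (by rintro L rfl; exact hUV) (fun W => P.mul.flip f) fun W' W a x h =>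
      P.mul_assoc a x f (h _ rfl)
  refine ⟨θ, fun W hW x => ?_⟩
  rw [hθ W hW.drop₂ hW.drop₁ (by rintro L rfl; exact hW)]
  rfl

theorem ofHom_unique (hUV : Q.TrL [U, V]) {θ θ' : P.NHom U V}
    (h : ∀ W, Q.TrL [W, U, V] → ∀ x, θ.1 W x = θ'.1 W x) : θ = θ' :=
  NHom.ext_on (S := {[U, V]}) (Set.toFinite _) (by rintro L rfl; exact hUV)
    fun W hW => LinearMap.ext (h W (hW _ rfl))

variable (P) in
/-- The natural family of multiplications with a morphism of a transversal pair. -/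
def ofHom (hUV : Q.TrL [U, V]) : Q.Hom U V →ₗ[k] P.NHom U V where
  toFun f := (exists_ofHom hUV f).choose
  map_add' f g := ofHom_unique hUV fun W hW x => by
    rw [(exists_ofHom hUV _).choose_spec W hW, map_add]
    exact congrArg₂ (· + ·) ((exists_ofHom hUV f).choose_spec W hW x).symm
      ((exists_ofHom hUV g).choose_spec W hW x).symm
  map_smul' c f := ofHom_unique hUV fun W hW x => by
    rw [(exists_ofHom hUV _).choose_spec W hW, map_smul]
    exact congrArg (c • ·) ((exists_ofHom hUV f).choose_spec W hW x).symm

theorem ofHom_apply (hUV : Q.TrL [U, V]) (f : Q.Hom U V) {W : Ob} (hW : Q.TrL [W, U, V])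
    (x : Q.Hom W U) : (P.ofHom hUV f).1 W x = P.mul x f :=
  (exists_ofHom hUV f).choose_spec W hW x

theorem exists_qi_pair (hUV : Q.TrL [U, V]) (X : Ob) : ∃ (W : Ob) (q : Q.Hom W X), P.Qi q ∧
    Q.TrL [W, X] ∧ Q.TrL [W, U, V] := by
  obtain ⟨W, q, hq, hW⟩ := P.exists_qi {[X], [U, V]} (Set.toFinite _)
    (by rintro L (rfl | rfl); exacts [Q.trL_single X, hUV]) X
  exact ⟨W, q, hq, hW _ (by simp), hW _ (by simp)⟩

/-- Evaluation at a quasi-isomorphism `q` takes the family of `f` to `q f`; both evaluation and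
multiplication with `q` are bijective. -/
theorem ofHom_bijective (hUV : Q.TrL [U, V]) : Function.Bijective (P.ofHom hUV) := by
  obtain ⟨W, q, hq, hU, hW⟩ := exists_qi_pair (P := P) hUV U
  refine (Function.Bijective.of_comp_iff' (ev_bijective hq hU hW.drop₁) _).1 ?_
  have h1 : P.ev q V ∘ P.ofHom hUV = P.mul q := by
    funext f
    exact ofHom_apply hUV f hW q
  rw [h1]
  exact P.qi_right hq hW

theorem ofHom_mem (hUV : Q.TrL [U, V]) {d : ZMod N} {f : Q.Hom U V} (hf : f ∈ Q.gr U V d) :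
    P.ofHom hUV f ∈ P.ngr U V d := by
  obtain ⟨W, q, hq, hU, hW⟩ := exists_qi_pair (P := P) hUV U
  refine (mem_ngr_iff hq hU hW.drop₁).2 ?_
  rw [ev_apply, ofHom_apply hUV f hW]
  have h1 := P.mul_mem (P.qi_mem hq) hf
  rwa [zero_add] at h1

theorem ofHom_mul (h : Q.TrL [U, V, Z]) (f : Q.Hom U V) (g : Q.Hom V Z) :
    P.nmul (P.ofHom h.drop₂ f) (P.ofHom h.drop₀ g) = P.ofHom h.drop₁ (P.mul f g) := by
  refine NHom.ext_on (S := {[U, V, Z]}) (Set.toFinite _) (by rintro L rfl; exact h)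
    fun W hW => LinearMap.ext fun x => ?_
  have hW' : Q.TrL [W, U, V, Z] := hW _ rfl
  rw [nmul_apply _ _ hW'.drop₂.drop₂ hW'.drop₁.drop₂ hW'.drop₁.drop₁, LinearMap.comp_apply,
    ofHom_apply _ f hW'.drop₃, ofHom_apply _ g hW'.drop₁, ofHom_apply _ _ hW'.drop₂,
    P.mul_assoc _ _ _ hW']

/-- Objects isomorphic in the category of natural families. -/
def NIso (P : PreCatStr Q) (X Y : Ob) : Prop :=
  ∃ (a : P.NHom X Y) (b : P.NHom Y X), P.nmul a b = P.none X ∧ P.nmul b a = P.none Y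

theorem NIso.refl (X : Ob) : NIso P X X :=
  ⟨P.none X, P.none X, none_nmul _, none_nmul _⟩

theorem NIso.symm {X Y : Ob} (h : NIso P X Y) : NIso P Y X := by
  obtain ⟨a, b, hab, hba⟩ := h
  exact ⟨b, a, hba, hab⟩

theorem NIso.trans {X Y Z : Ob} (h : NIso P X Y) (h' : NIso P Y Z) : NIso P X Z := by
  obtain ⟨a, b, hab, hba⟩ := h
  obtain ⟨c, d, hcd, hdc⟩ := h'
  refine ⟨P.nmul a c, P.nmul d b, ?_, ?_⟩
  · rw [nmul_assoc, ← nmul_assoc c, hcd, none_nmul, hab]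
  · rw [nmul_assoc, ← nmul_assoc b, hba, none_nmul, hdc]

/-- By evaluation, right multiplication with the family of `f` is bijective on all spaces `P.NHom X
U`. Surjectivity for `X = V` gives a one-sided inverse, and injectivity for `X = U` makes it
two-sided. -/
theorem nIso_of_qi (hUV : Q.TrL [U, V]) {f : Q.Hom U V} (hf : P.Qi f) : NIso P U V := by
  have hb : ∀ X, Function.Bijective fun θ : P.NHom X U => P.nmul θ (P.ofHom hUV f) := by
    intro X
    obtain ⟨W, q, hq, hX, hW⟩ := exists_qi_pair (P := P) hUV X
    refine (Function.Bijective.of_comp_iff' (ev_bijective hq hX hW.drop₁) _).1 ?_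
    have h1 : (P.ev q V ∘ fun θ : P.NHom X U => P.nmul θ (P.ofHom hUV f)) =
        (P.mul.flip f) ∘ P.ev q U := by
      funext θ
      change (P.nmul θ (P.ofHom hUV f)).1 W q = P.mul (θ.1 W q) f
      rw [nmul_apply _ _ hX hW.drop₂ hW.drop₁, LinearMap.comp_apply, ofHom_apply hUV f hW]
    rw [h1]
    exact (P.qi_left hf hW).comp (ev_bijective hq hX hW.drop₂)
  obtain ⟨g, hg⟩ := (hb V).2 (P.none V)
  refine ⟨P.ofHom hUV f, g, (hb U).1 ?_, hg⟩
  beta_reduce at hg ⊢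
  rw [nmul_assoc, hg, nmul_none, none_nmul]

end PreCatStr
end PreCat
end
end AInf

namespace AInf
noncomputable section

/-! ### Associativity as the lowest `A∞`-relation -/

section SqCoch

variable {k : Type w} [Field k] {N : ℕ} {Ob : Type u} {Q : TransversalQuiver.{w, u, v} k N Ob}
  (H : CatStr Q) (hQ : ∀ {n : ℕ} (X : Fin (n + 1) → Ob), Q.Tr X)

theorem CatStr.seqMul_assoc {M : ℕ} (X : Fin (M + 1) → Ob) (a b c : Q.SeqHom X) :
    H.seqMul X (H.seqMul X a b) c = H.seqMul X a (H.seqMul X b c) := by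
  refine seq_ext_ent fun s e => ?_
  simp only [H.ent_seqMul, map_sum, LinearMap.sum_apply, H.mul_assoc]
  exact Finset.sum_comm

/-- After desuspension the relation at index two consists of two terms of opposite sign, equal by
associativity. -/
theorem sq_susp_coch (hN : 2 ∣ N) : sq (susp (H.coch hQ)) 2 = 0 := by
  refine Coch.ext_at (G := (0 : Coch Q)) fun X hX => ?_
  refine seq_ext_homogeneous fun d a ha => ?_
  have h1 := dcompO_susp hN (H.coch hQ) (H.isDeg_coch hQ) X hX 2 (extendZero d) (extendZero a)
    (extendZero_mem ha)
  simp only [extendZero_val] at h1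
  rw [sq, tot_dcomp, tot_zero_of X hX rfl]
  refine h1.trans ?_
  rw [insertionSum_coch H hQ (fun j hj => H.coch_ne hQ hj), Finset.sum_range_succ,
    Finset.sum_range_one, H.tot_coch hQ, H.tot_coch hQ]
  have h2 : H.seqMul X (merge H 0 (extendZero a) 0) (merge H 0 (extendZero a) 1) =
      H.seqMul X (merge H 1 (extendZero a) 0) (merge H 1 (extendZero a) 1) := by
    simp [merge, H.seqMul_assoc]
  change sg k _ • ((-1 : ℤ) ^ 0 • H.seqMul X (merge H 0 (extendZero a) 0)
    (merge H 0 (extendZero a) 1) + (-1 : ℤ) ^ 1 • H.seqMul X (merge H 1 (extendZero a) 0)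
      (merge H 1 (extendZero a) 1)) = 0
  rw [h2]
  simp

end SqCoch

/-! ### Graded pre-categories and quasi-isomorphisms -/

section Graded

variable {k : Type w} [Field k] {N : ℕ}

/-- With zero differentials a space is its own cohomology. -/
theorem InducesCohomologyIso.bijective {A : Type v} {B : Type v'} [AddCommGroup A] [Module k A]
    [AddCommGroup B] [Module k B] {δ : A → A} {δ' : B → B} {g : A →ₗ[k] B}
    (h : InducesCohomologyIso δ δ' g) (hδ : ∀ a, δ a = 0) (hδ' : ∀ b, δ' b = 0) :
    Function.Bijective g := by
  refine ⟨(injective_iff_map_eq_zero _).2 fun a ha => ?_, fun b => ?_⟩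
  · obtain ⟨c, hc⟩ := h.2.1 a (hδ a) ⟨0, by rw [ha, hδ']⟩
    rw [hc, hδ]
  · obtain ⟨a, -, c, hc⟩ := h.2.2 b (hδ' b)
    exact ⟨a, by rw [hc, hδ', add_zero]⟩

variable (D : GradedPreCategory.{w, u, v} k N)

/-- The composition of a transversal triple. -/
def GradedPreCategory.binL (X Y Z : D.Ob) (h : D.Q.Tr ![X, Y, Z]) :
    D.Q.Hom X Y →ₗ[k] D.Q.Hom Y Z →ₗ[k] D.Q.Hom X Z :=
  LinearMap.mk₂ k (D.μ.bin X Y Z h)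
    (fun a b c => (D.μ.map 1 ![X, Y, Z] h).cons_add (Fin.cons c finZeroElim) a b)
    (fun r a c => (D.μ.map 1 ![X, Y, Z] h).cons_smul (Fin.cons c finZeroElim) r a)
    (fun a b c => ((D.μ.map 1 ![X, Y, Z] h).curryLeft a).cons_add finZeroElim b c)
    (fun r a c => ((D.μ.map 1 ![X, Y, Z] h).curryLeft a).cons_smul finZeroElim r c)

open Classical in
/-- The composition, extended by zero to all triples. -/
def GradedPreCategory.mul {X Y Z : D.Ob} : D.Q.Hom X Y →ₗ[k] D.Q.Hom Y Z →ₗ[k] D.Q.Hom X Z :=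
  if h : D.Q.Tr ![X, Y, Z] then D.binL X Y Z h else 0

variable {D} {X Y Z W : D.Ob}

theorem GradedPreCategory.mul_of_tr (h : D.Q.Tr ![X, Y, Z]) (a : D.Q.Hom X Y) (b : D.Q.Hom Y Z) :
    D.mul a b = D.μ.bin X Y Z h a b := by
  unfold GradedPreCategory.mul
  rw [dif_pos h]
  rfl

theorem GradedPreCategory.mul_mem {a : D.Q.Hom X Y} {b : D.Q.Hom Y Z} {d e : ZMod N}
    (ha : a ∈ D.Q.gr X Y d) (hb : b ∈ D.Q.gr Y Z e) : D.mul a b ∈ D.Q.gr X Z (d + e) := by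
  by_cases h : D.Q.Tr ![X, Y, Z]
  · rw [D.mul_of_tr h]
    have h1 := D.μ.map_mem 1 ![X, Y, Z] h ![d, e] (Fin.cons a (Fin.cons b finZeroElim)) (by
      intro p
      fin_cases p
      exacts [ha, hb])
    have h2 : (∑ p, ![d, e] p) + (((2 : ℤ) - ((1 : ℕ) + 1) : ℤ) : ZMod N) = d + e := by
      simp [Fin.sum_univ_two]
    rw [h2] at h1
    exact h1
  · unfold GradedPreCategory.mul
    rw [dif_neg h]
    exact Submodule.zero_mem _

theorem GradedPreCategory.map_one_apply (X : Fin 3 → D.Ob) (hX : D.Q.Tr X)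
    (a : ∀ p : Fin 2, D.Q.Hom (X p.castSucc) (X p.succ)) :
    D.μ.map 1 X hX a = D.mul (Y := X 1) (a 0) (a 1) := by
  obtain ⟨x, y, z, rfl⟩ : ∃ x y z, X = ![x, y, z] :=
    ⟨X 0, X 1, X 2, by funext p; fin_cases p <;> rfl⟩
  refine Eq.trans ?_ (D.mul_of_tr hX (a 0) (a 1)).symm
  refine congrArg (D.μ.map 1 ![x, y, z] hX) ?_
  funext p
  fin_cases p <;> rfl

theorem GradedPreCategory.lin_eq_zero (h : D.Q.Tr ![X, Y]) (a : D.Q.Hom X Y) :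
    D.μ.lin X Y h a = 0 :=
  DFunLike.congr_fun (D.map_eq_zero 0 (by decide) ![X, Y] h) _

theorem GradedPreCategory.mul_left_bijective (h : D.Q.Tr ![X, Y]) {f : D.Q.Hom X Y}
    (hf : IsQuasiIso D.μ h f) (hW : D.Q.Tr ![W, X, Y]) :
    Function.Bijective (D.mul.flip f : D.Q.Hom W X →ₗ[k] D.Q.Hom W Y) := by
  have h1 : (fun a => D.μ.bin W X Y hW a f) = (D.mul.flip f : D.Q.Hom W X →ₗ[k] D.Q.Hom W Y) := by
    funext a
    exact (D.mul_of_tr hW a f).symm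
  have h2 := hf.2.2.1 W hW
  rw [h1] at h2
  exact h2.bijective (D.lin_eq_zero _) (D.lin_eq_zero _)

theorem GradedPreCategory.mul_right_bijective (h : D.Q.Tr ![X, Y]) {f : D.Q.Hom X Y}
    (hf : IsQuasiIso D.μ h f) (hZ : D.Q.Tr ![X, Y, Z]) :
    Function.Bijective (D.mul f : D.Q.Hom Y Z →ₗ[k] D.Q.Hom X Z) := by
  have h1 : (fun b => D.μ.bin X Y Z hZ f b) = (D.mul f : D.Q.Hom Y Z →ₗ[k] D.Q.Hom X Z) := by
    funext b
    exact (D.mul_of_tr hZ f b).symm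
  have h2 := hf.2.2.2 Z hZ
  rw [h1] at h2
  exact h2.bijective (D.lin_eq_zero _) (D.lin_eq_zero _)

/-- The list `L` as a transversal sequence; the empty list is replaced by a sequence of length
one. -/
def listSeq {Ob : Type u} (X : Ob) : List Ob → Σ n : ℕ, Fin (n + 1) → Ob
  | [] => ⟨0, fun _ => X⟩
  | Y :: L => ⟨L.length, (Y :: L).get⟩

/-- Only the left half of the extension property is needed; the object on the right is removed by
passing to a subsequence. -/
theorem GradedPreCategory.exists_qi (S : Set (List D.Ob)) (hS : S.Finite)
    (hST : ∀ L ∈ S, D.Q.TrL L) (X : D.Ob) :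
    ∃ W, HasQuasiIso D.μ W X ∧ ∀ L ∈ S, D.Q.TrL (W :: L) := by
  obtain ⟨W, W', hW, _, h⟩ := D.hasExtension (listSeq X '' S) (hS.image _) (by
    rintro - ⟨L, hL, rfl⟩
    cases L with
    | nil => exact D.Q.tr_single _
    | cons Y L =>
      refine (hST _ hL) _ _ ?_
      have h1 : List.ofFn (listSeq X (Y :: L)).2 = Y :: L := List.ofFn_get (Y :: L)
      rw [h1]) X
  refine ⟨W, hW, fun L hL => ?_⟩
  cases L with
  | nil => exact D.Q.trL_single W
  | cons Y L =>
    have h1 := h _ ⟨_, hL, rfl⟩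
    rw [Fin.cons_snoc_eq_snoc_cons] at h1
    have h2 := D.Q.tr_sub h1 Fin.castSuccOrderEmb
    have h3 : (Fin.snoc (Fin.cons W (listSeq X (Y :: L)).2 : Fin (L.length + 2) → D.Ob) W' :
        Fin (L.length + 3) → D.Ob) ∘ Fin.castSuccOrderEmb =
        (Fin.cons W (Y :: L).get : Fin (L.length + 2) → D.Ob) := by
      funext p
      exact Fin.snoc_castSucc (α := fun _ => D.Ob) _ _ p
    have h4 := D.Q.trL_ofFn
      ((congrArg (fun V : Fin (L.length + 2) → D.Ob => D.Q.Tr V) h3).mp h2)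
    rw [List.ofFn_cons, List.ofFn_get] at h4
    exact h4

/-- Place `x`, `y`, `z` at the pairs `(0, 1)`, `(1, 2)`, `(2, 3)`. Only `m_2` is non-zero, so the
`A∞`-relation with three inputs has two terms, with signs `1` and `-1`. -/
theorem GradedPreCategory.mul_assoc_of_mem (hX : D.Q.Tr ![X, Y, Z, W]) {x : D.Q.Hom X Y}
    {y : D.Q.Hom Y Z} {z : D.Q.Hom Z W} {d e f : ZMod N} (hx : x ∈ D.Q.gr X Y d)
    (hy : y ∈ D.Q.gr Y Z e) (hz : z ∈ D.Q.gr Z W f) :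
    D.mul (D.mul x y) z = D.mul x (D.mul y z) := by
  let V : Fin 4 → D.Ob := ![X, Y, Z, W]
  let q : ∀ i j : Fin 4, i < j → Pr 3 := fun i j h => ⟨(i, j), h⟩
  have htot : ∀ (i j l : Fin 4) (hij : i < j) (hjl : j < l) (c : ∀ p : Fin 2, D.Q.SeqHom V)
      (a : D.Q.Hom (V i) (V j)) (b : D.Q.Hom (V j) (V l)), c 0 = sgl V (q i j hij) a →
      c 1 = sgl V (q j l hjl) b →
      D.μ.total V hX 1 c = sgl V (q i l (hij.trans hjl)) (D.mul a b) := by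
    intro i j l hij hjl c a b h0 h1
    have hm : StrictMono ![i, j, l] := by
      intro s t hst
      fin_cases s <;> fin_cases t <;> simp_all [hij.trans hjl]
    have h2 := Coch.tot_chain D.μ.map V hX (OrderEmbedding.ofStrictMono _ hm)
      (Fin.cons a (Fin.cons b finZeroElim))
    have h3 : c = fun p => sgl V (chainPr (OrderEmbedding.ofStrictMono _ hm) p)
        ((Fin.cons a (Fin.cons b finZeroElim) : ∀ p : Fin 2, D.Q.Hom
          (V (OrderEmbedding.ofStrictMono _ hm p.castSucc))
          (V (OrderEmbedding.ofStrictMono _ hm p.succ))) p) := by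
      funext p
      fin_cases p
      exacts [h0, h1]
    rw [h3]
    refine h2.trans ?_
    refine congrArg (sgl V _) ?_
    exact D.map_one_apply _ _ _
  let b : ℕ → D.Q.SeqHom V
    | 0 => sgl V (q 0 1 (by decide)) x
    | 1 => sgl V (q 1 2 (by decide)) y
    | 2 => sgl V (q 2 3 (by decide)) z
    | _ + 3 => 0
  let d' : ℕ → ZMod N
    | 0 => d
    | 1 => e
    | 2 => f
    | _ + 3 => 0
  have hb : ∀ s, b s ∈ D.Q.seqGr V (d' s)
    | 0 => sgl_mem V _ _ hx
    | 1 => sgl_mem V _ _ hy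
    | 2 => sgl_mem V _ _ hz
    | _ + 3 => Submodule.zero_mem _
  have key := D.isAInf 3 V hX 2 d' b hb
  have h0 : ∀ j ≠ 1, D.μ.total V hX j = 0 := fun j hj =>
    MultiMaps.total_eq_zero _ (fun X hX => D.map_eq_zero j hj X hX) _ _
  unfold insertionSum at key
  rw [Finset.sum_eq_single (1, 1), Finset.sum_range_succ, Finset.sum_range_one,
    htot 0 2 3 (by decide) (by decide) _ (D.mul x y) z ?_ rfl,
    htot 0 1 3 (by decide) (by decide) _ x (D.mul y z) rfl ?_] at key
  · have h2 : (2 : ZMod 2) = 0 := rfl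
    have hs : ∀ (l : ℕ) (t : ZMod 2),
        (((1 + 1 : ℕ) : ZMod 2) * t + ((l * 1 + (1 + 1) * 1 : ℕ) : ZMod 2)) = l := by
      intro l t
      push_cast
      linear_combination (t + 1) * h2
    rw [hs, hs, units_smul_eq (k := k), units_smul_eq (k := k), Nat.cast_zero, Nat.cast_one,
      sg_zero, sg_one, one_smul, neg_one_smul, ← sub_eq_add_neg, sub_eq_zero] at key
    have h3 := congrFun key (q 0 3 (by decide))
    refine (sgl_same V (q 0 3 (by decide)) _).symm.trans (h3.trans ?_)
    exact sgl_same V (q 0 3 (by decide)) _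
  · exact htot 1 2 3 (by decide) (by decide) _ y z rfl rfl
  · exact htot 0 1 2 (by decide) (by decide) _ x y rfl rfl
  · intro ij hij hne
    rw [Finset.HasAntidiagonal.mem_antidiagonal] at hij
    have h1 : ij.1 ≠ 1 := fun h => hne (Prod.ext h (by dsimp only; omega))
    refine Finset.sum_eq_zero fun l _ => ?_
    rw [h0 _ h1]
    exact smul_zero _
  · intro h
    exact absurd (Finset.HasAntidiagonal.mem_antidiagonal.2
      (show (1, 1).1 + (1, 1).2 = 2 from rfl)) h

theorem GradedPreCategory.mul_assoc (hX : D.Q.Tr ![X, Y, Z, W]) (a : D.Q.Hom X Y)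
    (b : D.Q.Hom Y Z) (c : D.Q.Hom Z W) : D.mul (D.mul a b) c = D.mul a (D.mul b c) := by
  refine LinearMap.congr_fun (f := (D.mul.flip c).comp (D.mul.flip b))
    (g := D.mul.flip (D.mul b c)) (linearMap_ext_homogeneous (D.Q.isInternal X Y)
      fun d a ha => ?_) a
  refine LinearMap.congr_fun (f := (D.mul.flip c).comp (D.mul a))
    (g := (D.mul a).comp (D.mul.flip c)) (linearMap_ext_homogeneous (D.Q.isInternal Y Z)
      fun e b hb => ?_) b
  refine LinearMap.congr_fun (f := D.mul (D.mul a b))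
    (g := (D.mul a).comp (D.mul b)) (linearMap_ext_homogeneous (D.Q.isInternal Z W)
      fun f c hc => ?_) c
  exact D.mul_assoc_of_mem hX ha hb hc

variable (D) in
/-- The composition and the quasi-isomorphisms of a graded pre-category. -/
def GradedPreCategory.preCatStr : PreCatStr D.Q where
  mul := D.mul
  mul_assoc a b c h := D.mul_assoc (TransversalQuiver.TrL.tr h) a b c
  mul_mem := D.mul_mem
  Qi {X Y} f := ∃ h : D.Q.Tr ![X, Y], IsQuasiIso D.μ h f
  qi_mem h := h.choose_spec.1
  qi_left h hW := D.mul_left_bijective _ h.choose_spec (TransversalQuiver.TrL.tr hW)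
  qi_right h hZ := D.mul_right_bijective _ h.choose_spec (TransversalQuiver.TrL.tr hZ)
  exists_qi S hS hST X := by
    obtain ⟨W, ⟨h, f, hf⟩, hW⟩ := D.exists_qi S hS hST X
    exact ⟨W, f, ⟨h, hf⟩, hW⟩

theorem GradedPreCategory.nIso_of_hasQuasiIso (h : HasQuasiIso D.μ X Y) :
    PreCatStr.NIso D.preCatStr X Y := by
  obtain ⟨h, f, hf⟩ := h
  exact PreCatStr.nIso_of_qi (P := D.preCatStr) (D.Q.trL_ofFn h) (f := f) ⟨h, hf⟩

theorem GradedPreCategory.nIso_of_quasiIsomorphic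
    (h : D.toAInfPreCategory.QuasiIsomorphic X Y) : PreCatStr.NIso D.preCatStr X Y := by
  induction h with
  | rel X Y h => exact D.nIso_of_hasQuasiIso h
  | refl X => exact PreCatStr.NIso.refl X
  | symm X Y _ ih => exact ih.symm
  | trans X Y Z _ _ ih ih' => exact ih.trans ih'

end Graded
end
end AInf

namespace AInf
noncomputable section

/-! ### Restriction of cochains along maps of objects -/

section Res

variable {k : Type w} [Field k] {N : ℕ} {Ob : Type u} {Ob' : Type u'}

/-- The morphism spaces `Hom (o X) (o Y)` with the transversal sequences of `R`. -/
def TransversalQuiver.restrict (Q : TransversalQuiver.{w, u', v} k N Ob') (o : Ob → Ob')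
    (R : TransversalQuiver.{w, u, v'} k N Ob) : TransversalQuiver.{w, u, v} k N Ob where
  Hom X Y := Q.Hom (o X) (o Y)
  gr X Y := Q.gr (o X) (o Y)
  isInternal X Y := Q.isInternal (o X) (o Y)
  Tr X := R.Tr X
  tr_single X := R.tr_single X
  tr_sub h i := R.tr_sub h i

variable {Q : TransversalQuiver.{w, u', v} k N Ob'}
  (hQ : ∀ {n : ℕ} (X : Fin (n + 1) → Ob'), Q.Tr X) (o : Ob → Ob')
  (R : TransversalQuiver.{w, u, v'} k N Ob)

/-- The cochain `(a_0, …, a_n) ↦ F (a_0, …, a_n)` on the sequences `(o X_0, …, o X_{n+1})`. -/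
def Coch.res (F : Coch Q) : Coch (Q.restrict o R) := fun n X _ => F n (o ∘ X) (hQ _)

/-- The compositions at a sequence are computed from the morphism spaces of its subsequences, and
restriction merely renames the objects. -/
theorem res_comp (F G : Coch Q) :
    (comp F G).res hQ o R = comp (F.res hQ o R) (G.res hQ o R) := rfl

theorem res_dcomp (F A Y B : Coch Q) : (dcomp F A Y B).res hQ o R =
    dcomp (F.res hQ o R) (A.res hQ o R) (Y.res hQ o R) (B.res hQ o R) := rfl

theorem res_linC (L : ∀ X Y, Q.Hom X Y →ₗ[k] Q.Hom X Y) :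
    (linC L).res hQ o R = linC (Q := Q.restrict o R) fun X Y => L (o X) (o Y) := by
  funext n
  cases n <;> rfl

theorem res_idC : (idC Q).res hQ o R = idC (Q.restrict o R) := res_linC hQ o R _

theorem res_tC (p : ℕ) : (tC Q p).res hQ o R = tC (Q.restrict o R) p := res_linC hQ o R _

theorem res_sub (F G : Coch Q) : (F - G).res hQ o R = F.res hQ o R - G.res hQ o R := rfl

theorem res_sq (b : Coch Q) : sq (b.res hQ o R) = (sq b).res hQ o R := by
  rw [sq, sq, res_dcomp, res_tC, res_idC]

theorem res_resid (b b' f : Coch Q) :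
    resid (b.res hQ o R) (b'.res hQ o R) (f.res hQ o R) = (resid b b' f).res hQ o R := by
  rw [resid, resid, res_sub, res_comp, res_dcomp, res_tC, res_idC]

theorem IsDeg.res {e : ℤ} {F : Coch Q} (hF : IsDeg e F) : IsDeg e (F.res hQ o R) :=
  fun n X _ d a ha => hF n (o ∘ X) (hQ _) d a ha

/-- As `o` is injective, a sequence has at most one preimage; the maps are copied from there and are
zero on all other sequences. -/
theorem exists_res_eq {o : Ob → Ob'} (ho : Function.Injective o)
    {R : TransversalQuiver.{w, u, v'} k N Ob} {e : ℤ} {c : Coch (Q.restrict o R)}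
    (hc : IsDeg e c) : ∃ F : Coch Q, IsDeg e F ∧ F.res hQ o R = c := by
  have h : ∀ (n : ℕ) (Z : Fin (n + 2) → Ob'), ∃ B : MultilinearMap k
      (fun p : Fin (n + 1) => Q.Hom (Z p.castSucc) (Z p.succ)) (Q.Hom (Z 0) (Z (Fin.last (n + 1)))),
      (∀ (d : Fin (n + 1) → ZMod N) (a : ∀ p : Fin (n + 1), Q.Hom (Z p.castSucc) (Z p.succ)),
        (∀ p, a p ∈ Q.gr (Z p.castSucc) (Z p.succ) (d p)) →
          B a ∈ Q.gr (Z 0) (Z (Fin.last (n + 1))) ((∑ p, d p) + ((e - (n + 1) : ℤ) : ZMod N))) ∧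
      ∀ (X : Fin (n + 2) → Ob) (hX : R.Tr X), o ∘ X = Z → HEq B (c n X hX) := by
    intro n Z
    by_cases hZ : ∃ X : Fin (n + 2) → Ob, R.Tr X ∧ o ∘ X = Z
    · obtain ⟨X, hX, rfl⟩ := hZ
      refine ⟨c n X hX, fun d a ha => hc n X hX d a ha, fun X' hX' h => ?_⟩
      obtain rfl := ho.comp_left h
      exact HEq.rfl
    · exact ⟨0, fun _ _ _ => Submodule.zero_mem _, fun X hX h => absurd ⟨X, hX, h⟩ hZ⟩
  choose B hB hB' using h
  refine ⟨fun n Z _ => B n Z, fun n Z _ d a ha => hB n Z d a ha, ?_⟩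
  funext n X hX
  exact eq_of_heq (hB' n (o ∘ X) X hX rfl)

end Res

/-! ### Embeddings of graded pre-categories into graded categories -/

section OfLin

variable {k : Type w} [Field k] {N : ℕ} {Ob : Type u} {Q : TransversalQuiver.{w, u, v} k N Ob}
  {R : TransversalQuiver.{w, u, v'} k N Ob}

/-- A collection of maps concentrated in arity one. -/
def MultiMaps.ofLin (L : ∀ X Y, Q.Tr ![X, Y] → Q.Hom X Y →ₗ[k] R.Hom X Y)
    (hL : ∀ X Y h d a, a ∈ Q.gr X Y d → L X Y h a ∈ R.gr X Y d) : MultiMaps Q R 1 where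
  map
    | 0 => fun X hX =>
      { toFun := fun a => L (X 0) (X 1) (Q.tr_pair hX (by decide)) (a 0)
        map_update_add' := by
          intro _ m i x y
          obtain rfl : i = 0 := Fin.fin_one_eq_zero i
          simp only [Function.update_self, map_add]
        map_update_smul' := by
          intro _ m i c x
          obtain rfl : i = 0 := Fin.fin_one_eq_zero i
          simp only [Function.update_self, map_smul] }
    | _ + 1 => fun _ _ => 0
  map_mem n X hX d a ha := by
    cases n with
    | zero =>
      have h1 := hL _ _ (Q.tr_pair hX (by decide)) _ _ (ha 0)
      have h2 : (∑ p, d p) + (((1 : ℤ) - ((0 : ℕ) + 1) : ℤ) : ZMod N) = d 0 := by simp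
      rw [h2]
      exact h1
    | succ n => exact Submodule.zero_mem _

end OfLin
end
end AInf

namespace AInf
noncomputable section

/-! ### Extension and restriction of structures along embeddings -/

section Embedding

variable {k : Type w} [Field k] {N : ℕ} {Ob' : Type u'} {Q : TransversalQuiver.{w, u', v'} k N Ob'}

/-- The lists of objects in the image of a map `o` that come from transversal sequences. -/
def trImage {Ob : Type u} (R : TransversalQuiver.{w, u, v} k N Ob) (o : Ob → Ob') :
    Set (List Ob') := {L | ∃ L', R.TrL L' ∧ L'.map o = L}

theorem trImage_sublist {Ob : Type u} {R : TransversalQuiver.{w, u, v} k N Ob} {o : Ob → Ob'} :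
    ∀ L ∈ trImage R o, ∀ L' : List Ob', L'.Sublist L → L' ∈ trImage R o := by
  rintro _ ⟨L, hL, rfl⟩ L' h
  obtain ⟨L₁, h1, rfl⟩ := List.sublist_map_iff.1 h
  exact ⟨L₁, hL.sub h1, rfl⟩

theorem nil_mem_trImage {Ob : Type u} {R : TransversalQuiver.{w, u, v} k N Ob} {o : Ob → Ob'} :
    [] ∈ trImage R o := ⟨[], R.trL_nil, rfl⟩

theorem exists_of_ofFn_mem_trImage {Ob : Type u} {R : TransversalQuiver.{w, u, v} k N Ob}
    {o : Ob → Ob'} {n : ℕ} {Z : Fin (n + 1) → Ob'} (h : List.ofFn Z ∈ trImage R o) :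
    ∃ X, R.Tr X ∧ o ∘ X = Z := by
  obtain ⟨L, hL, hLZ⟩ := h
  obtain ⟨m, X, rfl⟩ : ∃ (m : ℕ) (X : Fin m → Ob), L = List.ofFn X :=
    ⟨L.length, L.get, (List.ofFn_get L).symm⟩
  rw [List.map_ofFn] at hLZ
  have hm : m = n + 1 := by
    have := congrArg List.length hLZ
    simpa using this
  subst hm
  exact ⟨X, hL.tr, List.ofFn_injective hLZ⟩

theorem agreeOn_trImage {Ob : Type u} {R : TransversalQuiver.{w, u, v} k N Ob} {o : Ob → Ob'}
    {hQ : ∀ {n : ℕ} (X : Fin (n + 1) → Ob'), Q.Tr X} {F G : Coch Q} :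
    AgreeOn (trImage R o) F G ↔ F.res hQ o R = G.res hQ o R := by
  constructor
  · intro h
    funext n X hX
    exact h n (o ∘ X) (hQ _) ⟨List.ofFn X, R.trL_ofFn hX, List.map_ofFn⟩
  · intro h n Z hZ hZT
    obtain ⟨X, hX, rfl⟩ := exists_of_ofFn_mem_trImage hZT
    exact congrFun (congrFun (congrFun h n) X) hX

/-- An embedding of a graded pre-category into a graded category. -/
structure Embedding (H : CatStr Q) (G : GradedPreCategory.{w, u, v} k N) where
  obj : G.Ob → Ob'
  injective : Function.Injective obj
  lin : ∀ X Y, G.Q.Tr ![X, Y] → G.Q.Hom X Y →ₗ[k] Q.Hom (obj X) (obj Y)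
  bijective : ∀ X Y h, Function.Bijective (lin X Y h)
  lin_mem : ∀ X Y h d a, a ∈ G.Q.gr X Y d → lin X Y h a ∈ Q.gr (obj X) (obj Y) d
  lin_mul : ∀ X Y Z (h : G.Q.Tr ![X, Y, Z]) (a : G.Q.Hom X Y) (b : G.Q.Hom Y Z),
    lin X Z (G.Q.tr_outer h) (G.mul a b) =
      H.mul (lin X Y (G.Q.tr_left h) a) (lin Y Z (G.Q.tr_right h) b)
  extends_image : H.Extends (trImage G.Q obj)

/-- The cochain `b` is an `A∞`-structure on a graded category. -/
structure IsAInfCoch (H : CatStr Q) (hQ : ∀ {n : ℕ} (X : Fin (n + 1) → Ob'), Q.Tr X)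
    (b : Coch Q) : Prop where
  isDeg : IsDeg 2 b
  zero : b 0 = 0
  one : b 1 = susp (H.coch hQ) 1
  sq : sq b = 0

/-- Only the product `b 1` enters, and the image of an embedding satisfies the retract condition by
`extends_image`. -/
theorem relVanish_of_one_eq (hN : 2 ∣ N) {H : CatStr Q}
    {hQ : ∀ {n : ℕ} (X : Fin (n + 1) → Ob'), Q.Tr X} {G : GradedPreCategory.{w, u, v} k N}
    (i : Embedding H G) {b : Coch Q} (hb : b 1 = susp (H.coch hQ) 1) (p : ℕ) :
    RelVanish (trImage G.Q i.obj) (only 1 b) p := by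
  have h1 : only 1 b = susp (H.coch hQ) :=
    (only_congr hb).trans (only_eq_self fun j hj => susp_eq_zero (H.coch_ne hQ hj))
  rw [h1]
  exact relVanish_susp_coch H hN nil_mem_trImage trImage_sublist i.extends_image p

namespace Embedding

variable {H : CatStr Q} {hQ : ∀ {n : ℕ} (X : Fin (n + 1) → Ob'), Q.Tr X}
  {G : GradedPreCategory.{w, u, v} k N} (i : Embedding H G)

/-- The morphism spaces of the target on the transversal sequences of the source. -/
def quiver : TransversalQuiver.{w, u, v'} k N G.Ob := Q.restrict i.obj G.Q

/-- The maps of an embedding. -/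
def maps : MultiMaps G.Q i.quiver 1 := MultiMaps.ofLin (R := i.quiver) i.lin i.lin_mem

/-- The inverse of an embedding on the morphism spaces of transversal pairs. -/
def symmL (X Y : G.Ob) (h : G.Q.Tr ![X, Y]) : Q.Hom (i.obj X) (i.obj Y) →ₗ[k] G.Q.Hom X Y :=
  (LinearEquiv.ofBijective _ (i.bijective X Y h)).symm.toLinearMap

theorem lin_symmL (X Y : G.Ob) (h : G.Q.Tr ![X, Y]) (a : Q.Hom (i.obj X) (i.obj Y)) :
    i.lin X Y h (i.symmL X Y h a) = a :=
  (LinearEquiv.ofBijective _ (i.bijective X Y h)).apply_symm_apply a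

theorem symmL_lin (X Y : G.Ob) (h : G.Q.Tr ![X, Y]) (a : G.Q.Hom X Y) :
    i.symmL X Y h (i.lin X Y h a) = a :=
  (LinearEquiv.ofBijective _ (i.bijective X Y h)).symm_apply_apply a

theorem symmL_bijective (X Y : G.Ob) (h : G.Q.Tr ![X, Y]) :
    Function.Bijective (i.symmL X Y h) :=
  (LinearEquiv.ofBijective _ (i.bijective X Y h)).symm.bijective

/-- The inverse maps of an embedding. -/
def symm : MultiMaps i.quiver G.Q 1 :=
  MultiMaps.ofLin (Q := i.quiver) i.symmL fun X Y h d a ha =>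
    mem_of_map_mem _ _ (G.Q.isInternal X Y) (Q.isInternal _ _) (i.lin X Y h) (i.bijective X Y h).1
      (i.lin_mem X Y h) d _ ((i.lin_symmL X Y h a).symm ▸ ha)

/-- Transport of a collection of maps to the morphism spaces of the target. -/
def push {e : ℤ} (F : MultiMaps G.Q G.Q e) : MultiMaps i.quiver i.quiver e :=
  i.symm.transport (fun h => h) i.symmL_bijective F

/-- Transport of a collection of maps to the morphism spaces of the source. -/
def pull {e : ℤ} (F : MultiMaps i.quiver i.quiver e) : MultiMaps G.Q G.Q e :=
  i.maps.transport (fun h => h) i.bijective F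

theorem symmL_push {e : ℤ} (F : MultiMaps G.Q G.Q e) (n : ℕ) (X : Fin (n + 2) → G.Ob)
    (hX : G.Q.Tr X) (a : ∀ p : Fin (n + 1), Q.Hom (i.obj (X p.castSucc)) (i.obj (X p.succ))) :
    i.symmL _ _ (G.Q.tr_pair hX Fin.last_pos) ((i.push F).map n X hX a) =
      F.map n X hX fun p => i.symmL _ _ (G.Q.tr_pair hX p.castSucc_lt_succ) (a p) :=
  i.symm.lin_transport (fun h => h) i.symmL_bijective F n X hX a

theorem lin_pull {e : ℤ} (F : MultiMaps i.quiver i.quiver e) (n : ℕ) (X : Fin (n + 2) → G.Ob)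
    (hX : G.Q.Tr X) (a : ∀ p : Fin (n + 1), G.Q.Hom (X p.castSucc) (X p.succ)) :
    i.lin _ _ (G.Q.tr_pair hX Fin.last_pos) ((i.pull F).map n X hX a) =
      F.map n X hX fun p => i.lin _ _ (G.Q.tr_pair hX p.castSucc_lt_succ) (a p) :=
  i.maps.lin_transport (fun h => h) i.bijective F n X hX a

theorem pull_push {e : ℤ} (F : MultiMaps G.Q G.Q e) : i.pull (i.push F) = F := by
  refine MultiMaps.ext ?_
  funext n X hX
  refine MultilinearMap.ext fun a => (i.bijective _ _ (G.Q.tr_pair hX Fin.last_pos)).1 ?_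
  refine (i.lin_pull _ n X hX a).trans ?_
  refine (i.symmL_bijective _ _ (G.Q.tr_pair hX Fin.last_pos)).1 ?_
  refine (i.symmL_push F n X hX _).trans ?_
  simp only [symmL_lin]

theorem push_pull {e : ℤ} (F : MultiMaps i.quiver i.quiver e) : i.push (i.pull F) = F := by
  refine MultiMaps.ext ?_
  funext n X hX
  refine MultilinearMap.ext fun a =>
    (i.symmL_bijective _ _ (G.Q.tr_pair hX Fin.last_pos)).1 ?_
  refine (i.symmL_push _ n X hX a).trans ?_
  refine (i.bijective _ _ (G.Q.tr_pair hX Fin.last_pos)).1 ?_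
  refine (i.lin_pull F n X hX _).trans ?_
  refine Eq.trans ?_ (i.lin_symmL _ _ (G.Q.tr_pair hX Fin.last_pos) _).symm
  exact congrArg (F.map n X hX) (funext fun p => i.lin_symmL _ _ _ (a p))

theorem isAInf_push {F : MultiMaps G.Q G.Q 2} (hF : IsAInf F) : IsAInf (i.push F) :=
  hF.transport i.symm (fun h => h) i.symmL_bijective

theorem isAInf_pull {F : MultiMaps i.quiver i.quiver 2} (hF : IsAInf F) : IsAInf (i.pull F) :=
  hF.transport i.maps (fun h => h) i.bijective

theorem tr_three {X : Fin 3 → G.Ob} (hX : G.Q.Tr X) : G.Q.Tr ![X 0, X 1, X 2] := by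
  have h1 : X = ![X 0, X 1, X 2] := by funext p; fin_cases p <;> rfl
  exact h1 ▸ hX

theorem push_map_zero (m : AInfStructure G) (X : Fin 2 → G.Ob) (hX : G.Q.Tr X)
    (a : ∀ p : Fin 1, Q.Hom (i.obj (X p.castSucc)) (i.obj (X p.succ))) :
    (i.push m.ops).map 0 X hX a = (0 : Q.Hom (i.obj (X 0)) (i.obj (X (Fin.last 1)))) := by
  refine (i.symmL_bijective _ _ (G.Q.tr_pair hX Fin.last_pos)).1 ?_
  refine (i.symmL_push _ 0 X hX a).trans ?_
  rw [m.ops_one, map_zero]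
  rfl

theorem push_map_one (m : AInfStructure G) (X : Fin 3 → G.Ob) (hX : G.Q.Tr X)
    (a : ∀ p : Fin 2, Q.Hom (i.obj (X p.castSucc)) (i.obj (X p.succ))) :
    (i.push m.ops).map 1 X hX a = H.mul (Y := i.obj (X 1)) (a 0) (a 1) := by
  refine (i.symmL_bijective _ _ (G.Q.tr_pair hX Fin.last_pos)).1 ?_
  refine (i.symmL_push _ 1 X hX a).trans ?_
  rw [m.ops_two, G.map_one_apply]
  refine (i.bijective _ _ (G.Q.tr_pair hX Fin.last_pos)).1 ?_
  rw [lin_symmL]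
  refine (i.lin_mul (X 0) (X 1) (X 2) (tr_three hX) _ _).trans ?_
  exact congrArg₂ (fun x y => H.mul x y) (i.lin_symmL _ _ _ _) (i.lin_symmL _ _ _ _)

theorem push_gauge (f : GaugeMaps G) (X : Fin 2 → G.Ob) (hX : G.Q.Tr X)
    (a : ∀ p : Fin 1, Q.Hom (i.obj (X p.castSucc)) (i.obj (X p.succ))) :
    (i.push f.maps).map 0 X hX a = a 0 := by
  refine (i.symmL_bijective _ _ (G.Q.tr_pair hX Fin.last_pos)).1 ?_
  exact (i.symmL_push _ 0 X hX a).trans (f.maps_one X hX _)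

variable (hQ) in
/-- The `A∞`-structure `m` is the restriction of `b`. -/
def Restricts (b : Coch Q) (m : AInfStructure G) : Prop :=
  b.res hQ i.obj G.Q = susp (Q := i.quiver) (i.push m.ops).map

variable {i}

/-- In the two lowest components an arbitrary extension is replaced by zero and by the composition
of the whole category, which by hypothesis restrict to those of `c`. -/
theorem exists_res_eq_of_low (i : Embedding H G) {c : Coch i.quiver} (hc : IsDeg 2 c)
    (hc0 : c 0 = 0) (hc1 : c 1 = (susp (H.coch hQ)).res hQ i.obj G.Q 1) : ∃ b : Coch Q,
      IsDeg 2 b ∧ b 0 = 0 ∧ b 1 = susp (H.coch hQ) 1 ∧ b.res hQ i.obj G.Q = c := by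
  obtain ⟨B, hB, hBc⟩ := exists_res_eq hQ i.injective hc
  have hd : IsDeg 2 (susp (H.coch hQ)) := (H.isDeg_coch hQ).susp
  refine ⟨fun n => match n with
    | 0 => 0
    | 1 => susp (H.coch hQ) 1
    | n + 2 => B (n + 2), ?_, rfl, rfl, ?_⟩
  · intro n
    match n with
    | 0 => exact fun _ _ _ _ _ => Submodule.zero_mem _
    | 1 => exact hd 1
    | n + 2 => exact hB (n + 2)
  · funext n
    match n with
    | 0 => exact hc0.symm
    | 1 => exact hc1.symm
    | n + 2 => exact congrFun hBc (n + 2)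

theorem sq_eq_zero_of_low (hN : 2 ∣ N) {b : Coch Q} (hb0 : b 0 = 0)
    (hb1 : b 1 = susp (H.coch hQ) 1) : sq b 2 = 0 := by
  have h1 : only 1 b = susp (H.coch hQ) :=
    (only_congr hb1).trans (only_eq_self fun j hj => susp_eq_zero (H.coch_ne hQ hj))
  refine (dcomp_lead (A' := tC Q 1) (B' := idC Q) hb0 (fun j hj => ?_) rfl rfl).trans ?_
  · obtain rfl : j = 0 := by omega
    exact hb0
  · rw [h1]
    exact sq_susp_coch H hQ hN

/-- Carry `m` to the morphism spaces of the category and extend its maps without regard to the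
relations. These hold on the image of the embedding, and `exists_extension_structure` corrects the
maps elsewhere. -/
theorem exists_isAInfCoch (hN : 2 ∣ N) (m : AInfStructure G) :
    ∃ b, IsAInfCoch H hQ b ∧ i.Restricts hQ b m := by
  let c : Coch i.quiver := susp (i.push m.ops).map
  have hc : IsDeg 2 c := IsDeg.susp (i.push m.ops).map_mem
  have hsc : sq c = 0 := (isAInf_iff hN _).1 (i.isAInf_push m.isAInf)
  have hc0 : c 0 = 0 := by
    refine susp_eq_zero ?_
    funext X hX
    exact MultilinearMap.ext (i.push_map_zero m X hX)
  have hc1 : c 1 = (susp (H.coch hQ)).res hQ i.obj G.Q 1 := by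
    refine susp_congr (G := (H.coch hQ).res hQ i.obj G.Q) ?_
    funext X hX
    refine MultilinearMap.ext fun a => (i.push_map_one m X hX a).trans ?_
    exact (H.coch_apply hQ (i.obj ∘ X) a).symm
  obtain ⟨b₀, hb₀, hb0, hb1, hres⟩ := exists_res_eq_of_low (H := H) i hc hc0 hc1
  obtain ⟨b, h1, h2, h3, h4, h5⟩ := exists_extension_structure hN (T := trImage G.Q i.obj)
    trImage_sublist hb₀ hb0 (sq_eq_zero_of_low hN hb0 hb1)
    ((agreeOn_trImage (hQ := hQ)).2 (by
      rw [← res_sq, hres]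
      exact hsc)) (relVanish_of_one_eq hN i hb1 1)
  exact ⟨b, ⟨h1, h2, h3.trans hb1, h5⟩, ((agreeOn_trImage (hQ := hQ)).1 h4).trans hres⟩

/-- Restriction meets no obstruction: the relations restrict, and the extension property depends
only on `m_1` and `m_2`. -/
theorem exists_restricts (hN : 2 ∣ N) {b : Coch Q} (hb : IsAInfCoch H hQ b) :
    ∃ m, i.Restricts hQ b m := by
  let β : MultiMaps i.quiver i.quiver 2 :=
    ⟨susp (b.res hQ i.obj G.Q), (hb.isDeg.res hQ i.obj G.Q).susp⟩
  have hβ : IsAInf β := by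
    refine (isAInf_iff hN β).2 ?_
    change sq (susp (susp (b.res hQ i.obj G.Q))) = 0
    rw [susp_susp, res_sq, hb.sq]
    rfl
  have h1 : ∀ X hX, (i.pull β).map 0 X hX = 0 := by
    intro X hX
    refine MultilinearMap.ext fun a => (i.bijective _ _ (G.Q.tr_pair hX Fin.last_pos)).1 ?_
    refine (i.lin_pull β 0 X hX a).trans ?_
    change susp b 0 (i.obj ∘ X) _ _ = _
    rw [susp_eq_zero hb.zero]
    exact (map_zero _).symm
  have h2 : ∀ X hX, (i.pull β).map 1 X hX = G.μ.map 1 X hX := by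
    intro X hX
    refine MultilinearMap.ext fun a => (i.bijective _ _ (G.Q.tr_pair hX Fin.last_pos)).1 ?_
    refine (i.lin_pull β 1 X hX a).trans ?_
    change susp b 1 (i.obj ∘ X) _ _ = _
    rw [susp_congr hb.one, susp_susp, G.map_one_apply]
    exact (H.coch_apply hQ (i.obj ∘ X) _).trans
      (i.lin_mul (X 0) (X 1) (X 2) (tr_three hX) _ _).symm
  refine ⟨⟨i.pull β, h1, h2, i.isAInf_pull hβ, G.hasExtension.congr (fun X hX => ?_) h2⟩, ?_⟩
  · rw [h1, G.map_eq_zero 0 (by decide)]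
  · unfold Restricts
    rw [push_pull]
    exact (susp_susp _).symm

/-- Extend the maps of the homotopy arbitrarily, with identity linear part. The residual vanishes on
the image of the embedding, and `exists_extension_morphism` corrects the maps elsewhere. -/
theorem exists_resid_eq_zero (hN : 2 ∣ N) {b b' : Coch Q} (hb : IsAInfCoch H hQ b)
    (hb' : IsAInfCoch H hQ b') {m m' : AInfStructure G} (hm : i.Restricts hQ b m)
    (hm' : i.Restricts hQ b' m') (h : StronglyHomotopic m m') :
    ∃ F : Coch Q, IsDeg 1 F ∧ F 0 = idC Q 0 ∧ resid b b' F = 0 := by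
  obtain ⟨f, hf⟩ := h
  have hr : resid (susp (Q := i.quiver) (i.push m.ops).map)
      (susp (Q := i.quiver) (i.push m'.ops).map) (susp (Q := i.quiver) (i.push f.maps).map) = 0 :=
    (isAInfMor_iff hN _ _ _).1 (hf.transport i.symm (fun h => h) i.symmL_bijective)
  obtain ⟨B, hB, hBc⟩ := exists_res_eq hQ i.injective
    (c := susp (Q := i.quiver) (i.push f.maps).map) (IsDeg.susp (i.push f.maps).map_mem)
  have hc0 : susp (Q := i.quiver) (i.push f.maps).map 0 = idC i.quiver 0 := by
    exact susp_zero_eq ((eq_idC_zero_iff _).2 (i.push_gauge f))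
  let f₀ : Coch Q := fun n => match n with
    | 0 => idC Q 0
    | n + 1 => B (n + 1)
  have hf₀ : IsDeg 1 f₀ := by
    intro n
    match n with
    | 0 => exact IsDeg.idC (Q := Q) 0
    | n + 1 => exact hB (n + 1)
  have hres : f₀.res hQ i.obj G.Q = susp (Q := i.quiver) (i.push f.maps).map := by
    funext n
    match n with
    | 0 => exact hc0.symm
    | n + 1 => exact congrFun hBc (n + 1)
  obtain ⟨F, h1, h2, -, h3⟩ := exists_extension_morphism hN (T := trImage G.Q i.obj)
    trImage_sublist hb.isDeg hb'.isDeg hb.zero hb'.zero (hb.one.trans hb'.one.symm) hb.sq hb'.sq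
    hf₀ rfl ((agreeOn_trImage (hQ := hQ)).2 (by
      rw [← res_resid, hm, hm', hres]
      exact hr)) (relVanish_of_one_eq hN i hb.one 0)
  exact ⟨F, h1, h2, h3⟩

theorem stronglyHomotopic_of_resid (hN : 2 ∣ N) {b b' F : Coch Q} {m m' : AInfStructure G}
    (hm : i.Restricts hQ b m) (hm' : i.Restricts hQ b' m') (hF : IsDeg 1 F)
    (hF0 : F 0 = idC Q 0) (hFr : resid b b' F = 0) : StronglyHomotopic m m' := by
  let Φ : MultiMaps i.quiver i.quiver 1 :=
    ⟨susp (F.res hQ i.obj G.Q), (hF.res hQ i.obj G.Q).susp⟩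
  have hΦ : IsAInfMor (i.push m.ops) (i.push m'.ops) (fun h => h) Φ := by
    refine (isAInfMor_iff hN _ _ _).2 ?_
    change resid _ _ (susp (susp (F.res hQ i.obj G.Q))) = 0
    rw [susp_susp, ← hm, ← hm', res_resid, hFr]
    rfl
  have h1 := hΦ.transport i.maps (fun h => h) i.bijective
  change IsAInfMor (i.pull _) (i.pull _) _ (i.pull Φ) at h1
  rw [pull_push, pull_push] at h1
  refine ⟨⟨i.pull Φ, fun X hX a => (i.bijective _ _ (G.Q.tr_pair hX Fin.last_pos)).1 ?_⟩, h1⟩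
  refine (i.lin_pull Φ 0 X hX a).trans ?_
  change susp F 0 (i.obj ∘ X) _ _ = _
  rw [susp_zero_eq hF0]
  rfl

end Embedding
end Embedding
end
end AInf

universe u₁ v₁
namespace AInf
noncomputable section

/-! ### Invariance under equivalences -/

section Invariance

variable {k : Type w} [Field k] {N : ℕ}
  {C : GradedPreCategory.{w, u, v} k N} {D : GradedPreCategory.{w, u', v'} k N}

/-- The object of `D` underlying an object of `C` or `D`. -/
def GradedFunctor.sumObj (φ : GradedFunctor C D) : C.Ob ⊕ D.Ob → D.Ob := Sum.elim φ.obj id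

/-- The graded category of `D` with the objects of `C` added. -/
def GradedFunctor.sumQuiver (φ : GradedFunctor C D) :
    TransversalQuiver.{w, max u u', max u' v'} k N (C.Ob ⊕ D.Ob) :=
  D.preCatStr.nQuiver.comap φ.sumObj

theorem GradedFunctor.sumQuiver_tr (φ : GradedFunctor C D) {n : ℕ}
    (X : Fin (n + 1) → C.Ob ⊕ D.Ob) : φ.sumQuiver.Tr X := trivial

/-- The composition of the graded category of `D` with the objects of `C` added. -/
def GradedFunctor.sumCat (φ : GradedFunctor C D) : CatStr φ.sumQuiver where
  one X := D.preCatStr.nCat.one (φ.sumObj X)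
  mul := D.preCatStr.nCat.mul
  one_mul := D.preCatStr.nCat.one_mul
  mul_one := D.preCatStr.nCat.mul_one
  mul_assoc := D.preCatStr.nCat.mul_assoc
  one_mem X := D.preCatStr.nCat.one_mem (φ.sumObj X)
  mul_mem := D.preCatStr.nCat.mul_mem

/-- Every object is isomorphic to some `o Y`, and the extension property of `G` gives a
quasi-isomorphism `W → Y` with `W` prolonging the given lists. Hence `X` is isomorphic to `o W`, and
in particular a retract of it. -/
theorem GradedFunctor.sumCat_extends (φ : GradedFunctor C D)
    {G : GradedPreCategory.{w, u₁, v₁} k N}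
    (o : G.Ob → C.Ob ⊕ D.Ob)
    (h1 : ∀ X Y, HasQuasiIso G.μ X Y →
      PreCatStr.NIso D.preCatStr (φ.sumObj (o X)) (φ.sumObj (o Y)))
    (h2 : ∀ X, ∃ Y, PreCatStr.NIso D.preCatStr (φ.sumObj X) (φ.sumObj (o Y))) :
    φ.sumCat.Extends (trImage G.Q o) := by
  intro S hS hST X
  obtain ⟨S', hS', hfin, rfl⟩ := Set.exists_subset_image_finite_and (f := List.map o)
    (s := {L | G.Q.TrL L}) (p := fun t => t = S) |>.1 ⟨S, hST, hS, rfl⟩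
  obtain ⟨Y, hY⟩ := h2 X
  obtain ⟨W, hW, hWS⟩ := G.exists_qi S' hfin hS' Y
  obtain ⟨a, b, hab, -⟩ := hY.trans (h1 W Y hW).symm
  refine ⟨o W, a, b, hab, ?_⟩
  rintro _ ⟨L, hL, rfl⟩
  exact ⟨W :: L, hWS L hL, rfl⟩

/-- The inclusion of `D`. -/
def GradedFunctor.inclRight (φ : GradedFunctor C D) : Embedding φ.sumCat D where
  obj := Sum.inr
  injective := Sum.inr_injective
  lin _ _ h := D.preCatStr.ofHom (D.Q.trL_ofFn h)
  bijective _ _ h := PreCatStr.ofHom_bijective (P := D.preCatStr) (D.Q.trL_ofFn h)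
  lin_mem _ _ h _ _ ha := PreCatStr.ofHom_mem (P := D.preCatStr) (D.Q.trL_ofFn h) ha
  lin_mul _ _ _ h a b := (PreCatStr.ofHom_mul (P := D.preCatStr) (D.Q.trL_ofFn h) a b).symm
  extends_image := φ.sumCat_extends _ (fun _ _ h => D.nIso_of_hasQuasiIso h)
    fun X => ⟨φ.sumObj X, PreCatStr.NIso.refl _⟩

theorem GradedFunctor.map_mul (φ : GradedFunctor C D) {X Y Z : C.Ob} (h : C.Q.Tr ![X, Y, Z])
    (a : C.Q.Hom X Y) (b : C.Q.Hom Y Z) : φ.maps.lin X Z (C.Q.tr_outer h) (C.mul a b) =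
      D.mul (Y := φ.obj Y) (φ.maps.lin X Y (C.Q.tr_left h) a)
        (φ.maps.lin Y Z (C.Q.tr_right h) b) := by
  have h1 := φ.map_two ![X, Y, Z] h (Fin.cons a (Fin.cons b finZeroElim))
  rw [C.map_one_apply] at h1
  refine h1.trans ?_
  exact D.map_one_apply (φ.obj ∘ ![X, Y, Z]) (φ.tr h) _

theorem GradedFunctor.nIso_of_hasQuasiIso (φ : GradedFunctor C D) {X Y : C.Ob}
    (h : HasQuasiIso C.μ X Y) : PreCatStr.NIso D.preCatStr (φ.obj X) (φ.obj Y) := by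
  obtain ⟨h, f, hf⟩ := h
  exact D.nIso_of_hasQuasiIso ⟨_, _, φ.map_quasiIso h f hf⟩

/-- The inclusion of `C`. -/
def GradedFunctor.inclLeft (φ : GradedFunctor C D) (hφ : φ.IsEquivalence) :
    Embedding φ.sumCat C where
  obj := Sum.inl
  injective := Sum.inl_injective
  lin X Y h := (D.preCatStr.ofHom (D.Q.trL_ofFn (φ.tr h))).comp (φ.maps.lin X Y h)
  bijective X Y h := (PreCatStr.ofHom_bijective (P := D.preCatStr)
    (D.Q.trL_ofFn (φ.tr h))).comp (hφ.bijective X Y h)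
  lin_mem X Y h d a ha := PreCatStr.ofHom_mem (P := D.preCatStr) (D.Q.trL_ofFn (φ.tr h))
    (φ.maps.lin_mem h d a ha)
  lin_mul X Y Z h a b := by
    refine (congrArg (D.preCatStr.ofHom (D.Q.trL_ofFn (φ.tr (C.Q.tr_outer h))))
      (φ.map_mul h a b)).trans ?_
    exact (PreCatStr.ofHom_mul (P := D.preCatStr) (D.Q.trL_ofFn (φ.tr h)) _ _).symm
  extends_image := φ.sumCat_extends _ (fun X Y h => φ.nIso_of_hasQuasiIso h) (by
    intro X
    obtain ⟨Y, hY⟩ := hφ.2 (φ.sumObj X)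
    exact ⟨Y, D.nIso_of_quasiIsomorphic hY⟩)

/-- The object of `D` underlying an object, as an object of the category with the objects of `C`
added. -/
def GradedFunctor.retract (φ : GradedFunctor C D) (X : C.Ob ⊕ D.Ob) : C.Ob ⊕ D.Ob :=
  Sum.inr (φ.sumObj X)

/-- Pullback of cochains along the retraction to `D`. -/
def GradedFunctor.retractCoch (φ : GradedFunctor C D) (b : Coch φ.sumQuiver) :
    Coch φ.sumQuiver :=
  Coch.res φ.sumQuiver_tr φ.retract φ.sumQuiver b

variable {φ : GradedFunctor C D}

/-- The retraction leaves all morphism spaces and compositions unchanged, so it preserves the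
product as well as the relations. -/
theorem IsAInfCoch.retract {b : Coch φ.sumQuiver} (hb : IsAInfCoch φ.sumCat φ.sumQuiver_tr b) :
    IsAInfCoch φ.sumCat φ.sumQuiver_tr (φ.retractCoch b) where
  isDeg := hb.isDeg.res φ.sumQuiver_tr φ.retract φ.sumQuiver
  zero := by
    funext X hX
    exact congrFun (congrFun hb.zero (φ.retract ∘ X)) trivial
  one := by
    have h1 : (φ.retractCoch (susp (φ.sumCat.coch φ.sumQuiver_tr))) 1 =
        susp (φ.sumCat.coch φ.sumQuiver_tr) 1 := by
      refine susp_congr (F := φ.retractCoch (φ.sumCat.coch φ.sumQuiver_tr)) ?_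
      funext X hX
      refine MultilinearMap.ext fun a => ?_
      refine Eq.trans ?_ (φ.sumCat.coch_apply φ.sumQuiver_tr X a).symm
      exact φ.sumCat.coch_apply φ.sumQuiver_tr (φ.retract ∘ X) a
    refine Eq.trans ?_ h1
    funext X hX
    exact congrFun (congrFun hb.one (φ.retract ∘ X)) trivial
  sq := by
    refine (res_sq φ.sumQuiver_tr φ.retract φ.sumQuiver b).trans ?_
    rw [hb.sq]
    rfl

/-- The retraction fixes the objects of `D` by definition. -/
theorem restricts_retract_right {b : Coch φ.sumQuiver} {m : AInfStructure D}
    (h : φ.inclRight.Restricts φ.sumQuiver_tr b m) :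
    φ.inclRight.Restricts φ.sumQuiver_tr (φ.retractCoch b) m := h

/-- The inclusion of `C` is `φ` followed by the inclusion of `D` on morphism spaces. -/
theorem lin_symmL_inclLeft (hφ : φ.IsEquivalence) {X Y : C.Ob} (h : C.Q.Tr ![X, Y])
    (h' : D.Q.Tr ![φ.obj X, φ.obj Y]) (a : D.preCatStr.NHom (φ.obj X) (φ.obj Y)) :
    φ.maps.lin X Y h ((φ.inclLeft hφ).symmL X Y h a) =
      φ.inclRight.symmL (φ.obj X) (φ.obj Y) h' a := by
  refine (φ.inclRight.bijective (φ.obj X) (φ.obj Y) h').1 ?_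
  exact ((φ.inclLeft hφ).lin_symmL X Y h a).trans
    (φ.inclRight.lin_symmL (φ.obj X) (φ.obj Y) h' a).symm

theorem push_pullback_apply (hφ : φ.IsEquivalence) (m : AInfStructure D) (n : ℕ)
    (X : Fin (n + 2) → C.Ob) (hX : C.Q.Tr X)
    (a : ∀ p : Fin (n + 1), D.preCatStr.NHom (φ.obj (X p.castSucc)) (φ.obj (X p.succ))) :
    ((φ.inclLeft hφ).push (m.pullback φ hφ).ops).map n X hX a =
      (φ.inclRight.push m.ops).map n (φ.obj ∘ X) (φ.tr hX) a := by
  have hX' : D.Q.Tr (φ.obj ∘ X) := φ.tr hX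
  refine (φ.inclRight.symmL_bijective _ _ (D.Q.tr_pair hX' Fin.last_pos)).1 ?_
  refine Eq.trans ?_ (φ.inclRight.symmL_push m.ops n (φ.obj ∘ X) hX' a).symm
  refine (lin_symmL_inclLeft hφ (C.Q.tr_pair hX Fin.last_pos) _ _).symm.trans ?_
  refine (congrArg _ ((φ.inclLeft hφ).symmL_push (m.pullback φ hφ).ops n X hX a)).trans ?_
  refine (φ.maps.lin_transport φ.tr hφ.bijective (m.ops.comap φ.obj) n X hX _).trans ?_
  exact congrArg (m.ops.map n (φ.obj ∘ X) hX') (funext fun p =>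
    lin_symmL_inclLeft hφ (C.Q.tr_pair hX p.castSucc_lt_succ) _ (a p))

/-- The retraction sends an object of `C` to its image under `φ` in `D`; there `b` restricts to `m`,
and reading `m` through `φ` is the pullback. -/
theorem restricts_retract_left (hφ : φ.IsEquivalence) {b : Coch φ.sumQuiver} {m : AInfStructure D}
    (h : φ.inclRight.Restricts φ.sumQuiver_tr b m) :
    (φ.inclLeft hφ).Restricts φ.sumQuiver_tr (φ.retractCoch b) (m.pullback φ hφ) := by
  let c : Coch (φ.inclLeft hφ).quiver := fun n X hX =>
    (φ.inclRight.push m.ops).map n (φ.obj ∘ X) (φ.tr hX)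
  have key : ((φ.inclLeft hφ).push (m.pullback φ hφ).ops).map = c := by
    funext n X hX
    exact MultilinearMap.ext fun a => push_pullback_apply hφ m n X hX a
  unfold Embedding.Restricts
  rw [key]
  funext n X hX
  exact congrFun (congrFun (congrFun h n) (φ.obj ∘ X)) (φ.tr hX)

theorem AInfClasses.pullback_bijective (hN : 2 ∣ N) (hφ : φ.IsEquivalence) :
    Function.Bijective (AInfClasses.pullback φ hφ) := by
  constructor
  · rintro ⟨m⟩ ⟨m'⟩ h
    have h1 : StronglyHomotopic (m.pullback φ hφ) (m'.pullback φ hφ) :=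
      (Equivalence.eqvGen_iff (stronglyHomotopic_equivalence hN)).1 (Quot.eqvGen_exact h)
    obtain ⟨b, hb, hm⟩ := Embedding.exists_isAInfCoch (hQ := φ.sumQuiver_tr) (i := φ.inclRight) hN m
    obtain ⟨b', hb', hm'⟩ :=
      Embedding.exists_isAInfCoch (hQ := φ.sumQuiver_tr) (i := φ.inclRight) hN m'
    -- A homotopy of the pullbacks on `C` extends to one between the retracted extensions, which
    -- restrict to `m` and `m'` on `D`.
    obtain ⟨F, hF, hF0, hFr⟩ := Embedding.exists_resid_eq_zero hN hb.retract hb'.retract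
      (restricts_retract_left hφ hm) (restricts_retract_left hφ hm') h1
    exact Quot.sound (Embedding.stronglyHomotopic_of_resid hN (restricts_retract_right hm)
      (restricts_retract_right hm') hF hF0 hFr)
  · rintro ⟨m⟩
    obtain ⟨b, hb, hm⟩ :=
      Embedding.exists_isAInfCoch (hQ := φ.sumQuiver_tr) (i := φ.inclLeft hφ) hN m
    obtain ⟨m', hm'⟩ := Embedding.exists_restricts (i := φ.inclRight) hN hb
    -- Both `b` and its pullback along the retraction restrict to `m'` on `D`. So a homotopy from
    -- `m'` to itself extends to one between them, and its restriction to `C` joins the pullback of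
    -- `m'` to `m`.
    obtain ⟨F, hF, hF0, hFr⟩ := Embedding.exists_resid_eq_zero hN hb.retract hb
      (restricts_retract_right hm') hm' ((stronglyHomotopic_equivalence hN).refl m')
    exact ⟨Quot.mk _ m', Quot.sound (Embedding.stronglyHomotopic_of_resid hN
      (restricts_retract_left hφ hm') hm hF hF0 hFr)⟩

end Invariance
end
end AInf

theorem mainTheorem3 {k : Type w} [Field k] (N : ℕ) (hN : N = 0 ∨ N = 2)
    (C : AInf.GradedPreCategory.{w, u, v} k N) (D : AInf.GradedPreCategory.{w, u', v'} k N)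
    (φ : AInf.GradedFunctor C D) (hφ : φ.IsEquivalence) :
    Equivalence (AInf.StronglyHomotopic (C := C)) ∧
    Equivalence (AInf.StronglyHomotopic (C := D)) ∧
    Function.Bijective (AInf.AInfClasses.pullback φ hφ) := by
  -- Divisibility by two, which includes `N = 0`, is what makes `parity` additive.
  have hN2 : 2 ∣ N := by rcases hN with rfl | rfl <;> norm_num
  exact ⟨AInf.stronglyHomotopic_equivalence hN2, AInf.stronglyHomotopic_equivalence hN2,
    AInf.AInfClasses.pullback_bijective hN2 hφ⟩
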